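/- Let $K$ be a commutative ring. **A∞-categories.** A *unital $A_\infty$-category* $\mathcal C$ over $K$ consists of a set of objects, $\mathbb Z$-graded $K$-modules $\mathrm{Hom}_{\mathcal C}(x,y)$, $K$-multilinear operations $m^d:\mathrm{Hom}(x_{d-1},x_d)\otimes\dots\otimes\mathrm{Hom}(x_0,x_1)\to\mathrm{Hom}(x_0,x_d)$ of degree $2-d$ for $d\ge 1$, and elements $1_x\in\mathrm{Hom}^0(x,x)$, such that for all composable homogeneous $a_1,\dots,a_d$, with $\dagger_n=\deg a_1+\dots+\deg a_n-n$, $$\sum_{1\le m\le d,\;0\le n\le d-m}(-1)^{\dagger_n}\,m^{d-m+1}\bigl(a_d,\dots,a_{n+m+1},m^m(a_{n+m},\dots,a_{n+1}),a_n,\dots,a_1\bigr)=0,$$ and $m^2(f,1_x)=f$, $m^2(1_x,g)=(-1)^{\deg g}g$, and $m^n(\dots,1_x,\dots)=0$ for $n>2$. **A∞-functors.** A *unital $A_\infty$-functor* $F:\mathcal C\to\mathcal D$ consists of a map $F_0$ on objects and $K$-multilinear maps $F_n$ ($n\ge 1$) of degree $1-n$ from strings of $n$ composable morphisms of $\mathcal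 C$ from $x_0$ to $x_n$ to $\mathrm{Hom}_{\mathcal D}(F_0x_0,F_0x_n)$, such that $$\sum_{r\ge 1}\;\sum_{i_1+\dots+i_r=d}m^r_{\mathcal D}\bigl(F_{i_r}(a_d,\dots),\dots,F_{i_1}(a_{i_1},\dots,a_1)\bigr)=\sum_{m,n}(-1)^{\dagger_n}F_{d-m+1}\bigl(a_d,\dots,m^m_{\mathcal C}(a_{n+m},\dots,a_{n+1}),a_n,\dots,a_1\bigr),$$ $F_1(1_x)=1_{F_0x}$, and $F_n(\dots,1_x,\dots)=0$ for $n\ge 2$. The composite of $F$ and $G:\mathcal D\to\mathcal E$ is given by $G_0\circ F_0$ and $(G\circ F)_d(a_d,\dots,a_1)=\sum_{r\ge1}\sum_{i_1+\dots+i_r=d}G_r\bigl(F_{i_r}(a_d,\dots),\dots,F_{i_1}(a_{i_1},\dots,a_1)\bigr)$. **Quasi-equivalences.** The homotopy category $\mathrm{Ho}(\mathcal C)$ has the objects of $\mathcal C$, morphisms $H^0(\mathrm{Hom}_{\mathcal C}(x,y),m^1)$, and composition induced by $m^2$. The functor $F$ is a *quasi-equivalence* if $\mathrm{Ho}(F):\mathrm{Ho}(\mathcal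 C)\to\mathrm{Ho}(\mathcal D)$ is an equivalence of categories and $F_1:\mathrm{Hom}_{\mathcal C}(x,y)\to\mathrm{Hom}_{\mathcal D}(F_0x,F_0y)$ is a quasi-isomorphism of complexes for all objects $x,y$ of $\mathcal C$. **The nerve.** Let $[n]_K$ be the $A_\infty$-category with objects $0,\dots,n$, with $\mathrm{Hom}(i,k)$ free on one generator $j_{ik}$ of degree $0$ if $i\le k$ and zero otherwise, with $m^2(j_{kl},j_{ik})=j_{il}$, units $j_{ii}$, and $m^d=0$ for $d\ne 2$. A monotone map $\alpha:\{0,\dots,n\}\to\{0,\dots,n'\}$ induces the $A_\infty$-functor $[n]_K\to[n']_K$ with $j_{ik}\mapsto j_{\alpha(i)\alpha(k)}$ and no higher components. The *$A_\infty$-nerve* $N_{A_\infty}(\mathcal C)$ is the simplicial set whose $n$-simplices are the unital $A_\infty$-functors $[n]_K\to\mathcal C$, with simplicial structure by precomposition; $N_{A_\infty}(F)$ is postcomposition with $F$. **Weak equivalences.** For a simplicial set $X$ and vertices $x,y$, let $\mathrm{Hom}^R_X(x,y)$ be the simplicial set whose $n$-simplices are the $(n+1)$-simplices of $X$ whose restriction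 to $\{0,\dots,n\}$ is the degenerate $n$-simplex on $x$ and whose restriction to $\{n+1\}$ is $y$. A map $f:X\to Y$ of $\infty$-categories (quasi-categories) is a *weak equivalence* (in the Joyal model structure) if it induces an equivalence of homotopy categories $\mathrm{Ho}(X)\to\mathrm{Ho}(Y)$ and if, for all vertices $x,y$ of $X$, the geometric realization of $\mathrm{Hom}^R_X(x,y)\to\mathrm{Hom}^R_Y(f(x),f(y))$ is a weak homotopy equivalence of topological spaces. **Theorem 3.4.** Let $\mathcal C$, $\mathcal D$ be unital $A_\infty$-categories over $K$ and let $F:\mathcal C\to\mathcal D$ be a quasi-equivalence. Then $N_{A_\infty}(\mathcal C)$ and $N_{A_\infty}(\mathcal D)$ are $\infty$-categories and $N_{A_\infty}(F):N_{A_\infty}(\mathcal C)\to N_{A_\infty}(\mathcal D)$ is a weak equivalence in the Joyal model structure. -/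

import Mathlib

open CategoryTheory Opposite

universe w v₁ u₁ v₂ u₂ v₃ u₃ v₄ u₄ v u

namespace AInf

/-- The sum of the values of `f` over a finite list. -/
def lsum {α : Type u} {M : Type v} [AddCommGroup M] (L : List α) (f : α → M) : M := (L.map f).sum

section lsum
variable {α : Type u₁} {β : Type u₂} {M : Type v} {N : Type v₁} [AddCommGroup M] [AddCommGroup N]

@[simp] lemma lsum_nil (f : α → M) : lsum [] f = 0 := rfl
@[simp] lemma lsum_cons (a : α) (L : List α) (f : α → M) : lsum (a :: L) f = f a + lsum L f := by
  simp [lsum]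
@[simp] lemma lsum_append (L L' : List α) (f : α → M) :
    lsum (L ++ L') f = lsum L f + lsum L' f := by simp [lsum]
@[simp] lemma lsum_map (L : List α) (g : α → β) (f : β → M) :
    lsum (L.map g) f = lsum L (fun a => f (g a)) := by simp [lsum, Function.comp_def]
lemma lsum_congr {L : List α} {f g : α → M} (h : ∀ a ∈ L, f a = g a) : lsum L f = lsum L g := by
  unfold lsum; rw [List.map_congr_left h]
lemma lsum_add (L : List α) (f g : α → M) :
    lsum L (fun a => f a + g a) = lsum L f + lsum L g := by
  induction L with
  | nil => simp
  | cons a L ih => simp [ih]; abel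
lemma lsum_zero (L : List α) : lsum L (fun _ => (0 : M)) = 0 := by
  induction L with
  | nil => simp
  | cons a L ih => simp [ih]
lemma lsum_eq_zero {L : List α} {f : α → M} (h : ∀ a ∈ L, f a = 0) : lsum L f = 0 := by
  rw [lsum_congr h, lsum_zero]
lemma map_lsum {F : Type*} [FunLike F M N] [AddMonoidHomClass F M N] (φ : F) (L : List α)
    (f : α → M) : φ (lsum L f) = lsum L (fun a => φ (f a)) := by
  induction L with
  | nil => simp
  | cons a L ih => simp [ih]
lemma smul_lsum (ε : ℤˣ) (L : List α) (f : α → M) :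
    ε • lsum L f = lsum L (fun a => ε • f a) := by
  induction L with
  | nil => simp
  | cons a L ih => simp [ih, smul_add]
lemma lsum_comm (L : List α) (L' : List β) (f : α → β → M) :
    lsum L (fun a => lsum L' (f a)) = lsum L' (fun b => lsum L (fun a => f a b)) := by
  induction L with
  | nil => simp [lsum_zero]
  | cons a L ih => simp [ih, lsum_add]
end lsum

/-- Words of composable homogeneous morphisms
`(a_d, ..., a_1)`, `a_i` in `Hom x_{i-1} x_i k_i`, from `x = x_0` to `y = x_d`.
The head of the word is the last arrow `a_d`. -/
inductive Word {Obj : Type u} (Hom : Obj → Obj → ℤ → Type v) (x : Obj) : Obj → Type (max u v)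
  | nil : Word Hom x x
  | cons {y z : Obj} {k : ℤ} (a : Hom y z k) (t : Word Hom x y) : Word Hom x z

namespace Word

variable {Obj : Type u} {Hom : Obj → Obj → ℤ → Type v}

/-- Concatenation `(a_d, ..., a_{n+1}), (a_n, ..., a_1) ↦ (a_d, ..., a_1)`. -/
def append {x y : Obj} : {z : Obj} → Word Hom y z → Word Hom x y → Word Hom x z
  | _, nil, t => t
  | _, cons a s, t => cons a (s.append t)

/-- The word with one letter. -/
def single {x y : Obj} {k : ℤ} (a : Hom x y k) : Word Hom x y := cons a nil

/-- The number `d` of letters. -/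
def length {x : Obj} : {y : Obj} → Word Hom x y → ℕ
  | _, nil => 0
  | _, cons _ t => t.length + 1

/-- The reduced degree `(deg a_1 - 1) + ... + (deg a_d - 1)`. -/
def rdeg {x : Obj} : {y : Obj} → Word Hom x y → ℤ
  | _, nil => 0
  | _, cons (k := k) _ t => t.rdeg + (k - 1)

/-- All ways `t = (left, right)` of writing a word as a concatenation of two (possibly empty)
words. -/
def splits {x : Obj} : {z : Obj} → Word Hom x z → List (Σ y : Obj, Word Hom y z × Word Hom x y)
  | _, nil => [⟨x, nil, nil⟩]
  | z, cons a t => ⟨z, nil, cons a t⟩ :: t.splits.map fun s => ⟨s.1, cons a s.2.1, s.2.2⟩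

section basic
variable {x y z p q : Obj}

@[simp] lemma nil_append (t : Word Hom x y) : (nil : Word Hom y y).append t = t := rfl
@[simp] lemma cons_append {k : ℤ} (a : Hom z p k) (s : Word Hom y z) (t : Word Hom x y) :
    (cons a s).append t = cons a (s.append t) := rfl
@[simp] lemma append_nil (t : Word Hom x y) : t.append nil = t := by
  induction t with
  | nil => rfl
  | cons a t ih => simp [ih]
lemma append_assoc (r : Word Hom z p) (s : Word Hom y z) (t : Word Hom x y) :
    (r.append s).append t = r.append (s.append t) := by
  induction r with
  | nil => rfl
  | cons a r ih => simp [ih]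
@[simp] lemma rdeg_nil : (nil : Word Hom x x).rdeg = 0 := rfl
@[simp] lemma rdeg_cons {k : ℤ} (a : Hom y z k) (t : Word Hom x y) :
    (cons a t).rdeg = t.rdeg + (k - 1) := rfl
@[simp] lemma rdeg_single {k : ℤ} (a : Hom y z k) : (single a).rdeg = k - 1 := by simp [single]
@[simp] lemma rdeg_append (s : Word Hom y z) (t : Word Hom x y) :
    (s.append t).rdeg = s.rdeg + t.rdeg := by
  induction s with
  | nil => simp
  | cons a s ih => simp [ih]; ring
@[simp] lemma length_nil : (nil : Word Hom x x).length = 0 := rfl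
@[simp] lemma length_cons {k : ℤ} (a : Hom y z k) (t : Word Hom x y) :
    (cons a t).length = t.length + 1 := rfl
@[simp] lemma length_single {k : ℤ} (a : Hom y z k) : (single a).length = 1 := rfl
@[simp] lemma length_append (s : Word Hom y z) (t : Word Hom x y) :
    (s.append t).length = s.length + t.length := by
  induction s with
  | nil => simp
  | cons a s ih => simp [ih]; ring
@[simp] lemma splits_nil : (nil : Word Hom x x).splits = [⟨x, nil, nil⟩] := rfl
@[simp] lemma splits_cons {k : ℤ} (a : Hom y z k) (t : Word Hom x y) :
    (cons a t).splits =
      ⟨z, nil, cons a t⟩ :: t.splits.map fun s => ⟨s.1, cons a s.2.1, s.2.2⟩ := rfl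

lemma append_of_mem_splits (t : Word Hom x z) : ∀ s ∈ t.splits, s.2.1.append s.2.2 = t := by
  induction t with
  | nil => simp
  | cons a t ih =>
    intro s hs
    simp only [splits_cons, List.mem_cons, List.mem_map] at hs
    rcases hs with rfl | ⟨s, hs, rfl⟩
    · rfl
    · simp [ih s hs]

variable {M : Type v₁} [AddCommGroup M]

lemma lsum_splits_append {k : ℤ} (s : Word Hom q z) (a : Hom p q k) (t : Word Hom x p)
    (f : (Σ y : Obj, Word Hom y z × Word Hom x y) → M) :
    lsum (s.append (cons a t)).splits f =
      lsum s.splits (fun i => f ⟨i.1, i.2.1, i.2.2.append (cons a t)⟩) +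
      lsum t.splits (fun i => f ⟨i.1, s.append (cons a i.2.1), i.2.2⟩) := by
  induction s with
  | nil => simp
  | cons b s ih => simp [ih, add_assoc]

lemma lsum_splits_coassoc (t : Word Hom x z)
    (f : (p q : Obj) → Word Hom q z → Word Hom p q → Word Hom x p → M) :
    lsum t.splits (fun i => lsum i.2.2.splits (fun j => f j.1 i.1 i.2.1 j.2.1 j.2.2)) =
    lsum t.splits (fun i => lsum i.2.1.splits (fun j => f i.1 j.1 j.2.1 j.2.2 i.2.2)) := by
  induction t with
  | nil => simp
  | cons a t ih =>
    simp only [splits_cons, lsum_cons, lsum_map, splits_nil, lsum_nil, add_zero, lsum_add]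
    rw [ih (fun p q r s t => f p q (cons a r) s t), add_assoc]

end basic

end Word

open Word DirectSum

/-- The sum over all decompositions `t = left · mid · right` of a word of
`(-1) ^ rdeg right • φ (left, m mid, right)`. -/
def insertSum {Obj : Type u} {Hom : Obj → Obj → ℤ → Type v}
    (m : {x y : Obj} → (t : Word Hom x y) → Hom x y (t.rdeg + 2))
    {M : Type v₁} [AddCommGroup M] {x y : Obj} (φ : Word Hom x y → M) (t : Word Hom x y) : M :=
  lsum t.splits fun i => lsum i.2.2.splits fun j =>
    j.2.2.rdeg.negOnePow • φ (i.2.1.append (cons (m j.2.1) j.2.2))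

/-- A function of words is multilinear if it is linear in every letter. -/
def IsMultilinear (K : Type w) [CommRing K] {Obj : Type u} {Hom : Obj → Obj → ℤ → Type v}
    [∀ x y k, AddCommGroup (Hom x y k)] [∀ x y k, Module K (Hom x y k)]
    {M : Type v₁} [AddCommGroup M] [Module K M] {x y : Obj} (φ : Word Hom x y → M) : Prop :=
  ∀ {p q : Obj} (k : ℤ) (s : Word Hom q y) (t : Word Hom x p),
    IsLinearMap K fun a : Hom p q k => φ (s.append (cons a t))

/-- Objects, graded modules of morphisms and operations `m^d`, as in an A∞-category; no relations
yet. The operation `m^d` of degree `2 - d` is the restriction of `m` to words of length `d`;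
`m w e _` is its value as an element of degree `e`. -/
structure AInfData (K : Type w) [CommRing K] where
  /-- The objects. -/
  Obj : Type u
  /-- `Hom x y k` is the degree `k` part of the graded module of morphisms from `x` to `y`. -/
  Hom : Obj → Obj → ℤ → Type v
  [acg : ∀ x y k, AddCommGroup (Hom x y k)]
  [mod : ∀ x y k, Module K (Hom x y k)]
  /-- The operations `m^d (a_d, ..., a_1)`. -/
  m : {x y : Obj} → (t : Word Hom x y) → (e : ℤ) → t.rdeg + 2 = e → Hom x y e

attribute [instance] AInfData.acg AInfData.mod

namespace AInfData
variable {K : Type w} [CommRing K] (C : AInfData.{w, v, u} K)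

/-- The total module of morphisms. -/
abbrev Tot (x y : C.Obj) : Type v := ⨁ k : ℤ, C.Hom x y k

/-- `m` as a homogeneous element of the total module. -/
def mT {x y : C.Obj} (t : Word C.Hom x y) : C.Tot x y :=
  DirectSum.lof K ℤ (fun k => C.Hom x y k) _ (C.m t _ rfl)

end AInfData

/-- A (strictly) unital A∞-category over `K`. -/
structure AInfCategory (K : Type w) [CommRing K] extends AInfData.{w, v, u} K where
  /-- There is no operation `m^0`. -/
  m_nil : ∀ (x : Obj), toAInfData.m (Word.nil : Word Hom x x) 2 rfl = 0
  m_multilinear : ∀ {x y : Obj}, IsMultilinear K (toAInfData.mT (x := x) (y := y))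
  /-- The A∞-relations
  `∑ (-1) ^ † m (a_d, ..., m (a_{n+m}, ..., a_{n+1}), a_n, ..., a_1) = 0` with
  `† = deg a_1 + ... + deg a_n - n`. -/
  relation : ∀ {x y : Obj} (t : Word Hom x y),
    insertSum (fun s => toAInfData.m s _ rfl) toAInfData.mT t = 0
  /-- The units. -/
  one : (x : Obj) → Hom x x 0
  m_one_right : ∀ {x y : Obj} {k : ℤ} (f : Hom x y k),
    toAInfData.m (cons f (single (one x))) k (by simp; ring) = f
  m_one_left : ∀ {x y : Obj} {k : ℤ} (g : Hom x y k),
    toAInfData.m (cons (one y) (single g)) k (by simp; ring) = k.negOnePow • g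
  m_one : ∀ {x y z : Obj} (s : Word Hom y z) (t : Word Hom x y) (e : ℤ)
    (h : (s.append (cons (one y) t)).rdeg + 2 = e), 2 < (s.append (cons (one y) t)).length →
    toAInfData.m (s.append (cons (one y) t)) e h = 0

/-- The data of an A∞-functor: a map on objects and maps `F^n` of degree `1 - n`;
`F^n` is the restriction of `map` to words of length `n`. -/
structure AInfFunctorData {K : Type w} [CommRing K] (C : AInfData.{w, v₁, u₁} K)
    (D : AInfData.{w, v₂, u₂} K) where
  obj : C.Obj → D.Obj
  map : {x y : C.Obj} → (t : Word C.Hom x y) → (e : ℤ) → t.rdeg + 1 = e → D.Hom (obj x) (obj y) e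

namespace AInfFunctorData
variable {K : Type w} [CommRing K] {C : AInfData.{w, v₁, u₁} K} {D : AInfData.{w, v₂, u₂} K}
  (F : AInfFunctorData C D)

/-- `F` as a homogeneous element of the total module. -/
def mapT {x y : C.Obj} (t : Word C.Hom x y) : D.Tot (F.obj x) (F.obj y) :=
  DirectSum.lof K ℤ (fun k => D.Hom (F.obj x) (F.obj y) k) _ (F.map t _ rfl)

/-- All words `(F (b_r), ..., F (b_1))` for decompositions of the word `b · t` into non-empty blocks
`b_r, ..., b_1` with `b_r` beginning with `b`. -/
def expandAux {x : C.Obj} : {y z : C.Obj} → (b : Word C.Hom y z) → (t : Word C.Hom x y) →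
    List (Word D.Hom (F.obj x) (F.obj z))
  | _, _, b, nil => [cons (F.map b _ rfl) nil]
  | _, _, b, cons a t =>
      (expandAux (single a) t).map (cons (F.map b _ rfl)) ++ expandAux (b.append (single a)) t

/-- All words `(F (b_r), ..., F (b_1))`, for all decompositions `t = b_r · ... · b_1` of a word into
non-empty blocks. -/
def expand {x : C.Obj} : {y : C.Obj} → (t : Word C.Hom x y) →
    List (Word D.Hom (F.obj x) (F.obj y))
  | _, nil => [nil]
  | _, cons a t => F.expandAux (single a) t

end AInfFunctorData

/-- A (strictly) unital A∞-functor. -/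
structure AInfFunctor {K : Type w} [CommRing K] (C : AInfCategory.{w, v₁, u₁} K)
    (D : AInfCategory.{w, v₂, u₂} K) extends
    AInfFunctorData C.toAInfData D.toAInfData where
  /-- There is no map `F^0`. -/
  map_nil : ∀ (x : C.Obj), toAInfFunctorData.map (Word.nil : Word C.Hom x x) 1 rfl = 0
  map_multilinear : ∀ {x y : C.Obj},
    IsMultilinear K (toAInfFunctorData.mapT (x := x) (y := y))
  /-- `∑ m (F (b_r), ..., F (b_1)) = ∑ (-1) ^ † F (a_d, ..., m (a_{n+m}, ..., a_{n+1}), ..., a_1)`,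
  with `† = deg a_1 + ... + deg a_n - n`. -/
  relation : ∀ {x y : C.Obj} (t : Word C.Hom x y),
    lsum (toAInfFunctorData.expand t) D.mT =
      insertSum (fun s => C.m s _ rfl) toAInfFunctorData.mapT t
  map_one : ∀ (x : C.Obj), toAInfFunctorData.map (single (C.one x)) 0 (by simp) =
    D.one (toAInfFunctorData.obj x)
  map_one_of_length : ∀ {x y z : C.Obj} (s : Word C.Hom y z) (t : Word C.Hom x y) (e : ℤ)
    (h : (s.append (cons (C.one y) t)).rdeg + 1 = e), 1 < (s.append (cons (C.one y) t)).length →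
    toAInfFunctorData.map (s.append (cons (C.one y) t)) e h = 0

section multilinear
variable {K : Type w} [CommRing K] {Obj : Type u} {Hom : Obj → Obj → ℤ → Type v}
  [∀ x y k, AddCommGroup (Hom x y k)] [∀ x y k, Module K (Hom x y k)]
  {M : Type v₁} [AddCommGroup M] [Module K M] {x y : Obj}

lemma isLinearMap_lsum {α : Type u₁} {A : Type v₂} [AddCommGroup A] [Module K A] (L : List α)
    (f : α → A → M) (h : ∀ i ∈ L, IsLinearMap K (f i)) :
    IsLinearMap K (fun a => lsum L (fun i => f i a)) := by
  induction L with
  | nil => constructor <;> simp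
  | cons i L ih =>
    have h1 := h i (by simp)
    have h2 := ih fun j hj => h j (by simp [hj])
    constructor
    · intro a b
      simp only [lsum_cons, h1.map_add, h2.map_add]; abel
    · intro c a
      simp only [lsum_cons, h1.map_smul, h2.map_smul, smul_add]

/-- The extension of a multilinear function to inhomogeneous elements in one of the letters. -/
noncomputable def IsMultilinear.ext {φ : Word Hom x y → M} (h : IsMultilinear K φ) {p q : Obj}
    (s : Word Hom q y) (t : Word Hom x p) : (⨁ k : ℤ, Hom p q k) →ₗ[K] M :=
  DirectSum.toModule K ℤ M fun k => (h k s t).mk' _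

lemma IsMultilinear.ext_lof {φ : Word Hom x y → M} (h : IsMultilinear K φ) {p q : Obj}
    (s : Word Hom q y) (t : Word Hom x p) {k : ℤ} (a : Hom p q k) :
    h.ext s t (DirectSum.lof K ℤ _ k a) = φ (s.append (cons a t)) := by
  simp [IsMultilinear.ext]

lemma IsMultilinear.cons {φ : Word Hom x y → M} (h : IsMultilinear K φ) {z : Obj} {k : ℤ}
    (a : Hom z y k) : IsMultilinear K (fun t : Word Hom x z => φ (cons a t)) := by
  intro p q k s t
  exact h k (Word.cons a s) t

lemma IsMultilinear.zero {φ : Word Hom x y → M} (h : IsMultilinear K φ) {p q : Obj}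
    (s : Word Hom q y) (t : Word Hom x p) (k : ℤ) :
    φ (s.append (Word.cons (0 : Hom p q k) t)) = 0 := (h k s t).map_zero

end multilinear

namespace AInfFunctorData
section
variable {K : Type w} [CommRing K] {C : AInfData.{w, v₁, u₁} K} {D : AInfData.{w, v₂, u₂} K}
  {E : AInfData.{w, v₃, u₃} K}
  (F : AInfFunctorData C D) (G : AInfFunctorData D E)
  {M : Type v} [AddCommGroup M]

lemma lof_map {x y : C.Obj} (t : Word C.Hom x y) (e : ℤ) (h : t.rdeg + 1 = e) :
    DirectSum.lof K ℤ (fun k => D.Hom (F.obj x) (F.obj y) k) e (F.map t e h) = F.mapT t := by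
  subst h; rfl

@[simp] lemma expand_nil (x : C.Obj) : F.expand (nil : Word C.Hom x x) = [nil] := rfl

lemma lsum_expandAux {x y z : C.Obj} (b : Word C.Hom y z) (t : Word C.Hom x y)
    (φ : Word D.Hom (F.obj x) (F.obj z) → M) :
    lsum (F.expandAux b t) φ = lsum t.splits fun i =>
      lsum (F.expand i.2.2) fun q => φ (cons (F.map (b.append i.2.1) _ rfl) q) := by
  induction t generalizing z with
  | nil =>
    simp only [expandAux, splits_nil, lsum_cons, lsum_nil, add_zero, expand_nil]
    rw [append_nil]
  | cons a t ih =>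
    simp only [expandAux, lsum_append, lsum_map, splits_cons, lsum_cons]
    congr 1
    · rw [append_nil]
      rfl
    · rw [ih]
      apply lsum_congr
      intro i _
      rw [append_assoc]
      rfl

lemma lsum_expand_cons {x y z : C.Obj} {k : ℤ} (a : C.Hom y z k) (t : Word C.Hom x y)
    (φ : Word D.Hom (F.obj x) (F.obj z) → M) :
    lsum (F.expand (cons a t)) φ = lsum t.splits fun i =>
      lsum (F.expand i.2.2) fun q => φ (cons (F.map (cons a i.2.1) _ rfl) q) := by
  rw [expand, lsum_expandAux]
  rfl

lemma length_right_le {x z : C.Obj} (t : Word C.Hom x z) (s) (hs : s ∈ t.splits) :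
    s.2.2.length ≤ t.length := by
  have := congrArg length (append_of_mem_splits t s hs)
  simp at this; omega

lemma lsum_expand_splits {x z : C.Obj} (t : Word C.Hom x z)
    (ψ : (d : D.Obj) → Word D.Hom d (F.obj z) → Word D.Hom (F.obj x) d → M) :
    lsum (F.expand t) (fun q => lsum q.splits fun i => ψ i.1 i.2.1 i.2.2) =
    lsum t.splits fun i => lsum (F.expand i.2.1) fun q => lsum (F.expand i.2.2) fun q' =>
      ψ (F.obj i.1) q q' := by
  induction hn : t.length using Nat.strong_induction_on generalizing z with
  | _ n ih =>
  cases t with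
  | nil => simp
  | cons a t =>
    simp only [lsum_expand_cons, splits_cons, lsum_cons, lsum_map, lsum_add, expand_nil, lsum_nil,
      add_zero]
    congr 1
    rw [← lsum_splits_coassoc t (fun p q r s u => lsum (F.expand s) fun q' =>
      lsum (F.expand u) fun q'' => ψ (F.obj p) (cons (F.map (cons a r) _ rfl) q') q'')]
    apply lsum_congr
    intro i hi
    have := length_right_le t i hi
    simp only [length_cons] at hn
    exact ih i.2.2.length (by omega) i.2.2
      (fun d q q' => ψ d (cons (F.map (cons a i.2.1) _ rfl) q) q') rfl

lemma lsum_expand_append {x y p z : C.Obj} {k : ℤ} (s : Word C.Hom p z) (a : C.Hom y p k)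
    (t : Word C.Hom x y) (φ : Word D.Hom (F.obj x) (F.obj z) → M) :
    lsum (F.expand (s.append (cons a t))) φ =
    lsum s.splits fun i => lsum t.splits fun j =>
      lsum (F.expand i.2.1) fun q => lsum (F.expand j.2.2) fun q' =>
        φ (q.append (cons (F.map (i.2.2.append (cons a j.2.1)) _ rfl) q')) := by
  induction hn : s.length using Nat.strong_induction_on generalizing z with
  | _ n ih =>
  cases s with
  | nil => simp [lsum_expand_cons]
  | cons b s =>
    simp only [cons_append, lsum_expand_cons, splits_cons, lsum_cons, lsum_map, expand_nil,
      lsum_nil, add_zero, nil_append, lsum_splits_append]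
    rw [add_comm]
    congr 1
    have h1 : ∀ i ∈ s.splits, lsum (F.expand (i.2.2.append (cons a t)))
        (fun q => φ (cons (F.map (cons b i.2.1) _ rfl) q)) =
        lsum i.2.2.splits fun i' => lsum t.splits fun j =>
        lsum (F.expand i'.2.1) fun q => lsum (F.expand j.2.2) fun q' =>
        φ (cons (F.map (cons b i.2.1) _ rfl)
          (q.append (cons (F.map (i'.2.2.append (cons a j.2.1)) _ rfl) q'))) := by
      intro i hi
      have := length_right_le s i hi
      simp only [length_cons] at hn
      exact ih i.2.2.length (by omega) i.2.2
        (fun q => φ (cons (F.map (cons b i.2.1) _ rfl) q)) rfl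
    rw [lsum_congr h1, lsum_splits_coassoc s (fun p q r s u => lsum t.splits fun j =>
        lsum (F.expand s) fun q => lsum (F.expand j.2.2) fun q' =>
        φ (cons (F.map (cons b r) _ rfl)
          (q.append (cons (F.map (u.append (cons a j.2.1)) _ rfl) q'))))]
    apply lsum_congr
    intro i _
    rw [lsum_comm]

lemma rdeg_of_mem_expandAux {x y z : C.Obj} (b : Word C.Hom y z) (t : Word C.Hom x y) :
    ∀ q ∈ F.expandAux b t, q.rdeg = b.rdeg + t.rdeg := by
  induction t generalizing z with
  | nil => simp [expandAux]
  | cons a t ih =>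
    intro q hq
    simp only [expandAux, List.mem_append, List.mem_map] at hq
    rcases hq with ⟨q, hq, rfl⟩ | hq
    · simp [ih _ q hq]; ring
    · simp [ih _ q hq]; ring

lemma rdeg_of_mem_expand {x y : C.Obj} (t : Word C.Hom x y) :
    ∀ q ∈ F.expand t, q.rdeg = t.rdeg := by
  cases t with
  | nil => simp
  | cons a t =>
    intro q hq
    rw [F.rdeg_of_mem_expandAux _ _ q hq]; simp; ring

/-- The composition of A∞-functors:
`(G ∘ F) (t) = ∑ G (F (b_r), ..., F (b_1))`, the sum over all decompositions
`t = b_r · ... · b_1` into non-empty blocks. (All summands are of the same degree `e`.) -/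
abbrev comp : AInfFunctorData C E where
  obj x := G.obj (F.obj x)
  map t e _ := DirectSum.component K ℤ _ e (lsum (F.expand t) G.mapT)

lemma comp_mapT {x y : C.Obj} (t : Word C.Hom x y) :
    (F.comp G).mapT t = lsum (F.expand t) G.mapT := by
  have : ∀ L : List (Word D.Hom (F.obj x) (F.obj y)), (∀ q ∈ L, q.rdeg = t.rdeg) →
      DirectSum.lof K ℤ (fun k => E.Hom (G.obj (F.obj x)) (G.obj (F.obj y)) k) (t.rdeg + 1)
        (DirectSum.component K ℤ _ (t.rdeg + 1) (lsum L G.mapT)) = lsum L G.mapT := by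
    intro L hL
    induction L with
    | nil => simp
    | cons q L ih =>
      rw [lsum_cons, map_add, map_add, ih fun q hq => hL q (by simp [hq]),
        ← G.lof_map q (t.rdeg + 1) (by rw [hL q (by simp)]), DirectSum.component.lof_self]
  exact this _ (F.rdeg_of_mem_expand t)

/-- Multilinearity of the components of a functor. -/
def IsMulti : Prop := ∀ x y : C.Obj, IsMultilinear K (F.mapT (x := x) (y := y))

variable {F G} [Module K M]

lemma IsMulti.expand (hF : F.IsMulti) {x y : C.Obj}
    {φ : Word D.Hom (F.obj x) (F.obj y) → M} (hφ : IsMultilinear K φ) :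
    IsMultilinear K (fun t : Word C.Hom x y => lsum (F.expand t) φ) := by
  intro p q k s t
  simp only [lsum_expand_append]
  refine isLinearMap_lsum _ _ fun i _ => isLinearMap_lsum _ _ fun j _ =>
    isLinearMap_lsum _ _ fun r _ => isLinearMap_lsum _ _ fun r' _ => ?_
  have h := ((hφ.ext r r').comp ((hF _ _ k i.2.2 j.2.1).mk' _)).isLinear
  refine cast (congrArg _ ?_) h
  funext a
  exact hφ.ext_lof _ _ _

lemma map_comp_letter {x y : C.Obj} (t : Word C.Hom x y) {z z' : C.Obj}
    {φ : Word E.Hom (G.obj (F.obj z)) (G.obj (F.obj z')) → M} (hφ : IsMultilinear K φ)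
    (l : Word E.Hom (G.obj (F.obj y)) (G.obj (F.obj z')))
    (r : Word E.Hom (G.obj (F.obj z)) (G.obj (F.obj x))) :
    φ (l.append (cons ((F.comp G).map t _ rfl) r)) =
      lsum (F.expand t) fun q => φ (l.append (cons (G.map q _ rfl) r)) := by
  have h1 := hφ.ext_lof l r ((F.comp G).map t _ rfl)
  refine h1.symm.trans ?_
  rw [show DirectSum.lof K ℤ _ _ ((F.comp G).map t _ rfl) = lsum (F.expand t) G.mapT from
    comp_mapT F G t, map_lsum]
  apply lsum_congr
  intro q _
  exact hφ.ext_lof l r _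

lemma lsum_expand_comp {x y : C.Obj} (t : Word C.Hom x y)
    {φ : Word E.Hom (G.obj (F.obj x)) (G.obj (F.obj y)) → M} (hφ : IsMultilinear K φ) :
    lsum ((F.comp G).expand t) φ = lsum (F.expand t) fun q => lsum (G.expand q) φ := by
  induction hn : t.length using Nat.strong_induction_on generalizing y with
  | _ n ih =>
  cases t with
  | nil => simp
  | cons a t =>
    rw [lsum_expand_cons F]
    simp only [lsum_expand_cons G]
    refine ((F.comp G).lsum_expand_cons a t φ).trans ?_
    have h1 : ∀ i ∈ t.splits, lsum ((F.comp G).expand i.2.2)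
        (fun q => φ (cons ((F.comp G).map (cons a i.2.1) _ rfl) q)) =
        lsum i.2.1.splits fun j => lsum (F.expand j.2.2) fun p => lsum (F.expand i.2.2) fun q =>
          lsum (G.expand q) fun q' =>
          φ (cons (G.map (cons (F.map (cons a j.2.1) _ rfl) p) _ rfl) q') := by
      intro i hi
      have := length_right_le t i hi
      simp only [length_cons] at hn
      rw [ih i.2.2.length (by omega) i.2.2 (hφ.cons _) rfl,
        ← F.lsum_expand_cons a i.2.1 (fun p => lsum (F.expand i.2.2) fun q =>
          lsum (G.expand q) fun q' => φ (cons (G.map p _ rfl) q'))]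
      rw [lsum_comm (F.expand (cons a i.2.1))]
      apply lsum_congr
      intro q _
      rw [lsum_comm (F.expand (cons a i.2.1))]
      apply lsum_congr
      intro q' _
      exact map_comp_letter (cons a i.2.1) hφ nil q'
    refine (lsum_congr h1).trans ?_
    rw [← lsum_splits_coassoc t (fun p q r s u => lsum (F.expand s) fun p' =>
      lsum (F.expand u) fun q => lsum (G.expand q) fun q' =>
        φ (cons (G.map (cons (F.map (cons a r) _ rfl) p') _ rfl) q'))]
    apply lsum_congr
    intro i _
    exact (F.lsum_expand_splits i.2.2 (fun d p q => lsum (G.expand q) fun q' =>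
      φ (cons (G.map (cons (F.map (cons a i.2.1) _ rfl) p) _ rfl) q'))).symm

end
end AInfFunctorData

lemma Word.lsum_splits_five {Obj : Type u} {Hom : Obj → Obj → ℤ → Type v} {M : Type v₁}
    [AddCommGroup M] {x y : Obj} (t : Word Hom x y)
    (X : (p₁ p₂ p₃ p₄ : Obj) → Word Hom p₄ y → Word Hom p₃ p₄ → Word Hom p₂ p₃ → Word Hom p₁ p₂ →
      Word Hom x p₁ → M) :
    (lsum t.splits fun i => lsum i.2.2.splits fun j => lsum j.2.1.splits fun a =>
      lsum a.2.2.splits fun b => X j.1 b.1 a.1 i.1 i.2.1 a.2.1 b.2.1 b.2.2 j.2.2) =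
    lsum t.splits fun i => lsum i.2.2.splits fun j => lsum i.2.1.splits fun a =>
      lsum j.2.2.splits fun b => X b.1 j.1 i.1 a.1 a.2.1 a.2.2 j.2.1 b.2.1 b.2.2 := by
  have h1 : ∀ i ∈ t.splits, (lsum i.2.2.splits fun j => lsum j.2.1.splits fun a =>
      lsum a.2.2.splits fun b => X j.1 b.1 a.1 i.1 i.2.1 a.2.1 b.2.1 b.2.2 j.2.2) =
      lsum i.2.2.splits fun a => lsum a.2.2.splits fun b => lsum b.2.2.splits fun j =>
        X j.1 b.1 a.1 i.1 i.2.1 a.2.1 b.2.1 j.2.1 j.2.2 := by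
    intro i _
    rw [← lsum_splits_coassoc i.2.2 (fun p q r s u => lsum s.splits fun b =>
      X p b.1 q i.1 i.2.1 r b.2.1 b.2.2 u)]
    apply lsum_congr
    intro a _
    rw [← lsum_splits_coassoc a.2.2 (fun p q r s u =>
      X p q a.1 i.1 i.2.1 a.2.1 r s u)]
  rw [lsum_congr h1, lsum_splits_coassoc t (fun p q r s u => lsum u.splits fun b =>
    lsum b.2.2.splits fun j => X j.1 b.1 p q r s b.2.1 j.2.1 j.2.2)]
  apply lsum_congr
  intro i _
  rw [lsum_comm]

namespace AInfCategory
variable {K : Type w} [CommRing K] (C : AInfCategory.{w, v, u} K)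

lemma lof_m {x y : C.Obj} (t : Word C.Hom x y) (e : ℤ) (h : t.rdeg + 2 = e) :
    DirectSum.lof K ℤ (fun k => C.Hom x y k) e (C.m t e h) = C.mT t := by
  subst h; rfl

end AInfCategory

namespace AInfFunctor
variable {K : Type w} [CommRing K] {C : AInfCategory.{w, v₁, u₁} K} {D : AInfCategory.{w, v₂, u₂} K}
  {E : AInfCategory.{w, v₃, u₃} K} {B : AInfCategory.{w, v₄, u₄} K}

lemma isMulti (F : AInfFunctor C D) : F.IsMulti := fun _ _ => F.map_multilinear

lemma map_eq_zero_of_mapT (F : AInfFunctor C D) {x y : C.Obj} {t : Word C.Hom x y}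
    (h : F.mapT t = 0) (e : ℤ) (he : t.rdeg + 1 = e) : F.map t e he = 0 := by
  apply DirectSum.of_injective (β := fun k => D.Hom (F.obj x) (F.obj y) k) e
  rw [map_zero]
  exact (F.lof_map t e he).trans h

lemma comp_relation (F : AInfFunctor C D) (G : AInfFunctor D E) {x y : C.Obj}
    (t : Word C.Hom x y) :
    lsum ((F.comp G.toAInfFunctorData).expand t) E.mT =
      insertSum (fun s => C.m s _ rfl) (F.comp G.toAInfFunctorData).mapT t := by
  refine (AInfFunctorData.lsum_expand_comp t E.m_multilinear).trans ?_
  simp only [G.relation, insertSum]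
  rw [F.lsum_expand_splits t (fun d p q => lsum q.splits fun j => j.2.2.rdeg.negOnePow •
    G.mapT (p.append (cons (D.m j.2.1 _ rfl) j.2.2)))]
  have h1 : ∀ i ∈ t.splits, (lsum (F.expand i.2.1) fun p => lsum (F.expand i.2.2) fun q =>
      lsum q.splits fun j => j.2.2.rdeg.negOnePow •
        G.mapT (p.append (cons (D.m j.2.1 _ rfl) j.2.2))) =
      lsum i.2.2.splits fun j => lsum j.2.1.splits fun a => lsum a.2.2.splits fun b =>
      lsum (F.expand i.2.1) fun p => lsum (F.expand j.2.2) fun q =>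
        j.2.2.rdeg.negOnePow • b.2.2.rdeg.negOnePow • G.mapT (p.append (cons
          (F.map (a.2.1.append (cons (C.m b.2.1 _ rfl) b.2.2)) _ rfl) q)) := by
    intro i _
    have h2 : ∀ p ∈ F.expand i.2.1, (lsum (F.expand i.2.2) fun q =>
        lsum q.splits fun j => j.2.2.rdeg.negOnePow •
        G.mapT (p.append (cons (D.m j.2.1 _ rfl) j.2.2))) =
        lsum i.2.2.splits fun j => lsum j.2.1.splits fun a => lsum a.2.2.splits fun b =>
        lsum (F.expand j.2.2) fun q =>
        j.2.2.rdeg.negOnePow • b.2.2.rdeg.negOnePow • G.mapT (p.append (cons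
          (F.map (a.2.1.append (cons (C.m b.2.1 _ rfl) b.2.2)) _ rfl) q)) := by
      intro p _
      rw [F.lsum_expand_splits i.2.2 (fun d q q' => q'.rdeg.negOnePow •
        G.mapT (p.append (cons (D.m q _ rfl) q')))]
      apply lsum_congr
      intro j _
      rw [lsum_comm]
      have h3 : ∀ q ∈ F.expand j.2.2, (lsum (F.expand j.2.1) fun q' => q.rdeg.negOnePow •
          G.mapT (p.append (cons (D.m q' _ rfl) q))) =
          lsum j.2.1.splits fun a => lsum a.2.2.splits fun b =>
          j.2.2.rdeg.negOnePow • b.2.2.rdeg.negOnePow • G.mapT (p.append (cons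
          (F.map (a.2.1.append (cons (C.m b.2.1 _ rfl) b.2.2)) _ rfl) q)) := by
        intro q hq
        rw [F.rdeg_of_mem_expand _ q hq, ← smul_lsum]
        simp only [← smul_lsum]
        congr 1
        have h4 := congrArg (IsMultilinear.ext G.map_multilinear p q) (F.relation j.2.1)
        rw [map_lsum] at h4
        refine (lsum_congr fun q' _ => ?_).trans (h4.trans ?_)
        · exact (IsMultilinear.ext_lof G.map_multilinear p q _).symm
        · simp only [insertSum, map_lsum]
          refine lsum_congr fun a _ => lsum_congr fun b _ => ?_
          rw [Units.smul_def, map_zsmul, ← Units.smul_def]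
          congr 1
          exact (IsMultilinear.ext_lof G.map_multilinear p q _)
      rw [lsum_congr h3, lsum_comm]
      apply lsum_congr
      intro a _
      rw [lsum_comm]
    rw [lsum_congr h2, lsum_comm]
    apply lsum_congr
    intro j _
    rw [lsum_comm]
    apply lsum_congr
    intro a _
    rw [lsum_comm]
  rw [lsum_congr h1, lsum_splits_five t (fun p₁ p₂ p₃ p₄ w₅ w₄ w₃ w₂ w₁ =>
    lsum (F.expand w₅) fun p => lsum (F.expand w₁) fun q =>
        w₁.rdeg.negOnePow • w₂.rdeg.negOnePow • G.mapT (p.append (cons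
          (F.map (w₄.append (cons (C.m w₃ _ rfl) w₂)) _ rfl) q)))]
  refine lsum_congr fun i _ => lsum_congr fun j _ => ?_
  rw [AInfFunctorData.comp_mapT, AInfFunctorData.lsum_expand_append, smul_lsum]
  refine lsum_congr fun a _ => ?_
  rw [smul_lsum]
  refine lsum_congr fun b hb => ?_
  rw [smul_lsum]
  refine lsum_congr fun p _ => ?_
  rw [smul_lsum]
  refine lsum_congr fun q _ => ?_
  have hr : j.2.2.rdeg = b.2.1.rdeg + b.2.2.rdeg := by
    rw [← rdeg_append, append_of_mem_splits _ _ hb]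
  rw [smul_smul, hr, Int.negOnePow_add, mul_comm]

lemma map_cons_congr (F : AInfFunctor C D) {x y : C.Obj} (t : Word C.Hom x y) (e : ℤ)
    (h : t.rdeg + 1 = e) {z : D.Obj} (q : Word D.Hom z (F.obj x)) :
    cons (F.map t _ rfl) q = cons (F.map t e h) q := by
  subst h; rfl

lemma map_eq (F : AInfFunctor C D) {x y : C.Obj} (t : Word C.Hom x y) (e : ℤ)
    (h : t.rdeg + 1 = e) : F.map t e h = DirectSum.component K ℤ _ e (F.mapT t) := by
  rw [← F.lof_map t e h, DirectSum.component.lof_self]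

lemma mapT_eq_zero (F : AInfFunctor C D) {x y z : C.Obj} (s : Word C.Hom y z) (t : Word C.Hom x y)
    (h : 1 < (s.append (cons (C.one y) t)).length) : F.mapT (s.append (cons (C.one y) t)) = 0 := by
  rw [AInfFunctorData.mapT, F.map_one_of_length s t _ rfl h, map_zero]

lemma length_pos_of_mem_expand (F : AInfFunctor C D) {x y : C.Obj} (t : Word C.Hom x y)
    (h : 0 < t.length) : ∀ q ∈ F.expand t, 0 < q.length := by
  have aux : ∀ {y z : C.Obj} (b : Word C.Hom y z) (t : Word C.Hom x y),
      ∀ q ∈ F.expandAux b t, 0 < q.length := by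
    intro y z b t
    induction t generalizing z with
    | nil => simp [AInfFunctorData.expandAux]
    | cons a t ih =>
      intro q hq
      simp only [AInfFunctorData.expandAux, List.mem_append, List.mem_map] at hq
      rcases hq with ⟨q, hq, rfl⟩ | hq
      · simp
      · exact ih _ q hq
  cases t with
  | nil => simp at h
  | cons a t => exact aux _ _

lemma comp_mapT_one (F : AInfFunctor C D) (G : AInfFunctor D E) {x y z : C.Obj}
    (s : Word C.Hom y z) (t : Word C.Hom x y) (h : 1 < (s.append (cons (C.one y) t)).length) :
    (F.comp G.toAInfFunctorData).mapT (s.append (cons (C.one y) t)) = 0 := by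
  rw [AInfFunctorData.comp_mapT, AInfFunctorData.lsum_expand_append]
  refine lsum_eq_zero fun i hi => lsum_eq_zero fun j hj => lsum_eq_zero fun p hp =>
    lsum_eq_zero fun q hq => ?_
  have hi' := congrArg length (append_of_mem_splits _ _ hi)
  have hj' := congrArg length (append_of_mem_splits _ _ hj)
  obtain ⟨x₁, l₁, r₁⟩ := i
  obtain ⟨x₂, l₂, r₂⟩ := j
  simp only [length_append, length_cons] at hi' hj' h
  by_cases h0 : 1 < (r₁.append (cons (C.one y) l₂)).length
  · rw [F.map_one_of_length _ _ _ rfl h0]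
    exact IsMultilinear.zero G.map_multilinear _ _ _
  · simp only [length_append, length_cons] at h0
    cases r₁ with
    | cons => simp at h0; omega
    | nil =>
    cases l₂ with
    | cons => simp at h0
    | nil =>
    have h1 := F.map_one y
    simp only [length_nil] at hi' hj'
    have h2 : cons (F.map ((nil : Word C.Hom y y).append (cons (C.one y) nil)) _ rfl) q =
        cons (D.one (F.obj y)) q := by
      rw [← h1]
      exact F.map_cons_congr (single (C.one y)) 0 (by simp) q
    simp only [h2]
    apply mapT_eq_zero
    simp only [length_append, length_cons]
    by_cases h3 : 0 < l₁.length
    · have := F.length_pos_of_mem_expand _ h3 p hp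
      omega
    · have := F.length_pos_of_mem_expand r₂ (by omega) q hq
      omega

/-- The composition of A∞-functors, `F` followed by `G`. -/
def comp (F : AInfFunctor C D) (G : AInfFunctor D E) : AInfFunctor C E where
  toAInfFunctorData := AInfFunctorData.comp F.toAInfFunctorData G.toAInfFunctorData
  map_nil x := by
    simp only [AInfFunctorData.expand_nil, lsum_cons, lsum_nil, add_zero]
    exact (G.map_eq nil 1 rfl).symm.trans (G.map_nil (F.obj x))
  map_multilinear {x y} := by
    intro p q k s t
    have h' := F.isMulti.expand (G.map_multilinear (x := F.obj x) (y := F.obj y)) k s t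
    refine cast (congrArg _ ?_) h'
    funext a
    exact (AInfFunctorData.comp_mapT _ _ _).symm
  relation := comp_relation F G
  map_one x := by
    have h2 : cons (F.map (single (C.one x)) _ rfl) nil = single (D.one (F.obj x)) := by
      rw [← F.map_one x]
      exact F.map_cons_congr (single (C.one x)) 0 (by simp) nil
    simp only [single, AInfFunctorData.expand, AInfFunctorData.expandAux, lsum_cons, lsum_nil,
      add_zero]
    simp only [single] at h2
    rw [h2]
    exact (G.map_eq (single (D.one (F.obj x))) 0 (by simp)).symm.trans (G.map_one _)
  map_one_of_length s t e h hl := by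
    have := comp_mapT_one F G s t hl
    rw [AInfFunctorData.comp_mapT] at this
    simp only [this, map_zero]

lemma ext' {F G : AInfFunctor C D} (hobj : F.obj = G.obj)
    (hmap : ∀ (x y : C.Obj) (t : Word C.Hom x y), HEq (F.mapT t) (G.mapT t)) : F = G := by
  have hF : ∀ (x y : C.Obj) (t : Word C.Hom x y) e h, F.map t e h =
    DirectSum.component K ℤ _ e (F.mapT t) := fun x y t e h => F.map_eq t e h
  have hG : ∀ (x y : C.Obj) (t : Word C.Hom x y) e h, G.map t e h =
    DirectSum.component K ℤ _ e (G.mapT t) := fun x y t e h => G.map_eq t e h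
  obtain ⟨⟨fo, fm⟩, _, _, _, _, _⟩ := F
  obtain ⟨⟨go, gm⟩, _, _, _, _, _⟩ := G
  simp only at hobj hmap hF hG
  subst hobj
  have : @fm = @gm := by
    funext x y t e h
    rw [hF, hG, eq_of_heq (hmap x y t)]
  subst this
  rfl

lemma comp_assoc (F : AInfFunctor C D) (G : AInfFunctor D E) (H : AInfFunctor E B) :
    (F.comp G).comp H = F.comp (G.comp H) := by
  refine ext' rfl fun x y t => heq_of_eq ?_
  refine (AInfFunctorData.comp_mapT _ _ t).trans ?_
  refine (AInfFunctorData.lsum_expand_comp (F := F.toAInfFunctorData) (G := G.toAInfFunctorData)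
    t H.map_multilinear).trans ?_
  refine Eq.trans ?_ (AInfFunctorData.comp_mapT F.toAInfFunctorData
    (G.comp H).toAInfFunctorData t).symm
  exact lsum_congr fun q _ => (AInfFunctorData.comp_mapT _ _ q).symm

end AInfFunctor

section minimal
variable (K : Type w) [CommRing K]

/-- The degree `e` part of the graded module of morphisms `i → k` of `[n]_K`: it is `K` if `i ≤ k`
and `e = 0`, and zero otherwise. -/
def minimalHom (n : ℕ) (i k : Fin (n + 1)) (e : ℤ) : Submodule K K :=
  if i ≤ k ∧ e = 0 then ⊤ else ⊥

variable {K}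

lemma mem_minimalHom {n : ℕ} {i k : Fin (n + 1)} {e : ℤ} {c : K} :
    c ∈ minimalHom K n i k e ↔ (c ≠ 0 → i ≤ k ∧ e = 0) := by
  unfold minimalHom
  split_ifs with h
  · simp [h]
  · simp only [Submodule.mem_bot, h, imp_false, not_not]

/-- Product of the letters of a word in `[n]_K`. -/
def coef {n : ℕ} {i : Fin (n + 1)} : {k : Fin (n + 1)} →
    Word (fun i k e => minimalHom K n i k e) i k → K
  | _, nil => 1
  | _, cons a t => a.1 * coef t

lemma coef_ne_zero {n : ℕ} {i k : Fin (n + 1)} (t : Word (fun i k e => minimalHom K n i k e) i k)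
    (h : coef t ≠ 0) : i ≤ k ∧ t.rdeg = - t.length := by
  induction t with
  | nil => simp
  | cons a t ih =>
    have h1 : a.1 ≠ 0 := fun h' => h (by simp [coef, h'])
    have h2 : coef t ≠ 0 := fun h' => h (by simp [coef, h'])
    have h3 := mem_minimalHom.1 a.2 h1
    have h4 := ih h2
    refine ⟨h4.1.trans h3.1, ?_⟩
    simp [h4.2, h3.2]; ring

lemma coef_append {n : ℕ} {i j k : Fin (n + 1)}
    (s : Word (fun i k e => minimalHom K n i k e) j k)
    (t : Word (fun i k e => minimalHom K n i k e) i j) :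
    coef (s.append t) = coef s * coef t := by
  induction s with
  | nil => simp [coef]
  | cons a s ih => simp [coef, ih, mul_assoc]

variable (K) in
/-- The operations of `[n]_K`: composition `m^2 (b, a) = b * a`, and `m^d = 0` for `d ≠ 2`. -/
abbrev minimalData (n : ℕ) : AInfData.{w, w, 0} K where
  Obj := Fin (n + 1)
  Hom i k e := minimalHom K n i k e
  m t e h := ⟨if t.length = 2 then coef t else 0, by
    rw [mem_minimalHom]
    split_ifs with h2
    · intro h0
      have := coef_ne_zero t h0
      exact ⟨this.1, by rw [← h, this.2, h2]; rfl⟩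
    · simp⟩

variable (K) in
/-- Elements of `K` as degree zero elements. -/
noncomputable def minimalTot {n : ℕ} (i k : Fin (n + 1)) : K →ₗ[K] (minimalData K n).Tot i k :=
  if h : i ≤ k then
    DirectSum.lof K ℤ (fun e => minimalHom K n i k e) 0 ∘ₗ
      LinearMap.codRestrict _ LinearMap.id (fun _ => mem_minimalHom.2 fun _ => ⟨h, rfl⟩)
  else 0

lemma lof_minimal {n : ℕ} {i k : Fin (n + 1)} {e : ℤ} (a : minimalHom K n i k e) :
    DirectSum.lof K ℤ (fun e => minimalHom K n i k e) e a = minimalTot K i k a.1 := by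
  by_cases h : i ≤ k ∧ e = 0
  · obtain ⟨h, rfl⟩ := h
    simp only [minimalTot, h, dif_pos]
    rfl
  · have : a = 0 := by
      ext
      by_contra h0
      exact h (mem_minimalHom.1 a.2 h0)
    simp [this]

lemma minimal_mT {n : ℕ} {i k : Fin (n + 1)} (t : Word (minimalData K n).Hom i k) :
    (minimalData K n).mT t = minimalTot K i k (if t.length = 2 then coef t else 0) :=
  lof_minimal _

lemma minimal_mT_insert {n : ℕ} {i p q k : Fin (n + 1)} (s : Word (minimalData K n).Hom q k)
    {e : ℤ} (a : (minimalData K n).Hom p q e) (t : Word (minimalData K n).Hom i p) :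
    (minimalData K n).mT (s.append (cons a t)) =
      minimalTot K i k (if s.length + t.length = 1 then coef s * (a.1 * coef t) else 0) := by
  rw [minimal_mT, coef_append]
  congr 1
  simp only [length_append, length_cons, coef]
  congr 1
  simp only [eq_iff_iff]; omega

lemma minimal_insertSum {n : ℕ} {i₀ k : Fin (n + 1)} (t : Word (minimalData K n).Hom i₀ k) :
    insertSum (fun s => (minimalData K n).m s _ rfl) (minimalData K n).mT t = 0 := by
  have key : insertSum (fun s => (minimalData K n).m s _ rfl) (minimalData K n).mT t =
      lsum t.splits fun i => lsum i.2.2.splits fun j => j.2.2.rdeg.negOnePow •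
        minimalTot K i₀ k (if i.2.1.length + j.2.2.length = 1 then
          coef i.2.1 * ((if j.2.1.length = 2 then coef j.2.1 else 0) * coef j.2.2) else 0) :=
    lsum_congr fun i _ => lsum_congr fun j _ => congrArg _ (minimal_mT_insert _ _ _)
  rw [key]
  clear key
  match t with
  | nil => simp
  | cons a nil => simp
  | cons a (cons b nil) => simp
  | cons (k := ka) a (cons (k := kb) b (cons (k := kc) c nil)) =>
    simp [coef]
    by_cases hc : c.1 = 0
    · simp [hc]
    · have := (mem_minimalHom.1 c.2 hc).2
      subst this
      simp [mul_assoc]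
  | cons a (cons b (cons c (cons d t))) =>
    refine lsum_eq_zero fun i hi => lsum_eq_zero fun j hj => ?_
    have hi' := congrArg length (append_of_mem_splits _ _ hi)
    have hj' := congrArg length (append_of_mem_splits _ _ hj)
    simp only [length_append, length_cons] at hi' hj'
    by_cases h2 : j.2.1.length = 2
    · rw [if_neg (by omega)]; simp
    · simp [h2]

variable (K) in
/-- The category `[n]_K`, regarded as an A∞-category: the objects are `0, ..., n`,
`Hom(i, k)` is free with one generator `j_{ik}` of degree `0` if `i ≤ k`, and zero otherwise, and
`j_{kl} · j_{ik} = j_{il}`. -/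
noncomputable abbrev minimalCategory (n : ℕ) : AInfCategory.{w, w, 0} K where
  toAInfData := minimalData K n
  m_nil x := by ext; simp
  m_multilinear := by
    intro x y p q k s t
    refine cast (congrArg (IsLinearMap K) (funext fun a => (minimal_mT_insert s a t).symm)) ?_
    constructor
    · intro a b
      split_ifs
      · rw [← map_add]; congr 1; simp; ring
      · simp
    · intro c a
      split_ifs
      · rw [← map_smul]; congr 1; simp; ring
      · simp
  relation := minimal_insertSum
  one x := ⟨1, mem_minimalHom.2 fun _ => ⟨le_rfl, rfl⟩⟩
  m_one_right f := by ext; simp [coef, single]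
  m_one_left {x y k} g := by
    ext
    by_cases hg : g.1 = 0
    · have : g = 0 := by ext; exact hg
      simp [this, coef, single]
    · have := (mem_minimalHom.1 g.2 hg).2
      subst this
      simp [coef, single]
  m_one s t e h hl := by
    ext
    exact if_neg (by omega)

/-- Apply a functor to every letter of a word. -/
def mapLetters {C : AInfData.{w, v₁, u₁} K} {D : AInfData.{w, v₂, u₂} K}
    (F : AInfFunctorData C D) {x : C.Obj} : {y : C.Obj} → Word C.Hom x y →
      Word D.Hom (F.obj x) (F.obj y)
  | _, nil => nil
  | _, cons a t => cons (F.map (single a) _ rfl) (mapLetters F t)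

lemma lsum_expand_strict {C : AInfData.{w, v₁, u₁} K} {D : AInfData.{w, v₂, u₂} K}
    (F : AInfFunctorData C D)
    (hF : ∀ {x y : C.Obj} (t : Word C.Hom x y), 1 < t.length → F.map t _ rfl = 0)
    {M : Type v} [AddCommGroup M] [Module K M] {x y : C.Obj} (t : Word C.Hom x y)
    {φ : Word D.Hom (F.obj x) (F.obj y) → M} (hφ : IsMultilinear K φ) :
    lsum (F.expand t) φ = φ (mapLetters F t) := by
  induction t with
  | nil => simp [mapLetters]
  | cons a t ih =>
    rw [AInfFunctorData.lsum_expand_cons]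
    have key : ∀ i ∈ t.splits, 0 < i.2.1.length → (lsum (F.expand i.2.2) fun q =>
        φ (cons (F.map (cons a i.2.1) _ rfl) q)) = 0 := by
      intro i _ hi
      refine lsum_eq_zero fun q _ => ?_
      rw [hF _ (by simpa using hi)]
      exact IsMultilinear.zero hφ nil _ _
    have h0 : (lsum t.splits fun i => lsum (F.expand i.2.2) fun q =>
        φ (cons (F.map (cons a i.2.1) _ rfl) q)) = lsum (F.expand t) fun q =>
        φ (cons (F.map (single a) _ rfl) q) := by
      cases t with
      | nil => simp [single]
      | cons b t =>
        rw [splits_cons, lsum_cons, lsum_map]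
        rw [lsum_eq_zero (L := t.splits), add_zero]
        · rfl
        · intro i hi
          exact key ⟨i.1, cons b i.2.1, i.2.2⟩
            (by rw [splits_cons]; exact List.mem_cons_of_mem _ (List.mem_map_of_mem hi)) (by simp)
    rw [h0, ih (hφ.cons _)]
    rfl

variable (K) in
/-- The functor data `[m]_K → [n]_K`, `j_{ik} ↦ j_{α(i) α(k)}`, induced by a monotone map. -/
abbrev minimalFunctorData {m n : ℕ} (α : Fin (m + 1) →o Fin (n + 1)) :
    AInfFunctorData (minimalData K m) (minimalData K n) where
  obj := α
  map t e h := ⟨if t.length = 1 then coef t else 0, by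
    rw [mem_minimalHom]
    split_ifs with h2
    · intro h0
      have := coef_ne_zero t h0
      exact ⟨α.monotone this.1, by rw [← h, this.2, h2]; rfl⟩
    · simp⟩

lemma minimal_mapT {m n : ℕ} (α : Fin (m + 1) →o Fin (n + 1)) {i k : Fin (m + 1)}
    (t : Word (minimalData K m).Hom i k) :
    (minimalFunctorData K α).mapT t =
      minimalTot K (α i) (α k) (if t.length = 1 then coef t else 0) :=
  lof_minimal _

lemma minimal_strict {m n : ℕ} (α : Fin (m + 1) →o Fin (n + 1)) {i k : Fin (m + 1)}
    (t : Word (minimalData K m).Hom i k) (h : 1 < t.length) :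
    (minimalFunctorData K α).map t _ rfl = 0 := by
  ext
  exact if_neg (by omega)

lemma length_mapLetters {C : AInfData.{w, v₁, u₁} K} {D : AInfData.{w, v₂, u₂} K}
    (F : AInfFunctorData C D) {x y : C.Obj} (t : Word C.Hom x y) :
    (mapLetters F t).length = t.length := by
  induction t with
  | nil => rfl
  | cons a t ih => simp [mapLetters, ih]

lemma coef_mapLetters {m n : ℕ} (α : Fin (m + 1) →o Fin (n + 1)) {i k : Fin (m + 1)}
    (t : Word (minimalData K m).Hom i k) :
    coef (mapLetters (minimalFunctorData K α) t) = coef t := by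
  induction t with
  | nil => rfl
  | cons a t ih => simp [mapLetters, coef, ih, single]

variable (K) in
/-- The A∞-functor `[m]_K → [n]_K`, `j_{ik} ↦ j_{α(i) α(k)}`, induced by a monotone map. -/
noncomputable def minimalFunctor {m n : ℕ} (α : Fin (m + 1) →o Fin (n + 1)) :
    AInfFunctor (minimalCategory K m) (minimalCategory K n) where
  toAInfFunctorData := minimalFunctorData K α
  map_nil x := by ext; simp
  map_multilinear := by
    intro x y p q k s t
    simp only [minimal_mapT, coef_append, length_append, length_cons, coef]
    constructor
    · intro a b
      split_ifs
      · rw [← map_add]; congr 1; simp; ring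
      · simp
    · intro c a
      split_ifs
      · rw [← map_smul]; congr 1; simp; ring
      · simp
  relation {x y} t := by
    rw [lsum_expand_strict _ (minimal_strict α) t (minimalCategory K n).m_multilinear]
    rw [minimal_mT, length_mapLetters, coef_mapLetters]
    unfold insertSum
    simp only [minimal_mapT, coef_append, length_append, length_cons, coef]
    match t with
    | nil => simp
    | cons a nil => simp
    | cons a (cons b nil) => simp [coef]
    | cons a (cons b (cons c t)) =>
      rw [if_neg (by simp), map_zero]
      symm
      refine lsum_eq_zero fun i hi => lsum_eq_zero fun j hj => ?_
      have hi' := congrArg length (append_of_mem_splits _ _ hi)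
      have hj' := congrArg length (append_of_mem_splits _ _ hj)
      simp only [length_append, length_cons] at hi' hj'
      by_cases h2 : j.2.1.length = 2
      · rw [if_neg (by omega)]; simp
      · simp [h2]
  map_one x := by ext; simp [single, coef]
  map_one_of_length s t e h hl := by
    ext
    exact if_neg (by omega)

lemma minimalFunctor_comp {l m n : ℕ} (α : Fin (l + 1) →o Fin (m + 1))
    (β : Fin (m + 1) →o Fin (n + 1)) :
    (minimalFunctor K α).comp (minimalFunctor K β) = minimalFunctor K (β.comp α) := by
  refine AInfFunctor.ext' rfl fun x y t => heq_of_eq ?_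
  refine (AInfFunctorData.comp_mapT _ _ t).trans ?_
  refine (lsum_expand_strict _ (minimal_strict α) t (minimalFunctor K β).map_multilinear).trans ?_
  refine (minimal_mapT β _).trans ?_
  rw [length_mapLetters]
  refine (congrArg _ ?_).trans (minimal_mapT (β.comp α) t).symm
  rw [coef_mapLetters]

lemma minimalFunctor_id_comp {n : ℕ} {C : AInfCategory.{w, v, u} K}
    (σ : AInfFunctor (minimalCategory K n) C) :
    (minimalFunctor K OrderHom.id).comp σ = σ := by
  have h : ∀ {i k : Fin (n + 1)} (t : Word (minimalData K n).Hom i k),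
      mapLetters (minimalFunctorData K OrderHom.id) t = t := by
    intro i k t
    induction t with
    | nil => rfl
    | @cons p q e a t ih =>
      have aux : ∀ (e' : ℤ) (_ : e' = e) (b : minimalHom K n p q e') (_ : b.1 = a.1),
          (cons b t : Word (minimalData K n).Hom i q) = cons a t := by
        rintro _ rfl b hb
        congr 1
        exact Subtype.ext hb
      rw [mapLetters, ih]
      exact aux _ (by simp) _ (by simp [single, coef])
  refine AInfFunctor.ext' rfl fun x y t => heq_of_eq ?_
  refine (AInfFunctorData.comp_mapT _ _ t).trans ?_
  refine (lsum_expand_strict _ (minimal_strict OrderHom.id) t σ.map_multilinear).trans ?_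
  exact congrArg σ.mapT (h t)

end minimal

/-- The A∞-nerve: its `n`-simplices are the (unital) A∞-functors `[n]_K → C`. -/
noncomputable def nerve {K : Type w} [CommRing K] (C : AInfCategory.{w, v, u} K) :
    SSet.{max u v w} where
  obj n := AInfFunctor (minimalCategory K n.unop.len) C
  map α := ↾(fun σ => (minimalFunctor K α.unop.toOrderHom).comp σ)
  map_id n := by
    ext σ
    exact minimalFunctor_id_comp σ
  map_comp α β := by
    ext σ
    refine Eq.trans ?_ (AInfFunctor.comp_assoc _ _ _)
    exact congrArg (fun φ => AInfFunctor.comp φ σ) (minimalFunctor_comp _ _).symm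

/-- The map of A∞-nerves induced by an A∞-functor, by composition. -/
noncomputable def nerveMap {K : Type w} [CommRing K] {C D : AInfCategory.{w, v, u} K}
    (F : AInfFunctor C D) : nerve C ⟶ nerve D where
  app _ := ↾(fun σ => AInfFunctor.comp σ F)
  naturality _ _ α := by
    ext σ
    exact AInfFunctor.comp_assoc _ _ _


namespace AInfCategory
variable {K : Type w} [CommRing K] (C : AInfCategory.{w, v, u} K)

lemma m_congr {x y z : C.Obj} (t : Word C.Hom x y) (e : ℤ) (h : t.rdeg + 2 = e)
    (q : Word C.Hom z x) :
    (cons (C.m t _ rfl) q : Word C.Hom z y) = cons (C.m t e h) q := by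
  subst h; rfl

lemma mT_insert_nil {x y z : C.Obj} (s : Word C.Hom y z) (t : Word C.Hom x y) :
    C.mT (s.append (cons (C.m (nil : Word C.Hom y y) _ rfl) t)) = 0 := by
  rw [show C.m (nil : Word C.Hom y y) _ rfl = 0 from C.m_nil y]
  exact IsMultilinear.zero C.m_multilinear _ _ _

/-- The differential `m^1`. -/
def d {x y : C.Obj} (k l : ℤ) (h : k + 1 = l) : C.Hom x y k →ₗ[K] C.Hom x y l where
  toFun a := C.m (single a) l (by simp; omega)
  map_add' a b := by
    apply DirectSum.of_injective (β := fun k => C.Hom x y k) l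
    rw [map_add]
    refine (C.lof_m _ _ _).trans (((C.m_multilinear k nil nil).map_add a b).trans ?_)
    exact congrArg₂ (· + ·) (C.lof_m (single a) l (by simp; omega)).symm
      (C.lof_m (single b) l (by simp; omega)).symm
  map_smul' c a := by
    apply DirectSum.of_injective (β := fun k => C.Hom x y k) l
    refine (C.lof_m _ _ _).trans (((C.m_multilinear k nil nil).map_smul c a).trans ?_)
    refine (congrArg (c • ·) (C.lof_m (single a) l (by simp; omega)).symm).trans ?_
    exact (map_smul (DirectSum.lof K ℤ (fun k => C.Hom x y k) l) c _).symm

/-- The composition `m^2`. -/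
def mul {x y z : C.Obj} {i j : ℤ} (g : C.Hom y z j) (f : C.Hom x y i) (e : ℤ) (h : i + j = e) :
    C.Hom x z e :=
  C.m (cons g (single f)) e (by simp; omega)

variable {C}

lemma lof_d {x y : C.Obj} {k l : ℤ} (h : k + 1 = l) (a : C.Hom x y k) :
    DirectSum.lof K ℤ (fun k => C.Hom x y k) l (C.d k l h a) = C.mT (single a) :=
  C.lof_m _ _ _

lemma lof_mul {x y z : C.Obj} {i j : ℤ} (g : C.Hom y z j) (f : C.Hom x y i) (e : ℤ)
    (h : i + j = e) :
    DirectSum.lof K ℤ (fun k => C.Hom x z k) e (C.mul g f e h) = C.mT (cons g (single f)) :=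
  C.lof_m _ _ _

lemma lof_inj {x y : C.Obj} {e : ℤ} {a b : C.Hom x y e}
    (h : DirectSum.lof K ℤ (fun k => C.Hom x y k) e a = DirectSum.lof K ℤ _ e b) : a = b :=
  DirectSum.of_injective (β := fun k => C.Hom x y k) e h

lemma mul_add {x y z : C.Obj} {i j : ℤ} (g : C.Hom y z j) (f f' : C.Hom x y i) (e : ℤ)
    (h : i + j = e) : C.mul g (f + f') e h = C.mul g f e h + C.mul g f' e h := by
  apply lof_inj
  rw [map_add, lof_mul, lof_mul, lof_mul]
  exact (C.m_multilinear i (single g) nil).map_add f f'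

lemma add_mul {x y z : C.Obj} {i j : ℤ} (g g' : C.Hom y z j) (f : C.Hom x y i) (e : ℤ)
    (h : i + j = e) : C.mul (g + g') f e h = C.mul g f e h + C.mul g' f e h := by
  apply lof_inj
  rw [map_add, lof_mul, lof_mul, lof_mul]
  exact (C.m_multilinear j nil (single f)).map_add g g'

lemma mul_sub {x y z : C.Obj} {i j : ℤ} (g : C.Hom y z j) (f f' : C.Hom x y i) (e : ℤ)
    (h : i + j = e) : C.mul g (f - f') e h = C.mul g f e h - C.mul g f' e h := by
  rw [eq_sub_iff_add_eq, ← mul_add, sub_add_cancel]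

lemma sub_mul {x y z : C.Obj} {i j : ℤ} (g g' : C.Hom y z j) (f : C.Hom x y i) (e : ℤ)
    (h : i + j = e) : C.mul (g - g') f e h = C.mul g f e h - C.mul g' f e h := by
  rw [eq_sub_iff_add_eq, ← add_mul, sub_add_cancel]

lemma zero_mul {x y z : C.Obj} {i j : ℤ} (f : C.Hom x y i) (e : ℤ)
    (h : i + j = e) : C.mul (0 : C.Hom y z j) f e h = 0 := by
  have := C.sub_mul (0 : C.Hom y z j) 0 f e h
  rwa [sub_self, sub_self] at this

lemma mul_zero {x y z : C.Obj} {i j : ℤ} (g : C.Hom y z j) (e : ℤ)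
    (h : i + j = e) : C.mul g (0 : C.Hom x y i) e h = 0 := by
  have := C.mul_sub g (0 : C.Hom x y i) 0 e h
  rwa [sub_self, sub_self] at this

lemma insert_two {x y z : C.Obj} {i j : ℤ} (g : C.Hom y z j) (f : C.Hom x y i) {M : Type v₁}
    [AddCommGroup M] [Module K M] {φ : Word C.Hom x z → M} (hφ : IsMultilinear K φ) :
    insertSum (fun s => C.m s _ rfl) φ (cons g (single f)) =
      φ (single (C.mul g f (i + j) rfl)) + φ (cons g (single (C.d i _ rfl f))) +
      (i - 1).negOnePow • φ (cons (C.d j _ rfl g) (single f)) := by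
  have h0 : ∀ {p : C.Obj} (s : Word C.Hom p z) (t : Word C.Hom x p),
      φ (s.append (cons (C.m (nil : Word C.Hom p p) _ rfl) t)) = 0 := by
    intro p s t
    rw [show C.m (nil : Word C.Hom p p) _ rfl = 0 from C.m_nil p]
    exact IsMultilinear.zero hφ _ _ _
  have e1 := C.m_congr (cons g (single f)) (i + j) (by simp; omega) nil
  have e2 := C.m_congr (single f) (i + 1) (by simp; omega) nil
  have e3 := C.m_congr (single g) (j + 1) (by simp; omega) (single f)
  have z1 := h0 nil (cons g (single f))
  have z2 := h0 (single g) (single f)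
  have z3 := h0 (cons g (single f)) nil
  simp only [single] at e1 e2 e3 z1 z2 z3
  simp only [cons_append, nil_append] at z1 z2 z3
  simp only [insertSum, single, splits_cons, splits_nil, lsum_cons, lsum_nil, lsum_map, cons_append, nil_append,
    z1, z2, z3, e1, e2, e3]
  simp [mul, d, single]
  abel

lemma insert_one {x y : C.Obj} {i : ℤ} (f : C.Hom x y i) {M : Type v₁}
    [AddCommGroup M] [Module K M] {φ : Word C.Hom x y → M} (hφ : IsMultilinear K φ) :
    insertSum (fun s => C.m s _ rfl) φ (single f) = φ (single (C.d i _ rfl f)) := by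
  have h0 : ∀ {p : C.Obj} (s : Word C.Hom p y) (t : Word C.Hom x p),
      φ (s.append (cons (C.m (nil : Word C.Hom p p) _ rfl) t)) = 0 := by
    intro p s t
    rw [show C.m (nil : Word C.Hom p p) _ rfl = 0 from C.m_nil p]
    exact IsMultilinear.zero hφ _ _ _
  have e2 := C.m_congr (single f) (i + 1) (by simp; omega) nil
  have z1 := h0 nil (single f)
  have z2 := h0 (single f) nil
  simp only [single] at e2 z1 z2
  simp only [cons_append, nil_append] at z1 z2
  simp only [insertSum, single, splits_cons, splits_nil, lsum_cons, lsum_nil, lsum_map, cons_append, nil_append,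
    z1, z2, e2]
  simp [d, single]

lemma d_d {x y : C.Obj} {i j k : ℤ} (h : i + 1 = j) (h' : j + 1 = k) (a : C.Hom x y i) :
    C.d j k h' (C.d i j h a) = 0 := by
  subst h h'
  apply lof_inj
  rw [lof_d, map_zero, ← insert_one a C.m_multilinear]
  exact C.relation _

lemma d_mul {x y z : C.Obj} {i j : ℤ} (g : C.Hom y z j) (f : C.Hom x y i) :
    C.d (i + j) (i + j + 1) rfl (C.mul g f _ rfl) +
      C.mul g (C.d i (i + 1) rfl f) (i + j + 1) (by ring) +
      (i - 1).negOnePow • C.mul (C.d j (j + 1) rfl g) f (i + j + 1) (by ring) = 0 := by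
  apply lof_inj
  rw [map_add, map_add, Units.smul_def, map_zsmul, ← Units.smul_def, lof_d, lof_mul, lof_mul,
    map_zero, ← insert_two g f C.m_multilinear]
  exact C.relation _

lemma mul_assoc {x y z t : C.Obj} (h : C.Hom z t 0) (g : C.Hom y z 0) (f : C.Hom x y 0)
    (hh : C.d 0 1 rfl h = 0) (hg : C.d 0 1 rfl g = 0) (hf : C.d 0 1 rfl f = 0) :
    C.mul h (C.mul g f 0 rfl) 0 rfl - C.mul (C.mul h g 0 rfl) f 0 rfl =
      C.d (-1) 0 rfl (- C.m (cons h (cons g (single f))) (-1) (by simp)) := by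
  have h0 : ∀ {p : C.Obj} (s : Word C.Hom p t) (u : Word C.Hom x p),
      C.mT (s.append (cons (C.m (nil : Word C.Hom p p) _ rfl) u)) = 0 := C.mT_insert_nil
  have hz : ∀ {p q : C.Obj} (s : Word C.Hom q t) (u : Word C.Hom x p),
      C.mT (s.append (cons (0 : C.Hom p q 1) u)) = 0 := fun s u =>
    IsMultilinear.zero C.m_multilinear _ _ _
  have rel := C.relation (cons h (cons g (single f)))
  have z1 := h0 nil (cons h (cons g (single f)))
  have z2 := h0 (single h) (cons g (single f))
  have z3 := h0 (cons h (single g)) (single f)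
  have z4 := h0 (cons h (cons g (single f))) nil
  have e1 := C.m_congr (single f) 1 (by simp) nil
  have e2 := C.m_congr (single g) 1 (by simp) (single f)
  have e3 := C.m_congr (single h) 1 (by simp) (cons g (single f))
  have e4 := C.m_congr (cons g (single f)) 0 (by simp) nil
  have e5 := C.m_congr (cons h (single g)) 0 (by simp) (single f)
  have e6 := C.m_congr (cons h (cons g (single f))) (-1) (by simp) nil
  rw [show C.m (single f) 1 _ = 0 from hf] at e1
  rw [show C.m (single g) 1 _ = 0 from hg] at e2
  rw [show C.m (single h) 1 _ = 0 from hh] at e3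
  have y1 := hz (cons h (single g)) nil
  have y2 := hz (single h) (single f)
  have y3 := hz nil (cons g (single f))
  simp only [single] at z1 z2 z3 z4 e1 e2 e3 e4 e5 e6 y1 y2 y3 rel
  simp only [cons_append, nil_append] at z1 z2 z3 z4 y1 y2 y3
  simp only [insertSum, splits_cons, splits_nil, lsum_cons, lsum_nil, lsum_map, cons_append, nil_append,
    z1, z2, z3, z4, e1, e2, e3, e4, e5, e6, y1, y2, y3] at rel
  simp at rel
  apply lof_inj
  rw [map_neg, map_sub, map_neg, lof_mul, lof_mul, lof_d]
  simp only [mul, single]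
  rw [← add_eq_zero_iff_eq_neg, ← rel]
  abel

lemma mul_one {x y : C.Obj} (f : C.Hom x y 0) : C.mul f (C.one x) 0 rfl = f := C.m_one_right f

lemma one_mul {x y : C.Obj} (f : C.Hom x y 0) : C.mul (C.one y) f 0 rfl = f := by
  refine (C.m_one_left f).trans ?_
  simp

lemma d_one (x : C.Obj) : C.d 0 1 rfl (C.one x) = 0 := by
  have h := C.d_mul (C.one x) (C.one x)
  have h1 : C.mul (C.one x) (C.d 0 (0 + 1) rfl (C.one x)) (0 + 0 + 1) (by ring) =
      - C.d 0 1 rfl (C.one x) := by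
    refine (C.m_one_left _).trans ?_
    simp
  have h2 : C.mul (C.d 0 (0 + 1) rfl (C.one x)) (C.one x) (0 + 0 + 1) (by ring) =
      C.d 0 1 rfl (C.one x) := C.m_one_right _
  have h3 : C.d (0 + 0) (0 + 0 + 1) rfl (C.mul (C.one x) (C.one x) _ rfl) =
      C.d 0 1 rfl (C.one x) := congrArg _ (C.mul_one _)
  rw [h1, h2, h3] at h
  simpa using h

variable (C)

/-- The complex of morphisms `(Hom x y, m^1)`. -/
noncomputable def homComplex (x y : C.Obj) : CochainComplex (ModuleCat.{v} K) ℤ :=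
  CochainComplex.of (fun k => ModuleCat.of K (C.Hom x y k))
    (fun k => ModuleCat.ofHom (C.d k (k + 1) rfl))
    (fun k => by ext a; exact d_d rfl rfl a)

/-- The degree `0` cocycles. -/
def Z0 (x y : C.Obj) : Submodule K (C.Hom x y 0) := LinearMap.ker (C.d 0 1 rfl)

/-- The degree `0` coboundaries. -/
def B0 (x y : C.Obj) : Submodule K (C.Hom x y 0) := LinearMap.range (C.d (-1) 0 rfl)

/-- `H^0 (Hom x y) = Z^0 / B^0`. -/
abbrev H0 (x y : C.Obj) : Type v := C.Z0 x y ⧸ (C.B0 x y).submoduleOf (C.Z0 x y)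

variable {C}

lemma mul_mem_Z0 {x y z : C.Obj} {g : C.Hom y z 0} {f : C.Hom x y 0} (hg : g ∈ C.Z0 y z)
    (hf : f ∈ C.Z0 x y) : C.mul g f 0 rfl ∈ C.Z0 x z := by
  have h := C.d_mul g f
  rw [show C.d 0 (0 + 1) rfl f = 0 from hf, show C.d 0 (0 + 1) rfl g = 0 from hg, C.zero_mul,
    C.mul_zero] at h
  simp only [smul_zero, add_zero] at h
  exact h

lemma mul_mem_B0_left {x y z : C.Obj} {g : C.Hom y z 0} {f : C.Hom x y 0} (hg : g ∈ C.B0 y z)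
    (hf : f ∈ C.Z0 x y) : C.mul g f 0 rfl ∈ C.B0 x z := by
  obtain ⟨h, rfl⟩ := hg
  refine ⟨C.mul h f (-1) rfl, ?_⟩
  have := C.d_mul h f
  rw [show C.d 0 (0 + 1) rfl f = 0 from hf, C.mul_zero] at this
  simp at this
  exact add_neg_eq_zero.1 this

lemma mul_mem_B0_right {x y z : C.Obj} {g : C.Hom y z 0} {f : C.Hom x y 0} (hg : g ∈ C.Z0 y z)
    (hf : f ∈ C.B0 x y) : C.mul g f 0 rfl ∈ C.B0 x z := by
  obtain ⟨h, rfl⟩ := hf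
  refine ⟨- C.mul g h (-1) rfl, ?_⟩
  have := C.d_mul g h
  rw [show C.d 0 (0 + 1) rfl g = 0 from hg, C.zero_mul] at this
  simp only [smul_zero, add_zero] at this
  rw [map_neg]
  exact (eq_neg_of_add_eq_zero_right this).symm

/-- Composition in the homotopy category: `[g] ∘ [f] = [m^2 (g, f)]`. -/
def H0.comp {x y z : C.Obj} : C.H0 x y → C.H0 y z → C.H0 x z :=
  Quotient.map₂ (fun f g => ⟨C.mul g.1 f.1 0 rfl, mul_mem_Z0 g.2 f.2⟩) (by
    intro f f' hf g g' hg
    rw [← Quotient.eq_iff_equiv] at hf hg ⊢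
    have hf' := (Submodule.Quotient.eq _).1 hf
    have hg' := (Submodule.Quotient.eq _).1 hg
    refine (Submodule.Quotient.eq _).2 ?_
    change f.1 - f'.1 ∈ C.B0 x y at hf'
    change g.1 - g'.1 ∈ C.B0 y z at hg'
    change C.mul g.1 f.1 0 rfl - C.mul g'.1 f'.1 0 rfl ∈ C.B0 x z
    have : C.mul g.1 f.1 0 rfl - C.mul g'.1 f'.1 0 rfl =
        C.mul (g.1 - g'.1) f.1 0 rfl + C.mul g'.1 (f.1 - f'.1) 0 rfl := by
      rw [C.sub_mul, C.mul_sub]; abel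
    rw [this]
    exact add_mem (mul_mem_B0_left hg' f.2) (mul_mem_B0_right g'.2 hf'))

end AInfCategory

/-- The homotopy category `Ho C` of an A∞-category: same objects, morphisms
`H^0 (Hom x y)`. -/
structure Ho {K : Type w} [CommRing K] (C : AInfCategory.{w, v, u} K) where
  as : C.Obj

namespace Ho
variable {K : Type w} [CommRing K] {C : AInfCategory.{w, v, u} K}

instance : Category.{v} (Ho C) where
  Hom x y := C.H0 x.as y.as
  id x := Submodule.Quotient.mk ⟨C.one x.as, AInfCategory.d_one x.as⟩
  comp f g := AInfCategory.H0.comp f g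
  id_comp f := by
    induction f using Quotient.inductionOn with
    | _ f => exact congrArg Submodule.Quotient.mk (Subtype.ext (AInfCategory.mul_one f.1))
  comp_id f := by
    induction f using Quotient.inductionOn with
    | _ f => exact congrArg Submodule.Quotient.mk (Subtype.ext (AInfCategory.one_mul f.1))
  assoc f g h := by
    induction f using Quotient.inductionOn with
    | _ f =>
    induction g using Quotient.inductionOn with
    | _ g =>
    induction h using Quotient.inductionOn with
    | _ h =>
    refine (Submodule.Quotient.eq _).2 ?_
    exact ⟨_, (AInfCategory.mul_assoc h.1 g.1 f.1 h.2 g.2 f.2).symm⟩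

end Ho

namespace AInfFunctor
variable {K : Type w} [CommRing K] {C : AInfCategory.{w, v₁, u₁} K} {D : AInfCategory.{w, v₂, u₂} K}
  (F : AInfFunctor C D)

/-- The linear map `F^1`, of degree `0`. -/
def map₁ {x y : C.Obj} (k : ℤ) : C.Hom x y k →ₗ[K] D.Hom (F.obj x) (F.obj y) k where
  toFun a := F.map (single a) k (by simp)
  map_add' a b := by
    apply AInfCategory.lof_inj
    rw [map_add]
    refine (F.lof_map _ _ _).trans (((F.map_multilinear k nil nil).map_add a b).trans ?_)
    exact congrArg₂ (· + ·) (F.lof_map (single a) k (by simp)).symm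
      (F.lof_map (single b) k (by simp)).symm
  map_smul' c a := by
    apply AInfCategory.lof_inj
    refine (F.lof_map _ _ _).trans (((F.map_multilinear k nil nil).map_smul c a).trans ?_)
    refine (congrArg (c • ·) (F.lof_map (single a) k (by simp)).symm).trans ?_
    exact (map_smul (DirectSum.lof K ℤ (fun k => D.Hom (F.obj x) (F.obj y) k) k) c _).symm

lemma lof_map₁ {x y : C.Obj} {k : ℤ} (a : C.Hom x y k) :
    DirectSum.lof K ℤ (fun k => D.Hom (F.obj x) (F.obj y) k) k (F.map₁ k a) = F.mapT (single a) :=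
  F.lof_map _ _ _

lemma map₁_d {x y : C.Obj} {k l : ℤ} (h : k + 1 = l) (a : C.Hom x y k) :
    F.map₁ l (C.d k l h a) = D.d k l h (F.map₁ k a) := by
  subst h
  apply AInfCategory.lof_inj
  rw [AInfCategory.lof_d, lof_map₁, ← AInfCategory.insert_one a F.map_multilinear, ← F.relation]
  have e := F.map_cons_congr (single a) k (by simp) nil
  simp only [single] at e
  simp only [single, AInfFunctorData.expand, AInfFunctorData.expandAux, lsum_cons, lsum_nil,
    add_zero, e]
  rfl

lemma map₁_mul {x y z : C.Obj} {g : C.Hom y z 0} {f : C.Hom x y 0} (hg : C.d 0 1 rfl g = 0)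
    (hf : C.d 0 1 rfl f = 0) :
    F.map₁ 0 (C.mul g f 0 rfl) - D.mul (F.map₁ 0 g) (F.map₁ 0 f) 0 rfl =
      D.d (-1) 0 rfl (F.map (cons g (single f)) (-1) (by simp)) := by
  have h := F.relation (cons g (single f))
  rw [AInfCategory.insert_two g f F.map_multilinear] at h
  have z1 : F.mapT (cons g (single (C.d 0 (0 + 1) rfl f))) = 0 := by
    rw [show C.d 0 (0 + 1) rfl f = 0 from hf]
    exact IsMultilinear.zero F.map_multilinear (single g) nil 1
  have z2 : F.mapT (cons (C.d 0 (0 + 1) rfl g) (single f)) = 0 := by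
    rw [show C.d 0 (0 + 1) rfl g = 0 from hg]
    exact IsMultilinear.zero F.map_multilinear nil (single f) 1
  have z3 : F.mapT (single (C.mul g f (0 + 0) rfl)) = F.mapT (single (C.mul g f 0 rfl)) := rfl
  rw [z1, z2, z3, smul_zero, add_zero, add_zero] at h
  have e1 := F.map_cons_congr (single f) 0 (by simp) nil
  have e2 := F.map_cons_congr (single g) 0 (by simp) (cons (F.map (single f) 0 (by simp)) nil)
  have e3 := F.map_cons_congr (cons g (single f)) (-1) (by simp) nil
  simp only [single] at e1 e2 e3 h
  simp only [AInfFunctorData.expand, AInfFunctorData.expandAux, single, List.map_cons,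
    List.map_nil, lsum_append, lsum_cons, lsum_nil, add_zero, cons_append, nil_append,
    e1, e2, e3] at h
  apply AInfCategory.lof_inj
  rw [map_sub, lof_map₁, AInfCategory.lof_mul, AInfCategory.lof_d, sub_eq_iff_eq_add']
  exact h.symm

/-- The map of complexes `F^1 : Hom (x, y) ⟶ Hom (F x, F y)`. -/
noncomputable def homComplexMap {C D : AInfCategory.{w, v, u} K} (F : AInfFunctor C D)
    (x y : C.Obj) : C.homComplex x y ⟶ D.homComplex (F.obj x) (F.obj y) :=
  CochainComplex.ofHom (fun k => ModuleCat.ofHom (F.map₁ k)) (fun k => by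
    have h1 := CochainComplex.of_d (fun k => ModuleCat.of K (C.Hom x y k))
      (fun k => ModuleCat.ofHom (C.d k (k + 1) rfl)) k
    have h2 := CochainComplex.of_d (fun k => ModuleCat.of K (D.Hom (F.obj x) (F.obj y) k))
      (fun k => ModuleCat.ofHom (D.d k (k + 1) rfl)) k
    refine (congrArg _ h2).trans (Eq.trans ?_ (congrArg (· ≫ _) h1).symm)
    ext a
    exact (F.map₁_d rfl a).symm)

/-- The map induced by `F^1` on `H^0`. -/
def mapH0 (x y : C.Obj) : C.H0 x y → D.H0 (F.obj x) (F.obj y) :=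
  Quotient.map (fun f => ⟨F.map₁ 0 f.1, by
    have hf : C.d 0 1 rfl f.1 = 0 := f.2
    refine (F.map₁_d rfl f.1).symm.trans ?_
    exact (congrArg (F.map₁ 1) hf).trans (map_zero _)⟩) (by
    intro f f' hf
    rw [← Quotient.eq_iff_equiv] at hf ⊢
    obtain ⟨h, hh⟩ := (Submodule.Quotient.eq _).1 hf
    refine (Submodule.Quotient.eq _).2 ⟨F.map₁ (-1) h, ?_⟩
    rw [← F.map₁_d, hh]
    exact map_sub (F.map₁ 0) f.1 f'.1)

/-- The functor `Ho F : Ho C ⥤ Ho D`. -/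
def hoFunctor : Ho C ⥤ Ho D where
  obj x := ⟨F.obj x.as⟩
  map {x y} f := F.mapH0 x.as y.as f
  map_id x := congrArg Submodule.Quotient.mk (Subtype.ext (F.map_one x.as))
  map_comp f g := by
    induction f using Quotient.inductionOn with
    | _ f =>
    induction g using Quotient.inductionOn with
    | _ g =>
    exact (Submodule.Quotient.eq _).2 ⟨_, (F.map₁_mul g.2 f.2).symm⟩

/-- A quasi-equivalence of A∞-categories. -/
structure IsQuasiEquivalence {C D : AInfCategory.{w, v, u} K} (F : AInfFunctor C D) : Prop where
  isEquivalence_hoFunctor : F.hoFunctor.IsEquivalence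
  quasiIso (x y : C.Obj) : QuasiIso (F.homComplexMap x y)

end AInfFunctor

section topology
open scoped Topology.Homotopy unitInterval
variable {X : Type u} {Y : Type v} [TopologicalSpace X] [TopologicalSpace Y] (f : C(X, Y))

/-- The map induced on path components. -/
def pi0Map : ZerothHomotopy X → ZerothHomotopy Y :=
  ZerothHomotopy.lift (fun x => ZerothHomotopy.mk (f x))
    (fun _ _ p => ZerothHomotopy.sound (p.map f.continuous))

/-- The map induced on `n`-th homotopy groups. -/
def piMap (n : ℕ) (x : X) : HomotopyGroup.Pi n X x → HomotopyGroup.Pi n Y (f x) :=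
  Quotient.map (fun p => ⟨f.comp p.1, fun y hy => congrArg f (p.2 y hy)⟩)
    (fun _ _ h => h.comp_continuousMap f)

/-- Weak homotopy equivalences of topological spaces. -/
structure IsWeakHomotopyEquiv : Prop where
  bijective_pi0 : Function.Bijective (pi0Map f)
  bijective_pi (n : ℕ) (hn : 1 ≤ n) (x : X) : Function.Bijective (piMap f n x)

end topology

section joyal
open SimplexCategory

/-- The map `α ⋆ id : [m+1] → [n+1]`, extending `α : [m] → [n]` by `m + 1 ↦ n + 1`. -/
def coneMap {m n : SimplexCategory} (α : m ⟶ n) : mk (m.len + 1) ⟶ mk (n.len + 1) :=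
  Hom.mk
    { toFun := Fin.lastCases (Fin.last _) (fun j => (α.toOrderHom j).castSucc)
      monotone' := by
        intro i j hij
        induction j using Fin.lastCases with
        | last => simp [Fin.le_last]
        | cast j =>
          induction i using Fin.lastCases with
          | last => exact absurd hij (by simp)
          | cast i => simpa using α.toOrderHom.monotone (by simpa using hij) }

lemma coneMap_castSucc {m n : SimplexCategory} (α : m ⟶ n) (j : Fin (m.len + 1)) :
    (coneMap α).toOrderHom j.castSucc = (α.toOrderHom j).castSucc :=
  Fin.lastCases_castSucc (motive := fun _ => Fin (n.len + 1 + 1))  j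

lemma coneMap_last {m n : SimplexCategory} (α : m ⟶ n) :
    (coneMap α).toOrderHom (Fin.last _) = Fin.last _ :=
  Fin.lastCases_last (motive := fun _ => Fin (n.len + 1 + 1))

lemma coneMap_id (n : SimplexCategory) : coneMap (𝟙 n) = 𝟙 _ := by
  ext i : 3
  induction i using Fin.lastCases with
  | last => exact coneMap_last _
  | cast i => exact coneMap_castSucc _ _

lemma coneMap_comp {l m n : SimplexCategory} (α : l ⟶ m) (β : m ⟶ n) :
    coneMap (α ≫ β) = coneMap α ≫ coneMap β := by
  ext i : 3
  induction i using Fin.lastCases with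
  | last =>
    exact (coneMap_last _).trans
      ((congrArg (coneMap β).toOrderHom (coneMap_last α)).trans (coneMap_last β)).symm
  | cast i =>
    exact (coneMap_castSucc _ _).trans
      ((congrArg (coneMap β).toOrderHom (coneMap_castSucc α i)).trans (coneMap_castSucc β _)).symm

/-- The face `[n] → [n+1]` omitting the last vertex. -/
abbrev lastFace (n : SimplexCategory) : n ⟶ mk (n.len + 1) := SimplexCategory.δ (Fin.last _)

/-- The last vertex `[0] → [n+1]`. -/
abbrev lastVertex (n : SimplexCategory) : mk 0 ⟶ mk (n.len + 1) :=
  SimplexCategory.const _ _ (Fin.last _)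

lemma lastFace_coneMap {m n : SimplexCategory} (α : m ⟶ n) :
    lastFace m ≫ coneMap α = α ≫ lastFace n := by
  ext i : 3
  have h1 : (lastFace m).toOrderHom i = i.castSucc := Fin.succAbove_last_apply i
  have h2 : (lastFace n).toOrderHom (α.toOrderHom i) = (α.toOrderHom i).castSucc :=
    Fin.succAbove_last_apply _
  exact (congrArg (coneMap α).toOrderHom h1).trans ((coneMap_castSucc α i).trans h2.symm)

lemma lastVertex_coneMap {m n : SimplexCategory} (α : m ⟶ n) :
    lastVertex m ≫ coneMap α = lastVertex n := by
  ext i : 3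
  exact coneMap_last α

/-- The space of right morphisms `Hom^R_X (x, y)`: its `n`-simplices are the `n+1`-simplices of `X`
whose restriction to `{0, ..., n}` is the degenerate `n`-simplex on `x`, and whose restriction to
`{n+1}` is `y`. -/
def homR (X : SSet.{u}) (x y : X.obj (op (mk 0))) : SSet.{u} where
  obj n := { σ : X.obj (op (mk (n.unop.len + 1))) //
    X.map (lastFace n.unop).op σ = X.map (SimplexCategory.const n.unop (mk 0) 0).op x ∧
    X.map (lastVertex n.unop).op σ = y }
  map {n m} α := ↾(fun σ => ⟨X.map (coneMap α.unop).op σ.1, by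
    constructor
    · have h : (X.map (lastFace m.unop).op) (X.map (coneMap α.unop).op σ.1) =
          X.map α.unop.op (X.map (lastFace n.unop).op σ.1) := by
        rw [← Functor.map_comp_apply, ← Functor.map_comp_apply, ← op_comp,
          lastFace_coneMap, op_comp]
      rw [h, σ.2.1, ← Functor.map_comp_apply]
      rfl
    · rw [← Functor.map_comp_apply, ← op_comp, lastVertex_coneMap]
      exact σ.2.2⟩)
  map_id n := by
    ext σ
    change X.map (coneMap (𝟙 _)).op σ.1 = σ.1
    rw [coneMap_id]; simp
  map_comp α β := by
    ext σ
    change X.map (coneMap (β.unop ≫ α.unop)).op σ.1 = _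
    rw [coneMap_comp, op_comp, Functor.map_comp_apply]
    rfl

/-- The map `Hom^R_X (x, y) ⟶ Hom^R_Y (f x, f y)` induced by a map of simplicial sets. -/
def homRMap {X Y : SSet.{u}} (f : X ⟶ Y) (x y : X.obj (op (mk 0))) :
    homR X x y ⟶ homR Y (f.app _ x) (f.app _ y) where
  app n := ↾(fun σ => ⟨f.app _ σ.1, by
    constructor
    · rw [← NatTrans.naturality_apply, σ.2.1, NatTrans.naturality_apply]
    · rw [← NatTrans.naturality_apply, σ.2.2]⟩)
  naturality n m α := by
    ext σ
    refine Subtype.ext ?_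
    exact NatTrans.naturality_apply f _ σ.1

/-- Weak equivalences between ∞-categories, in the Joyal model structure: `X` and `Y` are
∞-categories (quasi-categories), `f` induces an equivalence of homotopy categories, and weak
homotopy equivalences between the geometric realizations of the mapping spaces. -/
structure IsJoyalWeakEquivalence {X Y : SSet.{u}} (f : X ⟶ Y) : Prop where
  quasicategory_source : SSet.Quasicategory X
  quasicategory_target : SSet.Quasicategory Y
  isEquivalence_hoFunctor : (SSet.hoFunctor.map f).toFunctor.IsEquivalence
  isWeakHomotopyEquiv (x y : X.obj (op (mk 0))) :
    IsWeakHomotopyEquiv (SSet.toTop.map (homRMap f x y)).hom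

end joyal

end AInf

/-!
The proof rests on two facts: A∞-functors out of `[n]_K` satisfy a Bianchi identity, and the
functors that are constant on a face of codimension one are governed by a linear equation.

**Functors out of `[n]_K`.** By multilinearity and strict unitality, a functor `[n]_K → C` is
determined by its values on the words of generators through strictly decreasing lists of vertices,
and any values of the right degree define a unital prefunctor (`ofValues`). It is an A∞-functor if
its curvature `curv`, the defect of the functor equation, vanishes on these words (`curv_eq_zero`).
Applying the A∞-relations of source and target gives the Bianchi identity (`IsMulti.bianchi`): the
curvature is closed.

**Inner horns.** For the horn missing the `k`-th face, all values are given except those on the full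
list of vertices and on the full list without `k`. The former is arbitrary. The equation for the
full list then determines the latter, since it contains this value linearly and with sign
(`curv_updateValue`). The equation for the missing face is not imposed: on the full list, all terms
of the Bianchi identity vanish except for the curvature of the missing face
(`curv_eq_zero_of_faces`). That `k` is an inner vertex enters through the operations of `[n]_K`,
which delete interior vertices of a word only. Hence `quasicategory_nerve`.

**Mapping spaces.** A simplex of `Hom^R (x, y)` is a functor on `[n+1]_K` that is constant on the
face opposite to the last vertex. All products of its values vanish, except for products with units,
so that the functor equation reads `d f = - ∑ ± f (faces)` (`curv_cone`). Thus `Hom^R (x, y)` is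
naturally isomorphic to the space that the Dold–Kan construction associates with the complex
`Hom (x, y)` (`homRToSpace`). A quasi-isomorphism of complexes factors through its mapping path
complex as a section of one map, followed by another map, both of which allow lifting of primitives
(`pathFst_hasLifting`, `pathSnd_hasLifting`). Such maps induce trivial fibrations of simplicial sets
(`spaceMap_rlp`), and trivial fibrations are deformation retractions (`exists_section_homotopy`).
The realization of a simplicial homotopy is a homotopy (`exists_realization_homotopy`), and maps
homotopic to the identity are weak homotopy equivalences, base points being transported along the
homotopy (`bijective_piMap_of_homotopy`). This gives `isWeakHomotopyEquiv_homRMap`.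

**Homotopy categories.** Sending an edge of the nerve to the class of its value on the generator
defines a functor from the homotopy category of the nerve of `C` to `Ho C`, natural in `C`
(`hoNerveFunctor`, `hoNerveFunctorIso`). By the description of the mapping spaces, edges are cocycles
of degree zero, and primitives of their differences are homotopies, so that it is an equivalence, and
an equivalence `Ho C ≌ Ho D` gives one for the nerves (`isEquivalence_hoFunctor_nerveMap`).
-/

/-! ### Nested insertions and the Bianchi identity -/

namespace AInf

open Word DirectSum

section insertion
variable {K : Type w} [CommRing K]

lemma lsum_sub {α : Type u} {M : Type v} [AddCommGroup M] (L : List α) (f g : α → M) :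
    lsum L (fun a => f a - g a) = lsum L f - lsum L g := by
  induction L with
  | nil => simp
  | cons a L ih => simp [ih]; abel

lemma lsum_neg {α : Type u} {M : Type v} [AddCommGroup M] (L : List α) (f : α → M) :
    lsum L (fun a => - f a) = - lsum L f := by
  induction L with
  | nil => simp
  | cons a L ih => simp [ih]; abel

variable {Obj : Type u} {Hom : Obj → Obj → ℤ → Type v}
  (m : {x y : Obj} → (t : Word Hom x y) → Hom x y (t.rdeg + 2))
  {M : Type v₁} [AddCommGroup M]

lemma insertSum_sub {x y : Obj} (φ ψ : Word Hom x y → M) (t : Word Hom x y) :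
    insertSum m (fun s => φ s - ψ s) t = insertSum m φ t - insertSum m ψ t := by
  simp only [insertSum, smul_sub, lsum_sub]

/-- Insertions into a word with a distinguished letter take place to the left of the letter, to
its right, or absorb it. -/
lemma insertSum_append {x y p q : Obj} {k : ℤ} (φ : Word Hom x y → M) (s : Word Hom q y)
    (a : Hom p q k) (t : Word Hom x p) :
    insertSum m φ (s.append (cons a t)) =
      (lsum s.splits fun i => lsum i.2.2.splits fun j =>
        (j.2.2.rdeg + (t.rdeg + (k - 1))).negOnePow •
          φ ((i.2.1.append (cons (m j.2.1) j.2.2)).append (cons a t))) +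
      (lsum s.splits fun i => lsum t.splits fun j => j.2.2.rdeg.negOnePow •
        φ (i.2.1.append (cons (m (i.2.2.append (cons a j.2.1))) j.2.2))) +
      (lsum t.splits fun i => lsum i.2.2.splits fun j => j.2.2.rdeg.negOnePow •
        φ (s.append (cons a (i.2.1.append (cons (m j.2.1) j.2.2))))) := by
  unfold insertSum
  rw [lsum_splits_append, ← lsum_add]
  congr 1
  · apply lsum_congr
    intro i _
    rw [lsum_splits_append]
    congr 1
    apply lsum_congr
    intro j _
    simp [append_assoc]
  · apply lsum_congr
    intro i _
    apply lsum_congr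
    intro j _
    simp [append_assoc]

lemma isMultilinear_insertSum [∀ x y k, AddCommGroup (Hom x y k)] [∀ x y k, Module K (Hom x y k)]
    [Module K M] {x y : Obj} {φ : Word Hom x y → M}
    (hφ : IsMultilinear K φ)
    (hm : ∀ x y : Obj, IsMultilinear K fun t : Word Hom x y => DirectSum.lof K ℤ (Hom x y) _ (m t)) :
    IsMultilinear K (insertSum m φ) := by
  intro p q k s t
  have hs : ∀ (ε : ℤˣ) (f : Hom p q k → M), IsLinearMap K f → IsLinearMap K fun a => ε • f a := by
    intro ε f hf
    constructor
    · intro a b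
      rw [hf.map_add, smul_add]
    · intro c a
      rw [hf.map_smul, smul_comm]
  have ha : ∀ (f g : Hom p q k → M), IsLinearMap K f → IsLinearMap K g →
      IsLinearMap K fun a => f a + g a := by
    intro f g hf hg
    constructor
    · intro a b
      rw [hf.map_add, hg.map_add]; abel
    · intro c a
      rw [hf.map_smul, hg.map_smul, smul_add]
  simp only [insertSum_append]
  refine ha _ _ (ha _ _ ?_ ?_) ?_
  · exact isLinearMap_lsum _ _ fun i _ => isLinearMap_lsum _ _ fun j _ => hs _ _ (hφ k _ t)
  · refine isLinearMap_lsum _ _ fun i _ => isLinearMap_lsum _ _ fun j _ => hs _ _ ?_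
    have h := ((hφ.ext i.2.1 j.2.2).comp ((hm _ _ k i.2.2 j.2.1).mk' _)).isLinear
    refine cast (congrArg _ ?_) h
    funext a
    exact hφ.ext_lof _ _ _
  · refine isLinearMap_lsum _ _ fun i _ => isLinearMap_lsum _ _ fun j _ => hs _ _ (hφ k s _)

end insertion

lemma Word.lsum_splits_five' {Obj : Type u} {Hom : Obj → Obj → ℤ → Type v} {M : Type v₁}
    [AddCommGroup M] {x y : Obj} (t : Word Hom x y)
    (X : (p₁ p₂ p₃ p₄ : Obj) → Word Hom p₄ y → Word Hom p₃ p₄ → Word Hom p₂ p₃ → Word Hom p₁ p₂ →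
      Word Hom x p₁ → M) :
    (lsum t.splits fun i => lsum i.2.2.splits fun j => lsum i.2.1.splits fun a =>
      lsum a.2.2.splits fun b => X j.1 i.1 b.1 a.1 a.2.1 b.2.1 b.2.2 j.2.1 j.2.2) =
    lsum t.splits fun i => lsum i.2.2.splits fun j => lsum j.2.2.splits fun a =>
      lsum a.2.2.splits fun b => X b.1 a.1 j.1 i.1 i.2.1 j.2.1 a.2.1 b.2.1 b.2.2 := by
  have h1 : ∀ i ∈ t.splits, (lsum i.2.2.splits fun j => lsum i.2.1.splits fun a =>
      lsum a.2.2.splits fun b => X j.1 i.1 b.1 a.1 a.2.1 b.2.1 b.2.2 j.2.1 j.2.2) =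
      lsum i.2.1.splits fun a => lsum a.2.2.splits fun b => lsum i.2.2.splits fun j =>
        X j.1 i.1 b.1 a.1 a.2.1 b.2.1 b.2.2 j.2.1 j.2.2 := by
    intro i _
    rw [lsum_comm]
    refine lsum_congr fun a _ => ?_
    rw [lsum_comm]
  rw [lsum_congr h1, ← lsum_splits_coassoc t (fun p q r s u => lsum s.splits fun b =>
    lsum u.splits fun j => X j.1 p b.1 q r b.2.1 b.2.2 j.2.1 j.2.2)]
  refine lsum_congr fun i _ => ?_
  rw [← lsum_splits_coassoc i.2.2 (fun p q r s u =>
    lsum u.splits fun j => X j.1 p q i.1 i.2.1 r s j.2.1 j.2.2)]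

namespace AInfCategory
variable {K : Type w} [CommRing K] (C : AInfCategory.{w, v, u} K)

lemma ext_relation {M : Type v₁} [AddCommGroup M] [Module K M] {x y p q : C.Obj}
    {φ : Word C.Hom x y → M} (hφ : IsMultilinear K φ) (l : Word C.Hom q y) (t : Word C.Hom p q)
    (r : Word C.Hom x p) :
    (lsum t.splits fun i => lsum i.2.2.splits fun j => j.2.2.rdeg.negOnePow •
      φ (l.append (cons (C.m (i.2.1.append (cons (C.m j.2.1 _ rfl) j.2.2)) _ rfl) r))) = 0 := by
  have h := congrArg (hφ.ext l r) (C.relation t)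
  simp only [insertSum, map_lsum, map_zero] at h
  refine Eq.trans ?_ h
  refine lsum_congr fun i _ => lsum_congr fun j _ => ?_
  rw [Units.smul_def, Units.smul_def, map_zsmul]
  congr 1
  exact (hφ.ext_lof l r _).symm

/-- The A∞-relations say that inserting the operations twice gives zero: two disjoint insertions
can be performed in either order, with opposite signs. -/
lemma insertSum_insertSum {M : Type v₁} [AddCommGroup M] [Module K M] {x y : C.Obj}
    {φ : Word C.Hom x y → M} (hφ : IsMultilinear K φ) (t : Word C.Hom x y) :
    insertSum (fun s => C.m s _ rfl) (insertSum (fun s => C.m s _ rfl) φ) t = 0 := by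
  have key : insertSum (fun s => C.m s _ rfl) (insertSum (fun s => C.m s _ rfl) φ) t =
      lsum t.splits fun i => lsum i.2.2.splits fun j => j.2.2.rdeg.negOnePow •
        insertSum (fun s => C.m s _ rfl) φ (i.2.1.append (cons (C.m j.2.1 _ rfl) j.2.2)) := rfl
  rw [key]
  simp only [insertSum_append, smul_add, lsum_add, smul_lsum, smul_smul]
  -- nested insertions: for a fixed outer subword, these are the A∞-relations
  have h2 : (lsum t.splits fun i => lsum i.2.2.splits fun j => lsum i.2.1.splits fun a =>
      lsum j.2.2.splits fun b => (j.2.2.rdeg.negOnePow * b.2.2.rdeg.negOnePow) •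
        φ (a.2.1.append (cons (C.m (a.2.2.append (cons (C.m j.2.1 _ rfl) b.2.1)) _ rfl) b.2.2)))
        = 0 := by
    have e1 : ∀ i ∈ t.splits, ∀ j ∈ i.2.2.splits, ∀ a ∈ i.2.1.splits, ∀ b ∈ j.2.2.splits,
        (j.2.2.rdeg.negOnePow * b.2.2.rdeg.negOnePow) •
        φ (a.2.1.append (cons (C.m (a.2.2.append (cons (C.m j.2.1 _ rfl) b.2.1)) _ rfl) b.2.2))
        = b.2.1.rdeg.negOnePow •
        φ (a.2.1.append (cons (C.m (a.2.2.append (cons (C.m j.2.1 _ rfl) b.2.1)) _ rfl) b.2.2))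
        := by
      intro i _ j _ a _ b hb
      have hr : j.2.2.rdeg = b.2.1.rdeg + b.2.2.rdeg := by
        rw [← rdeg_append, append_of_mem_splits _ _ hb]
      rw [hr, Int.negOnePow_add, _root_.mul_assoc, ← Int.negOnePow_add b.2.2.rdeg,
        Int.negOnePow_even _ (Even.add_self _), _root_.mul_one]
    rw [lsum_congr fun i hi => lsum_congr fun j hj => lsum_congr fun a ha => lsum_congr fun b hb =>
      e1 i hi j hj a ha b hb]
    rw [← lsum_splits_five t (fun p₁ p₂ p₃ p₄ w₅ w₄ w₃ w₂ w₁ => w₂.rdeg.negOnePow •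
      φ (w₅.append (cons (C.m (w₄.append (cons (C.m w₃ _ rfl) w₂)) _ rfl) w₁)))]
    exact lsum_eq_zero fun i _ => lsum_eq_zero fun j _ => C.ext_relation hφ _ _ _
  -- disjoint insertions: the two orders differ in sign, by the degree `1` of the shifted operations
  have h13 : (lsum t.splits fun i => lsum i.2.2.splits fun j => lsum i.2.1.splits fun a =>
      lsum a.2.2.splits fun b => (j.2.2.rdeg.negOnePow *
        (b.2.2.rdeg + (j.2.2.rdeg + (j.2.1.rdeg + 2 - 1))).negOnePow) •
        φ ((a.2.1.append (cons (C.m b.2.1 _ rfl) b.2.2)).append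
          (cons (C.m j.2.1 _ rfl) j.2.2))) = - lsum t.splits fun i => lsum i.2.2.splits fun j =>
      lsum j.2.2.splits fun a => lsum a.2.2.splits fun b =>
        (j.2.2.rdeg.negOnePow * b.2.2.rdeg.negOnePow) • φ (i.2.1.append (cons (C.m j.2.1 _ rfl)
          (a.2.1.append (cons (C.m b.2.1 _ rfl) b.2.2)))) := by
    have e1 : ∀ i ∈ t.splits, ∀ j ∈ i.2.2.splits, ∀ a ∈ i.2.1.splits, ∀ b ∈ a.2.2.splits,
        (j.2.2.rdeg.negOnePow *
        (b.2.2.rdeg + (j.2.2.rdeg + (j.2.1.rdeg + 2 - 1))).negOnePow) •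
        φ ((a.2.1.append (cons (C.m b.2.1 _ rfl) b.2.2)).append
          (cons (C.m j.2.1 _ rfl) j.2.2)) =
        (b.2.2.rdeg + j.2.1.rdeg + 1).negOnePow •
        φ (a.2.1.append (cons (C.m b.2.1 _ rfl) (b.2.2.append
          (cons (C.m j.2.1 _ rfl) j.2.2)))) := by
      intro i _ j _ a _ b _
      rw [append_assoc, ← Int.negOnePow_add]
      congr 1
      rw [Int.negOnePow_eq_iff]
      exact ⟨j.2.2.rdeg, by ring⟩
    have e2 : ∀ i ∈ t.splits, ∀ j ∈ i.2.2.splits, ∀ a ∈ j.2.2.splits, ∀ b ∈ a.2.2.splits,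
        (j.2.2.rdeg.negOnePow * b.2.2.rdeg.negOnePow) • φ (i.2.1.append (cons (C.m j.2.1 _ rfl)
          (a.2.1.append (cons (C.m b.2.1 _ rfl) b.2.2)))) =
        - ((a.2.1.rdeg + b.2.1.rdeg + 1).negOnePow • φ (i.2.1.append (cons (C.m j.2.1 _ rfl)
          (a.2.1.append (cons (C.m b.2.1 _ rfl) b.2.2))))) := by
      intro i _ j _ a ha b hb
      have hr : j.2.2.rdeg = a.2.1.rdeg + a.2.2.rdeg := by
        rw [← rdeg_append, append_of_mem_splits _ _ ha]
      have hr' : a.2.2.rdeg = b.2.1.rdeg + b.2.2.rdeg := by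
        rw [← rdeg_append, append_of_mem_splits _ _ hb]
      rw [Int.negOnePow_succ, Units.neg_smul, neg_neg, ← Int.negOnePow_add]
      congr 1
      rw [Int.negOnePow_eq_iff]
      exact ⟨b.2.2.rdeg, by rw [hr, hr']; ring⟩
    rw [lsum_congr fun i hi => lsum_congr fun j hj => lsum_congr fun a ha => lsum_congr fun b hb =>
      e1 i hi j hj a ha b hb, lsum_congr fun i hi => lsum_congr fun j hj => lsum_congr fun a ha =>
      lsum_congr fun b hb => e2 i hi j hj a ha b hb]
    simp only [lsum_neg, neg_neg]
    exact lsum_splits_five' t (fun p₁ p₂ p₃ p₄ w₅ w₄ w₃ w₂ w₁ =>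
      (w₃.rdeg + w₂.rdeg + 1).negOnePow • φ (w₅.append (cons (C.m w₄ _ rfl)
        (w₃.append (cons (C.m w₂ _ rfl) w₁)))))
  rw [h2, h13]
  simp

end AInfCategory

namespace AInfFunctorData
variable {K : Type w} [CommRing K] {C : AInfCategory.{w, v₁, u₁} K} {D : AInfCategory.{w, v₂, u₂} K}
  (F : AInfFunctorData C.toAInfData D.toAInfData)

/-- The defect of the A∞-functor equation for the data `F`:
`∑ m (F (b_r), ..., F (b_1)) - ∑ (-1) ^ † F (a_d, ..., m (a_{n+m}, ..., a_{n+1}), ..., a_1)`. -/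
def curv {x y : C.Obj} (t : Word C.Hom x y) : D.Tot (F.obj x) (F.obj y) :=
  lsum (F.expand t) D.mT - insertSum (fun s => C.m s _ rfl) F.mapT t

variable {F}

lemma IsMulti.curv (hF : F.IsMulti) (x y : C.Obj) :
    IsMultilinear K (F.curv (x := x) (y := y)) := by
  intro p q k s t
  have h1 := hF.expand (D.m_multilinear (x := F.obj x) (y := F.obj y)) k s t
  have h2 := isMultilinear_insertSum (K := K) (fun {x y} (s : Word C.Hom x y) => C.m s _ rfl)
    (hF x y) (fun x y => C.m_multilinear) k s t
  constructor
  · intro a b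
    simp only [AInfFunctorData.curv, h1.map_add, h2.map_add]; abel
  · intro c a
    simp only [AInfFunctorData.curv, h1.map_smul, h2.map_smul, smul_sub]

lemma lsum_expand_insertSum {x y : C.Obj} {M : Type v} [AddCommGroup M] [Module K M]
    {φ : Word D.Hom (F.obj x) (F.obj y) → M} (hφ : IsMultilinear K φ) (t : Word C.Hom x y) :
    lsum (F.expand t) (insertSum (fun s => D.m s _ rfl) φ) =
      lsum t.splits fun i => lsum i.2.2.splits fun j => j.2.2.rdeg.negOnePow •
        lsum (F.expand i.2.1) fun p => lsum (F.expand j.2.2) fun q =>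
          hφ.ext p q (lsum (F.expand j.2.1) D.mT) := by
  unfold insertSum
  rw [F.lsum_expand_splits t (fun d p q => lsum q.splits fun j => j.2.2.rdeg.negOnePow •
    φ (p.append (cons (D.m j.2.1 _ rfl) j.2.2)))]
  refine lsum_congr fun i _ => ?_
  have h2 : ∀ p ∈ F.expand i.2.1, (lsum (F.expand i.2.2) fun q =>
        lsum q.splits fun j => j.2.2.rdeg.negOnePow •
        φ (p.append (cons (D.m j.2.1 _ rfl) j.2.2))) =
        lsum i.2.2.splits fun j => lsum (F.expand j.2.2) fun q =>
        j.2.2.rdeg.negOnePow • hφ.ext p q (lsum (F.expand j.2.1) D.mT) := by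
    intro p _
    rw [F.lsum_expand_splits i.2.2 (fun d q q' => q'.rdeg.negOnePow •
      φ (p.append (cons (D.m q _ rfl) q')))]
    refine lsum_congr fun j _ => ?_
    rw [lsum_comm]
    refine lsum_congr fun q hq => ?_
    rw [F.rdeg_of_mem_expand _ q hq, ← smul_lsum, map_lsum]
    congr 1
    exact lsum_congr fun q' _ => (hφ.ext_lof p q _).symm
  rw [lsum_congr h2, lsum_comm]
  refine lsum_congr fun j _ => ?_
  rw [smul_lsum]
  refine lsum_congr fun p _ => ?_
  rw [smul_lsum]

lemma insertSum_lsum_expand {x y : C.Obj} {M : Type v} [AddCommGroup M] [Module K M]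
    {φ : Word D.Hom (F.obj x) (F.obj y) → M} (hφ : IsMultilinear K φ) (t : Word C.Hom x y) :
    insertSum (fun s => C.m s _ rfl) (fun s => lsum (F.expand s) φ) t =
      lsum t.splits fun i => lsum i.2.2.splits fun j => j.2.2.rdeg.negOnePow •
        lsum (F.expand i.2.1) fun p => lsum (F.expand j.2.2) fun q =>
          hφ.ext p q (insertSum (fun s => C.m s _ rfl) F.mapT j.2.1) := by
  have e : ∀ i ∈ t.splits, ∀ j ∈ i.2.2.splits, (j.2.2.rdeg.negOnePow •
        lsum (F.expand i.2.1) fun p => lsum (F.expand j.2.2) fun q =>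
          hφ.ext p q (insertSum (fun s => C.m s _ rfl) F.mapT j.2.1)) =
      lsum j.2.1.splits fun a => lsum a.2.2.splits fun b => lsum (F.expand i.2.1) fun p =>
        lsum (F.expand j.2.2) fun q => (j.2.2.rdeg.negOnePow * b.2.2.rdeg.negOnePow) •
          φ (p.append (cons (F.map (a.2.1.append (cons (C.m b.2.1 _ rfl) b.2.2)) _ rfl) q)) := by
    intro i _ j _
    have e1 : ∀ p ∈ F.expand i.2.1, ∀ q ∈ F.expand j.2.2,
        hφ.ext p q (insertSum (fun s => C.m s _ rfl) F.mapT j.2.1) =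
        lsum j.2.1.splits fun a => lsum a.2.2.splits fun b => b.2.2.rdeg.negOnePow •
          φ (p.append (cons (F.map (a.2.1.append (cons (C.m b.2.1 _ rfl) b.2.2)) _ rfl) q)) := by
      intro p _ q _
      simp only [insertSum, map_lsum]
      refine lsum_congr fun a _ => lsum_congr fun b _ => ?_
      rw [Units.smul_def, map_zsmul, ← Units.smul_def]
      congr 1
      exact hφ.ext_lof p q _
    rw [lsum_congr fun p hp => lsum_congr fun q hq => e1 p hp q hq]
    simp only [smul_lsum, smul_smul]
    rw [lsum_congr fun p hp => lsum_comm _ _ _, lsum_comm]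
    refine lsum_congr fun a _ => ?_
    rw [lsum_congr fun p hp => lsum_comm _ _ _, lsum_comm]
  rw [lsum_congr fun i hi => lsum_congr fun j hj => e i hi j hj,
    lsum_splits_five t (fun p₁ p₂ p₃ p₄ w₅ w₄ w₃ w₂ w₁ =>
    lsum (F.expand w₅) fun p => lsum (F.expand w₁) fun q =>
        (w₁.rdeg.negOnePow * w₂.rdeg.negOnePow) • φ (p.append (cons
          (F.map (w₄.append (cons (C.m w₃ _ rfl) w₂)) _ rfl) q)))]
  refine lsum_congr fun i _ => lsum_congr fun j _ => ?_
  beta_reduce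
  rw [AInfFunctorData.lsum_expand_append, smul_lsum]
  refine lsum_congr fun a _ => ?_
  rw [smul_lsum]
  refine lsum_congr fun b hb => ?_
  rw [smul_lsum]
  refine lsum_congr fun p _ => ?_
  rw [smul_lsum]
  refine lsum_congr fun q _ => ?_
  have hr : j.2.2.rdeg = b.2.1.rdeg + b.2.2.rdeg := by
    rw [← rdeg_append, append_of_mem_splits _ _ hb]
  rw [hr, Int.negOnePow_add, mul_comm]

/-- The Bianchi identity: the defect of the functor equation is closed for the
differential on coderivations along `F`. -/
lemma IsMulti.bianchi (hF : F.IsMulti) {x y : C.Obj} (t : Word C.Hom x y) :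
    insertSum (fun s => C.m s _ rfl) F.curv t +
      (lsum t.splits fun i => lsum i.2.2.splits fun j => j.2.2.rdeg.negOnePow •
        lsum (F.expand i.2.1) fun p => lsum (F.expand j.2.2) fun q =>
          IsMultilinear.ext D.m_multilinear p q (F.curv j.2.1)) = 0 := by
  have hm : IsMultilinear K (D.mT (x := F.obj x) (y := F.obj y)) := D.m_multilinear
  have h1 := lsum_expand_insertSum (F := F) hm t
  have h2 := insertSum_lsum_expand (F := F) hm t
  -- the A∞-relations of `C` and of `D` cancel the terms with two operations on the same side
  have h3 := C.insertSum_insertSum (hF x y) t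
  have h4 : lsum (F.expand t) (insertSum (fun s => D.m s _ rfl) D.mT) = 0 :=
    lsum_eq_zero fun q _ => D.relation q
  rw [h4] at h1
  have h5 : insertSum (fun s => C.m s _ rfl) F.curv t =
      insertSum (fun s => C.m s _ rfl) (fun s => lsum (F.expand s) D.mT) t -
      insertSum (fun s => C.m s _ rfl) (insertSum (fun s => C.m s _ rfl) F.mapT) t :=
    insertSum_sub _ _ _ t
  rw [h5, h3, h2, sub_zero]
  simp only [AInfFunctorData.curv, map_sub, lsum_sub, smul_sub]
  rw [← h1]
  abel

end AInfFunctorData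

end AInf

/-! ### Strict unitality -/

namespace AInf

open Word DirectSum

namespace Word
variable {Obj : Type u} {Hom : Obj → Obj → ℤ → Type v} {M : Type v₁} [AddCommGroup M]

lemma lsum_splits_of_right {x z : Obj} (t : Word Hom x z)
    (f : (Σ y : Obj, Word Hom y z × Word Hom x y) → M)
    (h : ∀ i ∈ t.splits, 0 < i.2.2.length → f i = 0) :
    lsum t.splits f = f ⟨x, t, nil⟩ := by
  induction t with
  | nil => simp
  | cons a t ih =>
    rw [splits_cons, lsum_cons, lsum_map, h _ (by simp) (by simp), zero_add]
    refine ih _ fun i hi hl => h _ ?_ hl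
    rw [splits_cons]
    exact List.mem_cons_of_mem _ (List.mem_map_of_mem hi)

lemma lsum_splits_of_left {x z : Obj} (t : Word Hom x z)
    (f : (Σ y : Obj, Word Hom y z × Word Hom x y) → M)
    (h : ∀ i ∈ t.splits, 0 < i.2.1.length → f i = 0) :
    lsum t.splits f = f ⟨z, nil, t⟩ := by
  cases t with
  | nil => simp
  | cons a t =>
    rw [splits_cons, lsum_cons, lsum_map, lsum_eq_zero, add_zero]
    intro i hi
    refine h _ ?_ (by simp)
    rw [splits_cons]
    exact List.mem_cons_of_mem _ (List.mem_map_of_mem hi)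

lemma eq_nil_or_append_single {x y : Obj} (t : Word Hom x y) :
    (∃ h : x = y, t = h ▸ nil) ∨
      ∃ (z : Obj) (k : ℤ) (s : Word Hom z y) (a : Hom x z k), t = s.append (single a) := by
  induction t with
  | nil => exact Or.inl ⟨rfl, rfl⟩
  | cons a t ih =>
    right
    obtain ⟨rfl, rfl⟩ | ⟨z, k, s, b, rfl⟩ := ih
    · exact ⟨_, _, nil, a, rfl⟩
    · exact ⟨z, k, cons a s, b, rfl⟩

lemma length_of_mem_splits {x z : Obj} {t : Word Hom x z} {i} (hi : i ∈ t.splits) :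
    i.2.1.length + i.2.2.length = t.length := by
  rw [← length_append, append_of_mem_splits t i hi]

lemma rdeg_of_mem_splits {x z : Obj} {t : Word Hom x z} {i} (hi : i ∈ t.splits) :
    i.2.1.rdeg + i.2.2.rdeg = t.rdeg := by
  rw [← rdeg_append, append_of_mem_splits t i hi]

end Word

namespace AInfCategory
variable {K : Type w} [CommRing K] (C : AInfCategory.{w, v, u} K)

lemma mT_single_one (x : C.Obj) : C.mT (single (C.one x)) = 0 := by
  rw [← lof_d (zero_add 1), d_one, map_zero]

lemma mT_one {x y z : C.Obj} (s : Word C.Hom y z) (t : Word C.Hom x y)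
    (h : 2 < (s.append (cons (C.one y) t)).length) :
    C.mT (s.append (cons (C.one y) t)) = 0 := by
  rw [AInfData.mT, C.m_one s t _ rfl h, map_zero]

lemma mT_one_right {x y : C.Obj} {k : ℤ} (f : C.Hom x y k) :
    C.mT (cons f (single (C.one x))) = DirectSum.lof K ℤ (fun k => C.Hom x y k) k f := by
  rw [← C.lof_m _ k (by simp; ring), C.m_one_right]

lemma mT_one_left {x y : C.Obj} {k : ℤ} (f : C.Hom x y k) :
    C.mT (cons (C.one y) (single f)) =
      k.negOnePow • DirectSum.lof K ℤ (fun k => C.Hom x y k) k f := by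
  rw [← C.lof_m _ k (by simp; ring), C.m_one_left, Units.smul_def, map_zsmul, ← Units.smul_def]

lemma cons_m_one_right {x y z : C.Obj} {k : ℤ} (f : C.Hom x y k) (r : Word C.Hom z x) :
    (cons (C.m (cons f (single (C.one x))) _ rfl) r : Word C.Hom z y) = cons f r := by
  rw [C.m_congr _ k (by simp; ring), C.m_one_right]

lemma ext_m_one_left {x y p q : C.Obj} {M : Type v₁} [AddCommGroup M] [Module K M]
    {φ : Word C.Hom x y → M} (hφ : IsMultilinear K φ)
    {k : ℤ} (f : C.Hom p q k) (l : Word C.Hom q y) (r : Word C.Hom x p) :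
    φ (l.append (cons (C.m (cons (C.one q) (single f)) _ rfl) r)) =
      k.negOnePow • φ (l.append (cons f r)) := by
  rw [C.m_congr _ k (by simp; ring), C.m_one_left, Units.smul_def, Units.smul_def]
  exact map_zsmul ((hφ k l r).mk' _) _ f

end AInfCategory

namespace AInfFunctorData
variable {K : Type w} [CommRing K] {C : AInfCategory.{w, v₁, u₁} K} {D : AInfCategory.{w, v₂, u₂} K}

/-- Strict unitality of the data of an A∞-functor, together with the absence of `F^0`. -/
structure IsUnital (F : AInfFunctorData C.toAInfData D.toAInfData) : Prop where
  mapT_nil (x : C.Obj) : F.mapT (nil : Word C.Hom x x) = 0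
  map_one (x : C.Obj) : F.map (single (C.one x)) 0 (by simp) = D.one (F.obj x)
  mapT_one {x y z : C.Obj} (s : Word C.Hom y z) (t : Word C.Hom x y)
    (h : 1 < (s.append (cons (C.one y) t)).length) : F.mapT (s.append (cons (C.one y) t)) = 0

variable {F : AInfFunctorData C.toAInfData D.toAInfData}

lemma cons_map_congr (F : AInfFunctorData C.toAInfData D.toAInfData) {x y : C.Obj}
    (t : Word C.Hom x y) (e : ℤ)
    (h : t.rdeg + 1 = e) {z : D.Obj} (q : Word D.Hom z (F.obj x)) :
    cons (F.map t _ rfl) q = cons (F.map t e h) q := by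
  subst h; rfl

lemma map_eq_zero_iff {x y : C.Obj} (t : Word C.Hom x y) (e : ℤ) (h : t.rdeg + 1 = e) :
    F.map t e h = 0 ↔ F.mapT t = 0 := by
  rw [← F.lof_map t e h]
  constructor
  · intro h
    rw [h, map_zero]
  · intro h
    apply AInfCategory.lof_inj
    rw [h, map_zero]

lemma length_pos_of_mem_expand' (F : AInfFunctorData C.toAInfData D.toAInfData) {x y : C.Obj}
    (t : Word C.Hom x y) (h : 0 < t.length) : ∀ q ∈ F.expand t, 0 < q.length := by
  have aux : ∀ {y z : C.Obj} (b : Word C.Hom y z) (t : Word C.Hom x y),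
      ∀ q ∈ F.expandAux b t, 0 < q.length := by
    intro y z b t
    induction t generalizing z with
    | nil => simp [AInfFunctorData.expandAux]
    | cons a t ih =>
      intro q hq
      simp only [AInfFunctorData.expandAux, List.mem_append, List.mem_map] at hq
      rcases hq with ⟨q, hq, rfl⟩ | hq
      · simp
      · exact ih _ q hq
  cases t with
  | nil => simp at h
  | cons a t => exact aux _ _

lemma IsUnital.lsum_expand_one (hF : F.IsUnital) {x y z : C.Obj} {M : Type v} [AddCommGroup M]
    [Module K M] (s : Word C.Hom y z) (t : Word C.Hom x y)
    {φ : Word D.Hom (F.obj x) (F.obj z) → M} (hφ : IsMultilinear K φ) :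
    lsum (F.expand (s.append (cons (C.one y) t))) φ =
      lsum (F.expand s) fun q => lsum (F.expand t) fun q' =>
        φ (q.append (cons (D.one (F.obj y)) q')) := by
  have h0 : ∀ {p r : C.Obj} (s' : Word C.Hom y r) (t' : Word C.Hom p y)
      (q : Word D.Hom (F.obj r) (F.obj z)) (q' : Word D.Hom (F.obj x) (F.obj p)),
      1 < (s'.append (cons (C.one y) t')).length →
      φ (q.append (cons (F.map (s'.append (cons (C.one y) t')) _ rfl) q')) = 0 := by
    intro p r s' t' q q' h
    rw [(map_eq_zero_iff _ _ rfl).2 (hF.mapT_one s' t' h)]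
    exact IsMultilinear.zero hφ _ _ _
  rw [lsum_expand_append, lsum_splits_of_right s, lsum_splits_of_left t]
  · refine lsum_congr fun q _ => lsum_congr fun q' _ => ?_
    have h1 : cons (F.map ((nil : Word C.Hom y y).append (cons (C.one y) nil)) _ rfl) q' =
        cons (D.one (F.obj y)) q' := by
      rw [← hF.map_one y]
      exact F.cons_map_congr (single (C.one y)) 0 (by simp) q'
    exact congrArg (fun r => φ (q.append r)) h1
  · intro j _ hj
    exact lsum_eq_zero fun q _ => lsum_eq_zero fun q' _ => h0 _ _ _ _ (by simpa using hj)
  · intro i _ hi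
    refine lsum_eq_zero fun j _ => lsum_eq_zero fun q _ => lsum_eq_zero fun q' _ => ?_
    refine h0 _ _ _ _ ?_
    rw [length_append, length_cons]
    omega

/-- The functor equation is automatic for words that contain a unit. -/
lemma IsUnital.curv_one (hF : F.IsUnital) (hM : F.IsMulti) {x y z : C.Obj} (s : Word C.Hom y z)
    (t : Word C.Hom x y) : F.curv (s.append (cons (C.one y) t)) = 0 := by
  have hm : IsMultilinear K (D.mT (x := F.obj x) (y := F.obj z)) := D.m_multilinear
  have hφ : IsMultilinear K (F.mapT (x := x) (y := z)) := hM x z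
  have hR : insertSum (fun s => C.m s _ rfl) F.mapT (s.append (cons (C.one y) t)) =
      lsum s.splits fun i => lsum t.splits fun j => j.2.2.rdeg.negOnePow •
        F.mapT (i.2.1.append (cons (C.m (i.2.2.append (cons (C.one y) j.2.1)) _ rfl) j.2.2)) := by
    rw [insertSum_append]
    refine Eq.trans (congrArg₂ (· + ·) (congrArg₂ (· + ·) (lsum_eq_zero fun i _ => lsum_eq_zero
      fun j _ => ?_) rfl) (lsum_eq_zero fun i _ => lsum_eq_zero fun j _ => ?_))
      ((add_zero _).trans (zero_add _))
    · rw [hF.mapT_one _ _ (by simp; omega), smul_zero]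
    · have h := hF.mapT_one s (i.2.1.append (cons (C.m j.2.1 _ rfl) j.2.2)) (by simp; omega)
      rw [h, smul_zero]
  have hz : ∀ {p q : C.Obj} (l : Word C.Hom q z) (u : Word C.Hom y q) (u' : Word C.Hom p y)
      (r : Word C.Hom x p), u.length + u'.length ≠ 1 →
      F.mapT (l.append (cons (C.m (u.append (cons (C.one y) u')) _ rfl) r)) = 0 := by
    intro p q l u u' r h
    have h0 : C.m (u.append (cons (C.one y) u')) _ rfl = 0 := by
      by_cases h2 : 2 < (u.append (cons (C.one y) u')).length
      · exact C.m_one _ _ _ _ h2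
      · simp only [length_append, length_cons] at h2
        cases u with
        | cons => simp at h h2; omega
        | nil =>
          cases u' with
          | cons => simp at h h2; omega
          | nil => exact C.d_one y
    rw [h0]
    exact hφ.zero _ _ _
  unfold curv
  rw [hF.lsum_expand_one s t hm, hR]
  obtain ⟨rfl, rfl⟩ | ⟨p, k, s', a, rfl⟩ := eq_nil_or_append_single s
  · cases t with
    | nil =>
      simp only [splits_nil, lsum_cons, lsum_nil, add_zero, expand_nil]
      rw [hz nil nil nil nil (by simp)]
      simpa [single] using D.mT_single_one (F.obj x)
    | @cons p _ k b t =>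
      have hL : (lsum (F.expand (cons b t)) fun q' => D.mT (cons (D.one (F.obj y)) q')) =
          (t.rdeg + k).negOnePow • F.mapT (cons b t) := by
        rw [lsum_expand_cons, lsum_splits_of_right, expand_nil, lsum_cons, lsum_nil, add_zero]
        · refine (D.mT_one_left (F.map (cons b t) _ rfl)).trans ?_
          have h : (cons b t).rdeg + 1 = t.rdeg + k := by simp; ring
          exact congrArg (fun e : ℤ => e.negOnePow • F.mapT (cons b t)) h
        · intro i _ hi
          refine lsum_eq_zero fun q hq => ?_
          have := length_pos_of_mem_expand' F _ hi q hq
          refine D.mT_one nil _ ?_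
          simp only [nil_append, length_cons]
          omega
      simp only [splits_nil, lsum_cons, lsum_nil, add_zero, expand_nil, splits_cons, lsum_map,
        nil_append]
      have z1 := hz nil nil nil (cons b t) (by simp)
      simp only [nil_append] at z1
      rw [z1, smul_zero, zero_add, hL, lsum_splits_of_left]
      · have h1 := C.ext_m_one_left hφ b nil t
        simp only [nil_append, single] at h1
        rw [h1, smul_smul, ← Int.negOnePow_add, sub_self]
      · intro j _ hj
        have h1 := hz nil nil (cons b j.2.1) j.2.2 (by simp; omega)
        simp only [nil_append] at h1
        rw [h1, smul_zero]
  · have hA : ∀ j ∈ t.splits, lsum (s'.append (single a)).splits (fun i =>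
        F.mapT (i.2.1.append (cons (C.m (i.2.2.append (cons (C.one y) j.2.1)) _ rfl) j.2.2))) =
        F.mapT (s'.append (cons (C.m (cons a (cons (C.one y) j.2.1)) _ rfl) j.2.2)) +
        F.mapT ((s'.append (single a)).append (cons (C.m (cons (C.one y) j.2.1) _ rfl) j.2.2)) := by
      intro j _
      rw [single, lsum_splits_append]
      congr 1
      · rw [lsum_splits_of_right]
        · rfl
        · intro i _ hi
          refine hz i.2.1 (i.2.2.append (cons a nil)) j.2.1 j.2.2 ?_
          simp
          omega
      · simp
    rw [lsum_comm (s'.append (single a)).splits]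
    have hA' : ∀ j ∈ t.splits, lsum (s'.append (single a)).splits (fun i =>
        j.2.2.rdeg.negOnePow • F.mapT
          (i.2.1.append (cons (C.m (i.2.2.append (cons (C.one y) j.2.1)) _ rfl) j.2.2))) =
        j.2.2.rdeg.negOnePow •
          F.mapT (s'.append (cons (C.m (cons a (cons (C.one y) j.2.1)) _ rfl) j.2.2)) +
        j.2.2.rdeg.negOnePow • F.mapT
          ((s'.append (single a)).append (cons (C.m (cons (C.one y) j.2.1) _ rfl) j.2.2)) := by
      intro j hj
      rw [← smul_lsum, ← smul_add, hA j hj]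
    rw [lsum_congr hA', lsum_add]
    rw [lsum_splits_of_left t]
    · have hR1 : cons (C.m (cons a (cons (C.one y) nil)) _ rfl) t = cons a t :=
        C.cons_m_one_right a t
      rw [hR1]
      cases t with
      | nil =>
        simp only [splits_nil, lsum_cons, lsum_nil, add_zero, expand_nil, rdeg_nil,
          Int.negOnePow_zero, one_smul]
        have z1 := hz (s'.append (single a)) nil nil nil (by simp)
        simp only [nil_append] at z1
        rw [z1, add_zero]
        obtain ⟨z', k', b, u, hbu⟩ : ∃ (z' : C.Obj) (k' : ℤ) (b : C.Hom z' z k')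
            (u : Word C.Hom _ z'), s'.append (single a) = cons b u := by
          cases s' with
          | nil => exact ⟨_, _, a, nil, rfl⟩
          | cons b u => exact ⟨_, _, b, u.append (single a), rfl⟩
        have h2 : s'.append (cons a nil) = cons b u := hbu
        rw [h2, hbu, lsum_expand_cons, lsum_splits_of_right, expand_nil, lsum_cons, lsum_nil,
          add_zero, sub_eq_zero]
        · exact D.mT_one_right (F.map (cons b u) _ rfl)
        · intro i _ hi
          refine lsum_eq_zero fun q hq => ?_
          have := length_pos_of_mem_expand' F _ hi q hq
          refine D.mT_one (cons _ q) nil ?_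
          simp only [length_append, length_cons]
          omega
      | @cons p _ e b t =>
        have hL : (lsum (F.expand (s'.append (single a))) fun q => lsum (F.expand (cons b t))
            fun q' => D.mT (q.append (cons (D.one (F.obj y)) q'))) = 0 := by
          refine lsum_eq_zero fun q hq => lsum_eq_zero fun q' hq' => ?_
          have := length_pos_of_mem_expand' F _ (by simp) q hq
          have := length_pos_of_mem_expand' F _ (by simp) q' hq'
          refine D.mT_one q q' ?_
          simp only [length_append, length_cons]
          omega
        rw [hL, splits_cons, lsum_cons, lsum_map]
        have z1 := hz (s'.append (single a)) nil nil (cons b t) (by simp)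
        simp only [nil_append] at z1
        rw [z1, smul_zero, zero_add, lsum_splits_of_left]
        · have h1 := C.ext_m_one_left hφ b (s'.append (single a)) t
          have h2 : s'.append (cons a (cons b t)) = (s'.append (single a)).append (cons b t) := by
            rw [append_assoc]; rfl
          simp only [single] at h1 h2
          simp only [single]
          rw [h1, h2, smul_smul, ← Int.negOnePow_add, rdeg_cons,
            show t.rdeg + (e - 1) = t.rdeg + e - 1 by ring, Int.negOnePow_sub, Int.negOnePow_one]
          simp
        · intro j _ hj
          have h1 := hz (s'.append (single a)) nil (cons b j.2.1) j.2.2 (by simp; omega)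
          simp only [nil_append] at h1
          rw [h1, smul_zero]
    · intro j _ hj
      have h1 := hz s' (cons a nil) j.2.1 j.2.2 (by simp; omega)
      simp only [nil_append, cons_append] at h1
      rw [h1, smul_zero]

end AInfFunctorData
end AInf

/-! ### Words of generators of `[n]_K` -/

namespace AInf

open Word DirectSum

section chains
variable (K : Type w) [CommRing K] {n : ℕ}

/-- The generator `j_{ik}` of `Hom (i, k)` in `[n]_K`; it is zero unless `i ≤ k`. -/
def gen (i k : Fin (n + 1)) : minimalHom K n i k 0 :=
  if h : i ≤ k then ⟨1, mem_minimalHom.2 fun _ => ⟨h, rfl⟩⟩ else 0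

/-- The source of the word of generators through the vertices `k :: l`, listed from the target to
the source. -/
@[reducible] def src : Fin (n + 1) → List (Fin (n + 1)) → Fin (n + 1)
  | k, [] => k
  | _, j :: l => src j l

/-- The word of generators of `[n]_K` through the vertices `k :: l`, listed from the target `k` to
the source. -/
def chainWord : (k : Fin (n + 1)) → (l : List (Fin (n + 1))) →
    Word (minimalData K n).Hom (src k l) k
  | _, [] => nil
  | k, j :: l => cons (gen K j k) (chainWord j l)

variable {K}

lemma gen_self (i : Fin (n + 1)) : gen K i i = (minimalCategory K n).one i := by
  simp [gen]

lemma gen_of_le {i k : Fin (n + 1)} (h : i ≤ k) : (gen K i k).1 = 1 := by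
  simp [gen, h]

/-- The vertices of a word in `[n]_K` other than its target, listed from the target to the
source. -/
def verts {i : Fin (n + 1)} : {k : Fin (n + 1)} → Word (minimalData K n).Hom i k →
    List (Fin (n + 1))
  | _, nil => []
  | _, cons (y := y) _ t => y :: verts t

@[simp] lemma verts_nil (i : Fin (n + 1)) :
    verts (nil : Word (minimalData K n).Hom i i) = [] := rfl
@[simp] lemma verts_cons {i j k : Fin (n + 1)} {e : ℤ} (a : (minimalData K n).Hom j k e)
    (t : Word (minimalData K n).Hom i j) : verts (cons a t) = j :: verts t := rfl

lemma src_verts {i k : Fin (n + 1)} (w : Word (minimalData K n).Hom i k) :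
    src k (verts w) = i := by
  induction w with
  | nil => rfl
  | cons a t ih => exact ih

lemma length_verts {i k : Fin (n + 1)} (w : Word (minimalData K n).Hom i k) :
    (verts w).length = w.length := by
  induction w with
  | nil => rfl
  | cons a t ih => exact congrArg (· + 1) ih

lemma verts_append {i j k : Fin (n + 1)} (s : Word (minimalData K n).Hom j k)
    (t : Word (minimalData K n).Hom i j) : verts (s.append t) = verts s ++ verts t := by
  induction s with
  | nil => rfl
  | cons a s ih => exact congrArg (List.cons _) ih

@[simp] lemma verts_chainWord (k : Fin (n + 1)) (l : List (Fin (n + 1))) :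
    verts (chainWord K k l) = l := by
  induction l generalizing k with
  | nil => rfl
  | cons j l ih => exact congrArg (List.cons _) (ih j)

@[simp] lemma length_chainWord (k : Fin (n + 1)) (l : List (Fin (n + 1))) :
    (chainWord K k l).length = l.length := by
  rw [← length_verts, verts_chainWord]

@[simp] lemma rdeg_chainWord (k : Fin (n + 1)) (l : List (Fin (n + 1))) :
    (chainWord K k l).rdeg = - l.length := by
  induction l generalizing k with
  | nil => rfl
  | cons j l ih =>
    refine (congrArg (· + ((0 : ℤ) - 1)) (ih j)).trans ?_
    push_cast [List.length_cons]
    ring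

lemma coef_chainWord {k : Fin (n + 1)} {l : List (Fin (n + 1))}
    (h : (k :: l).IsChain (· ≥ ·)) : coef (chainWord K k l) = 1 := by
  induction l generalizing k with
  | nil => rfl
  | cons j l ih =>
    rw [List.isChain_cons_cons] at h
    refine (congrArg₂ (· * ·) (gen_of_le h.1) (ih h.2)).trans (mul_one _)

/-- The word of generators with the same vertices as a given word. -/
def toGen {i : Fin (n + 1)} : {k : Fin (n + 1)} → Word (minimalData K n).Hom i k →
    Word (minimalData K n).Hom i k
  | _, nil => nil
  | _, cons (y := y) (z := z) _ t => cons (gen K y z) (toGen t)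

lemma toGen_eq {i k : Fin (n + 1)} (w : Word (minimalData K n).Hom i k) :
    toGen w = src_verts w ▸ chainWord K k (verts w) := by
  have h : ∀ (j k : Fin (n + 1)) (l : List (Fin (n + 1))) (i : Fin (n + 1)) (h : src j l = i),
      (h ▸ cons (gen K j k) (chainWord K j l) : Word (minimalData K n).Hom i k) =
        cons (gen K j k) (h ▸ chainWord K j l) := by
    rintro j k l _ rfl
    rfl
  induction w with
  | nil => rfl
  | @cons j k e a t ih =>
    rw [toGen, ih]
    exact (h j k (verts t) i (src_verts t)).symm

variable {M : Type v} [AddCommGroup M] [Module K M]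

lemma isMultilinear_eq_toGen {i k : Fin (n + 1)} {φ : Word (minimalData K n).Hom i k → M}
    (hφ : IsMultilinear K φ) (w : Word (minimalData K n).Hom i k) :
    φ w = coef w • φ (toGen w) := by
  induction w with
  | nil => simp [coef, toGen]
  | @cons j k e a t ih =>
    refine (ih (φ := fun t => φ (cons a t)) (hφ.cons a)).trans ?_
    rw [coef, toGen]
    by_cases ha : a.1 = 0
    · have h0 : a = 0 := Subtype.ext ha
      subst h0
      have h1 : φ (cons (0 : (minimalData K n).Hom j k e) (toGen t)) = 0 :=
        hφ.zero nil (toGen t) e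
      rw [h1]
      simp
    · obtain ⟨hjk, rfl⟩ := mem_minimalHom.1 a.2 ha
      have h1 : a = a.1 • gen K j k := by
        ext
        simp [gen_of_le hjk]
      have h2 := (hφ 0 nil (toGen t)).map_smul a.1 (gen K j k)
      simp only [nil_append] at h2
      rw [mul_comm, mul_smul, ← h2, ← h1]

/-- A multilinear function on words in `[n]_K` vanishes if it does on the words of generators
through decreasing lists of vertices. -/
lemma eq_zero_of_chainWord {i k : Fin (n + 1)} {φ : Word (minimalData K n).Hom i k → M}
    (hφ : IsMultilinear K φ)
    (h : ∀ (l : List (Fin (n + 1))) (hl : src k l = i), (k :: l).IsChain (· ≥ ·) →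
      φ (hl ▸ chainWord K k l) = 0) (w : Word (minimalData K n).Hom i k) : φ w = 0 := by
  rw [isMultilinear_eq_toGen hφ, toGen_eq]
  by_cases hc : (k :: verts w).IsChain (· ≥ ·)
  · rw [h _ _ hc, smul_zero]
  · suffices coef w = 0 by rw [this, zero_smul]
    clear h hφ φ
    induction w with
    | nil => exact absurd (List.isChain_singleton _) hc
    | @cons j k e a t ih =>
      rw [coef]
      by_cases ha : a.1 = 0
      · rw [ha, zero_mul]
      · rw [ih, mul_zero]
        intro h
        exact hc (List.isChain_cons_cons.2 ⟨(mem_minimalHom.1 a.2 ha).1, h⟩)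

lemma isChain_gt_or_exists_one {k : Fin (n + 1)} {l : List (Fin (n + 1))}
    (h : (k :: l).IsChain (· ≥ ·)) : (k :: l).IsChain (· > ·) ∨
      ∃ (y : Fin (n + 1)) (s : Word (minimalData K n).Hom y k)
        (t : Word (minimalData K n).Hom (src k l) y),
        chainWord K k l = s.append (cons ((minimalCategory K n).one y) t) := by
  induction l generalizing k with
  | nil => left; simp
  | cons j l ih =>
    rw [List.isChain_cons_cons] at h
    obtain h1 | ⟨y, s, t, hst⟩ := ih h.2
    · obtain h2 | h2 := h.1.lt_or_eq
      · exact Or.inl (List.isChain_cons_cons.2 ⟨h2, h1⟩)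
      · right
        subst h2
        exact ⟨j, nil, chainWord K j l, by rw [← gen_self]; rfl⟩
    · exact Or.inr ⟨y, cons (gen K j k) s, t, by rw [chainWord, hst]; rfl⟩

/-- The alternating sum `∑ ± g (l')`, over the lists `l'` obtained from `l` by deleting an entry
other than the last one; the sign is determined by the number of entries to the right of the
deleted one and the next one. -/
def interiorSum (g : List (Fin (n + 1)) → M) (l : List (Fin (n + 1))) : M :=
  ∑ p ∈ Finset.range (l.length - 1), (-1 : ℤˣ) ^ (l.length - 2 - p) • g (l.eraseIdx p)

lemma interiorSum_cons_cons (g : List (Fin (n + 1)) → M) (a b : Fin (n + 1))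
    (l : List (Fin (n + 1))) :
    interiorSum g (a :: b :: l) =
      (-1 : ℤˣ) ^ l.length • g (b :: l) + interiorSum (fun s => g (a :: s)) (b :: l) := by
  simp only [interiorSum, List.length_cons, Nat.add_sub_cancel]
  rw [Finset.sum_range_succ', add_comm]
  congr 1
  refine Finset.sum_congr rfl fun p hp => ?_
  rw [List.eraseIdx_cons_succ]
  congr 2
  omega

lemma negOnePow_neg_natCast (n : ℕ) : (-(n : ℤ)).negOnePow = (-1 : ℤˣ) ^ n := by
  rw [Int.negOnePow_neg]
  exact zpow_natCast _ _

lemma insertSum_cons_cons {i j j' k : Fin (n + 1)} {e e' : ℤ}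
    {φ : Word (minimalData K n).Hom i k → M} (hφ : IsMultilinear K φ)
    (a : (minimalData K n).Hom j k e) (b : (minimalData K n).Hom j' j e')
    (t : Word (minimalData K n).Hom i j') :
    insertSum (fun s => (minimalData K n).m s _ rfl) φ (cons a (cons b t)) =
      t.rdeg.negOnePow • φ (cons ((minimalData K n).m (cons a (single b)) _ rfl) t) +
      insertSum (fun s => (minimalData K n).m s _ rfl) (fun s => φ (cons a s)) (cons b t) := by
  have h0 : ∀ {p : Fin (n + 1)} (s : Word (minimalData K n).Hom p k)
      (r : Word (minimalData K n).Hom i p), s.length ≠ 2 →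
      φ (cons ((minimalData K n).m s _ rfl) r) = 0 := by
    intro p s r hs
    have : (minimalData K n).m s _ rfl = 0 := by
      ext
      exact if_neg hs
    rw [this]
    exact hφ.zero nil r _
  unfold insertSum
  rw [splits_cons, lsum_cons, lsum_map]
  congr 1
  simp only [splits_cons, lsum_cons, lsum_map, nil_append]
  rw [h0 _ _ (by simp), h0 _ _ (by simp), smul_zero, smul_zero, zero_add, zero_add]
  rw [lsum_splits_of_left]
  · rfl
  · intro i _ hi
    rw [h0 _ _ (by simp; omega), smul_zero]

lemma insertSum_cons_nil {i k : Fin (n + 1)} {e : ℤ}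
    {φ : Word (minimalData K n).Hom i k → M} (hφ : IsMultilinear K φ)
    (a : (minimalData K n).Hom i k e) :
    insertSum (fun s => (minimalData K n).m s _ rfl) φ (cons a nil) = 0 := by
  refine lsum_eq_zero fun i hi => lsum_eq_zero fun j hj => ?_
  have : (minimalData K n).m j.2.1 _ rfl = 0 := by
    ext
    refine if_neg ?_
    have h1 := length_of_mem_splits hi
    have h2 := length_of_mem_splits hj
    simp at h1
    omega
  beta_reduce
  rw [this, hφ.zero, smul_zero]

lemma insertSum_nil {i : Fin (n + 1)}
    {φ : Word (minimalData K n).Hom i i → M} (hφ : IsMultilinear K φ) :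
    insertSum (fun s => (minimalData K n).m s _ rfl) φ nil = 0 := by
  refine lsum_eq_zero fun i hi => lsum_eq_zero fun j hj => ?_
  have : (minimalData K n).m j.2.1 _ rfl = 0 := by
    ext
    refine if_neg ?_
    have h1 := length_of_mem_splits hi
    have h2 := length_of_mem_splits hj
    simp at h1
    omega
  beta_reduce
  rw [this, hφ.zero, smul_zero]

lemma cons_m_gen {i j j' k : Fin (n + 1)} (h : j ≤ k) (h' : j' ≤ j)
    (t : Word (minimalData K n).Hom i j') :
    cons ((minimalData K n).m (cons (gen K j k) (single (gen K j' j))) _ rfl) t =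
      cons (gen K j' k) t := by
  rw [(minimalCategory K n).m_congr _ 0 (by simp)]
  congr 1
  ext
  simp [coef, single, gen_of_le h, gen_of_le h', gen_of_le (h'.trans h)]

/-- Inserting the operations of `[n]_K` into a word of generators amounts to deleting its interior
vertices. -/
lemma insertSum_chainWord {i k : Fin (n + 1)} {φ : Word (minimalData K n).Hom i k → M}
    (hφ : IsMultilinear K φ) {g : List (Fin (n + 1)) → M}
    (hg : ∀ (l : List (Fin (n + 1))) (hl : src k l = i), (k :: l).IsChain (· ≥ ·) →
      φ (hl ▸ chainWord K k l) = g l)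
    (l : List (Fin (n + 1))) (hl : src k l = i) (hc : (k :: l).IsChain (· ≥ ·)) :
    insertSum (fun s => (minimalData K n).m s _ rfl) φ (hl ▸ chainWord K k l) =
      interiorSum g l := by
  subst hl
  induction l generalizing k g with
  | nil => exact insertSum_nil hφ
  | cons j l ih =>
    cases l with
    | nil => exact insertSum_cons_nil hφ _
    | cons j' l =>
      rw [List.isChain_cons_cons, List.isChain_cons_cons] at hc
      refine (insertSum_cons_cons hφ _ _ _).trans ?_
      rw [interiorSum_cons_cons]
      congr 1
      · refine congrArg₂ _ ((congrArg Int.negOnePow (rdeg_chainWord _ _)).trans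
          (negOnePow_neg_natCast _)) ?_
        rw [cons_m_gen hc.1 hc.2.1]
        exact hg (j' :: l) rfl (List.isChain_cons_cons.2 ⟨hc.2.1.trans hc.1, hc.2.2⟩)
      · refine ih (List.isChain_cons_cons.2 hc.2) (φ := fun t => φ (cons (gen K j k) t))
          (hφ.cons _) ?_
        intro s hs hcs
        have h := hg (j :: s) hs (List.isChain_cons_cons.2 ⟨hc.1, hcs⟩)
        rw [← h]
        clear h ih
        have : ∀ (p : Fin (n + 1)) (hs : src j s = p)
            (φ : Word (minimalData K n).Hom p k → M),
            φ (cons (gen K j k) (hs ▸ chainWord K j s)) =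
            φ (hs ▸ chainWord K k (j :: s) : Word (minimalData K n).Hom p k) := by
          rintro p rfl φ
          rfl
        exact this _ hs φ

end chains
end AInf

/-! ### Restriction along monotone maps -/

namespace AInf

open Word DirectSum

namespace AInfFunctorData

section curvature
variable {K : Type w} [CommRing K] {C : AInfCategory.{w, v₁, u₁} K} {D : AInfCategory.{w, v₂, u₂} K}
  {E : AInfCategory.{w, v₃, u₃} K}

lemma curv_comp (G : AInfFunctor C D) {F : AInfFunctorData D.toAInfData E.toAInfData}
    (hF : F.IsMulti) {x y : C.Obj} (t : Word C.Hom x y) :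
    curv (G.toAInfFunctorData.comp F) t = lsum (G.expand t) F.curv := by
  have h1 : lsum ((G.toAInfFunctorData.comp F).expand t) E.mT =
      lsum (G.expand t) fun q => lsum (F.expand q) E.mT :=
    lsum_expand_comp t E.m_multilinear
  have h2 : insertSum (fun s => C.m s _ rfl) (G.toAInfFunctorData.comp F).mapT t =
      lsum (G.expand t) (insertSum (fun s => D.m s _ rfl) F.mapT) := by
    have h3 : (G.toAInfFunctorData.comp F).mapT (x := x) (y := y) =
        fun s => lsum (G.expand s) F.mapT := funext fun s => comp_mapT _ _ s
    rw [h3]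
    refine (insertSum_lsum_expand (F := G.toAInfFunctorData) (hF _ _) t).trans ?_
    refine Eq.trans ?_ (lsum_expand_insertSum (F := G.toAInfFunctorData) (hF _ _) t).symm
    refine lsum_congr fun i _ => lsum_congr fun j _ => ?_
    simp only [G.relation]
  exact (congrArg₂ (· - ·) h1 h2).trans (lsum_sub _ _ _).symm

lemma expandAux_congr {obj : C.Obj → D.Obj}
    {f g : {x y : C.Obj} → (t : Word C.Hom x y) → (e : ℤ) → t.rdeg + 1 = e →
      D.Hom (obj x) (obj y) e} {x y z : C.Obj} (b : Word C.Hom y z) (t : Word C.Hom x y)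
    (h : ∀ (p q : C.Obj) (l : Word C.Hom q z) (w : Word C.Hom p q) (r : Word C.Hom x p),
      l.append (w.append r) = b.append t → f w _ rfl = g w _ rfl) :
    (AInfFunctorData.mk (C := C.toAInfData) (D := D.toAInfData) obj f).expandAux b t =
      (AInfFunctorData.mk (C := C.toAInfData) (D := D.toAInfData) obj g).expandAux b t := by
  induction t generalizing z with
  | nil =>
    have := h _ _ nil b nil (by simp)
    simp only [expandAux, this]
  | cons a t ih =>
    have h1 := h _ _ nil b (cons a t) rfl
    simp only [expandAux, h1]
    congr 1
    · congr 1
      exact ih _ fun p q l w r hl => h p q (b.append l) w r (by rw [append_assoc, hl]; rfl)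
    · exact ih _ fun p q l w r hl => h p q l w r (by rw [hl, append_assoc]; rfl)

lemma expand_congr {obj : C.Obj → D.Obj}
    {f g : {x y : C.Obj} → (t : Word C.Hom x y) → (e : ℤ) → t.rdeg + 1 = e →
      D.Hom (obj x) (obj y) e} {x y : C.Obj} (t : Word C.Hom x y)
    (h : ∀ (p q : C.Obj) (l : Word C.Hom q y) (w : Word C.Hom p q) (r : Word C.Hom x p),
      l.append (w.append r) = t → f w _ rfl = g w _ rfl) :
    (AInfFunctorData.mk (C := C.toAInfData) (D := D.toAInfData) obj f).expand t =
      (AInfFunctorData.mk (C := C.toAInfData) (D := D.toAInfData) obj g).expand t := by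
  cases t with
  | nil => rfl
  | cons a t => exact expandAux_congr _ _ h

end curvature

end AInfFunctorData

section simplices
variable {K : Type w} [CommRing K] {C : AInfCategory.{w, v, u} K} {m n : ℕ}

open AInfFunctorData

lemma isChain_map_ge (α : Fin (m + 1) →o Fin (n + 1)) {l : List (Fin (m + 1))}
    (h : l.IsChain (· ≥ ·)) : (l.map α).IsChain (· ≥ ·) := by
  rw [List.isChain_map]
  exact h.imp fun a b hab => α.monotone hab

lemma mapLetters_chainWord (α : Fin (m + 1) →o Fin (n + 1)) {k : Fin (m + 1)}
    {l : List (Fin (m + 1))} (h : (k :: l).IsChain (· ≥ ·)) :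
    (⟨α (src k l), mapLetters (minimalFunctorData K α) (chainWord K k l)⟩ :
      Σ i, Word (minimalData K n).Hom i (α k)) =
      ⟨src (α k) (l.map α), chainWord K (α k) (l.map α)⟩ := by
  have aux : ∀ {i j k : Fin (n + 1)} {e e' : ℤ} (a : minimalHom K n j k e)
      (b : minimalHom K n j k e') (_ : e = e') (_ : a.1 = b.1) (t : Word (minimalData K n).Hom i j),
      (cons a t : Word (minimalData K n).Hom i k) = cons b t := by
    rintro i j k e _ a b rfl hab t
    congr 1
    exact Subtype.ext hab
  induction l generalizing k with
  | nil => rfl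
  | cons j l ih =>
    rw [List.isChain_cons_cons] at h
    refine Eq.trans ?_ (congrArg (fun t : Σ i, Word (minimalData K n).Hom i (α j) =>
      (⟨t.1, cons (gen K (α j) (α k)) t.2⟩ : Σ i, Word (minimalData K n).Hom i (α k))) (ih h.2))
    refine congrArg (Sigma.mk (β := fun i => Word (minimalData K n).Hom i (α k)) _) ?_
    refine aux _ _ (by simp) ?_ _
    simp [single, coef, gen_of_le h.1, gen_of_le (α.monotone h.1)]

variable (C) in
/-- Morphisms of `C`, not necessarily homogeneous, together with their source and target. -/
abbrev Mor : Type (max u v) := Σ x : C.Obj × C.Obj, C.Tot x.1 x.2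

/-- The value of a functor on a word with given target, with its source and target. -/
def morOf (F : AInfFunctorData (minimalData K n) C.toAInfData) {k : Fin (n + 1)}
    (t : Σ i, Word (minimalData K n).Hom i k) : Mor C :=
  ⟨(F.obj t.1, F.obj k), F.mapT t.2⟩

/-- The value of a functor on the word of generators through a list of vertices, listed from the
target to the source. The empty list, which has no target, has no value. -/
def ev (F : AInfFunctorData (minimalData K n) C.toAInfData) : List (Fin (n + 1)) → Option (Mor C)
  | [] => none
  | k :: l => some (morOf F ⟨src k l, chainWord K k l⟩)

lemma comp_minimal_mapT (α : Fin (m + 1) →o Fin (n + 1))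
    {F : AInfFunctorData (minimalData K n) C.toAInfData} (hF : F.IsMulti) {i k : Fin (m + 1)}
    (t : Word (minimalData K m).Hom i k) :
    ((minimalFunctorData K α).comp F).mapT t = F.mapT (mapLetters (minimalFunctorData K α) t) :=
  (comp_mapT _ _ t).trans (lsum_expand_strict _ (minimal_strict α) t (hF _ _))

lemma ev_comp (α : Fin (m + 1) →o Fin (n + 1))
    {F : AInfFunctorData (minimalData K n) C.toAInfData} (hF : F.IsMulti)
    {l : List (Fin (m + 1))} (h : l.IsChain (· ≥ ·)) :
    ev ((minimalFunctorData K α).comp F) l = ev F (l.map α) := by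
  cases l with
  | nil => rfl
  | cons k l =>
    refine congrArg some (Eq.trans ?_ (congrArg (morOf F) (mapLetters_chainWord α h)))
    exact congrArg (Sigma.mk (β := fun x : C.Obj × C.Obj => C.Tot x.1 x.2) _)
      (comp_minimal_mapT α hF _)

lemma curv_comp_minimal (α : Fin (m + 1) →o Fin (n + 1))
    {F : AInfFunctorData (minimalData K n) C.toAInfData} (hF : F.IsMulti) {i k : Fin (m + 1)}
    (t : Word (minimalData K m).Hom i k) :
    curv (C := minimalCategory K m) ((minimalFunctorData K α).comp F) t =
      curv (C := minimalCategory K n) F (mapLetters (minimalFunctorData K α) t) :=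
  (curv_comp (minimalFunctor K α) hF t).trans
    (lsum_expand_strict _ (minimal_strict α) t (hF.curv (C := minimalCategory K n) _ _))

lemma AInfFunctor.isUnital {D : AInfCategory.{w, v₁, u₁} K} (F : AInfFunctor D C) :
    F.toAInfFunctorData.IsUnital where
  mapT_nil x := (map_eq_zero_iff (F := F.toAInfFunctorData) nil 1 rfl).1 (F.map_nil x)
  map_one := F.map_one
  mapT_one := F.mapT_eq_zero

lemma AInfFunctorData.IsUnital.mapT_eq {D : AInfCategory.{w, v₁, u₁} K} {obj : D.Obj → C.Obj}
    {f g : {x y : D.Obj} → (t : Word D.Hom x y) → (e : ℤ) → t.rdeg + 1 = e →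
      C.Hom (obj x) (obj y) e}
    (hf : (AInfFunctorData.mk (C := D.toAInfData) (D := C.toAInfData) obj f).IsUnital)
    (hg : (AInfFunctorData.mk (C := D.toAInfData) (D := C.toAInfData) obj g).IsUnital)
    {x y z : D.Obj} (s : Word D.Hom y z) (t : Word D.Hom x y) :
    (AInfFunctorData.mk (C := D.toAInfData) (D := C.toAInfData) obj f).mapT
      (s.append (cons (D.one y) t)) =
    (AInfFunctorData.mk (C := D.toAInfData) (D := C.toAInfData) obj g).mapT
      (s.append (cons (D.one y) t)) := by
  by_cases h : 1 < (s.append (cons (D.one y) t)).length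
  · rw [hf.mapT_one _ _ h, hg.mapT_one _ _ h]
  · cases s with
    | cons => simp at h
    | nil =>
      cases t with
      | cons => simp at h
      | nil =>
        have h1 := (hf.map_one x).trans (hg.map_one x).symm
        have h2 := congrArg (DirectSum.lof K ℤ (fun k => C.Hom (obj x) (obj x) k) 0) h1
        refine Eq.trans ?_ (h2.trans ?_)
        · exact (AInfFunctorData.lof_map
            (AInfFunctorData.mk (C := D.toAInfData) (D := C.toAInfData) obj f) _ _ _).symm
        · exact AInfFunctorData.lof_map
            (AInfFunctorData.mk (C := D.toAInfData) (D := C.toAInfData) obj g) _ _ _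

/-- A unital prefunctor on `[n]_K` is determined by its values on strictly decreasing lists of
vertices. -/
lemma ext_of_ev {F G : AInfFunctorData (minimalData K n) C.toAInfData} (hF : F.IsMulti)
    (hG : G.IsMulti) (uF : IsUnital (C := minimalCategory K n) F)
    (uG : IsUnital (C := minimalCategory K n) G)
    (h : ∀ l : List (Fin (n + 1)), l.IsChain (· > ·) → ev F l = ev G l) : F = G := by
  have hobj : F.obj = G.obj := by
    funext k
    have h1 := h [k] (List.isChain_singleton _)
    exact congrArg (fun x : Mor C => x.1.1) (Option.some.inj h1)
  obtain ⟨fo, fm⟩ := F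
  obtain ⟨go, gm⟩ := G
  obtain rfl : fo = go := hobj
  congr 1
  funext x y t e he
  apply DirectSum.of_injective (β := fun k => C.Hom (fo x) (fo y) k) e
  refine (AInfFunctorData.lof_map (AInfFunctorData.mk (C := minimalData K n) (D := C.toAInfData)
    fo fm) t e he).trans (Eq.trans ?_ (AInfFunctorData.lof_map (AInfFunctorData.mk
      (C := minimalData K n) (D := C.toAInfData) fo gm) t e he).symm)
  clear he e
  rw [← sub_eq_zero]
  refine eq_zero_of_chainWord (φ := fun t => AInfFunctorData.mapT (AInfFunctorData.mk
    (C := minimalData K n) (D := C.toAInfData) fo fm) t - AInfFunctorData.mapT (AInfFunctorData.mk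
      (C := minimalData K n) (D := C.toAInfData) fo gm) t) ?_ ?_ t
  · intro p q k s t
    exact (((hF _ _ k s t).mk' _) - ((hG _ _ k s t).mk' _)).isLinear
  · intro l hl hc
    cases hl
    rw [sub_eq_zero]
    obtain h1 | ⟨z, s, t, hst⟩ := isChain_gt_or_exists_one (K := K) hc
    · have h2 := Option.some.inj (h _ h1)
      exact eq_of_heq (Sigma.mk.inj h2).2
    · refine (congrArg (AInfFunctorData.mapT (AInfFunctorData.mk
        (C := minimalData K n) (D := C.toAInfData) fo fm)) hst).trans (Eq.trans ?_
        (congrArg (AInfFunctorData.mapT (AInfFunctorData.mk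
          (C := minimalData K n) (D := C.toAInfData) fo gm)) hst).symm)
      exact AInfFunctorData.IsUnital.mapT_eq (D := minimalCategory K n) uF uG s t

/-- The curvature of a unital prefunctor on `[n]_K` vanishes if it vanishes on the words of generators
through strictly decreasing lists of vertices: by multilinearity, these and the words that contain
a unit suffice. -/
lemma curv_eq_zero {F : AInfFunctorData (minimalData K n) C.toAInfData} (hF : F.IsMulti)
    (uF : IsUnital (C := minimalCategory K n) F) {k : Fin (n + 1)} {i : Fin (n + 1)}
    (h : ∀ l : List (Fin (n + 1)), src k l = i → (k :: l).IsChain (· > ·) →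
      curv (C := minimalCategory K n) F (chainWord K k l) = 0)
    (t : Word (minimalData K n).Hom i k) :
    curv (C := minimalCategory K n) F t = 0 := by
  refine eq_zero_of_chainWord (hF.curv (C := minimalCategory K n) _ _) ?_ t
  intro l hl hc
  cases hl
  obtain h1 | ⟨z, s, t, hst⟩ := isChain_gt_or_exists_one (K := K) hc
  · exact h l rfl h1
  · refine (congrArg (curv (C := minimalCategory K n) F) hst).trans ?_
    exact uF.curv_one hF s t

end simplices
end AInf

/-! ### Prefunctors with given values -/

namespace AInf

open Word DirectSum

section ofValues
variable {K : Type w} [CommRing K] {C : AInfCategory.{w, v, u} K} {m n : ℕ}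

open AInfFunctorData

variable (C) in
/-- The inclusion of the degree `e` part into the total module of morphisms. -/
abbrev hlof {x y : C.Obj} (e : ℤ) : C.Hom x y e →ₗ[K] C.Tot x y :=
  DirectSum.lof K ℤ (fun k => C.Hom x y k) e

/-- Extend values on the strictly decreasing lists of length at least `2` to values on all lists, in
the only way compatible with units. -/
noncomputable def normalize (X : Fin (n + 1) → C.Obj)
    (Ψ : (i k : Fin (n + 1)) → List (Fin (n + 1)) → C.Tot (X i) (X k)) (i k : Fin (n + 1))
    (l : List (Fin (n + 1))) : C.Tot (X i) (X k) :=
  if h : i = k then (if l = [k] then hlof C 0 (h ▸ C.one (X i)) else 0)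
    else if (k :: l).IsChain (· > ·) then Ψ i k l else 0

/-- The prefunctor on `[n]_K` with given values on the words of generators through strictly
decreasing lists of vertices. -/
noncomputable abbrev ofValues (X : Fin (n + 1) → C.Obj)
    (Ψ : (i k : Fin (n + 1)) → List (Fin (n + 1)) → C.Tot (X i) (X k)) :
    AInfFunctorData (minimalData K n) C.toAInfData where
  obj := X
  map {i k} t e _ := DirectSum.component K ℤ _ e (coef t • normalize X Ψ i k (verts t))

variable {X : Fin (n + 1) → C.Obj}
  {Ψ : (i k : Fin (n + 1)) → List (Fin (n + 1)) → C.Tot (X i) (X k)}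

/-- The value on a list of length `d` is homogeneous of degree `1 - d`. -/
def HasDegree (X : Fin (n + 1) → C.Obj)
    (Ψ : (i k : Fin (n + 1)) → List (Fin (n + 1)) → C.Tot (X i) (X k)) : Prop :=
  ∀ i k l, Ψ i k l ∈ LinearMap.range (hlof C (x := X i) (y := X k) (1 - l.length))

lemma lof_component {x y : C.Obj} {e : ℤ} {a : C.Tot x y} (h : a ∈ LinearMap.range (hlof C e)) :
    hlof C e (DirectSum.component K ℤ _ e a) = a := by
  obtain ⟨b, rfl⟩ := h
  rw [DirectSum.component.lof_self]

lemma normalize_mem (hΨ : HasDegree X Ψ) (i k : Fin (n + 1)) (l : List (Fin (n + 1))) :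
    normalize X Ψ i k l ∈ LinearMap.range (hlof C (x := X i) (y := X k) (1 - l.length)) := by
  unfold normalize
  split_ifs with h1 h2 h3
  · subst h2
    exact ⟨_, rfl⟩
  · exact zero_mem _
  · exact hΨ _ _ _
  · exact zero_mem _

lemma ofValues_mapT (hΨ : HasDegree X Ψ) {i k : Fin (n + 1)} (t : Word (minimalData K n).Hom i k) :
    (ofValues X Ψ).mapT t = coef t • normalize X Ψ i k (verts t) := by
  refine lof_component ?_
  by_cases h : coef t = 0
  · rw [h, zero_smul]
    exact zero_mem _
  · refine Submodule.smul_mem _ _ ?_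
    have h1 := normalize_mem hΨ i k (verts t)
    rw [length_verts] at h1
    rw [(coef_ne_zero t h).2, neg_add_eq_sub]
    exact h1

lemma ofValues_isMulti (hΨ : HasDegree X Ψ) : (ofValues X Ψ).IsMulti := by
  intro x y p q k s t
  have h : ∀ a : (minimalData K n).Hom p q k, (ofValues X Ψ).mapT (s.append (cons a t)) =
      (coef s * (a.1 * coef t)) • normalize X Ψ x y (verts s ++ p :: verts t) := by
    intro a
    rw [ofValues_mapT hΨ, coef_append, verts_append]
    rfl
  constructor
  · intro a b
    rw [h, h, h, ← add_smul]
    congr 1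
    simp; ring
  · intro c a
    rw [h, h, smul_smul]
    congr 1
    simp; ring

lemma not_isChain_of_one {x y z : Fin (n + 1)} (s : Word (minimalData K n).Hom y z)
    (t : Word (minimalData K n).Hom x y) :
    ¬ (z :: verts (s.append (cons ((minimalCategory K n).one y) t))).IsChain (· > ·) := by
  induction s with
  | nil => exact fun h => lt_irrefl _ (List.isChain_cons_cons.1 h).1
  | cons a s ih => exact fun h => ih (List.isChain_cons_cons.1 h).2

lemma ofValues_isUnital (hΨ : HasDegree X Ψ) : IsUnital (C := minimalCategory K n) (ofValues X Ψ) where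
  mapT_nil x := by
    rw [ofValues_mapT hΨ, normalize, dif_pos rfl]
    refine (congrArg (_ • ·) (if_neg ?_)).trans (smul_zero _)
    exact (List.cons_ne_nil _ _).symm
  map_one x := by
    apply AInfCategory.lof_inj
    refine (AInfFunctorData.lof_map (ofValues X Ψ) _ _ _).trans ((ofValues_mapT hΨ _).trans ?_)
    simp only [normalize]
    simp only [dif_pos]
    refine (congrArg₂ (· • ·) ?_ (if_pos rfl)).trans (one_smul K _)
    simp [single, coef]
  mapT_one {x y z} s t h := by
    refine (ofValues_mapT hΨ _).trans ?_
    rw [normalize]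
    split_ifs with h1 h2 h3
    · have h4 := congrArg List.length h2
      rw [length_verts] at h4
      rw [List.length_singleton] at h4
      exact absurd h4 h.ne'
    · rw [smul_zero]
    · exact absurd h3 (not_isChain_of_one s t)
    · rw [smul_zero]

lemma src_mem (k : Fin (n + 1)) (l : List (Fin (n + 1))) : src k l ∈ k :: l := by
  induction l generalizing k with
  | nil => simp
  | cons j l ih => exact List.mem_cons_of_mem _ (ih j)

lemma src_lt {k : Fin (n + 1)} {l : List (Fin (n + 1))} (h : (k :: l).IsChain (· > ·))
    (hl : l ≠ []) : src k l < k := by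
  cases l with
  | nil => exact absurd rfl hl
  | cons j l =>
    rw [List.isChain_iff_pairwise, List.pairwise_cons] at h
    exact h.1 _ (src_mem j l)

lemma isChain_ge {l : List (Fin (n + 1))} (h : l.IsChain (· > ·)) : l.IsChain (· ≥ ·) :=
  h.imp fun _ _ h => le_of_lt h

lemma ofValues_chainWord (hΨ : HasDegree X Ψ) {k : Fin (n + 1)} {l : List (Fin (n + 1))}
    (h : (k :: l).IsChain (· > ·)) (hl : l ≠ []) :
    (ofValues X Ψ).mapT (chainWord K k l) = Ψ (src k l) k l := by
  refine (ofValues_mapT hΨ _).trans ?_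
  rw [coef_chainWord (isChain_ge h), verts_chainWord, one_smul, normalize,
    dif_neg (src_lt h hl).ne, if_pos h]

end ofValues

section gluing
variable {T : Type u}

/-- Compatible faces take the same values on common lists of vertices. -/
lemma ev_eq_of_faces {n : ℕ} (J : Fin (n + 3) → Prop) (e : Fin (n + 3) → List (Fin (n + 2)) → T)
    (he : ∀ i j : Fin (n + 2), i ≤ j → J i.castSucc → J j.succ → ∀ l : List (Fin (n + 1)),
      l.IsChain (· ≥ ·) → e j.succ (l.map i.succAbove) = e i.castSucc (l.map j.succAbove))
    {j j' : Fin (n + 3)} (hj : J j) (hj' : J j') {l l' : List (Fin (n + 2))}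
    (hl : l.IsChain (· ≥ ·)) (h : l.map j.succAbove = l'.map j'.succAbove) :
    e j l = e j' l' := by
  have key : ∀ (i j : Fin (n + 2)) (l l' : List (Fin (n + 2))), i ≤ j → J i.castSucc → J j.succ →
      l.IsChain (· ≥ ·) → l.map i.castSucc.succAbove = l'.map j.succ.succAbove →
      e i.castSucc l = e j.succ l' := by
    intro i j l l' hij hi hj hl h
    have h1 : ∀ a ∈ l, a ∈ Set.range j.succAbove := by
      intro a ha
      rw [Fin.range_succAbove]
      rintro rfl
      have h2 : i.castSucc.succAbove a ∈ l'.map a.succ.succAbove :=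
        h ▸ List.mem_map_of_mem ha
      obtain ⟨b, _, hb⟩ := List.mem_map.1 h2
      have h3 : i.castSucc.succAbove a = a.succ :=
        Fin.succAbove_of_le_castSucc _ _ (by simpa using hij)
      rw [h3] at hb
      exact Fin.succAbove_ne _ _ hb
    obtain ⟨L, rfl⟩ : l ∈ Set.range (List.map j.succAbove) := by
      rw [Set.range_list_map]
      exact h1
    have h3 : l' = L.map i.succAbove := by
      apply List.map_injective_iff.2 (Fin.succAbove_right_injective (p := j.succ))
      rw [← h, List.map_map, List.map_map]
      refine List.map_congr_left fun a _ => ?_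
      exact congrArg (fun f => (SimplexCategory.Hom.toOrderHom f) a)
        (SimplexCategory.δ_comp_δ hij).symm
    subst h3
    refine (he i j hij hi hj L ?_).symm
    rw [List.isChain_map] at hl
    exact hl.imp fun a b hab => (Fin.strictMono_succAbove j).le_iff_le.1 hab
  obtain h1 | rfl | h1 := lt_trichotomy j j'
  · obtain ⟨i, rfl⟩ := Fin.exists_castSucc_eq.2 (Fin.ne_last_of_lt h1)
    obtain ⟨i', rfl⟩ := Fin.exists_succ_eq.2 (Fin.ne_zero_of_lt h1)
    exact key i i' l l' (by simpa [Fin.lt_def, Nat.lt_succ_iff] using h1) hj hj' hl h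
  · rw [List.map_injective_iff.2 (Fin.succAbove_right_injective) h]
  · obtain ⟨i, rfl⟩ := Fin.exists_castSucc_eq.2 (Fin.ne_last_of_lt h1)
    obtain ⟨i', rfl⟩ := Fin.exists_succ_eq.2 (Fin.ne_zero_of_lt h1)
    refine (key i i' l' l (by simpa [Fin.lt_def, Nat.lt_succ_iff] using h1) hj' hj ?_ h.symm).symm
    have h2 : (l.map i'.succ.succAbove).IsChain (· ≥ ·) := by
      rw [List.isChain_map]
      exact hl.imp fun a b hab => (Fin.strictMono_succAbove _).monotone hab
    rw [h, List.isChain_map] at h2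
    exact h2.imp fun a b hab => (Fin.strictMono_succAbove _).le_iff_le.1 hab

end gluing
end AInf

/-! ### Degrees, and lists of vertices -/

namespace AInf

open Word DirectSum

section
variable {K : Type w} [CommRing K]

namespace AInfFunctorData
variable {C : AInfCategory.{w, v₁, u₁} K} {D : AInfCategory.{w, v₂, u₂} K}

lemma curv_mem (F : AInfFunctorData C.toAInfData D.toAInfData) {x y : C.Obj} (t : Word C.Hom x y) :
    F.curv t ∈ LinearMap.range (hlof D (x := F.obj x) (y := F.obj y) (t.rdeg + 2)) := by
  have hs : ∀ {α : Type (max u₁ v₁)} (L : List α) (f : α → D.Tot (F.obj x) (F.obj y)),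
      (∀ a ∈ L, f a ∈ LinearMap.range (hlof D (x := F.obj x) (y := F.obj y) (t.rdeg + 2))) →
      lsum L f ∈ LinearMap.range (hlof D (x := F.obj x) (y := F.obj y) (t.rdeg + 2)) := by
    intro α L f h
    induction L with
    | nil => exact zero_mem _
    | cons a L ih =>
      rw [lsum_cons]
      exact add_mem (h _ (by simp)) (ih fun b hb => h b (by simp [hb]))
  have hs' : ∀ (L : List (Word D.Hom (F.obj x) (F.obj y))) (f : _ → D.Tot (F.obj x) (F.obj y)),
      (∀ a ∈ L, f a ∈ LinearMap.range (hlof D (x := F.obj x) (y := F.obj y) (t.rdeg + 2))) →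
      lsum L f ∈ LinearMap.range (hlof D (x := F.obj x) (y := F.obj y) (t.rdeg + 2)) := by
    intro L f h
    induction L with
    | nil => exact zero_mem _
    | cons a L ih =>
      rw [lsum_cons]
      exact add_mem (h _ (by simp)) (ih fun b hb => h b (by simp [hb]))
  refine sub_mem (hs' _ _ fun q hq => ?_) (hs _ _ fun i hi => hs _ _ fun j hj => ?_)
  · rw [← F.rdeg_of_mem_expand t q hq]
    exact ⟨_, rfl⟩
  · have h1 := rdeg_of_mem_splits hi
    have h2 := rdeg_of_mem_splits hj
    have h3 : F.mapT (i.2.1.append (cons (C.m j.2.1 _ rfl) j.2.2)) ∈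
        LinearMap.range (hlof D (x := F.obj x) (y := F.obj y) (t.rdeg + 2)) := by
      refine ⟨F.map _ (t.rdeg + 2) ?_, F.lof_map _ _ _⟩
      simp only [rdeg_append, rdeg_cons]
      omega
    rw [Units.smul_def]
    exact zsmul_mem h3 _

/-- A unital multilinear prefunctor without curvature is an A∞-functor. -/
def toFunctor (F : AInfFunctorData C.toAInfData D.toAInfData) (hF : F.IsMulti) (uF : F.IsUnital)
    (h : ∀ (x y : C.Obj) (t : Word C.Hom x y), F.curv t = 0) : AInfFunctor C D where
  toAInfFunctorData := F
  map_nil x := (map_eq_zero_iff (F := F) nil 1 rfl).2 (uF.mapT_nil x)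
  map_multilinear := hF _ _
  relation t := sub_eq_zero.1 (h _ _ t)
  map_one := uF.map_one
  map_one_of_length s t e he hl := (map_eq_zero_iff (F := F) _ e he).2 (uF.mapT_one s t hl)

end AInfFunctorData

open AInfFunctorData

lemma AInfFunctor.ext_data {C : AInfCategory.{w, v₁, u₁} K} {D : AInfCategory.{w, v₂, u₂} K}
    {F G : AInfFunctor C D} (h : F.toAInfFunctorData = G.toAInfFunctorData) : F = G := by
  cases F; cases G; cases h; rfl

variable {C : AInfCategory.{w, v, u} K} {m n : ℕ}

lemma AInfFunctor.curv_eq_zero {D : AInfCategory.{w, v₁, u₁} K} (F : AInfFunctor D C) {x y : D.Obj}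
    (t : Word D.Hom x y) : F.toAInfFunctorData.curv t = 0 := sub_eq_zero.2 (F.relation t)

lemma mapLetters_append {C : AInfData.{w, v₁, u₁} K} {D : AInfData.{w, v₂, u₂} K}
    (F : AInfFunctorData C D) {x y z : C.Obj} (s : Word C.Hom y z) (t : Word C.Hom x y) :
    mapLetters F (s.append t) = (mapLetters F s).append (mapLetters F t) := by
  induction s with
  | nil => rfl
  | cons a s ih => simp only [cons_append, mapLetters, ih]

lemma isMulti_comp_minimal (α : Fin (m + 1) →o Fin (n + 1))
    {F : AInfFunctorData (minimalData K n) C.toAInfData} (hF : F.IsMulti) :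
    ((minimalFunctorData K α).comp F).IsMulti := by
  intro x y p q k s t
  have h' := (minimalFunctor K α).isMulti.expand (hF (α x) (α y)) k s t
  refine cast (congrArg _ ?_) h'
  funext a
  exact (AInfFunctorData.comp_mapT _ _ _).symm

lemma isUnital_comp_minimal (α : Fin (m + 1) →o Fin (n + 1))
    {F : AInfFunctorData (minimalData K n) C.toAInfData} (hF : F.IsMulti)
    (uF : IsUnital (C := minimalCategory K n) F) :
    IsUnital (C := minimalCategory K m) ((minimalFunctorData K α).comp F) := by
  have h1 : ∀ {x y : Fin (m + 1)} (r : Word (minimalData K n).Hom (α x) (α y)),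
      cons ((minimalFunctorData K α).map (single ((minimalCategory K m).one y)) _ rfl) r =
        cons ((minimalCategory K n).one (α y)) r := by
    intro x y r
    refine (AInfFunctor.map_cons_congr (minimalFunctor K α) (single ((minimalCategory K m).one y))
      0 (by simp) r).trans ?_
    rw [(minimalFunctor K α).map_one y]
    rfl
  constructor
  · intro x
    exact (comp_minimal_mapT α hF _).trans (uF.mapT_nil (α x))
  · intro x
    apply AInfCategory.lof_inj
    refine (AInfFunctorData.lof_map ((minimalFunctorData K α).comp F) _ _ _).trans
      ((comp_minimal_mapT α hF _).trans ?_)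
    refine (congrArg F.mapT (h1 (x := x) nil)).trans ?_
    refine (AInfFunctorData.lof_map F (single ((minimalCategory K n).one (α x))) 0
      (by simp)).symm.trans ?_
    exact congrArg _ (uF.map_one (α x))
  · intro x y z s t h
    refine (comp_minimal_mapT α hF _).trans ?_
    have h2 : mapLetters (minimalFunctorData K α)
        (s.append (cons ((minimalCategory K m).one y) t)) =
        (mapLetters (minimalFunctorData K α) s).append (cons ((minimalCategory K n).one (α y))
          (mapLetters (minimalFunctorData K α) t)) := by
      rw [mapLetters_append]
      exact congrArg _ (h1 _)
    rw [h2]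
    refine uF.mapT_one _ _ ?_
    rw [← h2, length_mapLetters]
    exact h

end

section chains
variable {n : ℕ}

lemma isChain_src {k : Fin (n + 1)} {l l' : List (Fin (n + 1))}
    {R : Fin (n + 1) → Fin (n + 1) → Prop} (h : (k :: (l ++ l')).IsChain R) :
    (src k l :: l').IsChain R := by
  induction l generalizing k with
  | nil => exact h
  | cons j l ih => exact ih (List.isChain_cons_cons.1 h).2

lemma isChain_left {k : Fin (n + 1)} {l l' : List (Fin (n + 1))}
    {R : Fin (n + 1) → Fin (n + 1) → Prop} (h : (k :: (l ++ l')).IsChain R) :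
    (k :: l).IsChain R := by
  rw [← List.cons_append] at h
  exact h.left_of_append

lemma src_le {k : Fin (n + 1)} {l : List (Fin (n + 1))} (h : (k :: l).IsChain (· > ·)) :
    ∀ a ∈ k :: l, src k l ≤ a := by
  induction l generalizing k with
  | nil => simp [src]
  | cons j l ih =>
    rw [List.isChain_cons_cons] at h
    intro a ha
    have h1 := ih h.2
    obtain rfl | ha := List.mem_cons.1 ha
    · exact (h1 j (by simp)).trans (le_of_lt h.1)
    · exact h1 a ha

lemma le_of_isChain {k : Fin (n + 1)} {l : List (Fin (n + 1))} (h : (k :: l).IsChain (· > ·)) :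
    ∀ a ∈ k :: l, a ≤ k := by
  rw [List.isChain_iff_pairwise, List.pairwise_cons] at h
  intro a ha
  obtain rfl | ha := List.mem_cons.1 ha
  · exact le_rfl
  · exact le_of_lt (h.1 a ha)

/-- A strictly decreasing list is determined by its set of entries. -/
lemma eq_of_isChain_of_mem_iff {l l' : List (Fin (n + 1))} (h : l.IsChain (· > ·))
    (h' : l'.IsChain (· > ·)) (hl : ∀ a, a ∈ l ↔ a ∈ l') : l = l' := by
  rw [List.isChain_iff_pairwise] at h h'
  refine List.Perm.eq_of_pairwise (fun a b _ _ h1 h2 => absurd h1 (lt_asymm h2)) h h' ?_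
  rw [List.perm_ext_iff_of_nodup (h.imp fun h => h.ne') (h'.imp fun h => h.ne')]
  exact hl

lemma eraseIdx_sublist_cons (k : Fin (n + 1)) (l : List (Fin (n + 1))) (p : ℕ)
    (h : (k :: l).IsChain (· > ·)) : (k :: l.eraseIdx p).IsChain (· > ·) := by
  rw [List.isChain_iff_pairwise] at h ⊢
  exact h.sublist ((List.eraseIdx_sublist l p).cons_cons k)

variable {K : Type w} [CommRing K]

lemma verts_of_mem_splits {i k : Fin (n + 1)} {t : Word (minimalData K n).Hom i k} {s}
    (hs : s ∈ t.splits) : verts s.2.1 ++ verts s.2.2 = verts t := by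
  rw [← append_of_mem_splits t s hs, verts_append]

lemma ne_target_of_splits {i k : Fin (n + 1)} {t : Word (minimalData K n).Hom i k} {s}
    (ht : (k :: verts t).IsChain (· > ·)) (hs : s ∈ t.splits) (h : 0 < s.2.1.length) :
    s.1 ≠ k := by
  rw [← verts_of_mem_splits hs] at ht
  have h1 := src_lt (isChain_left ht) (by
    rw [← List.length_pos_iff, length_verts]
    exact h)
  rw [src_verts] at h1
  exact h1.ne

lemma ne_source_of_splits {i k : Fin (n + 1)} {t : Word (minimalData K n).Hom i k} {s}
    (ht : (k :: verts t).IsChain (· > ·)) (hs : s ∈ t.splits) (h : 0 < s.2.2.length) :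
    s.1 ≠ i := by
  rw [← verts_of_mem_splits hs] at ht
  have h1 := isChain_src ht
  rw [src_verts] at h1
  have h2 := src_lt h1 (by
    rw [← List.length_pos_iff, length_verts]
    exact h)
  rw [src_verts] at h2
  exact h2.ne'

end chains
end AInf

/-! ### Gluing functors along faces -/

namespace AInf

open Word DirectSum AInfFunctorData

section horn
variable {K : Type w} [CommRing K] {C : AInfCategory.{w, v, u} K} {n : ℕ}

/-- The face map omitting the vertex `j`, as a monotone map. -/
abbrev face (j : Fin (n + 2)) : Fin (n + 1) →o Fin (n + 2) := j.succAboveOrderEmb.toOrderHom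

lemma exists_map_succAbove {j : Fin (n + 2)} {l : List (Fin (n + 2))} (h : j ∉ l) :
    ∃ l' : List (Fin (n + 1)), l'.map j.succAbove = l := by
  change l ∈ Set.range (List.map j.succAbove)
  rw [Set.range_list_map]
  intro a ha
  rw [Fin.range_succAbove]
  rintro rfl
  exact h ha

lemma isChain_of_map_succAbove {j : Fin (n + 2)} {l : List (Fin (n + 1))}
    (h : (l.map j.succAbove).IsChain (· > ·)) : l.IsChain (· > ·) := by
  rw [List.isChain_map] at h
  exact h.imp fun a b hab => (Fin.strictMono_succAbove j).lt_iff_lt.1 hab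

/-- The common values of a family of functors on the faces other than the `k`-th one. -/
noncomputable def glue (k : Fin (n + 3)) (v : Fin (n + 3) → AInfFunctor (minimalCategory K (n + 1)) C)
    (L : List (Fin (n + 3))) : Option (Mor C) :=
  open Classical in
  if h : ∃ p : Fin (n + 3) × List (Fin (n + 2)), p.1 ≠ k ∧ p.2.IsChain (· ≥ ·) ∧
      p.2.map p.1.succAbove = L then
    ev (v h.choose.1).toAInfFunctorData h.choose.2
  else none

variable {k : Fin (n + 3)} {v : Fin (n + 3) → AInfFunctor (minimalCategory K (n + 1)) C}

lemma glue_map (hv : ∀ i j : Fin (n + 2), i ≤ j → i.castSucc ≠ k → j.succ ≠ k →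
      (minimalFunctor K (face i)).comp (v j.succ) = (minimalFunctor K (face j)).comp (v i.castSucc))
    {j : Fin (n + 3)} (hj : j ≠ k) {l : List (Fin (n + 2))} (hl : l.IsChain (· ≥ ·)) :
    glue k v (l.map j.succAbove) = ev (v j).toAInfFunctorData l := by
  have h : ∃ p : Fin (n + 3) × List (Fin (n + 2)), p.1 ≠ k ∧ p.2.IsChain (· ≥ ·) ∧
      p.2.map p.1.succAbove = l.map j.succAbove := ⟨(j, l), hj, hl, rfl⟩
  rw [glue, dif_pos h]
  obtain ⟨h1, h2, h3⟩ := h.choose_spec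
  refine ev_eq_of_faces (· ≠ k) (fun j => ev (v j).toAInfFunctorData) ?_ h1 hj h2 h3
  intro i j hij hi hj l hl
  refine (ev_comp (face i) (v j.succ).isMulti hl).symm.trans (Eq.trans ?_
    (ev_comp (face j) (v i.castSucc).isMulti hl))
  exact congrArg (fun F : AInfFunctor _ C => ev F.toAInfFunctorData l) (hv i j hij hi hj)

lemma ev_mem (F : AInfFunctorData (minimalData K n) C.toAInfData) {b : Fin (n + 1)}
    {l : List (Fin (n + 1))} {M : Mor C} (h : ev F (b :: l) = some M) :
    M.2 ∈ LinearMap.range (hlof C (x := M.1.1) (y := M.1.2) (1 - l.length)) := by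
  obtain rfl := Option.some.inj h
  refine ⟨F.map (chainWord K b l) _ ?_, F.lof_map _ _ _⟩
  rw [rdeg_chainWord]
  ring

/-- Compatible functors on the faces other than the `k`-th one are the restrictions of any
prefunctor with suitable values. -/
lemma exists_values (hv : ∀ i j : Fin (n + 2), i ≤ j → i.castSucc ≠ k → j.succ ≠ k →
      (minimalFunctor K (face i)).comp (v j.succ) =
        (minimalFunctor K (face j)).comp (v i.castSucc)) :
    ∃ (X : Fin (n + 3) → C.Obj) (Ψ₀ : (i k : Fin (n + 3)) → List (Fin (n + 3)) → C.Tot (X i) (X k)),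
      HasDegree X Ψ₀ ∧ ∀ Ψ : (i k : Fin (n + 3)) → List (Fin (n + 3)) → C.Tot (X i) (X k),
        HasDegree X Ψ →
        (∀ j ≠ k, ∀ i b l, j ∉ b :: l → Ψ i b l = Ψ₀ i b l) →
        ∀ j ≠ k, (minimalFunctorData K (face j)).comp (ofValues X Ψ) =
          (v j).toAInfFunctorData := by
  have hX : ∀ i, ∃ x, ∀ j ≠ k, ∀ a, j.succAbove a = i → (v j).obj a = x := by
    intro i
    obtain ⟨j₀, hj₀, hi⟩ : ∃ j₀ : Fin (n + 3), j₀ ≠ k ∧ j₀ ≠ i := by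
      obtain ⟨j, hj⟩ := Finset.exists_mem_notMem_of_card_lt_card
        (s := {k, i}) (t := (Finset.univ : Finset (Fin (n + 3))))
        (Finset.card_le_two.trans_lt (by simp))
      simp only [Finset.mem_insert, Finset.mem_singleton, not_or] at hj
      exact ⟨j, hj.2.1, hj.2.2⟩
    obtain ⟨a₀, ha₀⟩ := Fin.exists_succAbove_eq hi.symm
    refine ⟨(v j₀).obj a₀, fun j hj a ha => ?_⟩
    have h1 := glue_map hv hj (l := [a]) (List.isChain_singleton _)
    have h2 := glue_map hv hj₀ (l := [a₀]) (List.isChain_singleton _)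
    simp only [List.map_cons, List.map_nil] at h1 h2
    rw [ha] at h1
    rw [ha₀, h1] at h2
    exact congrArg (fun x : Mor C => x.1.1) (Option.some.inj h2)
  choose X hX using hX
  have hΨ : ∀ (i b : Fin (n + 3)) (l : List (Fin (n + 3))), ∃ a : C.Tot (X i) (X b),
      a ∈ LinearMap.range (hlof C (x := X i) (y := X b) (1 - l.length)) ∧
      ∀ a' : C.Tot (X i) (X b), glue k v (b :: l) = some ⟨(X i, X b), a'⟩ → a' = a := by
    intro i b l
    by_cases h : ∃ a : C.Tot (X i) (X b), glue k v (b :: l) = some ⟨(X i, X b), a⟩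
    · obtain ⟨a, ha⟩ := h
      refine ⟨a, ?_, ?_⟩
      · rw [glue] at ha
        split_ifs at ha with h
        obtain ⟨h1, h2, h3⟩ := h.choose_spec
        generalize h.choose = p at *
        obtain ⟨j, L⟩ := p
        cases L with
        | nil => simp at h3
        | cons b' L =>
          have h4 := ev_mem _ ha
          have h5 := congrArg List.length h3
          simp only [List.length_map, List.length_cons, Nat.add_right_cancel_iff] at h5
          rwa [h5] at h4
      · intro a' ha'
        rw [ha] at ha'
        have h1 := Option.some.inj ha'
        exact (eq_of_heq (Sigma.mk.inj h1).2).symm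
    · exact ⟨0, zero_mem _, fun a' ha' => absurd ⟨a', ha'⟩ h⟩
  choose Ψ₀ hΨ₀ hΨ₀' using hΨ
  refine ⟨X, Ψ₀, hΨ₀, fun Ψ hΨ hΨ' j hj => ?_⟩
  refine ext_of_ev (isMulti_comp_minimal _ (ofValues_isMulti hΨ)) (v j).isMulti
    (isUnital_comp_minimal _ (ofValues_isMulti hΨ) (ofValues_isUnital hΨ)) (v j).isUnital ?_
  intro l hl
  rw [ev_comp _ (ofValues_isMulti hΨ) (isChain_ge hl)]
  have h1 := glue_map hv hj (isChain_ge hl)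
  cases l with
  | nil => rfl
  | cons b l =>
    have hb := (hX _ j hj b rfl)
    have hs := (hX _ j hj (src b l) rfl)
    have hc : ((b :: l).map j.succAbove).IsChain (· > ·) := by
      rw [List.isChain_map]
      exact hl.imp fun a b hab => Fin.strictMono_succAbove j hab
    have hsrc : src (j.succAbove b) (l.map j.succAbove) = j.succAbove (src b l) := by
      clear hl h1 hb hs hc
      induction l generalizing b with
      | nil => rfl
      | cons c l ih => exact ih c
    refine congrArg some ?_
    -- compare the two values through the objects of the face
    obtain ⟨a, ha⟩ : ∃ a : C.Tot (X (src (j.succAbove b) (l.map j.succAbove)))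
        (X (j.succAbove b)), morOf (v j).toAInfFunctorData ⟨src b l, chainWord K b l⟩ =
          ⟨(X (src (j.succAbove b) (l.map j.succAbove)), X (j.succAbove b)), a⟩ := by
      rw [hsrc, ← hb, ← hs]
      exact ⟨_, rfl⟩
    refine Eq.trans ?_ ha.symm
    refine congrArg (Sigma.mk (β := fun x : C.Obj × C.Obj => C.Tot x.1 x.2) _) ?_
    cases l with
    | nil =>
      have h2 : (morOf (v j).toAInfFunctorData ⟨src b [], chainWord K b []⟩).2 = 0 :=
        (v j).isUnital.mapT_nil b
      have h3 : ∀ (M M' : Mor C), M = M' → M.2 = 0 → M'.2 = 0 := by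
        rintro M _ rfl h; exact h
      refine Eq.trans ?_ (h3 _ _ ha h2).symm
      exact (ofValues_isUnital hΨ).mapT_nil (j.succAbove b)
    | cons c l =>
      refine (ofValues_chainWord hΨ hc (List.cons_ne_nil _ _)).trans ?_
      rw [hΨ' j hj _ _ _ (fun h => ?_)]
      · refine (hΨ₀' _ _ _ a ?_).symm
        exact h1.trans (congrArg some ha)
      · obtain ⟨d, _, hd⟩ := List.mem_map.1
          (show j ∈ (b :: c :: l).map j.succAbove from h)
        exact Fin.succAbove_ne _ _ hd

end horn
end AInf

/-! ### The equation on the missing face -/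

namespace AInf

open Word DirectSum AInfFunctorData

section horn
variable {K : Type w} [CommRing K] {C : AInfCategory.{w, v, u} K} {n : ℕ}

/-- There is a strictly decreasing list of all vertices; it starts with the last one. -/
lemma exists_full (n : ℕ) : ∃ l : List (Fin (n + 2)),
    (Fin.last (n + 1) :: l).IsChain (· > ·) ∧ ∀ a, a ∈ Fin.last (n + 1) :: l := by
  refine ⟨((List.finRange (n + 1)).map Fin.castSucc).reverse, ?_, fun a => ?_⟩
  · rw [List.isChain_iff_pairwise, List.pairwise_cons]
    constructor
    · intro a ha
      simp only [List.mem_reverse, List.mem_map, List.mem_finRange, true_and] at ha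
      obtain ⟨b, rfl⟩ := ha
      exact Fin.castSucc_lt_last b
    · rw [List.pairwise_reverse, List.pairwise_map]
      exact (List.pairwise_lt_finRange _).imp fun h => h
  · induction a using Fin.lastCases with
    | last => simp
    | cast a => simp

lemma interiorSum_sub {M : Type v} [AddCommGroup M] (g g' : List (Fin (n + 1)) → M)
    {l : List (Fin (n + 1))} {p : ℕ} (hp : p < l.length - 1)
    (h : ∀ q, q < l.length - 1 → q ≠ p → g (l.eraseIdx q) = g' (l.eraseIdx q)) :
    interiorSum g l - interiorSum g' l =
      (-1 : ℤˣ) ^ (l.length - 2 - p) • (g (l.eraseIdx p) - g' (l.eraseIdx p)) := by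
  rw [interiorSum, interiorSum, ← Finset.sum_sub_distrib]
  rw [Finset.sum_eq_single_of_mem p (Finset.mem_range.2 hp)]
  · rw [smul_sub]
  · intro q hq hqp
    rw [h q (Finset.mem_range.1 hq) hqp, sub_self]

lemma cast_chainWord_curv (F : AInfFunctorData (minimalData K n) C.toAInfData) {i k : Fin (n + 1)}
    {l : List (Fin (n + 1))} (hl : src k l = i)
    (h : curv (C := minimalCategory K n) F (chainWord K k l) = 0) :
    curv (C := minimalCategory K n) F
      (hl ▸ chainWord K k l : Word (minimalData K n).Hom i k) = 0 := by
  cases hl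
  exact h

lemma verts_cast {i k : Fin (n + 1)} {l : List (Fin (n + 1))} (hl : src k l = i) :
    verts (hl ▸ chainWord K k l : Word (minimalData K n).Hom i k) = l := by
  cases hl
  exact verts_chainWord k l

lemma coef_cast {i k : Fin (n + 1)} {l : List (Fin (n + 1))} (hl : src k l = i)
    (h : (k :: l).IsChain (· ≥ ·)) :
    coef (hl ▸ chainWord K k l : Word (minimalData K n).Hom i k) = 1 := by
  cases hl
  exact coef_chainWord h

lemma rdeg_cast {i k : Fin (n + 1)} {l : List (Fin (n + 1))} (hl : src k l = i) :
    (hl ▸ chainWord K k l : Word (minimalData K n).Hom i k).rdeg = - l.length := by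
  cases hl
  exact rdeg_chainWord k l

/-- By the Bianchi identity, a prefunctor on `[n+2]_K` is an A∞-functor as soon as its curvature
vanishes on the faces other than an inner one and on the top-dimensional word. -/
lemma curv_eq_zero_of_faces {F : AInfFunctorData (minimalData K (n + 2)) C.toAInfData}
    (hF : F.IsMulti) (uF : IsUnital (C := minimalCategory K (n + 2)) F) {k : Fin (n + 3)}
    (hk0 : 0 < k) (hk1 : k < Fin.last (n + 2))
    (hface : ∀ (b : Fin (n + 3)) (l : List (Fin (n + 3))), (b :: l).IsChain (· > ·) →
      (∃ j ≠ k, j ∉ b :: l) → curv (C := minimalCategory K (n + 2)) F (chainWord K b l) = 0)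
    (hfull : ∀ l : List (Fin (n + 3)), (Fin.last (n + 2) :: l).IsChain (· > ·) →
      (∀ a, a ∈ Fin.last (n + 2) :: l) →
        curv (C := minimalCategory K (n + 2)) F (chainWord K (Fin.last (n + 2)) l) = 0)
    {x y : Fin (n + 3)} (w : Word (minimalData K (n + 2)).Hom x y) :
    curv (C := minimalCategory K (n + 2)) F w = 0 := by
  obtain ⟨t, ht, hmem⟩ := exists_full (n + 1)
  have hsub : ∀ (p q : Fin (n + 3)) (w : Word (minimalData K (n + 2)).Hom p q),
      (p ≠ 0 ∨ q ≠ Fin.last (n + 2)) → curv (C := minimalCategory K (n + 2)) F w = 0 := by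
    intro p q w h
    refine curv_eq_zero hF uF (fun l hl hc => hface q l hc ?_) w
    obtain h | h := h
    · refine ⟨0, hk0.ne, fun h0 => h ?_⟩
      have := src_le hc 0 h0
      rw [hl] at this
      exact Fin.le_zero_iff.1 this
    · refine ⟨Fin.last _, hk1.ne', fun h0 => h ?_⟩
      exact Fin.last_le_iff.1 (le_of_isChain hc _ h0)
  have hsrc : src (Fin.last (n + 2)) t = 0 := Fin.le_zero_iff.1 (src_le ht 0 (hmem 0))
  -- the position of the vertex `k`
  have hkt : k ∈ t := by
    obtain h | h := List.mem_cons.1 (hmem k)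
    · exact absurd h hk1.ne
    · exact h
  obtain ⟨p, hp, hpk⟩ := List.getElem_of_mem hkt
  have hnodup : t.Nodup := by
    rw [List.isChain_iff_pairwise, List.pairwise_cons] at ht
    exact ht.2.imp fun h => h.ne'
  have hk_erase : ∀ a, a ∈ t.eraseIdx p ↔ a ≠ k ∧ a ∈ t := by
    intro a
    rw [← hpk, ← hnodup.mem_erase_iff, hnodup.erase_getElem p hp]
  have hp1 : p < t.length - 1 := by
    by_contra hlt
    have h1 : t[p] = src (Fin.last (n + 2)) t := by
      have h2 : ∀ (b : Fin (n + 3)) (l : List (Fin (n + 3))) (hl : l ≠ []),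
          l.getLast hl = src b l := by
        intro b l hl
        induction l generalizing b with
        | nil => exact absurd rfl hl
        | cons c l ih =>
          cases l with
          | nil => rfl
          | cons d l => exact ih c (List.cons_ne_nil _ _)
      rw [← h2 _ t (List.ne_nil_of_length_pos (by omega)), List.getLast_eq_getElem]
      congr 1
      omega
    rw [hpk, hsrc] at h1
    exact hk0.ne' h1
  -- by assumption, deleting another interior vertex gives a word on which the curvature vanishes
  have hother : ∀ q, q < t.length - 1 → q ≠ p → ∀ h : src (Fin.last (n + 2)) (t.eraseIdx q) = 0,
      curv (C := minimalCategory K (n + 2)) F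
        (h ▸ chainWord K (Fin.last (n + 2)) (t.eraseIdx q) :
          Word (minimalData K (n + 2)).Hom 0 (Fin.last (n + 2))) = 0 := by
    intro q hq hqp h
    have hqt : q < t.length := by omega
    refine cast_chainWord_curv F h (hface _ _ (eraseIdx_sublist_cons _ _ _ ht)
      ⟨t[q], fun hqk => hqp ?_, ?_⟩)
    · rw [← hpk] at hqk
      exact (hnodup.getElem_inj_iff).1 hqk
    · intro hm
      obtain h1 | h1 := List.mem_cons.1 hm
      · rw [List.isChain_iff_pairwise, List.pairwise_cons] at ht
        exact (ht.1 _ (List.getElem_mem hqt)).ne h1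
      · rw [← hnodup.erase_getElem q hqt, hnodup.mem_erase_iff] at h1
        exact h1.1 rfl
  have hfull' : curv (C := minimalCategory K (n + 2)) F
      (hsrc ▸ chainWord K (Fin.last (n + 2)) t :
        Word (minimalData K (n + 2)).Hom 0 (Fin.last (n + 2))) = 0 :=
    cast_chainWord_curv F hsrc (hfull t ht hmem)
  have hs_src : src (Fin.last (n + 2)) (t.eraseIdx p) = 0 := by
    refine Fin.le_zero_iff.1 (src_le (eraseIdx_sublist_cons _ _ _ ht) 0 ?_)
    rw [List.mem_cons, hk_erase]
    obtain h | h := List.mem_cons.1 (hmem 0)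
    · exact Or.inl h
    · exact Or.inr ⟨hk0.ne, h⟩
  have hs : curv (C := minimalCategory K (n + 2)) F
      (hs_src ▸ chainWord K (Fin.last (n + 2)) (t.eraseIdx p) :
        Word (minimalData K (n + 2)).Hom 0 (Fin.last (n + 2))) = 0 := by
    let g : List (Fin (n + 3)) → C.Tot (F.obj 0) (F.obj (Fin.last (n + 2))) := fun l =>
      if hl : src (Fin.last (n + 2)) l = 0 then curv (C := minimalCategory K (n + 2)) F
        (hl ▸ chainWord K (Fin.last (n + 2)) l :
          Word (minimalData K (n + 2)).Hom 0 (Fin.last (n + 2))) else 0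
    -- in the Bianchi identity for the full word, only the deletion of `k` contributes: proper subwords
    -- miss `0` or the last vertex
    have h1 := hF.bianchi (C := minimalCategory K (n + 2))
      (hsrc ▸ chainWord K (Fin.last (n + 2)) t :
        Word (minimalData K (n + 2)).Hom 0 (Fin.last (n + 2)))
    have h2 := insertSum_chainWord (φ := curv (C := minimalCategory K (n + 2)) F
      (x := (0 : Fin (n + 3))) (y := Fin.last (n + 2)))
      (hF.curv (C := minimalCategory K (n + 2)) _ _) (g := g)
      (fun l hl _ => by simp only [g, dif_pos hl]) t hsrc (isChain_ge ht)
    have h3 := interiorSum_sub g (fun _ => 0) hp1 (fun q hq hqp => by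
      by_cases h : src (Fin.last (n + 2)) (t.eraseIdx q) = 0
      · exact (dif_pos h).trans (hother q hq hqp h)
      · exact dif_neg h)
    have h4 : interiorSum (fun _ : List (Fin (n + 3)) =>
        (0 : C.Tot (F.obj 0) (F.obj (Fin.last (n + 2))))) t = 0 := by
      simp [interiorSum]
    have hverts := verts_cast (K := K) hsrc
    have h5 := (congrArg₂ (· + ·) h2 rfl).symm.trans h1
    rw [h4, sub_zero, sub_zero] at h3
    have h6 : g (t.eraseIdx p) = 0 := by
      have h7 : interiorSum g t = 0 := by
        refine (add_zero _).symm.trans (Eq.trans (congrArg (_ + ·) ?_) h5)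
        symm
        have hz : ∀ {a b : Fin (n + 3)} (w : Word (minimalData K (n + 2)).Hom a b),
            curv (C := minimalCategory K (n + 2)) F w = 0 → ∀
            (l : Word (minimalData K (n + 2)).Hom b (Fin.last (n + 2)))
            (r : Word (minimalData K (n + 2)).Hom 0 a) (ε : ℤˣ),
            (ε • lsum (F.expand l) fun p => lsum (F.expand r) fun q =>
              IsMultilinear.ext C.m_multilinear p q
                (curv (C := minimalCategory K (n + 2)) F w)) = 0 := by
          intro a b w hw l r ε
          rw [lsum_eq_zero, smul_zero]
          intro q _
          refine lsum_eq_zero fun q' _ => ?_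
          rw [hw, map_zero]
        have hc : (Fin.last (n + 2) :: verts (hsrc ▸ chainWord K (Fin.last (n + 2)) t :
            Word (minimalData K (n + 2)).Hom 0 (Fin.last (n + 2)))).IsChain (· > ·) := by
          rw [hverts]
          exact ht
        rw [lsum_splits_of_left]
        · rw [lsum_splits_of_right]
          · exact hz _ hfull' _ _ _
          · intro j hj hj0
            exact hz _ (hsub _ _ _ (Or.inl (ne_source_of_splits hc hj hj0))) _ _ _
        · intro i hi hi0
          refine lsum_eq_zero fun j hj => ?_
          exact hz _ (hsub _ _ _ (Or.inr (ne_target_of_splits hc hi hi0))) _ _ _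
      rw [h7] at h3
      exact (smul_eq_zero_iff_eq _).1 h3.symm
    exact (dif_pos hs_src).symm.trans h6
  refine curv_eq_zero hF uF (fun l hl hc => ?_) w
  by_cases h : ∃ j ≠ k, j ∉ y :: l
  · exact hface y l hc h
  · push Not at h
    have hy : y = Fin.last (n + 2) := Fin.last_le_iff.1 (le_of_isChain hc _ (h _ hk1.ne'))
    subst hy
    by_cases hk : k ∈ Fin.last (n + 2) :: l
    · refine hfull l hc fun a => ?_
      by_cases hak : a = k
      · rwa [hak]
      · exact h a hak
    · have h1 : Fin.last (n + 2) :: l = Fin.last (n + 2) :: t.eraseIdx p := by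
        refine eq_of_isChain_of_mem_iff hc (eraseIdx_sublist_cons _ _ _ ht) fun a => ?_
        constructor
        · intro ha
          obtain rfl | h1 := List.mem_cons.1 (hmem a)
          · simp
          · refine List.mem_cons_of_mem _ ((hk_erase a).2 ⟨?_, h1⟩)
            rintro rfl
            exact hk ha
        · intro ha
          apply h
          rintro rfl
          obtain h1 | h1 := List.mem_cons.1 ha
          · exact hk1.ne h1
          · exact ((hk_erase a).1 h1).1 rfl
      obtain rfl := (List.cons.inj h1).2
      have h3 : ∀ (z : Fin (n + 3)) (hz : src (Fin.last (n + 2)) (t.eraseIdx p) = z),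
          curv (C := minimalCategory K (n + 2)) F
          (hz ▸ chainWord K (Fin.last (n + 2)) (t.eraseIdx p) :
            Word (minimalData K (n + 2)).Hom z (Fin.last (n + 2))) = 0 →
          curv (C := minimalCategory K (n + 2)) F
            (chainWord K (Fin.last (n + 2)) (t.eraseIdx p)) = 0 := by
        rintro _ rfl h
        exact h
      exact h3 _ hs_src hs

end horn
end AInf

/-! ### Fillers of inner horns -/

namespace AInf

open Word DirectSum AInfFunctorData

section horn
variable {K : Type w} [CommRing K] {C : AInfCategory.{w, v, u} K} {n : ℕ}

/-- Change the value on one list of vertices. -/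
def updateValue {X : Fin (n + 1) → C.Obj}
    (Ψ : (i k : Fin (n + 1)) → List (Fin (n + 1)) → C.Tot (X i) (X k)) (i k : Fin (n + 1))
    (l : List (Fin (n + 1))) (c : C.Tot (X i) (X k)) :
    (i k : Fin (n + 1)) → List (Fin (n + 1)) → C.Tot (X i) (X k) :=
  Function.update Ψ i (Function.update (Ψ i) k (Function.update (Ψ i k) l c))

variable {X : Fin (n + 1) → C.Obj}
  {Ψ : (i k : Fin (n + 1)) → List (Fin (n + 1)) → C.Tot (X i) (X k)} {i k : Fin (n + 1)}
  {l : List (Fin (n + 1))} {c : C.Tot (X i) (X k)}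

lemma updateValue_self : updateValue Ψ i k l c i k l = c := by
  simp [updateValue]

lemma updateValue_of_ne {i' k' : Fin (n + 1)} {l' : List (Fin (n + 1))}
    (h : ¬ (i' = i ∧ k' = k ∧ l' = l)) : updateValue Ψ i k l c i' k' l' = Ψ i' k' l' := by
  unfold updateValue
  by_cases hi : i' = i
  · subst hi
    rw [Function.update_self]
    by_cases hk : k' = k
    · subst hk
      rw [Function.update_self, Function.update_of_ne]
      exact fun hl => h ⟨rfl, rfl, hl⟩
    · rw [Function.update_of_ne hk]
  · rw [Function.update_of_ne hi]

lemma hasDegree_updateValue (hΨ : HasDegree X Ψ)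
    (hc : c ∈ LinearMap.range (hlof C (x := X i) (y := X k) (1 - l.length))) :
    HasDegree X (updateValue Ψ i k l c) := by
  intro i' k' l'
  by_cases h : i' = i ∧ k' = k ∧ l' = l
  · obtain ⟨rfl, rfl, rfl⟩ := h
    rwa [updateValue_self]
  · rw [updateValue_of_ne h]
    exact hΨ _ _ _

/-- The curvature on a word depends on the value on the word without the `p`-th interior vertex
through the term with that value alone, which enters with a sign. -/
lemma curv_updateValue (hΨ : HasDegree X Ψ) {t : List (Fin (n + 1))} (ht : (k :: t).IsChain (· > ·))
    (hi : src k t = i) {p : ℕ} (hp : p < t.length - 1) (hsrc : src k (t.eraseIdx p) = i)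
    {c : C.Tot (X i) (X k)}
    (hc : c ∈ LinearMap.range (hlof C (x := X i) (y := X k) (1 - (t.eraseIdx p).length))) :
    curv (C := minimalCategory K n) (ofValues X (updateValue Ψ i k (t.eraseIdx p) c))
      (hi ▸ chainWord K k t : Word (minimalData K n).Hom i k) =
    curv (C := minimalCategory K n) (ofValues X (updateValue Ψ i k (t.eraseIdx p) 0))
      (hi ▸ chainWord K k t : Word (minimalData K n).Hom i k) -
    (-1 : ℤˣ) ^ (t.length - 2 - p) • c := by
  have h0 := hasDegree_updateValue (l := t.eraseIdx p) (i := i) (k := k) hΨ (c := 0) (zero_mem _)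
  have hc' := hasDegree_updateValue hΨ hc
  have hlen : (t.eraseIdx p).length + 1 = t.length := by
    rw [List.length_eraseIdx_of_lt (by omega)]
    omega
  have hik : i ≠ k := by
    rw [← hi]
    exact (src_lt ht (List.ne_nil_of_length_pos (by omega))).ne
  have hverts := verts_cast (K := K) hi
  have hT : (k :: verts (hi ▸ chainWord K k t : Word (minimalData K n).Hom i k)).IsChain
      (· > ·) := by
    rw [hverts]
    exact ht
  -- the changed value does not enter the operations of `C`: no subword of the full word skips `p`
  have hE := expand_congr (C := minimalCategory K n) (D := C) (obj := X)
    (f := (ofValues X (updateValue Ψ i k (t.eraseIdx p) c)).map)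
    (g := (ofValues X (updateValue Ψ i k (t.eraseIdx p) 0)).map)
    (hi ▸ chainWord K k t : Word (minimalData K n).Hom i k) (by
      intro a b l w r h
      change DirectSum.component K ℤ _ _ _ = DirectSum.component K ℤ _ _ _
      congr 2
      unfold normalize
      rw [updateValue_of_ne, updateValue_of_ne]
      all_goals
        rintro ⟨rfl, rfl, hw⟩
        have hv := congrArg verts h
        rw [verts_append, verts_append, hverts] at hv
        rw [← hv] at ht
        have hl : verts l = [] := by
          by_contra hl
          have h1 := src_lt (isChain_left ht) hl
          rw [src_verts] at h1
          exact lt_irrefl _ h1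
        rw [hl, List.nil_append] at ht
        have hr : verts r = [] := by
          by_contra hr
          have h1 := isChain_src ht
          rw [src_verts] at h1
          have h2 := src_lt h1 hr
          rw [src_verts] at h2
          exact lt_irrefl _ h2
        rw [hl, hr, List.nil_append, List.append_nil, hw] at hv
        have h3 := congrArg List.length hv
        omega)
  have hI : ∀ c' : C.Tot (X i) (X k), HasDegree X (updateValue Ψ i k (t.eraseIdx p) c') →
      insertSum (fun s => (minimalData K n).m s _ rfl)
        (ofValues X (updateValue Ψ i k (t.eraseIdx p) c')).mapT
        (hi ▸ chainWord K k t : Word (minimalData K n).Hom i k) =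
      interiorSum (normalize X (updateValue Ψ i k (t.eraseIdx p) c') i k) t := by
    intro c' hc'
    refine insertSum_chainWord (ofValues_isMulti hc' i k) ?_ t hi (isChain_ge ht)
    intro l hl hch
    refine (ofValues_mapT hc' _).trans ?_
    rw [coef_cast hl hch, one_smul, verts_cast hl]
  have hdiff := interiorSum_sub (normalize X (updateValue Ψ i k (t.eraseIdx p) c) i k)
    (normalize X (updateValue Ψ i k (t.eraseIdx p) 0) i k) hp (by
      intro q hq hqp
      have h1 : t.eraseIdx q ≠ t.eraseIdx p := by
        have hnodup : t.Nodup := by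
          rw [List.isChain_iff_pairwise, List.pairwise_cons] at ht
          exact ht.2.imp fun h => h.ne'
        intro h
        have hq' : q < t.length := by omega
        have hp' : p < t.length := by omega
        rw [← hnodup.erase_getElem q hq', ← hnodup.erase_getElem p hp'] at h
        have h2 : t[p] ∈ t.erase t[q] := by
          rw [hnodup.mem_erase_iff]
          exact ⟨fun h => hqp (hnodup.getElem_inj_iff.1 h).symm, List.getElem_mem _⟩
        rw [h, hnodup.mem_erase_iff] at h2
        exact h2.1 rfl
      unfold normalize
      rw [updateValue_of_ne fun h => h1 h.2.2, updateValue_of_ne fun h => h1 h.2.2])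
  have hn : ∀ c', normalize X (updateValue Ψ i k (t.eraseIdx p) c') i k (t.eraseIdx p) = c' := by
    intro c'
    rw [normalize, dif_neg hik, if_pos (eraseIdx_sublist_cons _ _ _ ht), updateValue_self]
  rw [hn, hn, sub_zero] at hdiff
  have hE' := congrArg (fun L => lsum L (C.mT (x := X i) (y := X k))) hE
  refine (congrArg₂ (· - ·) hE' (hI c hc')).trans ?_
  refine Eq.trans ?_ (congrArg (fun z => z - _)
    (congrArg₂ (· - ·) rfl (hI 0 h0))).symm
  rw [← hdiff]
  abel

/-- Inner horns in the nerve have fillers. -/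
lemma exists_horn_filler {k : Fin (n + 3)} {v : Fin (n + 3) → AInfFunctor (minimalCategory K (n + 1)) C}
    (hv : ∀ i j : Fin (n + 2), i ≤ j → i.castSucc ≠ k → j.succ ≠ k →
      (minimalFunctor K (face i)).comp (v j.succ) =
        (minimalFunctor K (face j)).comp (v i.castSucc))
    (hk0 : 0 < k) (hk1 : k < Fin.last (n + 2)) :
    ∃ σ : AInfFunctor (minimalCategory K (n + 2)) C,
      ∀ j ≠ k, (minimalFunctor K (face j)).comp σ = v j := by
  obtain ⟨X, Ψ₀, hΨ₀, hv⟩ := exists_values hv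
  suffices ∃ Ψ : (i k : Fin (n + 3)) → List (Fin (n + 3)) → C.Tot (X i) (X k),
      HasDegree X Ψ ∧ (∀ j ≠ k, ∀ i b l, j ∉ b :: l → Ψ i b l = Ψ₀ i b l) ∧
      ∀ (x y : Fin (n + 3)) (w : Word (minimalData K (n + 2)).Hom x y),
        curv (C := minimalCategory K (n + 2)) (ofValues X Ψ) w = 0 by
    obtain ⟨Ψ, h1, h2, h3⟩ := this
    refine ⟨toFunctor (ofValues X Ψ) (ofValues_isMulti h1) (ofValues_isUnital h1) h3, ?_⟩
    intro j hj
    exact AInfFunctor.ext_data (hv Ψ h1 h2 j hj)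
  obtain ⟨t, ht, hmem⟩ := exists_full (n + 1)
  have hi : src (Fin.last (n + 2)) t = 0 := Fin.le_zero_iff.1 (src_le ht 0 (hmem 0))
  have hkt : k ∈ t := by
    obtain h | h := List.mem_cons.1 (hmem k)
    · exact absurd h hk1.ne
    · exact h
  obtain ⟨p, hp, hpk⟩ := List.getElem_of_mem hkt
  have hnodup : t.Nodup := by
    rw [List.isChain_iff_pairwise, List.pairwise_cons] at ht
    exact ht.2.imp fun h => h.ne'
  have hk_erase : ∀ a, a ∈ t.eraseIdx p ↔ a ≠ k ∧ a ∈ t := by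
    intro a
    rw [← hpk, ← hnodup.mem_erase_iff, hnodup.erase_getElem p hp]
  have h0t : (0 : Fin (n + 3)) ∈ t := by
    obtain h | h := List.mem_cons.1 (hmem 0)
    · exact absurd h (Fin.last_pos).ne
    · exact h
  have hp1 : p < t.length - 1 := by
    by_contra hlt
    obtain ⟨q, hq, hq0⟩ := List.getElem_of_mem h0t
    have hqp : q < p := by
      refine lt_of_le_of_ne (by omega) ?_
      rintro rfl
      exact hk0.ne' (hpk.symm.trans hq0)
    rw [List.isChain_iff_pairwise, List.pairwise_cons] at ht
    have := List.pairwise_iff_getElem.1 ht.2 q p hq hp hqp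
    rw [hpk, hq0] at this
    exact absurd this (not_lt.2 (Fin.zero_le k))
  have hsrc : src (Fin.last (n + 2)) (t.eraseIdx p) = 0 :=
    Fin.le_zero_iff.1 (src_le (eraseIdx_sublist_cons _ _ _ ht) 0
      (List.mem_cons_of_mem _ ((hk_erase 0).2 ⟨hk0.ne, h0t⟩)))
  have hlen : (t.eraseIdx p).length + 1 = t.length := by
    rw [List.length_eraseIdx_of_lt (by omega)]
    omega
  -- the value on the missing face is determined by the relation on the top-dimensional word
  set c₀ := curv (C := minimalCategory K (n + 2))
    (ofValues X (updateValue Ψ₀ 0 (Fin.last (n + 2)) (t.eraseIdx p) 0))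
    (hi ▸ chainWord K (Fin.last (n + 2)) t :
      Word (minimalData K (n + 2)).Hom 0 (Fin.last (n + 2))) with hc₀
  have hdeg : c₀ ∈ LinearMap.range (hlof C (x := X 0) (y := X (Fin.last (n + 2)))
      (1 - (t.eraseIdx p).length)) := by
    have h1 := curv_mem (C := minimalCategory K (n + 2))
      (ofValues X (updateValue Ψ₀ 0 (Fin.last (n + 2)) (t.eraseIdx p) 0))
      (hi ▸ chainWord K (Fin.last (n + 2)) t :
        Word (minimalData K (n + 2)).Hom 0 (Fin.last (n + 2)))
    have h2 : (hi ▸ chainWord K (Fin.last (n + 2)) t :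
        Word (minimalData K (n + 2)).Hom 0 (Fin.last (n + 2))).rdeg + 2 =
        1 - (t.eraseIdx p).length := by
      rw [rdeg_cast hi, ← hlen]
      push_cast
      ring
    rw [h2] at h1
    exact h1
  have hc : (-1 : ℤˣ) ^ (t.length - 2 - p) • c₀ ∈ LinearMap.range (hlof C (x := X 0)
      (y := X (Fin.last (n + 2))) (1 - (t.eraseIdx p).length)) := by
    rw [Units.smul_def]
    exact zsmul_mem hdeg _
  have hΨ := hasDegree_updateValue hΨ₀ hc
  have hΨ' : ∀ j ≠ k, ∀ i b l, j ∉ b :: l → updateValue Ψ₀ 0 (Fin.last (n + 2)) (t.eraseIdx p)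
      ((-1 : ℤˣ) ^ (t.length - 2 - p) • c₀) i b l = Ψ₀ i b l := by
    intro j hj i b l hjl
    refine updateValue_of_ne ?_
    rintro ⟨_, rfl, rfl⟩
    refine hjl ?_
    obtain rfl | h := List.mem_cons.1 (hmem j)
    · simp
    · exact List.mem_cons_of_mem _ ((hk_erase j).2 ⟨hj, h⟩)
  refine ⟨_, hΨ, hΨ', fun x y w => ?_⟩
  -- on the given faces, the curvature is that of the given functors; on the full list it vanishes by
  -- the choice of `c₀`
  refine curv_eq_zero_of_faces (ofValues_isMulti hΨ) (ofValues_isUnital hΨ) hk0 hk1 ?_ ?_ w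
  · rintro b l hbl ⟨j, hj, hjl⟩
    obtain ⟨L, hL⟩ := exists_map_succAbove hjl
    cases L with
    | nil => cases hL
    | cons b' L =>
      obtain ⟨rfl, rfl⟩ := List.cons.inj hL
      have h1 := curv_comp_minimal (face j) (ofValues_isMulti hΨ) (chainWord K b' L)
      have h2 : curv (C := minimalCategory K (n + 1)) ((minimalFunctorData K (face j)).comp
          (ofValues X (updateValue Ψ₀ 0 (Fin.last (n + 2)) (t.eraseIdx p)
            ((-1 : ℤˣ) ^ (t.length - 2 - p) • c₀)))) (chainWord K b' L) = 0 := by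
        rw [hv _ hΨ hΨ' j hj]
        exact (v j).curv_eq_zero _
      rw [h2] at h1
      have h3 := mapLetters_chainWord (K := K) (face j)
        (isChain_ge (isChain_of_map_succAbove hbl))
      have h4 : ∀ (s s' : Σ i, Word (minimalData K (n + 2)).Hom i (face j b')), s = s' →
          curv (C := minimalCategory K (n + 2)) (ofValues X (updateValue Ψ₀ 0 (Fin.last (n + 2))
            (t.eraseIdx p) ((-1 : ℤˣ) ^ (t.length - 2 - p) • c₀))) s.2 = 0 →
          curv (C := minimalCategory K (n + 2)) (ofValues X (updateValue Ψ₀ 0 (Fin.last (n + 2))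
            (t.eraseIdx p) ((-1 : ℤˣ) ^ (t.length - 2 - p) • c₀))) s'.2 = 0 := by
        rintro s _ rfl h
        exact h
      exact h4 _ _ h3 h1.symm
  · intro l hl hlm
    obtain rfl : l = t := by
      have h1 := eq_of_isChain_of_mem_iff hl ht fun a => ⟨fun _ => hmem a, fun _ => hlm a⟩
      exact (List.cons.inj h1).2
    have h1 := curv_updateValue hΨ₀ ht hi hp1 hsrc hc
    rw [← hc₀, smul_smul, Int.units_mul_self, one_smul, sub_self] at h1
    have h3 : ∀ (z : Fin (n + 3)) (hz : src (Fin.last (n + 2)) l = z),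
        curv (C := minimalCategory K (n + 2)) (ofValues X (updateValue Ψ₀ 0 (Fin.last (n + 2))
            (l.eraseIdx p) ((-1 : ℤˣ) ^ (l.length - 2 - p) • c₀)))
        (hz ▸ chainWord K (Fin.last (n + 2)) l :
          Word (minimalData K (n + 2)).Hom z (Fin.last (n + 2))) = 0 →
        curv (C := minimalCategory K (n + 2)) (ofValues X (updateValue Ψ₀ 0 (Fin.last (n + 2))
            (l.eraseIdx p) ((-1 : ℤˣ) ^ (l.length - 2 - p) • c₀)))
          (chainWord K (Fin.last (n + 2)) l) = 0 := by
      rintro _ rfl h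
      exact h
    exact h3 _ hi h1

/-- The A∞-nerve is an ∞-category. -/
lemma quasicategory_nerve (C : AInfCategory.{w, v, u} K) : SSet.Quasicategory (nerve C) := by
  refine SSet.quasicategory_of_filler _ fun n k σ₀ h0 h1 => ?_
  let v : Fin (n + 3) → AInfFunctor (minimalCategory K (n + 1)) C := fun j =>
    if h : j ≠ k then σ₀.app _ (SSet.horn.face k j h) else σ₀.app _ (SSet.horn.face k 0 h0.ne)
  have hvj : ∀ j (h : j ≠ k), v j = σ₀.app _ (SSet.horn.face k j h) := fun j h => dif_pos h
  obtain ⟨σ, hσ⟩ := exists_horn_filler (k := k) (v := v) (by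
    intro i j hij hi hj
    rw [hvj _ hi, hvj _ hj]
    have h2 := NatTrans.naturality_apply σ₀ (SimplexCategory.δ i).op
      (SSet.horn.face k j.succ hj)
    have h3 := NatTrans.naturality_apply σ₀ (SimplexCategory.δ j).op
      (SSet.horn.face k i.castSucc hi)
    refine h2.symm.trans (Eq.trans (congrArg _ ?_) h3)
    apply Subtype.ext
    apply SSet.stdSimplex.objEquiv.injective
    exact SimplexCategory.δ_comp_δ hij) h0 h1
  exact ⟨σ, fun j hj => (hσ j hj).trans (hvj j hj)⟩

end horn
end AInf

/-! ### The space associated with a complex -/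

namespace AInf

section spaces

/-- A cochain complex of abelian groups, given by a total group `T` with subgroups `gr e` of elements
of degree `e`. In this form, changing the degree along an equation requires no casts. The total
group is not required to be the direct sum of the homogeneous parts. -/
structure GradedComplex where
  T : Type v
  [acg : AddCommGroup T]
  gr : ℤ → AddSubgroup T
  d : T →+ T
  d_mem : ∀ {e : ℤ} {a : T}, a ∈ gr e → d a ∈ gr (e + 1)
  d_d : ∀ a : T, d (d a) = 0

attribute [instance] GradedComplex.acg

/-- The alternating sum `∑ ± f (l')` over all lists `l'` obtained from `l` by deleting an entry; the
sign is determined by the number of entries to the right of the deleted one. -/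
def boundarySum {ι : Type*} {T : Type v} [AddCommGroup T] (f : List ι → T) (l : List ι) : T :=
  ∑ p ∈ Finset.range l.length, (-1 : ℤˣ) ^ (l.length - 1 - p) • f (l.eraseIdx p)

section boundarySum
variable {ι : Type*} {T : Type v} [AddCommGroup T]

@[simp] lemma boundarySum_nil (f : List ι → T) : boundarySum f [] = 0 := by
  simp [boundarySum]

lemma boundarySum_cons (f : List ι → T) (a : ι) (l : List ι) :
    boundarySum f (a :: l) =
      (-1 : ℤˣ) ^ l.length • f l + boundarySum (fun s => f (a :: s)) l := by
  simp only [boundarySum, List.length_cons, Nat.add_sub_cancel]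
  rw [Finset.sum_range_succ', add_comm]
  congr 1
  refine Finset.sum_congr rfl fun p hp => ?_
  rw [List.eraseIdx_cons_succ]
  congr 2
  omega

lemma boundarySum_zero (l : List ι) : boundarySum (fun _ => (0 : T)) l = 0 := by
  simp [boundarySum]

lemma boundarySum_add (f g : List ι → T) (l : List ι) :
    boundarySum (fun s => f s + g s) l = boundarySum f l + boundarySum g l := by
  simp [boundarySum, smul_add, Finset.sum_add_distrib]

lemma boundarySum_smul (ε : ℤˣ) (f : List ι → T) (l : List ι) :
    boundarySum (fun s => ε • f s) l = ε • boundarySum f l := by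
  simp only [boundarySum, Finset.smul_sum, smul_smul]
  refine Finset.sum_congr rfl fun p _ => ?_
  rw [mul_comm]

lemma boundarySum_congr {f g : List ι → T} {l : List ι}
    (h : ∀ p < l.length, f (l.eraseIdx p) = g (l.eraseIdx p)) :
    boundarySum f l = boundarySum g l :=
  Finset.sum_congr rfl fun p hp => by rw [h p (Finset.mem_range.1 hp)]

lemma map_boundarySum {T' : Type v₁} [AddCommGroup T'] (φ : T →+ T') (f : List ι → T)
    (l : List ι) : φ (boundarySum f l) = boundarySum (fun s => φ (f s)) l := by
  rw [boundarySum, map_sum]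
  refine Finset.sum_congr rfl fun p _ => ?_
  rw [Units.smul_def, map_zsmul, ← Units.smul_def]

lemma boundarySum_map {κ : Type*} (f : List κ → T) (g : ι → κ) (l : List ι) :
    boundarySum (fun s => f (s.map g)) l = boundarySum f (l.map g) := by
  rw [boundarySum, boundarySum, List.length_map]
  refine Finset.sum_congr rfl fun p _ => ?_
  rw [List.eraseIdx_map]

lemma boundarySum_boundarySum (f : List ι → T) (l : List ι) :
    boundarySum (boundarySum f) l = 0 := by
  induction l generalizing f with
  | nil => simp
  | cons a l ih =>
    rw [boundarySum_cons]
    have h : boundarySum (fun s => boundarySum f (a :: s)) l =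
        boundarySum (fun s => (-1 : ℤˣ) ^ (l.length - 1) • f s) l +
        boundarySum (boundarySum fun s => f (a :: s)) l := by
      rw [← boundarySum_add]
      refine boundarySum_congr fun p hp => ?_
      rw [boundarySum_cons, List.length_eraseIdx_of_lt hp]
    rw [h, ih, add_zero, boundarySum_smul]
    cases l with
    | nil => simp
    | cons b l =>
      rw [List.length_cons, Nat.add_sub_cancel, pow_succ, mul_neg_one, Units.neg_smul,
        neg_add_cancel]

/-- The terms of the sum for a list with two equal adjacent entries cancel, if the function vanishes
on such lists. -/
lemma boundarySum_eq_zero {f : List ι → T} {R : ι → ι → Prop} (hR : ∀ a, ¬ R a a)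
    (hf : ∀ l : List ι, ¬ l.IsChain R → f l = 0) (s t : List ι) (a : ι) :
    boundarySum f (s ++ a :: a :: t) = 0 := by
  have hbad : ∀ s t : List ι, ¬ (s ++ a :: a :: t).IsChain R := by
    intro s t h
    have h1 := h.right_of_append
    exact hR a (List.isChain_cons_cons.1 h1).1
  induction s generalizing f with
  | nil =>
    rw [List.nil_append, boundarySum_cons, boundarySum_cons]
    have h : boundarySum (fun s => f (a :: a :: s)) t = 0 := by
      rw [← boundarySum_zero t]
      exact boundarySum_congr fun p _ => hf _ (hbad [] _)
    rw [h, add_zero, List.length_cons, pow_succ, mul_neg_one, Units.neg_smul, neg_add_cancel]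
  | cons b s ih =>
    rw [List.cons_append, boundarySum_cons, hf _ (hbad s t), smul_zero, zero_add]
    exact ih (f := fun l => f (b :: l)) fun l hl => hf _ fun h => hl h.of_cons

end boundarySum

variable (A : GradedComplex.{v})

/-- The `n`-simplices of the space associated with a complex: cochains on the strictly
decreasing lists of vertices (extended by zero) whose differential is their alternating sum. -/
def Simplices (n : ℕ) : Type v :=
  { f : List (Fin (n + 1)) → A.T //
    (∀ l, f l ∈ A.gr (1 - l.length)) ∧
    (∀ l, ¬ (l ≠ [] ∧ l.IsChain (· > ·)) → f l = 0) ∧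
    ∀ l, l.IsChain (· > ·) → A.d (f l) = - boundarySum f l }

variable {A} {m n : ℕ}

lemma isChain_gt_of_map {α : Fin (m + 1) →o Fin (n + 1)} {l : List (Fin (m + 1))}
    (h : (l.map α).IsChain (· > ·)) : l.IsChain (· > ·) := by
  rw [List.isChain_map] at h
  exact h.imp fun a b hab => not_le.1 fun hle => not_le.2 hab (α.monotone hle)

lemma exists_repeat {l : List (Fin (n + 1))} (h : l.IsChain (· ≥ ·)) (h' : ¬ l.IsChain (· > ·)) :
    ∃ s a t, l = s ++ a :: a :: t := by
  induction l with
  | nil => exact absurd List.isChain_nil h'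
  | cons b l ih =>
    by_cases h1 : l.IsChain (· > ·)
    · cases l with
      | nil => exact absurd (List.isChain_singleton _) h'
      | cons c l =>
        rw [List.isChain_cons_cons] at h h'
        have h2 : b = c := by
          by_contra hbc
          exact h' ⟨lt_of_le_of_ne h.1 (Ne.symm hbc), h1⟩
        exact ⟨[], b, l, by rw [h2]; rfl⟩
    · obtain ⟨s, a, t, rfl⟩ := ih h.of_cons h1
      exact ⟨b :: s, a, t, rfl⟩

/-- The equation for the differential also holds on lists with repetitions: there, both sides vanish. -/
lemma Simplices.d_eq (f : Simplices A n) {l : List (Fin (n + 1))} (h : l.IsChain (· ≥ ·)) :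
    A.d (f.1 l) = - boundarySum f.1 l := by
  by_cases h' : l.IsChain (· > ·)
  · exact f.2.2.2 l h'
  · obtain ⟨s, a, t, rfl⟩ := exists_repeat h h'
    rw [boundarySum_eq_zero (R := (· > ·)) (fun a => lt_irrefl a)
      (fun l hl => f.2.2.1 l fun h => hl h.2), f.2.2.1 _ fun h => h' h.2, map_zero, neg_zero]

/-- Restriction of simplices along a monotone map. -/
def Simplices.restrict (f : Simplices A n) (α : Fin (m + 1) →o Fin (n + 1)) : Simplices A m :=
  ⟨fun l => f.1 (l.map α), fun l => by simpa using f.2.1 (l.map α), fun l hl => f.2.2.1 _ (by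
    rintro ⟨h1, h2⟩
    exact hl ⟨by simpa using h1, isChain_gt_of_map h2⟩), fun l hl => by
    rw [f.d_eq (isChain_map_ge α (isChain_ge hl)), boundarySum_map]⟩

/-- The simplicial set associated with a complex (the Dold–Kan construction, in terms of cochains
on decreasing lists of vertices). -/
def space (A : GradedComplex.{v}) : SSet.{max u v} where
  obj n := ULift.{u} (Simplices A n.unop.len)
  map α := ↾(fun f => ⟨f.down.restrict α.unop.toOrderHom⟩)
  map_id n := by
    ext f : 3
    refine ULift.ext _ _ (Subtype.ext (funext fun l => ?_))
    exact congrArg f.down.1 (List.map_id l)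
  map_comp α β := by
    ext f : 3
    refine ULift.ext _ _ (Subtype.ext (funext fun l => ?_))
    refine congrArg f.down.1 ?_
    exact (List.map_map (l := l) (f := β.unop.toOrderHom) (g := α.unop.toOrderHom)).symm

/-- A map of complexes, of degree `0`. -/
structure ComplexMap (A : GradedComplex.{v}) (B : GradedComplex.{v₁}) where
  f : A.T →+ B.T
  mem : ∀ {e : ℤ} {a : A.T}, a ∈ A.gr e → f a ∈ B.gr e
  d_comm : ∀ a, f (A.d a) = B.d (f a)

/-- The action of a map of complexes on simplices. -/
def ComplexMap.onSimplices {A : GradedComplex.{v}} {B : GradedComplex.{v₁}} (φ : ComplexMap A B)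
    (s : Simplices A n) : Simplices B n :=
  ⟨fun l => φ.f (s.1 l), fun l => φ.mem (s.2.1 l), fun l hl => (congrArg φ.f (s.2.2.1 l hl)).trans (map_zero _),
    fun l hl => (φ.d_comm _).symm.trans ((congrArg φ.f (s.2.2.2 l hl)).trans
      ((map_neg _ _).trans (congrArg Neg.neg (map_boundarySum _ _ _))))⟩

/-- The map of simplicial sets associated with a map of complexes. -/
def spaceMap {A B : GradedComplex.{v}} (φ : ComplexMap A B) : space.{v, u} A ⟶ space.{v, u} B where
  app n := ↾(fun f => ⟨φ.onSimplices f.down⟩)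
  naturality _ _ _ := rfl

end spaces
end AInf

/-! ### Complexes of morphisms, and constant faces -/

namespace AInf

open Word DirectSum AInfFunctorData

section homComplex
variable {K : Type w} [CommRing K] (C : AInfCategory.{w, v, u} K)

/-- The differential `m^1` on the total module of morphisms. -/
noncomputable def AInfCategory.dTot (x y : C.Obj) : C.Tot x y →ₗ[K] C.Tot x y :=
  IsMultilinear.ext C.m_multilinear nil nil

lemma AInfCategory.dTot_lof {x y : C.Obj} {k : ℤ} (a : C.Hom x y k) :
    C.dTot x y (hlof C k a) = C.mT (single a) :=
  IsMultilinear.ext_lof C.m_multilinear nil nil a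

lemma AInfCategory.dTot_lof' {x y : C.Obj} {k l : ℤ} (h : k + 1 = l) (a : C.Hom x y k) :
    C.dTot x y (hlof C k a) = hlof C l (C.d k l h a) :=
  (C.dTot_lof a).trans (AInfCategory.lof_d h a).symm

/-- The complex of morphisms, as a complex with a total group. -/
noncomputable def homGraded (x y : C.Obj) : GradedComplex.{v} where
  T := C.Tot x y
  gr e := (LinearMap.range (hlof C (x := x) (y := y) e)).toAddSubgroup
  d := (C.dTot x y).toAddMonoidHom
  d_mem := by
    rintro e _ ⟨a, rfl⟩
    exact ⟨_, (C.dTot_lof' rfl a).symm⟩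
  d_d a := by
    induction a using DirectSum.induction_on with
    | zero => simp
    | of k a =>
      have h1 := C.dTot_lof' (x := x) (y := y) (rfl : k + 1 = k + 1) a
      have h2 := C.dTot_lof' (x := x) (y := y) (rfl : k + 1 + 1 = k + 1 + 1)
        (C.d k (k + 1) rfl a)
      refine (congrArg (C.dTot x y) h1).trans (h2.trans ?_)
      rw [AInfCategory.d_d, map_zero]
    | add a b ha hb => rw [map_add, map_add, ha, hb, add_zero]

variable {C}

/-- A morphism, regarded as a morphism between given objects if it is one, and `0` otherwise. -/
noncomputable def prTo (x y : C.Obj) (M : Mor C) : C.Tot x y :=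
  open Classical in if h : M.1 = (x, y) then
    cast (congrArg (fun p : C.Obj × C.Obj => C.Tot p.1 p.2) h) M.2 else 0

lemma prTo_mk {x y : C.Obj} (a : C.Tot x y) : prTo x y ⟨(x, y), a⟩ = a := dif_pos rfl

lemma eq_mk_prTo {x y : C.Obj} {M : Mor C} (h : M.1 = (x, y)) : M = ⟨(x, y), prTo x y M⟩ := by
  obtain ⟨p, a⟩ := M
  obtain rfl : p = (x, y) := h
  rw [prTo_mk]

/-- `prTo` on morphisms between given objects, as an additive map. -/
noncomputable def prHom (x y : C.Obj) (p : C.Obj × C.Obj) : C.Tot p.1 p.2 →+ C.Tot x y where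
  toFun a := prTo x y ⟨p, a⟩
  map_zero' := by
    by_cases h : p = (x, y)
    · subst h; exact prTo_mk _
    · exact dif_neg h
  map_add' a b := by
    by_cases h : p = (x, y)
    · subst h; simp only [prTo_mk]
    · simp only [prTo, dif_neg h, add_zero]

lemma prHom_d (x y : C.Obj) (p : C.Obj × C.Obj) (a : C.Tot p.1 p.2) :
    prHom x y p (C.dTot p.1 p.2 a) = C.dTot x y (prHom x y p a) := by
  change prTo x y _ = C.dTot x y (prTo x y _)
  by_cases h : p = (x, y)
  · subst h; simp only [prTo_mk]
  · simp only [prTo, dif_neg h, map_zero]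

lemma prTo_mem (x y : C.Obj) {p : C.Obj × C.Obj} {a : C.Tot p.1 p.2} {e : ℤ}
    (h : a ∈ LinearMap.range (hlof C (x := p.1) (y := p.2) e)) :
    prTo x y ⟨p, a⟩ ∈ LinearMap.range (hlof C (x := x) (y := y) e) := by
  by_cases hp : p = (x, y)
  · subst hp; rwa [prTo_mk]
  · rw [prTo, dif_neg hp]; exact zero_mem _

lemma prHom_injective {x y : C.Obj} {p : C.Obj × C.Obj} (h : p = (x, y)) {a : C.Tot p.1 p.2}
    (ha : prTo x y ⟨p, a⟩ = 0) : a = 0 := by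
  subst h
  rwa [prTo_mk] at ha

/-- A degree zero morphism that equals a unit after an identification of objects. -/
def IsUnitAt (x : C.Obj) {p q : C.Obj} {e : ℤ} (u : C.Hom p q e) : Prop :=
  e = 0 ∧ (⟨(p, q), hlof C e u⟩ : Mor C) = ⟨(x, x), hlof C 0 (C.one x)⟩

lemma IsUnitAt.elim {x : C.Obj}
    {motive : ∀ {p q : C.Obj} {e : ℤ}, C.Hom p q e → Prop} (h : motive (C.one x)) {p q : C.Obj}
    {e : ℤ} {u : C.Hom p q e} (hu : IsUnitAt x u) : motive u := by
  obtain ⟨rfl, hu⟩ := hu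
  obtain ⟨h1, h2⟩ := Sigma.mk.inj hu
  obtain ⟨rfl, rfl⟩ := Prod.mk.inj h1
  have h3 := AInfCategory.lof_inj (eq_of_heq h2)
  rwa [h3]

end homComplex

section cone
variable {K : Type w} [CommRing K] {C : AInfCategory.{w, v, u} K} {n : ℕ}

lemma lsum_splits_mapLetters {C : AInfData.{w, v₁, u₁} K} {D : AInfData.{w, v₂, u₂} K}
    (F : AInfFunctorData C D) {x z : C.Obj} {M : Type v₃} [AddCommGroup M] (t : Word C.Hom x z)
    (f : (Σ y : D.Obj, Word D.Hom y (F.obj z) × Word D.Hom (F.obj x) y) → M) :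
    lsum (mapLetters F t).splits f =
      lsum t.splits fun s => f ⟨F.obj s.1, mapLetters F s.2.1, mapLetters F s.2.2⟩ := by
  induction t with
  | nil => rfl
  | cons a t ih =>
    simp only [mapLetters, splits_cons, lsum_cons, lsum_map]
    rw [ih]

/-- The functor on the face opposite to the last vertex. -/
noncomputable abbrev lastRestrict (F : AInfFunctorData (minimalData K (n + 1)) C.toAInfData) :
    AInfFunctorData (minimalData K n) C.toAInfData :=
  (minimalFunctorData K (face (Fin.last (n + 1)))).comp F

/-- The word of generators of the face opposite to the last vertex. -/
abbrev lastWord {i b : Fin (n + 1)} (w : Word (minimalData K n).Hom i b) :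
    Word (minimalData K (n + 1)).Hom (face (Fin.last (n + 1)) i) (face (Fin.last (n + 1)) b) :=
  mapLetters (minimalFunctorData K (face (Fin.last (n + 1)))) w

/-- The prefunctor is constant, with value the object `x`, on the face opposite to the last
vertex. -/
structure IsConstAt (x : C.Obj) (F : AInfFunctorData (minimalData K (n + 1)) C.toAInfData) :
    Prop where
  map_eq_zero : ∀ {i j : Fin (n + 1)} (w : Word (minimalData K n).Hom i j), 1 < w.length →
    (lastRestrict F).map w _ rfl = 0
  isUnitAt : ∀ {i j : Fin (n + 1)}, i ≤ j → IsUnitAt x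
    ((lastRestrict F).map (single (gen K i j)) _ rfl)

variable {F : AInfFunctorData (minimalData K (n + 1)) C.toAInfData} {x : C.Obj}

lemma lsum_expand_cone (hF : F.IsMulti) (hx : IsConstAt x F) {k : Fin (n + 2)} {i b : Fin (n + 1)}
    {e : ℤ} (g : (minimalData K (n + 1)).Hom (face (Fin.last (n + 1)) b) k e)
    (w : Word (minimalData K n).Hom i b) {M : Type v₁} [AddCommGroup M] [Module K M]
    {φ : Word C.Hom (F.obj (face (Fin.last (n + 1)) i)) (F.obj k) → M} (hφ : IsMultilinear K φ) :
    lsum (F.expand (cons g (lastWord w))) φ = lsum w.splits fun s =>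
      φ (cons (F.map (cons g (lastWord s.2.1)) _ rfl) (mapLetters (lastRestrict F) s.2.2)) := by
  rw [lsum_expand_cons, lsum_splits_mapLetters]
  refine lsum_congr fun s _ => ?_
  have h1 : IsMultilinear K fun q : Word C.Hom (F.obj (face (Fin.last (n + 1)) i))
      (F.obj (face (Fin.last (n + 1)) s.1)) =>
      φ (cons (F.map (cons g (lastWord s.2.1)) _ rfl) q) := hφ.cons _
  have h2 := lsum_expand_strict (minimalFunctorData K (face (Fin.last (n + 1))))
    (minimal_strict _) s.2.2 (φ := fun t => lsum (F.expand t) fun q =>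
      φ (cons (F.map (cons g (lastWord s.2.1)) _ rfl) q)) (hF.expand h1)
  refine h2.symm.trans ?_
  have h3 := lsum_expand_comp (F := minimalFunctorData K (face (Fin.last (n + 1)))) (G := F)
    s.2.2 (φ := fun q => φ (cons (F.map (cons g (lastWord s.2.1)) _ rfl) q)) h1
  refine h3.symm.trans ?_
  exact lsum_expand_strict (lastRestrict F) (fun w hw => hx.map_eq_zero w hw) s.2.2
    (φ := fun q => φ (cons (F.map (cons g (lastWord s.2.1)) _ rfl) q)) h1

/-- If the function `φ` vanishes on words of length at least `d` ending with a unit, then only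
the two coarsest decompositions contribute. -/
lemma lsum_expand_cone_append (hF : F.IsMulti) (hx : IsConstAt x F) {k : Fin (n + 2)}
    {i z b : Fin (n + 1)} {e : ℤ} (g : (minimalData K (n + 1)).Hom (face (Fin.last (n + 1)) b) k e)
    (s : Word (minimalData K n).Hom z b) (hiz : i ≤ z) {M : Type v₁} [AddCommGroup M] [Module K M]
    {φ : Word C.Hom (F.obj (face (Fin.last (n + 1)) i)) (F.obj k) → M} (hφ : IsMultilinear K φ)
    (hφ1 : ∀ {p : C.Obj} {e : ℤ} (u : C.Hom (F.obj (face (Fin.last (n + 1)) i)) p e)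
      (q : Word C.Hom p (F.obj k)), IsUnitAt x u → 1 < q.length → φ (q.append (cons u nil)) = 0) :
    lsum (F.expand (cons g (lastWord (s.append (single (gen K i z)))))) φ =
      φ (single (F.map (cons g (lastWord (s.append (single (gen K i z))))) _ rfl)) +
      φ (cons (F.map (cons g (lastWord s)) _ rfl)
        (single ((lastRestrict F).map (single (gen K i z)) _ rfl))) := by
  rw [lsum_expand_cone hF hx g _ hφ]
  refine (lsum_splits_append s (gen K i z) nil _).trans ?_
  rw [add_comm]
  congr 1
  · simp only [splits_nil, lsum_cons, lsum_nil, add_zero]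
    rfl
  · rw [lsum_splits_of_right]
    · rfl
    · intro j _ hj
      rw [mapLetters_append]
      refine hφ1 _ (cons (F.map (cons g (lastWord j.2.1)) _ rfl)
        (mapLetters (lastRestrict F) j.2.2)) (hx.isUnitAt hiz) ?_
      rw [length_cons, length_mapLetters]
      omega

end cone
end AInf

/-! ### The curvature of a cone -/

namespace AInf

open Word DirectSum AInfFunctorData

section cone
variable {K : Type w} [CommRing K] {C : AInfCategory.{w, v, u} K} {m n : ℕ}

lemma mapT_point (x : AInfFunctor (minimalCategory K 0) C) {i j : Fin (0 + 1)}
    (t : Word (minimalData K 0).Hom i j) (h : 1 < t.length) : x.mapT t = 0 := by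
  rw [isMultilinear_eq_toGen x.map_multilinear t]
  suffices h' : x.mapT (toGen t) = 0 by rw [h', smul_zero]
  cases t with
  | nil => simp at h
  | @cons p q e a t =>
    obtain rfl : p = j := @Subsingleton.elim (Fin 1) _ _ _
    have h1 : toGen (cons a t) = (nil : Word (minimalData K 0).Hom p p).append
        (cons ((minimalCategory K 0).one p) (toGen t)) := by
      rw [toGen, ← gen_self]
      rfl
    rw [h1]
    refine x.mapT_eq_zero _ _ ?_
    have h2 : ∀ {i j : Fin (0 + 1)} (t : Word (minimalData K 0).Hom i j),
        (toGen t).length = t.length := by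
      intro i j t
      induction t with
      | nil => rfl
      | cons a t ih => exact congrArg (· + 1) ih
    have h3 := h2 t
    simp only [nil_append, length_cons] at h ⊢
    omega

lemma isConstAt_of_comp {F : AInfFunctorData (minimalData K (n + 1)) C.toAInfData}
    (x : AInfFunctor (minimalCategory K 0) C) (α : Fin (n + 1) →o Fin (0 + 1))
    (h : lastRestrict F = (minimalFunctorData K α).comp x.toAInfFunctorData) :
    IsConstAt (x.obj 0) F := by
  constructor
  · intro i j w hw
    rw [map_eq_zero_iff (C := minimalCategory K n)]
    have : ∀ G : AInfFunctorData (minimalData K n) C.toAInfData,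
        G = (minimalFunctorData K α).comp x.toAInfFunctorData → G.mapT w = 0 := by
      rintro _ rfl
      refine (comp_minimal_mapT α x.isMulti w).trans (mapT_point x _ ?_)
      rw [length_mapLetters]
      exact hw
    exact this _ h
  · intro i j hij
    have : ∀ G : AInfFunctorData (minimalData K n) C.toAInfData,
        G = (minimalFunctorData K α).comp x.toAInfFunctorData →
        (⟨(G.obj i, G.obj j), G.mapT (single (gen K i j))⟩ : Mor C) =
          ⟨(x.obj 0, x.obj 0), hlof C 0 (C.one (x.obj 0))⟩ := by
      rintro _ rfl
      have h1 := ev_comp α x.isMulti (l := [j, i]) (by simpa using hij)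
      have h2 : ∀ k : Fin (0 + 1), k = 0 := fun k => @Subsingleton.elim (Fin 1) _ _ _
      simp only [List.map_cons, List.map_nil] at h1
      rw [h2 (α i), h2 (α j)] at h1
      refine (Option.some.inj h1).trans ?_
      refine congrArg (Sigma.mk (β := fun x : C.Obj × C.Obj => C.Tot x.1 x.2) _) ?_
      refine Eq.trans ?_ (congrArg (hlof C 0) (x.map_one 0))
      refine Eq.trans ?_ (AInfFunctorData.lof_map x.toAInfFunctorData
        (single ((minimalCategory K 0).one 0)) 0 (by simp)).symm
      rw [← gen_self]
      rfl
    exact ⟨by simp, this _ h⟩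

variable (F : AInfFunctorData (minimalData K (n + 1)) C.toAInfData) (x y : C.Obj)

/-- The values of a functor on the lists of vertices starting from the last vertex. -/
noncomputable def coneVal (l : List (Fin (n + 1))) : C.Tot x y :=
  prTo x y (morOf F ⟨_, chainWord K (Fin.last (n + 1)) (l.map (face (Fin.last (n + 1))))⟩)

lemma cone_sigma {b : Fin (n + 1)} {l : List (Fin (n + 1))} (h : (b :: l).IsChain (· ≥ ·)) :
    (⟨face (Fin.last (n + 1)) (src b l), cons (gen K (face (Fin.last (n + 1)) b) (Fin.last (n + 1)))
      (lastWord (chainWord K b l))⟩ : Σ i, Word (minimalData K (n + 1)).Hom i (Fin.last (n + 1))) =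
    ⟨_, chainWord K (Fin.last (n + 1)) ((b :: l).map (face (Fin.last (n + 1))))⟩ :=
  congrArg (fun t : Σ i, Word (minimalData K (n + 1)).Hom i (face (Fin.last (n + 1)) b) =>
    (⟨t.1, cons (gen K (face (Fin.last (n + 1)) b) (Fin.last (n + 1))) t.2⟩ :
      Σ i, Word (minimalData K (n + 1)).Hom i (Fin.last (n + 1))))
    (mapLetters_chainWord (face (Fin.last (n + 1))) h)

lemma chainWord_append_singleton (b : Fin (n + 1)) (l : List (Fin (n + 1))) (c : Fin (n + 1)) :
    (⟨src b (l ++ [c]), chainWord K b (l ++ [c])⟩ : Σ i, Word (minimalData K n).Hom i b) =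
      ⟨c, (chainWord K b l).append (single (gen K c (src b l)))⟩ := by
  induction l generalizing b with
  | nil => rfl
  | cons d l ih =>
    exact congrArg (fun t : Σ i, Word (minimalData K n).Hom i d =>
      (⟨t.1, cons (gen K d b) t.2⟩ : Σ i, Word (minimalData K n).Hom i b)) (ih d)

lemma IsUnitAt.mT_cons {x : C.Obj} {p q z : C.Obj} {e k : ℤ} {u : C.Hom p q e}
    (hu : IsUnitAt x u) (B : C.Hom q z k) :
    (⟨(p, z), C.mT (cons B (single u))⟩ : Mor C) = ⟨(q, z), hlof C k B⟩ := by
  refine hu.elim (motive := fun {p q e} u => ∀ B : C.Hom q z k,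
    (⟨(p, z), C.mT (cons B (single u))⟩ : Mor C) = ⟨(q, z), hlof C k B⟩) ?_ B
  intro B
  rw [C.mT_one_right]

lemma IsUnitAt.mT_eq_zero {x : C.Obj} {p q z : C.Obj} {e : ℤ} {u : C.Hom p q e}
    (hu : IsUnitAt x u) (s : Word C.Hom q z) (hs : 1 < s.length) :
    C.mT (s.append (cons u nil)) = 0 := by
  refine hu.elim (motive := fun {p q e} u => ∀ s : Word C.Hom q z, 1 < s.length →
    C.mT (s.append (cons u nil)) = 0) ?_ s hs
  intro s hs
  refine C.mT_one s nil ?_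
  simp only [length_append, length_cons, length_nil]
  omega

lemma IsUnitAt.mapT_eq_zero {D : AInfCategory.{w, v₁, u₁} K} (G : AInfFunctor C D)
    {x : C.Obj} {p q z : C.Obj} {e : ℤ} {u : C.Hom p q e}
    (hu : IsUnitAt x u) (s : Word C.Hom q z) (hs : 0 < s.length) :
    G.mapT (s.append (cons u nil)) = 0 := by
  refine hu.elim (motive := fun {p q e} u => ∀ s : Word C.Hom q z, 0 < s.length →
    G.mapT (s.append (cons u nil)) = 0) ?_ s hs
  intro s hs
  refine G.mapT_eq_zero s nil ?_
  simp only [length_append, length_cons, length_nil]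
  omega

variable {F} {x}

lemma coneVal_nil (uF : IsUnital (C := minimalCategory K (n + 1)) F) : coneVal F x y [] = 0 := by
  have h : F.mapT (chainWord K (Fin.last (n + 1)) []) = 0 := uF.mapT_nil _
  refine (congrArg (fun a => prTo x y ⟨_, a⟩) h).trans ?_
  exact map_zero (prHom x y _)

lemma mT_expand_cone (hF : F.IsMulti) (uF : IsUnital (C := minimalCategory K (n + 1)) F)
    (hx : IsConstAt x F) {l : List (Fin (n + 1))} (hl : l.IsChain (· ≥ ·)) (hl0 : l ≠ []) :
    prTo x y ⟨(F.obj _, F.obj _), lsum (F.expand (chainWord K (Fin.last (n + 1))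
      (l.map (face (Fin.last (n + 1)))))) C.mT⟩ =
      C.dTot x y (coneVal F x y l) + coneVal F x y l.dropLast := by
  have hd : ∀ {p : C.Obj} {e : ℤ} (B : C.Hom p (F.obj (Fin.last (n + 1))) e),
      prTo x y ⟨(p, F.obj (Fin.last (n + 1))), C.mT (single B)⟩ =
        C.dTot x y (prTo x y ⟨(p, F.obj (Fin.last (n + 1))), hlof C e B⟩) := by
    intro p e B
    rw [← C.dTot_lof]
    exact prHom_d x y (p, F.obj (Fin.last (n + 1))) _
  cases l with
  | nil => exact absurd rfl hl0
  | cons b l =>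
  obtain rfl | ⟨l, c, rfl⟩ := List.eq_nil_or_concat' l
  · refine Eq.trans ?_ (congrArg (_ + ·) (coneVal_nil y uF).symm)
    rw [add_zero]
    refine (congrArg (fun a => prTo x y ⟨_, a⟩) ?_).trans (hd _)
    exact add_zero _
  · have hlb : (b :: l).IsChain (· ≥ ·) := hl.left_of_append (l₁ := b :: l) (l₂ := [c])
    have hc : c ≤ src b l := by
      have h1 := isChain_src hl
      exact (List.isChain_cons_cons.1 h1).1
    -- the word of generators, with its first and last letters split off
    have hS : (⟨face (Fin.last (n + 1)) c, cons (gen K (face (Fin.last (n + 1)) b)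
        (Fin.last (n + 1))) (lastWord ((chainWord K b l).append (single (gen K c (src b l)))))⟩ :
        Σ i, Word (minimalData K (n + 1)).Hom i (Fin.last (n + 1))) =
        ⟨_, chainWord K (Fin.last (n + 1)) ((b :: (l ++ [c])).map (face (Fin.last (n + 1))))⟩ := by
      refine Eq.trans ?_ (cone_sigma hl)
      exact congrArg (fun t : Σ i, Word (minimalData K n).Hom i b =>
        (⟨face (Fin.last (n + 1)) t.1, cons (gen K (face (Fin.last (n + 1)) b) (Fin.last (n + 1)))
          (lastWord t.2)⟩ : Σ i, Word (minimalData K (n + 1)).Hom i (Fin.last (n + 1))))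
        (chainWord_append_singleton b l c).symm
    have h1 := congrArg (fun t : Σ i, Word (minimalData K (n + 1)).Hom i (Fin.last (n + 1)) =>
      prTo x y ⟨(F.obj t.1, F.obj (Fin.last (n + 1))), lsum (F.expand t.2) C.mT⟩) hS
    refine h1.symm.trans ?_
    have h2 := lsum_expand_cone_append hF hx (gen K (face (Fin.last (n + 1)) b) (Fin.last (n + 1)))
      (chainWord K b l) hc (φ := C.mT) C.m_multilinear (fun u q hu hq => hu.mT_eq_zero q hq)
    refine (congrArg (fun a => prTo x y ⟨_, a⟩) h2).trans ?_
    refine (map_add (prHom x y _) _ _).trans ?_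
    refine congrArg₂ (· + ·) ((hd _).trans (congrArg (C.dTot x y) ?_)) ?_
    · exact congrArg (fun t => prTo x y (morOf F t)) hS
    · refine (congrArg (prTo x y) ((hx.isUnitAt hc).mT_cons _)).trans ?_
      have h3 := congrArg (fun t => prTo x y (morOf F t)) (cone_sigma (K := K) hlb)
      refine h3.trans ?_
      rw [coneVal, ← List.cons_append, List.dropLast_concat]

lemma src_eraseIdx (k : Fin (n + 1)) (l : List (Fin (n + 1))) {p : ℕ} (hp : p < l.length - 1) :
    src k (l.eraseIdx p) = src k l := by
  induction l generalizing k p with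
  | nil => rfl
  | cons a l ih =>
    cases p with
    | zero =>
      cases l with
      | nil => simp at hp
      | cons b l => rfl
    | succ p => exact ih a (by simp at hp; omega)

lemma insertSum_cone (hF : F.IsMulti) {l : List (Fin (n + 1))} (hl : l.IsChain (· ≥ ·)) :
    prTo x y ⟨(F.obj _, F.obj _), insertSum (fun s => (minimalData K (n + 1)).m s _ rfl) F.mapT
      (chainWord K (Fin.last (n + 1)) (l.map (face (Fin.last (n + 1)))))⟩ =
      interiorSum (coneVal F x y) l := by
  set L := l.map (face (Fin.last (n + 1))) with hL
  have hLc : (Fin.last (n + 1) :: L).IsChain (· ≥ ·) := by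
    have h1 := isChain_map_ge (face (Fin.last (n + 1))) hl
    rw [List.isChain_iff_pairwise, List.pairwise_cons]
    exact ⟨fun a _ => Fin.le_last a, List.isChain_iff_pairwise.1 h1⟩
  let g : List (Fin (n + 2)) → C.Tot (F.obj (src (Fin.last (n + 1)) L))
      (F.obj (Fin.last (n + 1))) := fun s =>
    if h : src (Fin.last (n + 1)) s = src (Fin.last (n + 1)) L then
      F.mapT (h ▸ chainWord K (Fin.last (n + 1)) s) else 0
  have h1 := insertSum_chainWord (φ := F.mapT) (hF (src (Fin.last (n + 1)) L) (Fin.last (n + 1)))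
    (g := g) (fun s hs _ => by simp only [g, dif_pos hs]) L rfl hLc
  refine (congrArg (fun a => prTo x y ⟨_, a⟩) h1).trans ?_
  refine (map_sum (prHom x y _) _ _).trans ?_
  have hlen : L.length = l.length := by rw [hL, List.length_map]
  rw [interiorSum, hlen]
  refine Finset.sum_congr rfl fun p hp => ?_
  rw [Finset.mem_range] at hp
  rw [Units.smul_def, map_zsmul, ← Units.smul_def]
  congr 1
  have h2 : src (Fin.last (n + 1)) (L.eraseIdx p) = src (Fin.last (n + 1)) L :=
    src_eraseIdx _ _ (by rw [hlen]; exact hp)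
  have h3 : g (L.eraseIdx p) = F.mapT (h2 ▸ chainWord K (Fin.last (n + 1)) (L.eraseIdx p)) :=
    dif_pos h2
  have h4 : ∀ (i : Fin (n + 2)) (h : src (Fin.last (n + 1)) (L.eraseIdx p) = i),
      prTo x y ⟨(F.obj i, F.obj (Fin.last (n + 1))),
        F.mapT (h ▸ chainWord K (Fin.last (n + 1)) (L.eraseIdx p))⟩ =
      prTo x y (morOf F ⟨_, chainWord K (Fin.last (n + 1)) (L.eraseIdx p)⟩) := by
    rintro _ rfl
    rfl
  refine (congrArg (fun a => prTo x y ⟨_, a⟩) h3).trans ((h4 _ h2).trans ?_)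
  rw [coneVal, hL, List.eraseIdx_map]

/-- The curvature of a prefunctor that is constant on the face opposite to the last vertex is linear
in its remaining values. -/
lemma curv_cone (hF : F.IsMulti) (uF : IsUnital (C := minimalCategory K (n + 1)) F)
    (hx : IsConstAt x F) {l : List (Fin (n + 1))} (hl : l.IsChain (· ≥ ·)) (hl0 : l ≠ []) :
    prTo x y ⟨(F.obj _, F.obj _), curv (C := minimalCategory K (n + 1)) F (chainWord K (Fin.last (n + 1))
      (l.map (face (Fin.last (n + 1)))))⟩ =
      C.dTot x y (coneVal F x y l) + boundarySum (coneVal F x y) l := by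
  refine (map_sub (prHom x y _) _ _).trans ?_
  refine (congrArg₂ (· - ·) (mT_expand_cone y hF uF hx hl hl0) (insertSum_cone y hF hl)).trans ?_
  have hlen : 0 < l.length := List.length_pos_iff.2 hl0
  obtain ⟨N, hN⟩ : ∃ N, l.length = N + 1 := ⟨l.length - 1, by omega⟩
  rw [boundarySum, hN, Finset.sum_range_succ, interiorSum, hN]
  simp only [Nat.add_sub_cancel, Nat.sub_self, pow_zero, one_smul]
  have h1 : l.eraseIdx N = l.dropLast := by
    exact List.eraseIdx_eq_dropLast hN.symm
  rw [h1, add_sub_assoc, sub_eq_add_neg, add_comm (coneVal F x y l.dropLast),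
    ← Finset.sum_neg_distrib]
  congr 2
  refine Finset.sum_congr rfl fun p hp => ?_
  rw [Finset.mem_range] at hp
  rw [show N - p = (N + 1 - 2 - p) + 1 by omega, pow_succ, mul_neg_one, Units.neg_smul]

end cone
end AInf

/-! ### Cones and their cochains -/

namespace AInf

open Word DirectSum AInfFunctorData SimplexCategory

section cone
variable {K : Type w} [CommRing K] {C : AInfCategory.{w, v, u} K} {m n : ℕ}

/-- The simplices of the mapping space of the nerve: the functors on `[n+1]_K` that are constant
on the face opposite to the last vertex. -/
structure IsCone (x y : AInfFunctor (minimalCategory K 0) C)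
    (σ : AInfFunctor (minimalCategory K (n + 1)) C) : Prop where
  left : (minimalFunctor K (face (Fin.last (n + 1)))).comp σ =
    (minimalFunctor K (OrderHom.const _ 0)).comp x
  right : (minimalFunctor K (OrderHom.const _ (Fin.last (n + 1)))).comp σ = y

namespace IsCone
variable {x y : AInfFunctor (minimalCategory K 0) C} {σ : AInfFunctor (minimalCategory K (n + 1)) C}

lemma isConstAt (h : IsCone x y σ) : IsConstAt (x.obj 0) σ.toAInfFunctorData :=
  isConstAt_of_comp x _ (congrArg AInfFunctor.toAInfFunctorData h.left)

lemma obj_last (h : IsCone x y σ) : σ.obj (Fin.last (n + 1)) = y.obj 0 :=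
  congrArg (fun F : AInfFunctor (minimalCategory K 0) C => F.obj 0) h.right

lemma obj_face (h : IsCone x y σ) (i : Fin (n + 1)) :
    σ.obj (face (Fin.last (n + 1)) i) = x.obj 0 :=
  congrArg (fun F : AInfFunctor (minimalCategory K n) C => F.obj i) h.left

end IsCone

lemma mapT_chainWord_eq_zero {F : AInfFunctorData (minimalData K n) C.toAInfData}
    (uF : IsUnital (C := minimalCategory K n) F) {k : Fin (n + 1)} {l : List (Fin (n + 1))}
    (h : (k :: l).IsChain (· ≥ ·)) (h' : ¬ (k :: l).IsChain (· > ·)) (hl : 1 < l.length) :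
    F.mapT (chainWord K k l) = 0 := by
  obtain h1 | ⟨z, s, t, hst⟩ := isChain_gt_or_exists_one (K := K) h
  · exact absurd h1 h'
  · refine (congrArg F.mapT hst).trans (uF.mapT_one s t ?_)
    rw [← hst]
    exact hl.trans_eq (length_chainWord k l).symm

lemma isChain_last {R : Fin (n + 2) → Fin (n + 2) → Prop} [IsTrans _ R] {l : List (Fin (n + 1))}
    (hR : ∀ i, R (Fin.last (n + 1)) (face (Fin.last (n + 1)) i))
    (h : (l.map (face (Fin.last (n + 1)))).IsChain R) :
    (Fin.last (n + 1) :: l.map (face (Fin.last (n + 1)))).IsChain R := by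
  rw [List.isChain_iff_pairwise] at h
  rw [List.isChain_iff_pairwise, List.pairwise_cons]
  refine ⟨fun a ha => ?_, h⟩
  obtain ⟨b, _, rfl⟩ := List.mem_map.1 ha
  exact hR b

lemma face_last_lt (i : Fin (n + 1)) : face (Fin.last (n + 1)) i < Fin.last (n + 1) :=
  lt_of_le_of_ne (Fin.le_last _) (Fin.succAbove_ne _ _)

lemma isChain_last_ge {l : List (Fin (n + 1))} (h : l.IsChain (· ≥ ·)) :
    (Fin.last (n + 1) :: l.map (face (Fin.last (n + 1)))).IsChain (· ≥ ·) :=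
  isChain_last (fun i => le_of_lt (face_last_lt i)) (isChain_map_ge _ h)

lemma isChain_last_gt {l : List (Fin (n + 1))} :
    (Fin.last (n + 1) :: l.map (face (Fin.last (n + 1)))).IsChain (· > ·) ↔ l.IsChain (· > ·) := by
  constructor
  · intro h
    exact isChain_of_map_succAbove h.of_cons
  · intro h
    refine isChain_last (fun i => face_last_lt i) ?_
    rw [List.isChain_map]
    exact h.imp fun a b hab => Fin.strictMono_succAbove _ hab

lemma coneVal_eq_zero {F : AInfFunctorData (minimalData K (n + 1)) C.toAInfData}
    (uF : IsUnital (C := minimalCategory K (n + 1)) F) (x y : C.Obj) {l : List (Fin (n + 1))}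
    (h : l.IsChain (· ≥ ·)) (h' : ¬ (l ≠ [] ∧ l.IsChain (· > ·))) : coneVal F x y l = 0 := by
  by_cases hl : l = []
  · subst hl
    exact coneVal_nil y uF
  · have h1 : ¬ l.IsChain (· > ·) := fun h2 => h' ⟨hl, h2⟩
    have h2 := mapT_chainWord_eq_zero uF (isChain_last_ge h) (fun h3 => h1 (isChain_last_gt.1 h3))
      (by
        rw [List.length_map]
        by_contra h3
        match l, hl, h3, h1 with
        | [a], _, _, h1 => exact h1 (List.isChain_singleton _)
        | a :: b :: l, _, h3, _ => simp at h3)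
    refine (congrArg (fun a => prTo x y ⟨_, a⟩) h2).trans ?_
    exact map_zero (prHom x y _)

lemma coneVal_mem (F : AInfFunctorData (minimalData K (n + 1)) C.toAInfData) (x y : C.Obj)
    (l : List (Fin (n + 1))) :
    coneVal F x y l ∈ LinearMap.range (hlof C (x := x) (y := y) (1 - l.length)) := by
  refine prTo_mem x y ?_
  have h := ev_mem F (b := Fin.last (n + 1)) (l := l.map (face (Fin.last (n + 1)))) rfl
  rw [List.length_map] at h
  exact h

open Classical in
/-- The cochain of a cone. -/
noncomputable def coneSimplex {x y : AInfFunctor (minimalCategory K 0) C}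
    {σ : AInfFunctor (minimalCategory K (n + 1)) C} (h : IsCone x y σ) :
    Simplices (homGraded C (x.obj 0) (y.obj 0)) n :=
  ⟨fun l => if l.IsChain (· > ·) then coneVal σ.toAInfFunctorData (x.obj 0) (y.obj 0) l else 0, by
    intro l
    by_cases h1 : l.IsChain (· > ·)
    · exact (congrArg (· ∈ (homGraded C (x.obj 0) (y.obj 0)).gr (1 - l.length)) (if_pos h1)).mpr
        (coneVal_mem _ _ _ _)
    · exact (congrArg (· ∈ (homGraded C (x.obj 0) (y.obj 0)).gr (1 - l.length)) (if_neg h1)).mpr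
        (zero_mem _), by
    intro l hl
    by_cases h1 : l.IsChain (· > ·)
    · exact (if_pos h1).trans (coneVal_eq_zero σ.isUnital _ _ (isChain_ge h1) hl)
    · exact if_neg h1, by
    intro l hl
    have h2 : boundarySum (fun l => if l.IsChain (· > ·) then
        coneVal σ.toAInfFunctorData (x.obj 0) (y.obj 0) l else 0) l =
        boundarySum (coneVal σ.toAInfFunctorData (x.obj 0) (y.obj 0)) l := by
      refine boundarySum_congr fun p _ => if_pos ?_
      rw [List.isChain_iff_pairwise] at hl ⊢
      exact hl.sublist (List.eraseIdx_sublist _ _)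
    refine Eq.trans ?_ (congrArg Neg.neg h2).symm
    refine (congrArg _ (if_pos hl)).trans ?_
    by_cases hl0 : l = []
    · subst hl0
      refine (congrArg (C.dTot _ _) (coneVal_nil _ σ.isUnital)).trans ?_
      exact (map_zero _).trans (neg_zero.symm.trans (congrArg Neg.neg (boundarySum_nil _).symm))
    · have h1 := curv_cone (y.obj 0) σ.isMulti σ.isUnital h.isConstAt (isChain_ge hl) hl0
      rw [σ.curv_eq_zero] at h1
      exact eq_neg_of_add_eq_zero_left (h1.symm.trans (map_zero (prHom _ _ _)))⟩

lemma coneSimplex_apply {x y : AInfFunctor (minimalCategory K 0) C}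
    {σ : AInfFunctor (minimalCategory K (n + 1)) C} (h : IsCone x y σ) {l : List (Fin (n + 1))}
    (hl : l.IsChain (· ≥ ·)) :
    (coneSimplex h).1 l = coneVal σ.toAInfFunctorData (x.obj 0) (y.obj 0) l := by
  by_cases h1 : l.IsChain (· > ·)
  · exact if_pos h1
  · exact (if_neg h1).trans (coneVal_eq_zero σ.isUnital _ _ hl fun h2 => h1 h2.2).symm

/-- The cochain determines the cone. -/
lemma coneSimplex_injective {x y : AInfFunctor (minimalCategory K 0) C}
    {σ σ' : AInfFunctor (minimalCategory K (n + 1)) C} (h : IsCone x y σ) (h' : IsCone x y σ')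
    (he : coneSimplex h = coneSimplex h') : σ = σ' := by
  refine AInfFunctor.ext_data (ext_of_ev σ.isMulti σ'.isMulti σ.isUnital σ'.isUnital ?_)
  intro l hl
  by_cases hlast : Fin.last (n + 1) ∈ l
  · cases l with
    | nil => simp at hlast
    | cons b l =>
    obtain rfl : b = Fin.last (n + 1) := by
      have := le_of_isChain hl _ hlast
      exact Fin.last_le_iff.1 this
    have hl' : Fin.last (n + 1) ∉ l := by
      rw [List.isChain_iff_pairwise, List.pairwise_cons] at hl
      exact fun h => lt_irrefl _ (hl.1 _ h)
    obtain ⟨L, rfl⟩ := exists_map_succAbove hl'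
    refine congrArg some ?_
    change morOf _ ⟨_, chainWord K (Fin.last (n + 1)) (L.map (face (Fin.last (n + 1))))⟩ =
      morOf _ ⟨_, chainWord K (Fin.last (n + 1)) (L.map (face (Fin.last (n + 1))))⟩
    cases L with
    | nil =>
      have h1 : ∀ τ : AInfFunctor (minimalCategory K (n + 1)) C, IsCone x y τ →
          (⟨(τ.obj (Fin.last (n + 1)), τ.obj (Fin.last (n + 1))),
            τ.mapT (chainWord K (Fin.last (n + 1)) [])⟩ : Mor C) = ⟨(y.obj 0, y.obj 0), 0⟩ := by
        intro τ hτ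
        rw [show τ.mapT (chainWord K (Fin.last (n + 1)) []) = 0 from τ.isUnital.mapT_nil _,
          hτ.obj_last]
      exact (h1 σ h).trans (h1 σ' h').symm
    | cons b L =>
      have hL := isChain_last_gt.1 hl
      have hobj : ∀ τ : AInfFunctor (minimalCategory K (n + 1)) C, IsCone x y τ →
          (morOf τ.toAInfFunctorData ⟨_, chainWord K (Fin.last (n + 1))
            ((b :: L).map (face (Fin.last (n + 1))))⟩).1 = (x.obj 0, y.obj 0) := by
        intro τ hτ
        refine Prod.ext ?_ hτ.obj_last
        obtain ⟨c, _, hc⟩ := List.mem_map.1 (show src (face (Fin.last (n + 1)) b)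
          (L.map (face (Fin.last (n + 1)))) ∈ (b :: L).map (face (Fin.last (n + 1)))
          from src_mem _ _)
        refine Eq.trans ?_ (hτ.obj_face c)
        exact congrArg τ.obj hc.symm
      refine (eq_mk_prTo (hobj σ h)).trans (Eq.trans ?_ (eq_mk_prTo (hobj σ' h')).symm)
      refine congrArg (Sigma.mk (β := fun x : C.Obj × C.Obj => C.Tot x.1 x.2) _) ?_
      have h1 := congrArg (fun f => f.1 (b :: L)) he
      exact (coneSimplex_apply h (isChain_ge hL)).symm.trans
        (h1.trans (coneSimplex_apply h' (isChain_ge hL)))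
  · obtain ⟨L, rfl⟩ := exists_map_succAbove hlast
    have hL := isChain_ge (isChain_of_map_succAbove hl)
    refine (ev_comp (face (Fin.last (n + 1))) σ.isMulti hL).symm.trans
      (Eq.trans ?_ (ev_comp (face (Fin.last (n + 1))) σ'.isMulti hL))
    have h1 := congrArg AInfFunctor.toAInfFunctorData (h.left.trans h'.left.symm)
    exact congrArg (fun F => ev F L) h1

end cone
end AInf

/-! ### Cones with given cochain -/

namespace AInf

open Word DirectSum AInfFunctorData SimplexCategory

section cone
variable {K : Type w} [CommRing K] {C : AInfCategory.{w, v, u} K} {m n : ℕ}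

lemma ev_const_comp (x : AInfFunctor (minimalCategory K 0) C) (α : Fin (n + 1) →o Fin (0 + 1))
    {k : Fin (n + 1)} {l : List (Fin (n + 1))} (h : (k :: l).IsChain (· ≥ ·)) :
    ev ((minimalFunctorData K α).comp x.toAInfFunctorData) (k :: l) =
      some ⟨(x.obj 0, x.obj 0), if l.length = 1 then hlof C 0 (C.one (x.obj 0)) else 0⟩ := by
  have h0 : ∀ k : Fin (0 + 1), k = 0 := fun k => @Subsingleton.elim (Fin 1) _ _ _
  refine (ev_comp α x.isMulti h).trans (congrArg some ?_)
  have hne : ∀ l : List (Fin (n + 1)), l.length ≠ 1 →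
      x.mapT (chainWord K (α k) (l.map α)) = 0 := by
    intro l hl
    cases l with
    | nil => exact x.isUnital.mapT_nil _
    | cons b l =>
      refine mapT_point x _ ?_
      rw [length_chainWord, List.length_map]
      simp only [List.length_cons] at hl ⊢
      omega
  have hobj : ∀ i : Fin (0 + 1), x.obj i = x.obj 0 := fun i => congrArg x.obj (h0 i)
  by_cases hl : l.length = 1
  · obtain ⟨b, rfl⟩ := List.length_eq_one_iff.1 hl
    have h1 : ∀ i j : Fin (0 + 1), (⟨(x.obj i, x.obj j), x.mapT (single (gen K i j))⟩ : Mor C) =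
        ⟨(x.obj 0, x.obj 0), hlof C 0 (C.one (x.obj 0))⟩ := by
      intro i j
      rw [h0 i, h0 j]
      refine congrArg (Sigma.mk (β := fun x : C.Obj × C.Obj => C.Tot x.1 x.2) _) ?_
      refine Eq.trans ?_ (congrArg (hlof C 0) (x.map_one 0))
      refine Eq.trans ?_ (AInfFunctorData.lof_map x.toAInfFunctorData
        (single ((minimalCategory K 0).one 0)) 0 (by simp)).symm
      rw [← gen_self]
    exact (h1 (α b) (α k)).trans (congrArg (Sigma.mk (β := fun x : C.Obj × C.Obj =>
      C.Tot x.1 x.2) _) (if_pos rfl).symm)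
  · rw [if_neg hl]
    refine (congrArg (Sigma.mk (β := fun x : C.Obj × C.Obj => C.Tot x.1 x.2) _)
      (hne l hl)).trans ?_
    dsimp only
    rw [hobj (src _ _), hobj (α k)]

/-- Functors on `[0]_K` are objects. -/
lemma ext_point {x y : AInfFunctor (minimalCategory K 0) C} (h : x.obj 0 = y.obj 0) : x = y := by
  refine AInfFunctor.ext_data (ext_of_ev x.isMulti y.isMulti x.isUnital y.isUnital ?_)
  intro l hl
  have hv : ∀ z : AInfFunctor (minimalCategory K 0) C,
      ev z.toAInfFunctorData [0] = some ⟨(z.obj 0, z.obj 0), 0⟩ := by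
    intro z
    exact congrArg some (congrArg (Sigma.mk (β := fun x : C.Obj × C.Obj => C.Tot x.1 x.2) _)
      (z.isUnital.mapT_nil _))
  match l with
  | [] => rfl
  | [a] =>
    obtain rfl : a = 0 := @Subsingleton.elim (Fin 1) _ _ _
    rw [hv, hv, h]
  | a :: b :: l =>
    have h1 := (List.isChain_cons_cons.1 hl).1
    obtain rfl : a = b := @Subsingleton.elim (Fin 1) _ _ _
    exact absurd h1 (lt_irrefl _)

variable (x y : C.Obj) (f : List (Fin (n + 1)) → C.Tot x y)

/-- The objects of a cone: `y` at the last vertex, and `x` elsewhere. -/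
def coneObj (i : Fin (n + 2)) : C.Obj := if i = Fin.last (n + 1) then y else x

open Classical in
/-- The values of a cone with given cochain `f`, together with their sources and targets: the value
is read off from `f` on lists starting from the last vertex, and on all other lists it is that of
the constant functor at `x`. -/
noncomputable def coneMor (k : Fin (n + 2)) (l : List (Fin (n + 2))) : Mor C :=
  if k = Fin.last (n + 1) then
    ⟨(x, y), if h : ∃ L : List (Fin (n + 1)), L.map (face (Fin.last (n + 1))) = l then f h.choose
      else 0⟩
  else ⟨(x, x), if l.length = 1 then hlof C 0 (C.one x) else 0⟩

/-- The values of a cone with given cochain `f`, as morphisms between the objects of the cone. -/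
noncomputable def coneValues (i k : Fin (n + 2)) (l : List (Fin (n + 2))) :
    C.Tot (coneObj x y i) (coneObj x y k) :=
  prTo _ _ (coneMor x y f k l)

variable {x y f}

lemma coneMor_last (L : List (Fin (n + 1))) :
    coneMor x y f (Fin.last (n + 1)) (L.map (face (Fin.last (n + 1)))) = ⟨(x, y), f L⟩ := by
  have h : ∃ L' : List (Fin (n + 1)), L'.map (face (Fin.last (n + 1))) =
      L.map (face (Fin.last (n + 1))) := ⟨L, rfl⟩
  have h1 : h.choose = L := List.map_injective_iff.2 (Fin.succAbove_right_injective) h.choose_spec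
  rw [coneMor, if_pos rfl, dif_pos h, h1]

lemma coneMor_of_ne {k : Fin (n + 2)} (hk : k ≠ Fin.last (n + 1)) (l : List (Fin (n + 2))) :
    coneMor x y f k l = ⟨(x, x), if l.length = 1 then hlof C 0 (C.one x) else 0⟩ := if_neg hk

lemma hasDegree_coneValues (hf : ∀ l, f l ∈ LinearMap.range (hlof C (x := x) (y := y) (1 - l.length))) :
    HasDegree (coneObj x y) (coneValues x y f) := by
  intro i k l
  refine prTo_mem _ _ ?_
  suffices h : ∀ M : Mor C, coneMor x y f k l = M →
      M.2 ∈ LinearMap.range (hlof C (x := M.1.1) (y := M.1.2) (1 - l.length)) from h _ rfl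
  intro M hM
  rw [coneMor] at hM
  split_ifs at hM with h1 h2 h3 <;> subst hM
  · have h3 := hf h2.choose
    have h4 := congrArg List.length h2.choose_spec
    rw [List.length_map] at h4
    rw [h4] at h3
    exact h3
  · exact zero_mem _
  · rw [h3]
    exact ⟨_, rfl⟩
  · exact zero_mem _

lemma coneObj_last : coneObj x y (Fin.last (n + 1)) = y := if_pos rfl

lemma coneObj_face (i : Fin (n + 1)) : coneObj x y (face (Fin.last (n + 1)) i) = x :=
  if_neg (face_last_lt i).ne

lemma ne_src_last {l : List (Fin (n + 1))} (hl : l ≠ []) :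
    ∃ i, src (Fin.last (n + 1)) (l.map (face (Fin.last (n + 1)))) = face (Fin.last (n + 1)) i := by
  cases l with
  | nil => exact absurd rfl hl
  | cons b l =>
    obtain ⟨c, _, hc⟩ := List.mem_map.1 (show src (face (Fin.last (n + 1)) b)
      (l.map (face (Fin.last (n + 1)))) ∈ (b :: l).map (face (Fin.last (n + 1))) from src_mem _ _)
    exact ⟨c, hc.symm⟩

lemma coneVal_ofValues (hf : ∀ l, f l ∈ LinearMap.range (hlof C (x := x) (y := y) (1 - l.length)))
    {l : List (Fin (n + 1))} (hl : l.IsChain (· > ·)) (hl0 : l ≠ []) :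
    coneVal (ofValues (coneObj x y) (coneValues x y f)) x y l = f l := by
  have h1 := ofValues_chainWord (hasDegree_coneValues hf) (isChain_last_gt.2 hl) (by simpa using hl0)
  refine (congrArg (fun a => prTo x y ⟨_, a⟩) h1).trans ?_
  obtain ⟨i, hi⟩ := ne_src_last hl0
  have h2 : coneMor x y f (Fin.last (n + 1)) (l.map (face (Fin.last (n + 1)))) =
    ⟨(coneObj x y (src (Fin.last (n + 1)) (l.map (face (Fin.last (n + 1))))),
      coneObj x y (Fin.last (n + 1))), _⟩ := eq_mk_prTo (by
    rw [coneMor_last, hi, coneObj_face, coneObj_last])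
  refine (congrArg (prTo x y) (h2.symm.trans (coneMor_last l))).trans (prTo_mk _)

/-- The prefunctor with the values of a cone is constant on the face opposite to the last vertex. -/
lemma ofValues_const (x : AInfFunctor (minimalCategory K 0) C) (α : Fin (n + 1) →o Fin (0 + 1))
    {f : List (Fin (n + 1)) → C.Tot (x.obj 0) y}
    (hf : ∀ l, f l ∈ LinearMap.range (hlof C (x := x.obj 0) (y := y) (1 - l.length))) :
    lastRestrict (ofValues (coneObj (x.obj 0) y) (coneValues (x.obj 0) y f)) =
      (minimalFunctorData K α).comp x.toAInfFunctorData := by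
  have hM := ofValues_isMulti (hasDegree_coneValues hf)
  have hU := ofValues_isUnital (hasDegree_coneValues hf)
  refine ext_of_ev (isMulti_comp_minimal _ hM) (isMulti_comp_minimal _ x.isMulti)
    (isUnital_comp_minimal _ hM hU) (isUnital_comp_minimal _ x.isMulti x.isUnital) ?_
  intro l hl
  cases l with
  | nil => rfl
  | cons k l =>
  rw [ev_const_comp x α (isChain_ge hl), ev_comp _ hM (isChain_ge hl)]
  refine congrArg some ?_
  by_cases hl0 : l = []
  · subst hl0
    refine (congrArg (Sigma.mk (β := fun x : C.Obj × C.Obj => C.Tot x.1 x.2) _)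
      (hU.mapT_nil _)).trans ?_
    have h1 : ∀ p : C.Obj, p = x.obj 0 → (⟨(p, p), 0⟩ : Mor C) = ⟨(x.obj 0, x.obj 0), 0⟩ := by
      rintro _ rfl
      rfl
    exact h1 _ (coneObj_face k)
  · have hl' : ((k :: l).map (face (Fin.last (n + 1)))).IsChain (· > ·) := by
      rw [List.isChain_map]
      exact hl.imp fun a b hab => Fin.strictMono_succAbove _ hab
    refine (congrArg (Sigma.mk (β := fun x : C.Obj × C.Obj => C.Tot x.1 x.2) _)
      (ofValues_chainWord (hasDegree_coneValues hf) hl' (by simpa using hl0))).trans ?_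
    have h1 := coneMor_of_ne (x := x.obj 0) (y := y) (f := f) (face_last_lt k).ne
      (l.map (face (Fin.last (n + 1))))
    refine (eq_mk_prTo ?_).symm.trans (h1.trans ?_)
    · rw [h1]
      obtain ⟨c, _, hc⟩ := List.mem_map.1 (show src (face (Fin.last (n + 1)) k)
        (l.map (face (Fin.last (n + 1)))) ∈ (k :: l).map (face (Fin.last (n + 1))) from src_mem _ _)
      refine Prod.ext ?_ (coneObj_face k).symm
      exact ((congrArg (coneObj (x.obj 0) y) hc.symm).trans (coneObj_face c)).symm
    · rw [List.length_map]

lemma curv_nil {F : AInfFunctorData (minimalData K n) C.toAInfData} (hF : F.IsMulti)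
    (k : Fin (n + 1)) : curv (C := minimalCategory K n) F (nil : Word (minimalData K n).Hom k k) = 0 := by
  have h1 : C.mT (nil : Word C.Hom (F.obj k) (F.obj k)) = 0 :=
    (congrArg (hlof C 2) (C.m_nil _)).trans (map_zero _)
  have h2 : F.mapT (cons ((minimalCategory K n).m (nil : Word (minimalData K n).Hom k k) _ rfl) nil) = 0 := by
    rw [show (minimalCategory K n).m (nil : Word (minimalData K n).Hom k k) _ rfl = 0 from
      (minimalCategory K n).m_nil k]
    exact IsMultilinear.zero (hF k k) nil nil _
  refine sub_eq_zero.2 ?_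
  simp only [AInfFunctorData.expand, insertSum, splits_nil, lsum_cons, lsum_nil, add_zero, nil_append]
  rw [h1, h2, smul_zero]

/-- Every simplex of the space of morphisms is the cochain of a cone. -/
lemma exists_coneSimplex_eq (x y : AInfFunctor (minimalCategory K 0) C)
    (f : Simplices (homGraded C (x.obj 0) (y.obj 0)) n) :
    ∃ (σ : AInfFunctor (minimalCategory K (n + 1)) C) (h : IsCone x y σ), coneSimplex h = f := by
  have hf := f.2.1
  have hD := hasDegree_coneValues hf
  have hM := ofValues_isMulti hD
  have hU := ofValues_isUnital hD
  set F := ofValues (coneObj (x.obj 0) (y.obj 0)) (coneValues (x.obj 0) (y.obj 0) f.1) with hF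
  have hleft := ofValues_const x (OrderHom.const _ 0) hf
  have hc := isConstAt_of_comp x _ hleft
  have hval : ∀ {l : List (Fin (n + 1))}, l.IsChain (· > ·) →
      coneVal F (x.obj 0) (y.obj 0) l = f.1 l := by
    intro l hl
    by_cases hl0 : l = []
    · subst hl0
      exact (coneVal_nil _ hU).trans (f.2.2.1 _ fun h => h.1 rfl).symm
    · exact coneVal_ofValues hf hl hl0
  have hcurv : ∀ (k : Fin (n + 2)) (l : List (Fin (n + 2))), (k :: l).IsChain (· > ·) →
      curv (C := minimalCategory K (n + 1)) F (chainWord K k l) = 0 := by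
    intro k l hl
    -- on words that end in the last vertex, the curvature is `d f + ∑ ± f (faces)`; all other words lie
    -- in the face on which the prefunctor is constant
    by_cases hlast : Fin.last (n + 1) ∈ k :: l
    · obtain rfl : k = Fin.last (n + 1) := Fin.last_le_iff.1 (le_of_isChain hl _ hlast)
      have hl' : Fin.last (n + 1) ∉ l := by
        rw [List.isChain_iff_pairwise, List.pairwise_cons] at hl
        exact fun h => lt_irrefl _ (hl.1 _ h)
      obtain ⟨L, rfl⟩ := exists_map_succAbove hl'
      by_cases hL0 : L = []
      · subst hL0
        exact curv_nil hM _
      · have hL := isChain_last_gt.1 hl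
        refine prHom_injective (x := x.obj 0) (y := y.obj 0) ?_
          ((curv_cone (y.obj 0) hM hU hc (isChain_ge hL) hL0).trans ?_)
        · obtain ⟨i, hi⟩ := ne_src_last hL0
          exact Prod.ext ((congrArg _ hi).trans (coneObj_face i)) coneObj_last
        · rw [hval hL]
          have h1 : boundarySum (coneVal F (x.obj 0) (y.obj 0)) L = boundarySum f.1 L := by
            refine boundarySum_congr fun p _ => hval ?_
            rw [List.isChain_iff_pairwise] at hL ⊢
            exact hL.sublist (List.eraseIdx_sublist _ _)
          refine (congrArg (_ + ·) h1).trans ?_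
          refine (congrArg (· + _) (f.2.2.2 L hL)).trans ?_
          exact neg_add_cancel (G := C.Tot _ _) _
    · obtain ⟨L, hL⟩ := exists_map_succAbove hlast
      cases L with
      | nil => cases hL
      | cons b' L =>
        obtain ⟨rfl, rfl⟩ := List.cons.inj hL
        have h1 := curv_comp_minimal (face (Fin.last (n + 1))) hM (chainWord K b' L)
        have h2 : curv (C := minimalCategory K n) (lastRestrict F) (chainWord K b' L) = 0 := by
          rw [hleft]
          exact ((minimalFunctor K _).comp x).curv_eq_zero _
        rw [h2] at h1
        have h3 := mapLetters_chainWord (K := K) (face (Fin.last (n + 1)))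
          (isChain_ge (isChain_of_map_succAbove hl))
        have h4 : ∀ (s s' : Σ i, Word (minimalData K (n + 1)).Hom i (face (Fin.last (n + 1)) b')),
            s = s' → curv (C := minimalCategory K (n + 1)) F s.2 = 0 →
            curv (C := minimalCategory K (n + 1)) F s'.2 = 0 := by
          rintro s _ rfl h
          exact h
        exact h4 _ _ h3 h1.symm
  let σ : AInfFunctor (minimalCategory K (n + 1)) C := toFunctor F hM hU fun i k t =>
    curv_eq_zero hM hU (fun l _ hl => hcurv k l hl) t
  have hσ : IsCone x y σ := ⟨AInfFunctor.ext_data hleft, ext_point coneObj_last⟩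
  refine ⟨σ, hσ, Subtype.ext (funext fun l => ?_)⟩
  by_cases hl : l.IsChain (· > ·)
  · exact (coneSimplex_apply hσ (isChain_ge hl)).trans (hval hl)
  · exact ((coneSimplex hσ).2.2.1 l fun h => hl h.2).trans (f.2.2.1 l fun h => hl h.2).symm

end cone
end AInf

/-! ### Mapping spaces of the nerve -/

namespace AInf

open Word DirectSum AInfFunctorData SimplexCategory

section mappingSpace
variable {K : Type w} [CommRing K] {C D : AInfCategory.{w, v, u} K} {m n : ℕ}

lemma coneVal_comp_coneMap {a b : SimplexCategory} (α : a ⟶ b)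
    {F : AInfFunctorData (minimalData K (b.len + 1)) C.toAInfData} (hF : F.IsMulti) (x y : C.Obj)
    {l : List (Fin (a.len + 1))} (hl : l.IsChain (· ≥ ·)) :
    coneVal ((minimalFunctorData K (coneMap α).toOrderHom).comp F) x y l =
      coneVal F x y (l.map α.toOrderHom) := by
  have h1 := ev_comp (coneMap α).toOrderHom hF (isChain_last_ge hl)
  have h2 : (Fin.last (a.len + 1) :: l.map (face (Fin.last (a.len + 1)))).map
      (coneMap α).toOrderHom = Fin.last (b.len + 1) :: (l.map α.toOrderHom).map
        (face (Fin.last (b.len + 1))) := by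
    rw [List.map_cons, List.map_map, List.map_map]
    refine congrArg₂ _ (coneMap_last α) (List.map_congr_left fun i _ => ?_)
    exact congrArg (fun f => (SimplexCategory.Hom.toOrderHom f) i) (lastFace_coneMap α)
  rw [h2] at h1
  exact congrArg (prTo x y) (Option.some.inj h1)

lemma isCone_homR {x y : (nerve C).obj (op (mk 0))} {n : SimplexCategoryᵒᵖ}
    (σ : (homR (nerve C) x y).obj n) : IsCone (n := n.unop.len) x y σ.1 := ⟨σ.2.1, σ.2.2⟩

/-- The right mapping spaces of the nerve are the spaces associated with the complexes of
morphisms. -/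
noncomputable def homRToSpace (x y : (nerve C).obj (op (mk 0))) :
    homR (nerve C) x y ⟶ space.{v, max u w} (homGraded C (x.obj 0) (y.obj 0)) where
  app n := ↾(fun σ => ⟨coneSimplex (isCone_homR σ)⟩)
  naturality a b α := by
    ext σ
    refine ULift.ext _ _ (Subtype.ext (funext fun l => ?_))
    by_cases hl : l.IsChain (· > ·)
    · refine (coneSimplex_apply (isCone_homR ((homR (nerve C) x y).map α σ)) (isChain_ge hl)).trans
        (Eq.trans ?_ (coneSimplex_apply (isCone_homR σ)
        (isChain_map_ge α.unop.toOrderHom (isChain_ge hl))).symm)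
      exact coneVal_comp_coneMap α.unop (AInfFunctor.isMulti σ.1) _ _ (isChain_ge hl)
    · exact ((coneSimplex (isCone_homR ((homR (nerve C) x y).map α σ))).2.2.1 l
        (fun h => hl h.2)).trans (((coneSimplex (isCone_homR σ)).restrict
          α.unop.toOrderHom).2.2.1 l (fun h => hl h.2)).symm

/-- Cones are determined by their cochains, and every simplex of the space is the cochain of a cone. -/
instance (x y : (nerve C).obj (op (mk 0))) : IsIso (homRToSpace x y) := by
  rw [NatTrans.isIso_iff_isIso_app]
  intro n
  rw [isIso_iff_bijective]
  constructor
  · intro σ σ' h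
    exact Subtype.ext (coneSimplex_injective (isCone_homR σ) (isCone_homR σ') (congrArg ULift.down h))
  · rintro ⟨f⟩
    obtain ⟨σ, h, hf⟩ := exists_coneSimplex_eq x y f
    exact ⟨⟨σ, h.left, h.right⟩, congrArg ULift.up hf⟩

/-- The linear map `F^1` on the total module of morphisms. -/
noncomputable def AInfFunctor.totMap (F : AInfFunctor C D) (x y : C.Obj) :
    C.Tot x y →ₗ[K] D.Tot (F.obj x) (F.obj y) :=
  IsMultilinear.ext F.map_multilinear nil nil

lemma AInfFunctor.totMap_lof (F : AInfFunctor C D) {x y : C.Obj} {k : ℤ} (a : C.Hom x y k) :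
    F.totMap x y (hlof C k a) = F.mapT (single a) :=
  IsMultilinear.ext_lof F.map_multilinear nil nil a

/-- The map of complexes `F^1`. -/
noncomputable def AInfFunctor.homGradedMap (F : AInfFunctor C D) (x y : C.Obj) :
    ComplexMap (homGraded C x y) (homGraded D (F.obj x) (F.obj y)) where
  f := (F.totMap x y).toAddMonoidHom
  mem := by
    rintro e _ ⟨a, rfl⟩
    exact ⟨F.map₁ e a, (F.lof_map₁ a).trans (F.totMap_lof a).symm⟩
  d_comm a := by
    change F.totMap x y (C.dTot x y a) = D.dTot _ _ (F.totMap x y a)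
    induction a using DirectSum.induction_on with
    | zero => simp
    | of k a =>
      have h1 := C.dTot_lof' (x := x) (y := y) (rfl : k + 1 = k + 1) a
      have h2 : F.totMap x y (hlof C k a) = hlof D k (F.map₁ k a) :=
        (F.totMap_lof a).trans (F.lof_map₁ a).symm
      refine (congrArg (F.totMap x y) h1).trans (Eq.trans ?_ (congrArg (D.dTot _ _) h2).symm)
      refine (F.totMap_lof _).trans ((F.lof_map₁ _).symm.trans ?_)
      rw [F.map₁_d]
      exact (D.dTot_lof' rfl _).symm
    | add a b ha hb => rw [map_add, map_add, map_add, map_add, ha, hb]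

lemma coneVal_comp (F : AInfFunctor C D) {x y : C.Obj}
    {G : AInfFunctorData (minimalData K (n + 1)) C.toAInfData} (hG : G.IsMulti)
    (hx : IsConstAt x G) (hy : G.obj (Fin.last (n + 1)) = y)
    (hobj : ∀ i, G.obj (face (Fin.last (n + 1)) i) = x)
    {l : List (Fin (n + 1))} (hl : l.IsChain (· ≥ ·)) (hl0 : l ≠ []) :
    coneVal (G.comp F.toAInfFunctorData) (F.obj x) (F.obj y) l = F.totMap x y (coneVal G x y l) := by
  have hpr : ∀ (p : C.Obj × C.Obj) (a : C.Tot p.1 p.2), p = (x, y) →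
      prTo (F.obj x) (F.obj y) ⟨(F.obj p.1, F.obj p.2), F.totMap p.1 p.2 a⟩ =
        F.totMap x y (prTo x y ⟨p, a⟩) := by
    rintro _ a rfl
    rw [prTo_mk, prTo_mk]
  obtain ⟨i, hi⟩ := ne_src_last hl0
  have key : (⟨(F.obj (G.obj _), F.obj (G.obj _)), (G.comp F.toAInfFunctorData).mapT
      (chainWord K (Fin.last (n + 1)) (l.map (face (Fin.last (n + 1)))))⟩ : Mor D) =
      ⟨(F.obj (G.obj _), F.obj (G.obj _)), F.totMap _ _ (G.mapT (chainWord K (Fin.last (n + 1))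
        (l.map (face (Fin.last (n + 1))))))⟩ := by
    refine congrArg (Sigma.mk (β := fun x : D.Obj × D.Obj => D.Tot x.1 x.2) _) ?_
    refine (comp_mapT _ _ _).trans ?_
    have hmap : ∀ {i k : Fin (n + 2)} (w : Word (minimalData K (n + 1)).Hom i k),
        F.mapT (single (G.map w _ rfl)) = F.totMap _ _ (G.mapT w) :=
      fun w => (F.totMap_lof _).symm
    cases l with
    | nil => exact absurd rfl hl0
    | cons b l =>
    obtain rfl | ⟨l, c, rfl⟩ := List.eq_nil_or_concat' l
    · exact (add_zero _).trans (hmap _)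
    · have hc : c ≤ src b l := (List.isChain_cons_cons.1 (isChain_src hl)).1
      have hS : (⟨face (Fin.last (n + 1)) c, cons (gen K (face (Fin.last (n + 1)) b)
          (Fin.last (n + 1))) (lastWord ((chainWord K b l).append (single (gen K c (src b l)))))⟩ :
          Σ i, Word (minimalData K (n + 1)).Hom i (Fin.last (n + 1))) =
          ⟨_, chainWord K (Fin.last (n + 1)) ((b :: (l ++ [c])).map (face (Fin.last (n + 1))))⟩ := by
        refine Eq.trans ?_ (cone_sigma hl)
        exact congrArg (fun t : Σ i, Word (minimalData K n).Hom i b =>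
          (⟨face (Fin.last (n + 1)) t.1, cons (gen K (face (Fin.last (n + 1)) b) (Fin.last (n + 1)))
            (lastWord t.2)⟩ : Σ i, Word (minimalData K (n + 1)).Hom i (Fin.last (n + 1))))
          (chainWord_append_singleton b l c).symm
      have h2 := lsum_expand_cone_append hG hx (gen K (face (Fin.last (n + 1)) b) (Fin.last (n + 1)))
        (chainWord K b l) hc (φ := F.mapT) F.map_multilinear
        (fun u q hu hq => hu.mapT_eq_zero F q (by omega))
      have h3 := (hx.isUnitAt hc).mapT_eq_zero F (single (G.map (cons (gen K (face
        (Fin.last (n + 1)) b) (Fin.last (n + 1))) (lastWord (chainWord K b l))) _ rfl))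
        Nat.one_pos
      have h4 := h2.trans ((congrArg₂ (· + ·) (hmap _) h3).trans (add_zero _))
      have h5 : ∀ (s s' : Σ i, Word (minimalData K (n + 1)).Hom i (Fin.last (n + 1))), s = s' →
          lsum (G.expand s.2) F.mapT = F.totMap _ _ (G.mapT s.2) →
          lsum (G.expand s'.2) F.mapT = F.totMap _ _ (G.mapT s'.2) := by
        rintro s _ rfl h
        exact h
      exact h5 _ _ hS h4
  refine (congrArg (prTo (F.obj x) (F.obj y)) key).trans (hpr (G.obj _, G.obj _) _ ?_)
  exact Prod.ext ((congrArg G.obj hi).trans (hobj i)) hy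

lemma homRToSpace_naturality (F : AInfFunctor C D) (x y : (nerve C).obj (op (mk 0))) :
    homRMap (nerveMap F) x y ≫ homRToSpace ((nerveMap F).app _ x) ((nerveMap F).app _ y) =
      homRToSpace x y ≫ spaceMap.{v, max u w} (F.homGradedMap (x.obj 0) (y.obj 0)) := by
  ext a σ
  refine ULift.ext _ _ (Subtype.ext (funext fun l => ?_))
  by_cases hl : l ≠ [] ∧ l.IsChain (· > ·)
  · have hσ := isCone_homR σ
    refine (coneSimplex_apply (isCone_homR ((homRMap (nerveMap F) x y).app a σ)) (isChain_ge hl.2)).trans (Eq.trans ?_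
      (congrArg (F.totMap _ _) (coneSimplex_apply hσ (isChain_ge hl.2)).symm))
    exact coneVal_comp F (AInfFunctor.isMulti σ.1) hσ.isConstAt hσ.obj_last hσ.obj_face
      (isChain_ge hl.2) hl.1
  · exact ((coneSimplex (isCone_homR ((homRMap (nerveMap F) x y).app a σ))).2.2.1 l hl).trans
      (((F.homGradedMap _ _).onSimplices (coneSimplex (isCone_homR σ))).2.2.1 l hl).symm

end mappingSpace
end AInf

/-! ### Lifting against boundaries of simplices -/

namespace AInf

section lifting
variable {n m : ℕ}

/-- The list of all vertices `[n, ..., 0]`. -/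
def topList (n : ℕ) : List (Fin (n + 1)) := List.ofFn Fin.rev

lemma mem_topList (a : Fin (n + 1)) : a ∈ topList n :=
  List.mem_ofFn.2 ⟨a.rev, Fin.rev_rev a⟩

@[simp] lemma length_topList (n : ℕ) : (topList n).length = n + 1 := List.length_ofFn

lemma isChain_topList (n : ℕ) : (topList n).IsChain (· > ·) := by
  rw [List.isChain_iff_pairwise, topList, List.pairwise_ofFn]
  intro i j hij
  exact Fin.rev_lt_rev.2 hij

/-- A decreasing list of vertices, as a monotone map. -/
def listHom (l : List (Fin (n + 1))) (h : l.IsChain (· ≥ ·)) (hm : l.length = m + 1) :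
    Fin (m + 1) →o Fin (n + 1) where
  toFun i := l.get ⟨i.rev, by omega⟩
  monotone' i j hij := by
    rw [List.isChain_iff_pairwise, List.pairwise_iff_get] at h
    obtain rfl | hij := eq_or_lt_of_le hij
    · exact le_rfl
    · exact h _ _ (Fin.rev_lt_rev.2 hij)

lemma map_listHom (l : List (Fin (n + 1))) (h : l.IsChain (· ≥ ·)) (hm : l.length = m + 1) :
    (topList m).map (listHom l h hm) = l := by
  refine List.ext_get (by simp [hm]) fun p h1 h2 => ?_
  simp only [topList, listHom, List.get_eq_getElem, List.getElem_map, List.getElem_ofFn]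
  change l[((⟨p, _⟩ : Fin (m + 1)).rev.rev : ℕ)] = _
  simp only [Fin.rev_rev]

/-- Every monotone map is invariant under an endomorphism of its source that is constant on the
fibres: the one that sends an element to the least element of its fibre. -/
lemma exists_idempotent (s : Fin (m + 1) →o Fin (n + 1)) : ∃ α : Fin (m + 1) →o Fin (m + 1),
    (∀ i, s (α i) = s i) ∧ ∀ i j, s i = s j → α i = α j := by
  classical
  let S : Fin (m + 1) → Finset (Fin (m + 1)) := fun i => Finset.univ.filter fun j => s i ≤ s j
  have hS : ∀ i, (S i).Nonempty := fun i => ⟨i, by simp [S]⟩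
  refine ⟨⟨fun i => (S i).min' (hS i), fun i j hij => ?_⟩, fun i => ?_, fun i j hij => ?_⟩
  · refine Finset.min'_subset _ fun k hk => ?_
    simp only [S, Finset.mem_filter, Finset.mem_univ, true_and] at hk ⊢
    exact (s.monotone hij).trans hk
  · refine le_antisymm (s.monotone (Finset.min'_le _ _ (by simp [S]))) ?_
    have h := (S i).min'_mem (hS i)
    simp only [S, Finset.mem_filter, Finset.mem_univ, true_and] at h
    exact h
  · have h : S i = S j := by simp only [S, hij]
    change (S i).min' (hS i) = (S j).min' (hS j)
    congr 1

variable {A B : GradedComplex.{v}}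

open Classical in
/-- The cochain of a compatible family of simplices on the non-surjective maps. Its value on a list
is computed from any presentation of the list as the image of a list of all vertices under a
non-surjective monotone map; it is zero if there is none, as for the list of all vertices. -/
noncomputable def glueCochain
    (T : ∀ {m : ℕ} (s : Fin (m + 1) →o Fin (n + 1)), ¬ Function.Surjective s → Simplices A m)
    (l : List (Fin (n + 1))) : A.T :=
  if h : l.IsChain (· > ·) ∧ ∃ p : Σ m : ℕ, (Fin (m + 1) →o Fin (n + 1)),
    (¬ Function.Surjective p.2) ∧ (topList p.1).map p.2 = l then
    (T h.2.choose.2 h.2.choose_spec.1).1 (topList h.2.choose.1) else 0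

variable
  (T : ∀ {m : ℕ} (s : Fin (m + 1) →o Fin (n + 1)), ¬ Function.Surjective s → Simplices A m)

/-- The simplices of a compatible family are the restrictions of the glued cochain. -/
lemma glueCochain_apply
    (hT : ∀ {m m' : ℕ} (α : Fin (m' + 1) →o Fin (m + 1)) (s : Fin (m + 1) →o Fin (n + 1))
      (hs : ¬ Function.Surjective s) (hs' : ¬ Function.Surjective (s.comp α)),
      T (s.comp α) hs' = (T s hs).restrict α)
    (s : Fin (m + 1) →o Fin (n + 1)) (hs : ¬ Function.Surjective s) (L : List (Fin (m + 1))) :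
    (T s hs).1 L = if (L.map s).IsChain (· > ·) then glueCochain T (L.map s) else 0 := by
  by_cases hL : L ≠ [] ∧ L.IsChain (· > ·)
  · by_cases hl : (L.map s).IsChain (· > ·)
    · rw [if_pos hl]
      obtain ⟨k, hk⟩ : ∃ k, L.length = k + 1 :=
        Nat.exists_eq_succ_of_ne_zero (by simpa using hL.1)
      have hns : ¬ Function.Surjective (s.comp (listHom L (isChain_ge hL.2) hk)) :=
        fun h => hs (Function.Surjective.of_comp (g := listHom L (isChain_ge hL.2) hk) h)
      have hmap : (topList k).map (s.comp (listHom L (isChain_ge hL.2) hk)) = L.map s := by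
        exact (List.map_map (f := listHom L (isChain_ge hL.2) hk) (g := s)).symm.trans (congrArg (List.map s) (map_listHom L _ hk))
      have hex : (L.map s).IsChain (· > ·) ∧ ∃ p : Σ m : ℕ, (Fin (m + 1) →o Fin (n + 1)),
          (¬ Function.Surjective p.2) ∧ (topList p.1).map p.2 = L.map s :=
        ⟨hl, ⟨k, _⟩, hns, hmap⟩
      rw [glueCochain, dif_pos hex]
      have key : ∀ (p : Σ m : ℕ, (Fin (m + 1) →o Fin (n + 1))) (hp : ¬ Function.Surjective p.2),
          (topList p.1).map p.2 = L.map s → (T p.2 hp).1 (topList p.1) = (T s hs).1 L := by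
        rintro ⟨k', s'⟩ hp hps
        obtain rfl : k' = k := by
          have := congrArg List.length hps
          simp [hk] at this
          exact this
        obtain rfl : s' = s.comp (listHom L (isChain_ge hL.2) hk) := by
          ext i : 2
          have h1 := hps.trans hmap.symm
          exact List.map_inj_left.1 h1 i (mem_topList i)
        rw [hT _ s hs]
        exact congrArg (T s hs).1 (map_listHom L _ hk)
      exact (key _ hex.2.choose_spec.1 hex.2.choose_spec.2).symm
    · rw [if_neg hl]
      -- `T s` is degenerate along the fibres of `s`, hence vanishes on lists with entries in one fibre
      obtain ⟨α, h1, h2⟩ := exists_idempotent s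
      have h3 : s.comp α = s := by ext i : 2; exact h1 i
      have h4 : T s hs = (T s hs).restrict α := by
        have := hT α s hs (by rw [h3]; exact hs)
        rw [← this]
        congr 1
        exact h3.symm
      rw [h4]
      refine (T s hs).2.2.1 _ fun h => hl ?_
      have h5 := h.2
      rw [List.isChain_iff_pairwise, List.pairwise_map] at h5 ⊢
      refine h5.imp_of_mem fun {a b} ha hb hab => ?_
      refine lt_of_le_of_ne ?_ fun h => hab.ne (h2 _ _ h)
      rw [← h1 a, ← h1 b]
      exact s.monotone (le_of_lt hab)
  · rw [(T s hs).2.2.1 L hL]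
    split_ifs with h
    · rw [glueCochain, dif_neg]
      rintro ⟨-, p, -, hp⟩
      refine hL ⟨?_, isChain_gt_of_map h⟩
      rintro rfl
      have := congrArg List.length hp
      simp at this
    · rfl

/-- A map of complexes has the lifting property if every cocycle of the source, with a
primitive of its image, has a primitive lifting the given one. -/
def ComplexMap.HasLifting (φ : ComplexMap A B) : Prop :=
  ∀ (e : ℤ) (z : A.T) (b : B.T), z ∈ A.gr (e + 1) → A.d z = 0 → b ∈ B.gr e → B.d b = φ.f z →
    ∃ c ∈ A.gr e, A.d c = z ∧ φ.f c = b

/-- For a map `φ` with the lifting property, a simplex over `b` can be found with given boundary `T`: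
only its value on the list of all vertices has to be chosen, as a primitive that lifts the value
of `b`. -/
lemma exists_boundary_lift
    (hT : ∀ {m m' : ℕ} (α : Fin (m' + 1) →o Fin (m + 1)) (s : Fin (m + 1) →o Fin (n + 1))
      (hs : ¬ Function.Surjective s) (hs' : ¬ Function.Surjective (s.comp α)),
      T (s.comp α) hs' = (T s hs).restrict α)
    {φ : ComplexMap A B} (hφ : φ.HasLifting) (b : Simplices B n)
    (hb : ∀ {m : ℕ} (s : Fin (m + 1) →o Fin (n + 1)) (hs : ¬ Function.Surjective s),
      φ.onSimplices (T s hs) = b.restrict s) :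
    ∃ F : Simplices A n, (∀ {m : ℕ} (s : Fin (m + 1) →o Fin (n + 1))
      (hs : ¬ Function.Surjective s), F.restrict s = T s hs) ∧ φ.onSimplices F = b := by
  classical
  set f := glueCochain T with hf
  have happ := fun {m : ℕ} (s : Fin (m + 1) →o Fin (n + 1)) hs L => glueCochain_apply T hT (m := m) s hs L
  have hbad : ∀ l, ¬ (l ≠ [] ∧ l.IsChain (· > ·)) → f l = 0 := by
    intro l hl
    rw [hf, glueCochain, dif_neg]
    rintro ⟨h1, p, -, hp⟩
    refine hl ⟨?_, h1⟩
    rintro rfl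
    have := congrArg List.length hp
    simp at this
  have htop : ∀ l : List (Fin (n + 1)), l.IsChain (· > ·) → (∀ a, a ∈ l) → l = topList n :=
    fun l h h' => eq_of_isChain_of_mem_iff h (isChain_topList n)
      fun a => ⟨fun _ => mem_topList a, fun _ => h' a⟩
  -- the proper strictly decreasing lists are pushed forward from the family
  have hex : ∀ l : List (Fin (n + 1)), l ≠ [] → l.IsChain (· > ·) → l ≠ topList n →
      ∃ (m : ℕ) (s : Fin (m + 1) →o Fin (n + 1)) (_ : ¬ Function.Surjective s),
        (topList m).map s = l := by
    intro l hl0 hl hlt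
    obtain ⟨k, hk⟩ : ∃ k, l.length = k + 1 := Nat.exists_eq_succ_of_ne_zero (by simpa using hl0)
    refine ⟨k, listHom l (isChain_ge hl) hk, fun h => hlt (htop l hl fun a => ?_),
      map_listHom l _ hk⟩
    obtain ⟨i, rfl⟩ := h a
    exact List.get_mem _ _
  have hval : ∀ {m : ℕ} (s : Fin (m + 1) →o Fin (n + 1)) (hs : ¬ Function.Surjective s)
      (L : List (Fin (m + 1))), (L.map s).IsChain (· > ·) → f (L.map s) = (T s hs).1 L := by
    intro m s hs L hL
    rw [happ s hs L, if_pos hL]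
  have hfT : f (topList n) = 0 := by
    rw [hf, glueCochain, dif_neg]
    rintro ⟨-, p, hp, h⟩
    refine hp fun a => ?_
    obtain ⟨c, -, hc⟩ := List.mem_map.1 (h.symm ▸ mem_topList a)
    exact ⟨c, hc⟩
  have hmem : ∀ l, f l ∈ A.gr (1 - l.length) := by
    intro l
    by_cases hl : l ≠ [] ∧ l.IsChain (· > ·)
    · by_cases hlt : l = topList n
      · rw [hlt, hfT]; exact zero_mem _
      · obtain ⟨m, s, hs, rfl⟩ := hex l hl.1 hl.2 hlt
        rw [hval s hs _ hl.2, List.length_map]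
        exact (T s hs).2.1 _
    · rw [hbad l hl]; exact zero_mem _
  have hd : ∀ l : List (Fin (n + 1)), l.IsChain (· > ·) → l ≠ topList n →
      A.d (f l) = - boundarySum f l := by
    intro l hl hlt
    by_cases hl0 : l = []
    · rw [hl0, hbad [] (by simp), boundarySum_nil, map_zero, neg_zero]
    · obtain ⟨m, s, hs, rfl⟩ := hex l hl0 hl hlt
      rw [hval s hs _ hl, (T s hs).2.2.2 _ (isChain_topList m)]
      refine congrArg Neg.neg (Eq.trans ?_ (boundarySum_map f s (topList m)))
      refine boundarySum_congr fun p _ => (hval s hs _ ?_).symm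
      rw [← List.eraseIdx_map]
      rw [List.isChain_iff_pairwise] at hl ⊢
      exact hl.sublist (List.eraseIdx_sublist _ _)
  have hfb : ∀ l : List (Fin (n + 1)), l ≠ topList n → φ.f (f l) = b.1 l := by
    intro l hlt
    by_cases hl : l ≠ [] ∧ l.IsChain (· > ·)
    · obtain ⟨m, s, hs, rfl⟩ := hex l hl.1 hl.2 hlt
      rw [hval s hs _ hl.2]
      exact congrArg (fun g => g.1 (topList m)) (hb s hs)
    · rw [hbad l hl, b.2.2.1 l hl, map_zero]
  have hne : ∀ p < (topList n).length, (topList n).eraseIdx p ≠ topList n := by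
    intro p hp h
    have := congrArg List.length h
    rw [List.length_eraseIdx_of_lt hp] at this
    omega
  have hch : ∀ p, ((topList n).eraseIdx p).IsChain (· > ·) := by
    intro p
    have := isChain_topList n
    rw [List.isChain_iff_pairwise] at this ⊢
    exact this.sublist (List.eraseIdx_sublist _ _)
  obtain ⟨c, hc, hdc, hcb⟩ := hφ (1 - (topList n).length) (- boundarySum f (topList n))
      (b.1 (topList n)) (by
    refine neg_mem (sum_mem fun p hp => ?_)
    rw [Units.smul_def]
    refine zsmul_mem ?_ _
    have h1 := hmem ((topList n).eraseIdx p)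
    rw [List.length_eraseIdx_of_lt (Finset.mem_range.1 hp)] at h1
    have h2 : 0 < (topList n).length := by simp
    rwa [Nat.cast_sub h2, Nat.cast_one, ← sub_add] at h1) (by
    have h1 : A.d (boundarySum f (topList n)) = boundarySum (fun l => A.d (f l)) (topList n) :=
      map_boundarySum A.d f _
    have h2 : boundarySum (fun l => A.d (f l)) (topList n) =
        boundarySum (fun l => (-1 : ℤˣ) • boundarySum f l) (topList n) := by
      refine boundarySum_congr fun p hp => ?_
      rw [Units.neg_smul, one_smul]
      exact hd _ (hch p) (hne p hp)
    rw [map_neg, h1, h2, boundarySum_smul, boundarySum_boundarySum, smul_zero, neg_zero])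
    (b.2.1 _) (by
    rw [b.2.2.2 _ (isChain_topList n), map_neg, map_boundarySum]
    congr 1
    exact boundarySum_congr fun p hp => (hfb _ (hne p hp)).symm)
  -- `c` is a primitive of minus the boundary sum on the list of all vertices, over the value of `b`
  let F : List (Fin (n + 1)) → A.T := Function.update f (topList n) c
  have hF : ∀ l, l ≠ topList n → F l = f l := fun l hl => Function.update_of_ne hl _ _
  have hF' : F (topList n) = c := Function.update_self _ _ _
  refine ⟨⟨F, fun l => ?_, fun l hl => ?_, fun l hl => ?_⟩, fun {m} s hs => ?_, ?_⟩
  · by_cases h : l = topList n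
    · rw [h, hF']; exact hc
    · rw [hF l h]; exact hmem l
  · rw [hF l ?_, hbad l hl]
    rintro rfl
    exact hl ⟨by rw [← List.length_pos_iff]; simp, isChain_topList n⟩
  · have h1 : boundarySum F l = boundarySum f l := by
      refine boundarySum_congr fun p hp => hF _ fun h => ?_
      have h2 : ∀ a, a ∈ l := fun a => List.mem_of_mem_eraseIdx (h ▸ mem_topList a)
      exact hne p (htop l hl h2 ▸ hp) (htop l hl h2 ▸ h)
    rw [h1]
    by_cases h : l = topList n
    · rw [h, hF', hdc]
    · rw [hF l h]; exact hd l hl h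
  · refine Subtype.ext (funext fun L => ?_)
    refine Eq.trans ?_ (happ s hs L).symm
    change F (L.map s) = _
    have h1 : L.map s ≠ topList n := by
      intro h
      refine hs fun a => ?_
      obtain ⟨c, -, hc⟩ := List.mem_map.1 (h.symm ▸ mem_topList a)
      exact ⟨c, hc⟩
    rw [hF _ h1]
    split_ifs with h
    · rfl
    · exact hbad _ fun h' => h h'.2
  · refine Subtype.ext (funext fun l => ?_)
    change φ.f (F l) = b.1 l
    by_cases h : l = topList n
    · rw [h, hF', hcb]
    · rw [hF l h, hfb l h]

open SSet.modelCategoryQuillen in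
/-- Maps of complexes with the lifting property induce trivial fibrations of spaces. -/
lemma spaceMap_rlp {φ : ComplexMap A B} (hφ : φ.HasLifting) :
    I.rlp (spaceMap.{v, u} φ) := by
  rintro _ _ _ ⟨n⟩
  constructor
  intro t b sq
  let b' : Simplices B n := (SSet.yonedaEquiv b).down
  have hbs : ∀ {m : ℕ} (s : Fin (m + 1) →o Fin (n + 1)),
      (b.app (op (SimplexCategory.mk m)) (SSet.stdSimplex.objMk s)).down = b'.restrict s := by
    intro m s
    have h := SSet.yonedaEquiv_symm_app_objEquiv_symm (SSet.yonedaEquiv b)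
      (show SimplexCategory.mk m ⟶ SimplexCategory.mk n from SimplexCategory.Hom.mk s)
    rw [Equiv.symm_apply_apply] at h
    exact congrArg ULift.down h
  let T : ∀ {m : ℕ} (s : Fin (m + 1) →o Fin (n + 1)), ¬ Function.Surjective s → Simplices A m :=
    fun {m} s hs => (t.app (op (SimplexCategory.mk m)) ⟨SSet.stdSimplex.objMk s, hs⟩).down
  obtain ⟨F, h1, h2⟩ := exists_boundary_lift T (fun {m m'} α s hs hs' => by
    exact congrArg ULift.down (NatTrans.naturality_apply t
      (show SimplexCategory.mk m' ⟶ SimplexCategory.mk m from SimplexCategory.Hom.mk α).op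
      (⟨SSet.stdSimplex.objMk s, hs⟩ : (SSet.boundary n : SSet).obj (op (SimplexCategory.mk m))))) hφ b' (fun {m} s hs => by
    refine Eq.trans ?_ (hbs s)
    exact congrArg (fun g => (g.app (op (SimplexCategory.mk m))
      (⟨SSet.stdSimplex.objMk s, hs⟩ : (SSet.boundary n : SSet).obj (op (SimplexCategory.mk m)))).down) sq.w)
  refine ⟨⟨⟨SSet.yonedaEquiv.symm (⟨F⟩ : (space.{v, u} A).obj (op (SimplexCategory.mk n))), ?_, ?_⟩⟩⟩
  · ext m ⟨s, hs⟩
    obtain ⟨s, rfl⟩ := SSet.stdSimplex.objMk_bijective.2 s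
    exact congrArg ULift.up (h1 s hs)
  · refine SSet.yonedaEquiv.injective ?_
    rw [SSet.yonedaEquiv_comp]
    refine (congrArg ((spaceMap.{v, u} φ).app _) (Equiv.apply_symm_apply _ _)).trans ?_
    exact congrArg ULift.up h2

end lifting
end AInf

/-! ### The mapping path complex -/

namespace AInf

section roof
variable {A B : GradedComplex.{v}}

/-- Quasi-isomorphisms: a cocycle `z` whose image has a primitive `b` has a primitive `a`, and `a`
can be chosen so that its image is cohomologous to `b`. -/
def ComplexMap.IsQuasiIso (φ : ComplexMap A B) : Prop :=
  ∀ (e : ℤ) (z : A.T) (b : B.T), z ∈ A.gr (e + 1) → A.d z = 0 → b ∈ B.gr e → B.d b = φ.f z →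
    ∃ a ∈ A.gr e, ∃ h ∈ B.gr (e - 1), A.d a = z ∧ φ.f a - b = B.d h

namespace ComplexMap
variable (φ : ComplexMap A B)

/-- The mapping path complex `A ⊕ B[-1] ⊕ B`, whose cocycles are triples `(a, h, b)` such that `h`
is a homotopy from `b` to the image of `a`, that is, `φ a - b = d h`. -/
def path : GradedComplex.{v} where
  T := A.T × B.T × B.T
  gr e := (A.gr e).prod ((B.gr (e - 1)).prod (B.gr e))
  d :=
    { toFun := fun x => (A.d x.1, φ.f x.1 - x.2.2 - B.d x.2.1, B.d x.2.2)
      map_zero' := by simp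
      map_add' := fun x y => by
        refine Prod.ext (map_add _ _ _) (Prod.ext ?_ (map_add _ _ _))
        simp only [Prod.fst_add, Prod.snd_add, map_add]
        abel }
  d_mem := by
    rintro e ⟨a, h, b⟩ ⟨ha, hh, hb⟩
    have h1 : B.d h ∈ B.gr e := by
      have := B.d_mem hh
      rwa [sub_add_cancel] at this
    refine ⟨A.d_mem ha, ?_, B.d_mem hb⟩
    change φ.f a - b - B.d h ∈ B.gr (e + 1 - 1)
    rw [add_sub_cancel_right]
    exact sub_mem (sub_mem (φ.mem ha) hb) h1
  d_d := by
    rintro ⟨a, h, b⟩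
    refine Prod.ext (A.d_d a) (Prod.ext ?_ (B.d_d b))
    change φ.f (A.d a) - B.d b - B.d (φ.f a - b - B.d h) = 0
    rw [map_sub, map_sub, B.d_d, φ.d_comm]
    abel

/-- The projection of the mapping path complex to the source. -/
def pathFst : ComplexMap φ.path A where
  f := AddMonoidHom.fst _ _
  mem h := h.1
  d_comm _ := rfl

/-- The projection of the mapping path complex to the target. -/
def pathSnd : ComplexMap φ.path B where
  f := (AddMonoidHom.snd _ _).comp (AddMonoidHom.snd _ _)
  mem h := h.2.2
  d_comm _ := rfl

/-- The section of the first projection, given by the zero homotopies. -/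
def toPath : ComplexMap A φ.path where
  f :=
    { toFun := fun a => (a, 0, φ.f a)
      map_zero' := by rw [map_zero]; rfl
      map_add' := fun a b => by
        refine Prod.ext rfl (Prod.ext (add_zero _).symm (map_add _ _ _)) }
  mem h := ⟨h, zero_mem _, φ.mem h⟩
  d_comm a := by
    refine Prod.ext rfl (Prod.ext ?_ (φ.d_comm a))
    change (0 : B.T) = φ.f a - φ.f a - B.d 0
    rw [map_zero, sub_self, sub_zero]

/-- The fibre of the first projection is a cone, so that primitives lift for any `φ`. -/
lemma pathFst_hasLifting : φ.pathFst.HasLifting := by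
  rintro e ⟨za, zh, zb⟩ a ⟨-, hz, -⟩ hd ha hda
  obtain ⟨-, h2⟩ := Prod.mk.inj hd
  obtain ⟨h2, h3⟩ := Prod.mk.inj h2
  change zh ∈ B.gr (e + 1 - 1) at hz
  change φ.f za - zb - B.d zh = 0 at h2
  change A.d a = za at hda
  rw [add_sub_cancel_right] at hz
  have hb : φ.f a - zh ∈ B.gr e := sub_mem (φ.mem ha) hz
  -- the homotopy of the primitive is taken to be zero, which leaves one choice for its last entry
  refine ⟨(a, 0, φ.f a - zh), ⟨ha, zero_mem _, hb⟩, ?_, rfl⟩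
  refine Prod.ext hda (Prod.ext ?_ ?_)
  · change φ.f a - (φ.f a - zh) - B.d 0 = zh
    rw [map_zero]
    abel
  · change B.d (φ.f a - zh) = zb
    rw [map_sub, ← φ.d_comm, hda, ← sub_eq_zero, ← h2]
    abel

/-- The fibre of the second projection is the cocone of `φ`, which is acyclic. -/
lemma pathSnd_hasLifting (hφ : φ.IsQuasiIso) : φ.pathSnd.HasLifting := by
  rintro e ⟨za, zh, zb⟩ b ⟨hza, hz, -⟩ hd hb hdb
  obtain ⟨h1, h2⟩ := Prod.mk.inj hd
  obtain ⟨h2, h3⟩ := Prod.mk.inj h2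
  change zh ∈ B.gr (e + 1 - 1) at hz
  change φ.f za - zb - B.d zh = 0 at h2
  change B.d b = zb at hdb
  rw [add_sub_cancel_right] at hz
  -- as `φ za - zb = d zh`, the element `b + zh` is a primitive of `φ za`
  obtain ⟨a, ha, h, hh, h4, h5⟩ := hφ e za (b + zh) hza h1 (add_mem hb hz) (by
    rw [map_add, hdb, eq_comm, ← sub_eq_zero, ← h2]
    abel)
  refine ⟨(a, h, b), ⟨ha, hh, hb⟩, Prod.ext h4 (Prod.ext ?_ hdb), rfl⟩
  change φ.f a - b - B.d h = zh
  rw [← h5]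
  abel

lemma toPath_pathFst :
    spaceMap.{v, u} φ.toPath ≫ spaceMap.{v, u} φ.pathFst = 𝟙 (space.{v, u} A) := rfl

lemma toPath_pathSnd :
    spaceMap.{v, u} φ.toPath ≫ spaceMap.{v, u} φ.pathSnd = spaceMap.{v, u} φ := rfl

end ComplexMap
end roof
end AInf

/-! ### Cocycles and primitives under quasi-isomorphisms -/

namespace AInf

open DirectSum

section quasiIso
variable {R : Type w} [CommRing R] {S₁ S₂ : ShortComplex (ModuleCat.{v} R)} (φ : S₁ ⟶ S₂)

lemma exists_primitive_of_quasiIso [ShortComplex.QuasiIso φ] (z : S₁.X₂) (hz : S₁.g z = 0)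
    (b : S₂.X₁) (hb : S₂.f b = φ.τ₂ z) : ∃ a : S₁.X₁, S₁.f a = z := by
  let γ : ShortComplex.LeftHomologyMapData φ S₁.moduleCatLeftHomologyData
    S₂.moduleCatLeftHomologyData := default
  have hiso : IsIso γ.φH := γ.quasiIso_iff.1 inferInstance
  let z' : S₁.moduleCatLeftHomologyData.K := (⟨z, hz⟩ : LinearMap.ker S₁.g.hom)
  have h1 : (γ.φK z').1 = φ.τ₂ z := congrArg (fun f => f.hom z') γ.commi
  have h2 : γ.φH (S₁.moduleCatLeftHomologyData.π z') = 0 := by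
    have h3 : γ.φH (S₁.moduleCatLeftHomologyData.π z') =
        S₂.moduleCatLeftHomologyData.π (γ.φK z') := congrArg (fun f => f.hom z') γ.commπ
    rw [h3]
    exact (Submodule.Quotient.mk_eq_zero _).2 ⟨b, Subtype.ext (hb.trans h1.symm)⟩
  have h4 : Function.Injective γ.φH := (ConcreteCategory.bijective_of_isIso γ.φH).1
  have h5 : S₁.moduleCatLeftHomologyData.π z' = 0 := h4 (h2.trans (map_zero γ.φH.hom).symm)
  obtain ⟨a, ha⟩ := (Submodule.Quotient.mk_eq_zero _).1 h5
  exact ⟨a, congrArg Subtype.val ha⟩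

lemma exists_cocycle_of_quasiIso [ShortComplex.QuasiIso φ] (y : S₂.X₂) (hy : S₂.g y = 0) :
    ∃ (x : S₁.X₂) (h : S₂.X₁), S₁.g x = 0 ∧ φ.τ₂ x - y = S₂.f h := by
  let γ : ShortComplex.LeftHomologyMapData φ S₁.moduleCatLeftHomologyData
    S₂.moduleCatLeftHomologyData := default
  have hiso : IsIso γ.φH := γ.quasiIso_iff.1 inferInstance
  let y' : S₂.moduleCatLeftHomologyData.K := (⟨y, hy⟩ : LinearMap.ker S₂.g.hom)
  obtain ⟨q, hq⟩ := (ConcreteCategory.bijective_of_isIso γ.φH).2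
    (S₂.moduleCatLeftHomologyData.π y')
  obtain ⟨x, rfl⟩ := Submodule.Quotient.mk_surjective _ q
  have h3 : γ.φH (S₁.moduleCatLeftHomologyData.π x) =
      S₂.moduleCatLeftHomologyData.π (γ.φK x) := congrArg (fun f => f.hom x) γ.commπ
  have h1 : (γ.φK x).1 = φ.τ₂ x.1 := congrArg (fun f => f.hom x) γ.commi
  obtain ⟨h, hh⟩ := (Submodule.Quotient.eq _).1 (h3.symm.trans hq)
  refine ⟨x.1, h, x.2, ?_⟩
  rw [← h1]
  exact (congrArg Subtype.val hh).symm

end quasiIso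

section homComplex
variable {K : Type w} [CommRing K] {C D : AInfCategory.{w, v, u} K} (F : AInfFunctor C D)
  (x y : C.Obj)

/-- The map `F^1` in degrees `k`, `k + 1`, `k + 2`. -/
noncomputable abbrev AInfFunctor.shortComplexMap (k : ℤ) :=
  (HomologicalComplex.shortComplexFunctor' (ModuleCat.{v} K) (ComplexShape.up ℤ) k (k + 1)
    (k + 1 + 1)).map (F.homComplexMap x y)

lemma shortComplex_f (C : AInfCategory.{w, v, u} K) (x y : C.Obj) (k : ℤ) :
    ((HomologicalComplex.shortComplexFunctor' (ModuleCat.{v} K) (ComplexShape.up ℤ) k (k + 1)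
      (k + 1 + 1)).obj (C.homComplex x y)).f = ModuleCat.ofHom (C.d k (k + 1) rfl) :=
  CochainComplex.of_d (fun k => ModuleCat.of K (C.Hom x y k))
    (fun k => ModuleCat.ofHom (C.d k (k + 1) rfl)) k

lemma shortComplex_g (C : AInfCategory.{w, v, u} K) (x y : C.Obj) (k : ℤ) :
    ((HomologicalComplex.shortComplexFunctor' (ModuleCat.{v} K) (ComplexShape.up ℤ) k (k + 1)
      (k + 1 + 1)).obj (C.homComplex x y)).g =
        ModuleCat.ofHom (C.d (k + 1) (k + 1 + 1) rfl) :=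
  CochainComplex.of_d (fun k => ModuleCat.of K (C.Hom x y k))
    (fun k => ModuleCat.ofHom (C.d k (k + 1) rfl)) (k + 1)

variable [QuasiIso (F.homComplexMap x y)]

lemma quasiIso_shortComplexMap (k : ℤ) : ShortComplex.QuasiIso (F.shortComplexMap x y k) :=
  (quasiIsoAt_iff' (F.homComplexMap x y) k (k + 1) (k + 1 + 1) (by simp) (by simp)).1
    inferInstance

variable {x y}

lemma exists_primitive {k : ℤ} {z : C.Hom x y (k + 1)} (hz : C.d (k + 1) (k + 1 + 1) rfl z = 0)
    {b : D.Hom (F.obj x) (F.obj y) k} (hb : D.d k (k + 1) rfl b = F.map₁ (k + 1) z) :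
    ∃ a : C.Hom x y k, C.d k (k + 1) rfl a = z := by
  have := quasiIso_shortComplexMap F x y k
  obtain ⟨a, ha⟩ := exists_primitive_of_quasiIso (F.shortComplexMap x y k) z
    ((congrArg (fun f => f.hom z) (shortComplex_g C x y k)).trans hz) b
    ((congrArg (fun f => f.hom b) (shortComplex_f D _ _ k)).trans hb)
  exact ⟨a, (congrArg (fun f => f.hom a) (shortComplex_f C x y k)).symm.trans ha⟩

lemma exists_cocycle {k : ℤ} {c : D.Hom (F.obj x) (F.obj y) (k + 1)}
    (hc : D.d (k + 1) (k + 1 + 1) rfl c = 0) :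
    ∃ (a : C.Hom x y (k + 1)) (h : D.Hom (F.obj x) (F.obj y) k),
      C.d (k + 1) (k + 1 + 1) rfl a = 0 ∧ F.map₁ (k + 1) a - c = D.d k (k + 1) rfl h := by
  have := quasiIso_shortComplexMap F x y k
  obtain ⟨a, h, h1, h2⟩ := exists_cocycle_of_quasiIso (F.shortComplexMap x y k) c
    ((congrArg (fun f => f.hom c) (shortComplex_g D _ _ k)).trans hc)
  exact ⟨a, h, (congrArg (fun f => f.hom a) (shortComplex_g C x y k)).symm.trans h1,
    h2.trans (congrArg (fun f => f.hom h) (shortComplex_f D _ _ k))⟩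

lemma isQuasiIso_homGradedMap : (F.homGradedMap x y).IsQuasiIso := by
  intro e
  obtain ⟨e, rfl⟩ : ∃ k, e = k + 1 := ⟨e - 1, by ring⟩
  rintro _ _ ⟨z, rfl⟩ hz ⟨b, rfl⟩ hb
  have hmap : ∀ {k : ℤ} (a : C.Hom x y k), F.totMap x y (hlof C k a) = hlof D k (F.map₁ k a) :=
    fun a => (F.totMap_lof a).trans (F.lof_map₁ a).symm
  have hz' : C.d (e + 1 + 1) (e + 1 + 1 + 1) rfl z = 0 :=
    AInfCategory.lof_inj (((C.dTot_lof' rfl z).symm.trans hz).trans (map_zero _).symm)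
  have hb' : D.d (e + 1) (e + 1 + 1) rfl b = F.map₁ (e + 1 + 1) z :=
    AInfCategory.lof_inj ((D.dTot_lof' rfl b).symm.trans (hb.trans (hmap z)))
  obtain ⟨a, ha⟩ := exists_primitive F hz' hb'
  obtain ⟨c, h, hc, hh⟩ := exists_cocycle F (c := F.map₁ (e + 1) a - b) (by
    rw [map_sub, hb', ← F.map₁_d, ha, sub_self])
  refine ⟨hlof C (e + 1) (a - c), ⟨_, rfl⟩, hlof D e (- h), ?_, ?_, ?_⟩
  · rw [add_sub_cancel_right]
    exact ⟨_, rfl⟩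
  · refine (C.dTot_lof' rfl _).trans ?_
    rw [map_sub, ha, hc, sub_zero]
  · refine Eq.trans ?_ (D.dTot_lof' rfl _).symm
    refine (congrArg (· - _) (hmap _)).trans ?_
    refine (map_sub (hlof D (e + 1)) _ _).symm.trans (congrArg (hlof D (e + 1)) ?_)
    rw [map_neg, ← hh, map_sub]
    abel

end homComplex
end AInf

/-! ### Homotopy groups and change of base point -/

namespace AInf

open scoped unitInterval Topology Topology.Homotopy

section cube
variable {n : ℕ}

/-- The distance of a point of the cube from its center, in the sup norm, normalized to be `1` on
the boundary. -/
noncomputable def cubeNorm (y : I^(Fin n)) : ℝ := ‖fun i => 2 * (y i : ℝ) - 1‖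

lemma continuous_cubeNorm : Continuous (cubeNorm (n := n)) := by
  unfold cubeNorm
  fun_prop

lemma abs_le_one (t : I) : |2 * (t : ℝ) - 1| ≤ 1 := by
  rw [abs_le]
  constructor <;> linarith [t.2.1, t.2.2]

lemma cubeNorm_le_one (y : I^(Fin n)) : cubeNorm y ≤ 1 :=
  (pi_norm_le_iff_of_nonneg zero_le_one).2 fun i => abs_le_one (y i)

lemma cubeNorm_eq_one {y : I^(Fin n)} (hy : y ∈ Cube.boundary (Fin n)) : cubeNorm y = 1 := by
  refine le_antisymm (cubeNorm_le_one y) ?_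
  obtain ⟨i, hi⟩ := hy
  refine le_trans ?_ (norm_le_pi_norm (fun i => 2 * (y i : ℝ) - 1) i)
  obtain hi | hi := hi <;> rw [hi] <;> norm_num

lemma exists_abs_eq_cubeNorm (y : I^(Fin n)) (h : 0 < cubeNorm y) :
    ∃ i, |2 * (y i : ℝ) - 1| = cubeNorm y := by
  by_contra! h'
  refine lt_irrefl (cubeNorm y) ((pi_norm_lt_iff h).2 fun i => ?_)
  exact lt_of_le_of_ne (norm_le_pi_norm (fun i => 2 * (y i : ℝ) - 1) i) (h' i)

/-- The dilation of the cube by the factor `1 + c`, truncated. -/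
noncomputable def dilate (c : I) (y : I^(Fin n)) : I^(Fin n) := fun i =>
  Set.projIcc 0 1 zero_le_one (1 / 2 + (1 + c) * ((y i : ℝ) - 1 / 2))

lemma continuous_dilate : Continuous fun p : I × (I^(Fin n)) => dilate p.1 p.2 := by
  unfold dilate
  fun_prop

lemma dilate_zero (y : I^(Fin n)) : dilate 0 y = y := by
  funext i
  refine Subtype.ext ?_
  have h : (1 / 2 + (1 + ((0 : I) : ℝ)) * ((y i : ℝ) - 1 / 2)) = y i := by simp
  rw [dilate, h, Set.projIcc_val]

lemma dilate_mem {c : I} {y : I^(Fin n)} (h : (1 + (c : ℝ)) * cubeNorm y = 1) :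
    dilate c y ∈ Cube.boundary (Fin n) := by
  have hc : 0 < 1 + (c : ℝ) := by linarith [c.2.1]
  have h0 : 0 < cubeNorm y := by
    by_contra h'
    nlinarith
  obtain ⟨i, hi⟩ := exists_abs_eq_cubeNorm y h0
  rw [← hi] at h
  refine ⟨i, ?_⟩
  obtain h1 | h1 := abs_cases (2 * (y i : ℝ) - 1)
  · right
    refine Set.projIcc_of_right_le _ ?_
    rw [h1.1] at h
    linarith
  · left
    refine Set.projIcc_of_le_left _ ?_
    rw [h1.1] at h
    linarith

variable {X : Type u} [TopologicalSpace X] {P : Type v} [TopologicalSpace P]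

/-- The extension of a family of maps on cubes by a collar, on which it depends on the distance from
the boundary only. -/
noncomputable def collar (M : C(P × (I^(Fin n)), X)) (N : C(P × I, X)) (c : C(P, I))
    (h : ∀ q, ∀ z ∈ Cube.boundary (Fin n), M (q, z) = N (q, 0)) : C(P × (I^(Fin n)), X) where
  toFun p := if (1 + (c p.1 : ℝ)) * cubeNorm p.2 ≤ 1 then M (p.1, dilate (c p.1) p.2)
    else N (p.1, Set.projIcc 0 1 zero_le_one ((1 + (c p.1 : ℝ)) * cubeNorm p.2 - 1))
  continuous_toFun := by
    have h1 : Continuous fun p : P × (I^(Fin n)) => (1 + (c p.1 : ℝ)) * cubeNorm p.2 :=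
      Continuous.mul (by fun_prop) (continuous_cubeNorm.comp continuous_snd)
    refine Continuous.if_le ?_ ?_ h1 continuous_const ?_
    · refine M.continuous.comp (continuous_fst.prodMk ?_)
      exact continuous_dilate.comp ((c.continuous.comp continuous_fst).prodMk continuous_snd)
    · refine N.continuous.comp (continuous_fst.prodMk ?_)
      exact continuous_projIcc.comp (h1.sub continuous_const)
    · rintro ⟨q, y⟩ hq
      dsimp only at hq ⊢
      rw [h q _ (dilate_mem hq), hq, sub_self, Set.projIcc_left]
      rfl

variable {M : C(P × (I^(Fin n)), X)} {N : C(P × I, X)} {c : C(P, I)}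
  {h : ∀ q, ∀ z ∈ Cube.boundary (Fin n), M (q, z) = N (q, 0)}

lemma collar_boundary (q : P) {y : I^(Fin n)} (hy : y ∈ Cube.boundary (Fin n)) :
    collar M N c h (q, y) = N (q, c q) := by
  simp only [collar, ContinuousMap.coe_mk, cubeNorm_eq_one hy, mul_one]
  split_ifs with h1
  · have h2 : c q = 0 := Subtype.ext (le_antisymm (by simpa using h1) (c q).2.1)
    rw [h2, dilate_zero, h q y hy]
  · rw [add_sub_cancel_left, Set.projIcc_val]

lemma collar_zero (q : P) (hq : c q = 0) (y : I^(Fin n)) : collar M N c h (q, y) = M (q, y) := by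
  have h1 := cubeNorm_le_one y
  simp only [collar, ContinuousMap.coe_mk, hq, dilate_zero]
  rw [if_pos]
  simpa using h1

end cube

section basepoint
variable {X : Type u} [TopologicalSpace X] {n : ℕ} {x x' : X}

/-- Homotopies of maps on the cube that move the values on the boundary along a path. -/
def HomotopicAlong (γ : Path x x') (f g : C(I^(Fin n), X)) : Prop :=
  ∃ A : C(I × (I^(Fin n)), X), (∀ y, A (0, y) = f y) ∧ (∀ y, A (1, y) = g y) ∧
    ∀ t, ∀ y ∈ Cube.boundary (Fin n), A (t, y) = γ t

lemma HomotopicAlong.symm {γ : Path x x'} {f g : C(I^(Fin n), X)} (h : HomotopicAlong γ f g) :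
    HomotopicAlong γ.symm g f := by
  obtain ⟨A, h0, h1, h2⟩ := h
  refine ⟨⟨fun p => A (σ p.1, p.2), by fun_prop⟩, fun y => ?_, fun y => ?_, fun t y hy => ?_⟩
  · simp [h1]
  · simp [h0]
  · simp [h2 _ y hy, Path.symm]

lemma homotopic_iff {f g : GenLoop (Fin n) X x} :
    GenLoop.Homotopic f g ↔ HomotopicAlong (Path.refl x) f.1 g.1 := by
  constructor
  · rintro ⟨H⟩
    refine ⟨H.toContinuousMap, fun y => H.apply_zero y, fun y => H.apply_one y, fun t y hy => ?_⟩
    exact (H.eq_fst t hy).trans (f.2 y hy)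
  · rintro ⟨A, h0, h1, h2⟩
    exact ⟨⟨⟨A, h0, h1⟩, fun t y hy => (h2 t y hy).trans (f.2 y hy).symm⟩⟩

/-- The extension of a loop by a collar that runs through a path of base points. -/
noncomputable def transportCollar (γ : Path x x') (f : GenLoop (Fin n) X x) :
    C(Unit × (I^(Fin n)), X) :=
  collar ⟨fun p => f.1 p.2, by fun_prop⟩ ⟨fun p => γ p.2, by fun_prop⟩ (.const _ 1)
    (fun _ z hz => (f.2 z hz).trans γ.source.symm)

/-- Transport of a loop along a path of base points. -/
noncomputable def transport (γ : Path x x') (f : GenLoop (Fin n) X x) : GenLoop (Fin n) X x' :=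
  ⟨⟨fun y => transportCollar γ f ((), y), by fun_prop⟩, fun y hy => by
    refine Eq.trans ?_ γ.target
    exact collar_boundary (h := fun _ z hz => (f.2 z hz).trans γ.source.symm) () hy⟩

lemma collar_eq_transport {γ : Path x x'} {f : GenLoop (Fin n) X x} {P : Type v}
    [TopologicalSpace P] {M : C(P × (I^(Fin n)), X)} {N : C(P × I, X)} {c : C(P, I)}
    {h : ∀ q, ∀ z ∈ Cube.boundary (Fin n), M (q, z) = N (q, 0)} {q : P}
    (hM : ∀ y, M (q, y) = f.1 y) (hN : ∀ t, N (q, t) = γ t) (hc : c q = 1) (y : I^(Fin n)) :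
    collar M N c h (q, y) = (transport γ f).1 y := by
  have h1 : (transport γ f).1 y = transportCollar γ f ((), y) := rfl
  rw [h1]
  simp only [transportCollar, collar, ContinuousMap.coe_mk, hM, hN, hc, ContinuousMap.const_apply]
  rfl

lemma homotopicAlong_transport (γ : Path x x') (f : GenLoop (Fin n) X x) :
    HomotopicAlong γ f.1 (transport γ f).1 := by
  refine ⟨collar ⟨fun p => f.1 p.2, by fun_prop⟩ ⟨fun p => γ p.2, by fun_prop⟩
    (.id I) (fun _ z hz => (f.2 z hz).trans γ.source.symm), fun y => ?_, fun y => ?_, fun t y hy => ?_⟩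
  · exact collar_zero _ rfl _
  · exact collar_eq_transport (fun _ => rfl) (fun _ => rfl) rfl y
  · exact collar_boundary _ hy

lemma transport_homotopic {γ : Path x x'} {f f' : GenLoop (Fin n) X x}
    (h : GenLoop.Homotopic f f') : GenLoop.Homotopic (transport γ f) (transport γ f') := by
  rw [homotopic_iff] at h ⊢
  obtain ⟨A, h0, h1, h2⟩ := h
  refine ⟨collar A ⟨fun p => γ p.2, by fun_prop⟩
    (.const _ 1) (fun t z hz => (h2 t z hz).trans γ.source.symm), fun y => ?_, fun y => ?_, fun t y hy => ?_⟩
  · exact collar_eq_transport h0 (fun _ => rfl) rfl y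
  · exact collar_eq_transport h1 (fun _ => rfl) rfl y
  · exact (collar_boundary _ hy).trans γ.target

lemma transport_refl_homotopic (g : GenLoop (Fin n) X x) :
    GenLoop.Homotopic g (transport (Path.refl x) g) :=
  homotopic_iff.2 (homotopicAlong_transport _ g)

/-- A loop homotopic to `f` along a path is homotopic, relative to the boundary, to the transport of
`f` along the path. -/
lemma HomotopicAlong.transport_homotopic {γ : Path x x'} {f : GenLoop (Fin n) X x}
    {g : GenLoop (Fin n) X x'} (h : HomotopicAlong γ f.1 g.1) :
    GenLoop.Homotopic (transport γ f) g := by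
  refine GenLoop.Homotopic.trans ?_ (transport_refl_homotopic g).symm
  obtain ⟨A, h0, h1, h2⟩ := h
  rw [homotopic_iff]
  -- at time `t`, the collar runs through the remaining part of the path
  refine ⟨collar A ⟨fun p => γ (Set.projIcc 0 1 zero_le_one
    ((p.1 : ℝ) + (1 - (p.1 : ℝ)) * (p.2 : ℝ))), by fun_prop⟩
    (.const _ 1) (fun t z hz => ?_), fun y => ?_, fun y => ?_, fun t y hy => ?_⟩
  · refine (h2 t z hz).trans ?_
    simp
  · refine collar_eq_transport h0 (fun t => ?_) rfl y
    simp
  · refine collar_eq_transport h1 (fun t => ?_) rfl y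
    simp
  · refine (collar_boundary _ hy).trans ?_
    simp

lemma transport_symm_transport (γ : Path x x') (f : GenLoop (Fin n) X x) :
    GenLoop.Homotopic (transport γ.symm (transport γ f)) f :=
  (homotopicAlong_transport γ f).symm.transport_homotopic

/-- Maps homotopic to the identity induce bijections on homotopy groups. -/
lemma bijective_piMap_of_homotopy {φ : C(X, X)} (H : (ContinuousMap.id X).Homotopy φ) (n : ℕ)
    (x : X) : Function.Bijective (piMap φ n x) := by
  let γ : Path x (φ x) := ⟨⟨fun t => H (t, x), by fun_prop⟩, by simp, by simp⟩
  -- the induced map is transport along the path of the base point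
  have key : ∀ f : GenLoop (Fin n) X x, piMap φ n x ⟦f⟧ = ⟦transport γ f⟧ := by
    intro f
    refine Quotient.sound (HomotopicAlong.transport_homotopic ?_).symm
    refine ⟨⟨fun p => H (p.1, f.1 p.2), by fun_prop⟩, fun y => ?_, fun y => ?_, fun t y hy => ?_⟩
    · simp
    · simp
    · exact congrArg (fun z => H (t, z)) (f.2 y hy)
  constructor
  · intro a b
    refine Quotient.inductionOn₂ a b fun f g hfg => ?_
    rw [key, key] at hfg
    have h1 := transport_homotopic (γ := γ.symm) (Quotient.exact hfg)
    exact Quotient.sound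
      (((transport_symm_transport γ f).symm.trans h1).trans (transport_symm_transport γ g))
  · intro b
    refine Quotient.inductionOn b fun g => ⟨⟦transport γ.symm g⟧, ?_⟩
    rw [key]
    have h1 := transport_symm_transport γ.symm g
    rw [Path.symm_symm] at h1
    exact Quotient.sound h1

lemma pi0Map_eq_of_homotopy {φ : C(X, X)} (H : (ContinuousMap.id X).Homotopy φ) :
    pi0Map φ = id := by
  funext a
  induction a using ZerothHomotopy.rec with
  | mk x => exact (ZerothHomotopy.sound ⟨⟨fun t => H (t, x), by fun_prop⟩, by simp, by simp⟩).symm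

end basepoint

section weakEquiv
variable {X Y Z : Type u} [TopologicalSpace X] [TopologicalSpace Y] [TopologicalSpace Z]

lemma isWeakHomotopyEquiv_of_homotopy {φ : C(X, X)} (H : (ContinuousMap.id X).Homotopy φ) :
    IsWeakHomotopyEquiv φ where
  bijective_pi0 := by
    rw [pi0Map_eq_of_homotopy H]
    exact Function.bijective_id
  bijective_pi n _ x := bijective_piMap_of_homotopy H n x

lemma pi0Map_comp (g : C(Y, Z)) (f : C(X, Y)) : pi0Map (g.comp f) = pi0Map g ∘ pi0Map f := by
  funext a
  induction a using ZerothHomotopy.rec with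
  | mk x => rfl

lemma piMap_comp (g : C(Y, Z)) (f : C(X, Y)) (n : ℕ) (x : X) :
    piMap (g.comp f) n x = piMap g n (f x) ∘ piMap f n x := by
  funext a
  exact Quotient.inductionOn a fun f => rfl

lemma IsWeakHomotopyEquiv.comp {g : C(Y, Z)} {f : C(X, Y)} (hg : IsWeakHomotopyEquiv g)
    (hf : IsWeakHomotopyEquiv f) : IsWeakHomotopyEquiv (g.comp f) where
  bijective_pi0 := by
    rw [pi0Map_comp]
    exact hg.bijective_pi0.comp hf.bijective_pi0
  bijective_pi n hn x := by
    rw [piMap_comp]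
    exact (hg.bijective_pi n hn _).comp (hf.bijective_pi n hn x)

lemma IsWeakHomotopyEquiv.of_comp_left {g : C(Y, Z)} {f : C(X, Y)} (hg : IsWeakHomotopyEquiv g)
    (hgf : IsWeakHomotopyEquiv (g.comp f)) : IsWeakHomotopyEquiv f where
  bijective_pi0 := by
    have h := hgf.bijective_pi0
    rw [pi0Map_comp] at h
    exact (Function.Bijective.of_comp_iff' hg.bijective_pi0 _).1 h
  bijective_pi n hn x := by
    have h := hgf.bijective_pi n hn x
    rw [piMap_comp] at h
    exact (Function.Bijective.of_comp_iff' (hg.bijective_pi n hn _) _).1 h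

lemma isWeakHomotopyEquiv_id : IsWeakHomotopyEquiv (ContinuousMap.id X) :=
  isWeakHomotopyEquiv_of_homotopy (.refl _)

lemma isWeakHomotopyEquiv_of_section {p : C(X, Y)} {s : C(Y, X)} (hps : p.comp s = .id Y)
    (hsp : IsWeakHomotopyEquiv (s.comp p)) : IsWeakHomotopyEquiv p := by
  have h1 : IsWeakHomotopyEquiv (p.comp s) := hps ▸ isWeakHomotopyEquiv_id
  have aux : ∀ {α β γ δ : Type u} (f : α → β) (g : β → γ) (h : γ → δ),
      Function.Bijective (g ∘ f) → Function.Bijective (h ∘ g) → Function.Bijective f := by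
    intro α β γ δ f g h h1 h2
    have hg : Function.Bijective g := ⟨h2.1.of_comp, h1.2.of_comp⟩
    exact (Function.Bijective.of_comp_iff' hg f).1 h1
  constructor
  · have h2 := hsp.bijective_pi0
    have h3 := h1.bijective_pi0
    rw [pi0Map_comp] at h2 h3
    exact aux _ _ _ h2 h3
  · intro n hn x
    have h2 := hsp.bijective_pi n hn x
    have h3 := h1.bijective_pi n hn (p x)
    rw [piMap_comp] at h2 h3
    exact aux _ _ _ h2 h3

end weakEquiv
end AInf

/-! ### The prism as a quotient of simplices -/

namespace AInf

open Topology

section prism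

lemma map_apply {α β : Type*} [Fintype α] [Fintype β] [DecidableEq β] (f : α → β)
    (r : stdSimplex ℝ α) (y : β) :
    stdSimplex.map f r y = ∑ i, if f i = y then r i else 0 := by
  rw [stdSimplex.map_coe, FunOnFinite.linearMap_apply_apply, Finset.sum_filter]

lemma map_apply_of_injective {α β : Type*} [Fintype α] [Fintype β] {f : α → β}
    (hf : Function.Injective f) (r : stdSimplex ℝ α) (a : α) :
    stdSimplex.map f r (f a) = r a := by
  classical
  rw [map_apply]
  simp [hf.eq_iff]

lemma le_map_apply {α β : Type*} [Fintype α] [Fintype β] (f : α → β) (r : stdSimplex ℝ α) (a : α) :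
    r a ≤ stdSimplex.map f r (f a) := by
  classical
  rw [map_apply]
  refine le_trans (by simp) (Finset.single_le_sum (f := fun i => if f i = f a then r i else 0)
    (fun i _ => ?_) (Finset.mem_univ a))
  split_ifs
  exacts [r.2.1 i, le_rfl]

lemma exists_of_map_apply_pos {α β : Type*} [Fintype α] [Fintype β] (f : α → β)
    (r : stdSimplex ℝ α) (y : β) (h : 0 < stdSimplex.map f r y) : ∃ a, 0 < r a ∧ f a = y := by
  classical
  rw [map_apply] at h
  obtain ⟨a, -, ha⟩ := Finset.exists_lt_of_sum_lt (f := fun _ => (0 : ℝ)) (by simpa using h)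
  by_cases hf : f a = y
  · exact ⟨a, by simpa [hf] using ha, hf⟩
  · simp [hf] at ha

lemma map_injective_of_injective {α β : Type*} [Fintype α] [Fintype β] {f : α → β}
    (hf : Function.Injective f) : Function.Injective (stdSimplex.map (S := ℝ) f) := by
  intro r r' h
  refine stdSimplex.ext (funext fun a => ?_)
  rw [← map_apply_of_injective hf r a, h, map_apply_of_injective hf]

/-- A point of a simplex lies in the interior of a unique face. -/
lemma exists_interior {L : Type*} [Fintype L] [LinearOrder L] (w : stdSimplex ℝ L) :
    ∃ (j : ℕ) (e : Fin (j + 1) ↪o L) (v : stdSimplex ℝ (Fin (j + 1))),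
      (∀ i, 0 < v i) ∧ stdSimplex.map e v = w := by
  classical
  let S : Finset L := {a | 0 < w a}
  have hsum : ∑ a ∈ S, w a = 1 := by
    rw [← w.2.2]
    refine Finset.sum_subset (Finset.subset_univ _) fun a _ ha => ?_
    refine le_antisymm ?_ (w.2.1 a)
    simpa [S] using ha
  have hS : S.card ≠ 0 := by
    intro h
    rw [Finset.card_eq_zero.1 h] at hsum
    simp at hsum
  obtain ⟨j, hj⟩ := Nat.exists_eq_succ_of_ne_zero hS
  let e := S.orderEmbOfFin hj
  have he : ∀ i, 0 < w (e i) := fun i => by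
    exact (Finset.mem_filter.1 (S.orderEmbOfFin_mem hj i)).2
  have hr : ∀ y, 0 < w y → ∃ i, e i = y := by
    intro y hy
    have : y ∈ Set.range e := by
      rw [S.range_orderEmbOfFin hj]
      simpa [S] using hy
    exact this
  have hv : ∑ i, w (e i) = 1 := by
    rw [← hsum, ← S.image_orderEmbOfFin_univ hj, Finset.sum_image]
    exact fun a _ b _ h => e.injective h
  let v : stdSimplex ℝ (Fin (j + 1)) := ⟨fun i => w (e i), fun i => (he i).le, hv⟩
  refine ⟨j, e, v, he, stdSimplex.ext (funext fun y => ?_)⟩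
  by_cases hy : 0 < w y
  · obtain ⟨i, rfl⟩ := hr y hy
    exact map_apply_of_injective e.injective v i
  · have h0 : w y = 0 := le_antisymm (not_lt.1 hy) (w.2.1 y)
    rw [h0]
    refine le_antisymm ?_ (stdSimplex.zero_le _ y)
    by_contra! hc
    obtain ⟨a, -, ha⟩ := exists_of_map_apply_pos _ _ _ hc
    exact hy (ha ▸ he a)

variable {n : ℕ}

/-- A chain in `[n] × [1]` carrying weights is determined by its marginals, where the weights are
considered as a distribution on `[n] × [1]`. -/
lemma map_eq_of_marginals {k k' : ℕ} (γ : Fin (k + 1) →o Fin (n + 1) × Fin 2)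
    (γ' : Fin (k' + 1) →o Fin (n + 1) × Fin 2) (r : stdSimplex ℝ (Fin (k + 1)))
    (r' : stdSimplex ℝ (Fin (k' + 1)))
    (h1 : stdSimplex.map (fun i => (γ i).1) r = stdSimplex.map (fun i => (γ' i).1) r')
    (h2 : stdSimplex.map (fun i => (γ i).2) r = stdSimplex.map (fun i => (γ' i).2) r') :
    stdSimplex.map γ r = stdSimplex.map γ' r' := by
  set w := stdSimplex.map γ r with hw
  set w' := stdSimplex.map γ' r' with hw'
  -- in the support of a chain, `(i, 0)` and `(j, 1)` satisfy `i ≤ j`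
  have chain : ∀ {k : ℕ} (γ : Fin (k + 1) →o Fin (n + 1) × Fin 2)
      (r : stdSimplex ℝ (Fin (k + 1))) (i j : Fin (n + 1)),
      0 < stdSimplex.map γ r (i, 0) → 0 < stdSimplex.map γ r (j, 1) → i ≤ j := by
    intro k γ r i j hi hj
    obtain ⟨a, -, ha⟩ := exists_of_map_apply_pos _ _ _ hi
    obtain ⟨b, -, hb⟩ := exists_of_map_apply_pos _ _ _ hj
    obtain h | h := le_total a b
    · have := γ.monotone h
      rw [ha, hb] at this
      exact this.1
    · have := γ.monotone h
      rw [ha, hb] at this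
      exact absurd this.2 (by simp)
  have hfst : ∀ {k : ℕ} (γ : Fin (k + 1) →o Fin (n + 1) × Fin 2)
      (r : stdSimplex ℝ (Fin (k + 1))) (i : Fin (n + 1)),
      stdSimplex.map (fun i => (γ i).1) r i =
        stdSimplex.map γ r (i, 0) + stdSimplex.map γ r (i, 1) := by
    intro k γ r i
    have : stdSimplex.map (fun i => (γ i).1) r = stdSimplex.map Prod.fst (stdSimplex.map γ r) :=
      (stdSimplex.map_comp_apply γ Prod.fst r).symm
    rw [this, map_apply, Fintype.sum_prod_type, Finset.sum_eq_single i]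
    · simp [Fin.sum_univ_two]
    · intro j _ hj
      simp [hj]
    · simp
  have hsnd : ∀ {k : ℕ} (γ : Fin (k + 1) →o Fin (n + 1) × Fin 2)
      (r : stdSimplex ℝ (Fin (k + 1))),
      stdSimplex.map (fun i => (γ i).2) r 0 = ∑ i, stdSimplex.map γ r (i, 0) := by
    intro k γ r
    have : stdSimplex.map (fun i => (γ i).2) r = stdSimplex.map Prod.snd (stdSimplex.map γ r) :=
      (stdSimplex.map_comp_apply γ Prod.snd r).symm
    rw [this, map_apply, Fintype.sum_prod_type]
    simp
  have e1 : ∀ i, w (i, 0) + w (i, 1) = w' (i, 0) + w' (i, 1) := fun i => by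
    rw [← hfst, ← hfst, h1]
  have e2 : ∑ i, w (i, 0) = ∑ i, w' (i, 0) := by rw [← hsnd, ← hsnd, h2]
  have key : ∀ i, w (i, 0) = w' (i, 0) := by
    by_contra! hne
    have hlt : ∃ i, w (i, 0) < w' (i, 0) := by
      by_contra! hle
      obtain ⟨i, hi⟩ := hne
      exact (Finset.sum_lt_sum (fun i _ => hle i)
        ⟨i, Finset.mem_univ _, lt_of_le_of_ne (hle i) hi.symm⟩).ne e2.symm
    have hgt : ∃ i, w' (i, 0) < w (i, 0) := by
      by_contra! hle
      obtain ⟨i, hi⟩ := hne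
      exact (Finset.sum_lt_sum (fun i _ => hle i)
        ⟨i, Finset.mem_univ _, lt_of_le_of_ne (hle i) hi⟩).ne e2
    obtain ⟨i, hi⟩ := hlt
    obtain ⟨j, hj⟩ := hgt
    have a1 := e1 i
    have a2 := e1 j
    have p1 := stdSimplex.zero_le w (i, 0)
    have p2 := stdSimplex.zero_le w' (j, 0)
    have p3 := stdSimplex.zero_le w (j, 1)
    have p4 := stdSimplex.zero_le w' (i, 1)
    have l1 : j ≤ i := chain γ r j i (by rw [← hw]; linarith) (by rw [← hw]; linarith)
    have l2 : i ≤ j := chain γ' r' i j (by rw [← hw']; linarith) (by rw [← hw']; linarith)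
    rw [le_antisymm l1 l2] at hj
    exact lt_asymm hi hj
  refine stdSimplex.ext (funext fun p => ?_)
  obtain ⟨i, e⟩ := p
  fin_cases e
  · exact key i
  · have a1 := e1 i
    rw [key i] at a1
    exact add_left_cancel a1

variable {Z : Type*}

/-- A family of functions on the topological simplices `Δ^k`, one for each `k`-simplex `γ` of the
prism `Δ[n] × Δ[1]`, natural with respect to all monotone maps. -/
def IsPrismFamily
    (Φ : ∀ k : ℕ, (Fin (k + 1) →o Fin (n + 1) × Fin 2) → stdSimplex ℝ (Fin (k + 1)) → Z) : Prop :=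
  ∀ {k k' : ℕ} (π : Fin (k + 1) →o Fin (k' + 1)) (γ : Fin (k' + 1) →o Fin (n + 1) × Fin 2)
    (r : stdSimplex ℝ (Fin (k + 1))), Φ k (γ.comp π) r = Φ k' γ (stdSimplex.map π r)

variable
  {Φ : ∀ k : ℕ, (Fin (k + 1) →o Fin (n + 1) × Fin 2) → stdSimplex ℝ (Fin (k + 1)) → Z}

/-- The values of a natural family are computed on the face that contains the point in its
interior. -/
lemma IsPrismFamily.eq_interior (hΦ : IsPrismFamily Φ) {k j : ℕ}
    (γ : Fin (k + 1) →o Fin (n + 1) × Fin 2) (r : stdSimplex ℝ (Fin (k + 1)))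
    (e : Fin (j + 1) ↪o Fin (n + 1) ×ₗ Fin 2) {v : stdSimplex ℝ (Fin (j + 1))} (hv : ∀ i, 0 < v i)
    (h : stdSimplex.map e v = stdSimplex.map (fun i => toLex (γ i)) r) :
    ∃ h : Monotone fun i => ofLex (e i), Φ k γ r = Φ j ⟨_, h⟩ v := by
  have he : ∀ i, ∃ a, toLex (γ a) = e i := by
    intro i
    have h1 := hv i
    rw [← map_apply_of_injective e.injective v i, h] at h1
    obtain ⟨a, -, ha⟩ := exists_of_map_apply_pos _ _ _ h1
    exact ⟨a, ha⟩
  have hmono : Monotone fun i => ofLex (e i) := by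
    intro i j hij
    obtain ⟨a, ha⟩ := he i
    obtain ⟨b, hb⟩ := he j
    dsimp only
    rw [← ha, ← hb, ofLex_toLex, ofLex_toLex]
    obtain hab | hab := le_total a b
    · exact γ.monotone hab
    · have h1 : e j ≤ e i := by
        rw [← ha, ← hb]
        exact Prod.Lex.toLex_mono (γ.monotone hab)
      have h2 : toLex (γ a) = toLex (γ b) := by
        rw [ha, hb]
        exact le_antisymm (e.monotone hij) h1
      exact (toLex.injective h2).le
  refine ⟨hmono, ?_⟩
  obtain ⟨l, δ, r', hr', rfl⟩ := exists_interior r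
  have hπ : ∀ i, ∃ a, e a = toLex (γ (δ i)) := by
    intro i
    have h1 := le_map_apply (fun i => toLex (γ i)) (stdSimplex.map δ r') (δ i)
    rw [map_apply_of_injective δ.injective, ← h] at h1
    obtain ⟨a, -, ha⟩ := exists_of_map_apply_pos _ _ _ ((hr' i).trans_le h1)
    exact ⟨a, ha⟩
  choose π hπ using hπ
  have hπm : Monotone π := by
    intro i j hij
    rw [← e.le_iff_le, hπ, hπ]
    exact Prod.Lex.toLex_mono (γ.monotone (δ.monotone hij))
  have h1 : stdSimplex.map π r' = v := by
    refine map_injective_of_injective e.injective ?_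
    rw [h, stdSimplex.map_comp_apply, stdSimplex.map_comp_apply]
    refine congrArg (fun f => stdSimplex.map f r') (funext fun i => ?_)
    exact hπ i
  have h2 := hΦ δ.toOrderHom γ r'
  have h3 := hΦ ⟨π, hπm⟩ ⟨_, hmono⟩ r'
  refine h2.symm.trans (Eq.trans ?_ (h3.trans (congrArg _ h1)))
  refine congrArg (fun γ => Φ l γ r') (OrderHom.ext _ _ (funext fun i => ?_))
  exact (congrArg ofLex (hπ i)).symm

/-- A natural family of functions on the simplices of the prism is given by a function on the
product of topological simplices. -/
lemma IsPrismFamily.eq_of_marginals (hΦ : IsPrismFamily Φ) {k k' : ℕ}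
    {γ : Fin (k + 1) →o Fin (n + 1) × Fin 2}
    {γ' : Fin (k' + 1) →o Fin (n + 1) × Fin 2} {r : stdSimplex ℝ (Fin (k + 1))}
    {r' : stdSimplex ℝ (Fin (k' + 1))}
    (h1 : stdSimplex.map (fun i => (γ i).1) r = stdSimplex.map (fun i => (γ' i).1) r')
    (h2 : stdSimplex.map (fun i => (γ i).2) r = stdSimplex.map (fun i => (γ' i).2) r') :
    Φ k γ r = Φ k' γ' r' := by
  have h3 := congrArg (stdSimplex.map (toLex : _ → Fin (n + 1) ×ₗ Fin 2))
    (map_eq_of_marginals γ γ' r r' h1 h2)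
  rw [stdSimplex.map_comp_apply, stdSimplex.map_comp_apply] at h3
  obtain ⟨j, e, v, hv, hw⟩ := exists_interior
    (stdSimplex.map (fun i => (toLex (γ i) : Fin (n + 1) ×ₗ Fin 2)) r)
  obtain ⟨hm, h4⟩ := hΦ.eq_interior γ r e hv hw
  exact h4.trans (hΦ.eq_interior γ' r' e hv (hw.trans h3)).choose_spec.symm

/-- The maximal simplices of the prism. -/
def prismChain (i : Fin (n + 1)) : Fin (n + 2) →o Fin (n + 1) × Fin 2 where
  toFun j := (i.predAbove j, if j ≤ i.castSucc then 0 else 1)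
  monotone' j j' h := by
    refine ⟨Fin.predAbove_right_monotone i h, ?_⟩
    dsimp only
    split_ifs with h1 h2
    · exact le_rfl
    · exact Fin.zero_le _
    · exact absurd (h.trans ‹_›) h1
    · exact le_rfl

/-- The maximal simplices cover the prism. -/
lemma exists_prismChain (t : stdSimplex ℝ (Fin (n + 1))) (s : stdSimplex ℝ (Fin 2)) :
    ∃ (i : Fin (n + 1)) (r : stdSimplex ℝ (Fin (n + 2))),
      stdSimplex.map (fun j => (prismChain i j).1) r = t ∧
      stdSimplex.map (fun j => (prismChain i j).2) r = s := by
  have hs0 := stdSimplex.zero_le s 0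
  have hs1 := stdSimplex.zero_le s 1
  have hs := stdSimplex.add_eq_one s
  -- the simplex is determined by the position of `s 0` among the partial sums of `t`
  have hex : ∃ i : Fin (n + 1), s 0 ≤ ∑ j with j ≤ i, t j := by
    refine ⟨Fin.last n, ?_⟩
    simp only [Fin.le_last, Finset.filter_true]
    have := t.2.2
    refine le_trans ?_ this.ge
    linarith
  classical
  obtain ⟨i, hi, hmin⟩ := WellFounded.has_min (wellFounded_lt (α := Fin (n + 1)))
    {i | s 0 ≤ ∑ j with j ≤ i, t j} hex
  have hi' : ∑ j with j < i, t j ≤ s 0 := by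
    induction i using Fin.cases with
    | zero => simp
    | succ i =>
      have h1 := hmin i.castSucc
      have h2 : ¬ s 0 ≤ ∑ j with j ≤ i.castSucc, t j := fun h => h1 h (Fin.castSucc_lt_succ)
      refine le_trans (le_of_eq ?_) (not_le.1 h2).le
      refine Finset.sum_congr (Finset.filter_congr fun j _ => ?_) fun _ _ => rfl
      exact Fin.le_castSucc_iff.symm
  have hsplit : ∑ j with j ≤ i, t j = ∑ j with j < i, t j + t i := by
    rw [← Finset.sum_subset (s₁ := insert i (Finset.univ.filter fun j => j < i)), Finset.sum_insert (by simp), add_comm]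
    · intro j
      simp only [Finset.mem_insert, Finset.mem_filter, Finset.mem_univ, true_and]
      rintro (rfl | h)
      exacts [le_rfl, h.le]
    · intro j h1 h2
      simp only [Finset.mem_insert, Finset.mem_filter, Finset.mem_univ, true_and] at h1 h2
      exact absurd (eq_or_lt_of_le h1) h2
  set a : ℝ := s 0 - ∑ j with j < i, t j with ha
  set b : ℝ := ∑ j with j ≤ i, t j - s 0 with hb
  have hab : a + b = t i := by rw [ha, hb, hsplit]; ring
  let q : Fin (n + 1) → ℝ := Function.update t i b
  let ρ : Fin (n + 2) → ℝ := i.castSucc.insertNth a q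
  have hq : ∀ j, 0 ≤ q j := by
    intro j
    by_cases h : j = i
    · subst h
      simp only [q, Function.update_self]
      exact sub_nonneg.2 hi
    · simp only [q, Function.update_of_ne h]
      exact stdSimplex.zero_le t j
  have hsum : ∀ f : Fin (n + 2) → ℝ, ∑ j, f j * ρ j =
      f i.castSucc * a + ∑ j, f (i.castSucc.succAbove j) * q j := by
    intro f
    rw [Fin.sum_univ_succAbove _ i.castSucc]
    simp [ρ]
  have hq2 : ∀ f : Fin (n + 1) → ℝ, ∑ j, f j * q j = ∑ j, f j * t j - f i * a := by
    intro f
    rw [← Finset.add_sum_erase _ _ (Finset.mem_univ i),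
      ← Finset.add_sum_erase (a := i) _ (fun j => f j * t j) (Finset.mem_univ i), ← hab]
    have : ∑ j ∈ Finset.univ.erase i, f j * q j = ∑ j ∈ Finset.univ.erase i, f j * t j := by
      refine Finset.sum_congr rfl fun j hj => ?_
      rw [show q j = t j from Function.update_of_ne (Finset.ne_of_mem_erase hj) _ _]
    rw [this, show q i = b from Function.update_self _ _ _]
    ring
  have hρ0 : ∀ j, 0 ≤ ρ j := by
    intro j
    induction j using Fin.succAboveCases i.castSucc with
    | x =>
      simp only [ρ, Fin.insertNth_apply_same]
      exact sub_nonneg.2 hi'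
    | p j => simpa [ρ] using hq j
  have hρ1 : ∑ j, ρ j = 1 := by
    have h1 := hsum fun _ => 1
    have h2 := hq2 fun _ => 1
    simp only [one_mul] at h1 h2
    rw [h1, h2, add_sub_cancel, ← t.2.2]
    rfl
  refine ⟨i, ⟨ρ, hρ0, hρ1⟩, ?_, ?_⟩
  · refine stdSimplex.ext (funext fun m => ?_)
    have h1 := hsum fun j => if i.predAbove j = m then 1 else 0
    have h2 := hq2 fun j => if j = m then 1 else 0
    simp only [Fin.predAbove_succAbove, Fin.predAbove_castSucc_self, ite_mul, one_mul,
      zero_mul] at h1 h2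
    rw [map_apply]
    refine h1.trans ?_
    rw [h2]
    simp
  · have h0 : stdSimplex.map (fun j => (prismChain i j).2) ⟨ρ, hρ0, hρ1⟩ 0 = s 0 := by
      have h1 := hsum fun j => if j ≤ i.castSucc then 1 else 0
      have h2 := hq2 fun j => if j < i then 1 else 0
      have h3 : ∀ j, i.castSucc.succAbove j ≤ i.castSucc ↔ j < i := by
        intro j
        rw [← Fin.castSucc_lt_castSucc_iff, ← Fin.succAbove_lt_iff_castSucc_lt]
        exact ⟨fun h => lt_of_le_of_ne h (Fin.succAbove_ne _ _), le_of_lt⟩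
      simp only [h3, ite_mul, one_mul, zero_mul, le_rfl, lt_irrefl, if_true, if_false,
        sub_zero] at h1 h2
      rw [map_apply]
      have h4 : ∀ j, (prismChain i j).2 = 0 ↔ j ≤ i.castSucc := by
        intro j
        change (if j ≤ i.castSucc then (0 : Fin 2) else 1) = 0 ↔ _
        split_ifs with h <;> simp [h]
      simp only [h4]
      refine h1.trans ?_
      rw [h2, ← Finset.sum_filter, ha]
      ring
    have h1 := stdSimplex.add_eq_one (stdSimplex.map (fun j => (prismChain i j).2) ⟨ρ, hρ0, hρ1⟩)
    refine stdSimplex.ext (funext fun e => ?_)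
    fin_cases e
    · exact h0
    · rw [h0] at h1
      exact add_left_cancel (h1.trans hs.symm)

variable [TopologicalSpace Z]

/-- Natural families of continuous functions on the simplices of the prism are the continuous
functions on the product of topological simplices. -/
lemma IsPrismFamily.exists_desc (hΦ : IsPrismFamily Φ) (hc : ∀ k γ, Continuous (Φ k γ)) :
    ∃ Ψ : C(stdSimplex ℝ (Fin (n + 1)) × stdSimplex ℝ (Fin 2), Z),
      ∀ k γ r, Ψ (stdSimplex.map (fun j => (γ j).1) r, stdSimplex.map (fun j => (γ j).2) r) =
        Φ k γ r := by
  let f : C((Σ _ : Fin (n + 1), stdSimplex ℝ (Fin (n + 2))),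
      stdSimplex ℝ (Fin (n + 1)) × stdSimplex ℝ (Fin 2)) :=
    ⟨fun p => (stdSimplex.map (fun j => (prismChain p.1 j).1) p.2,
        stdSimplex.map (fun j => (prismChain p.1 j).2) p.2), continuous_sigma fun i =>
      (stdSimplex.continuous_map fun j => (prismChain i j).1).prodMk
        (stdSimplex.continuous_map fun j => (prismChain i j).2)⟩
  let g : C((Σ _ : Fin (n + 1), stdSimplex ℝ (Fin (n + 2))), Z) :=
    ⟨fun p => Φ (n + 1) (prismChain p.1) p.2, continuous_sigma fun i => hc (n + 1) (prismChain i)⟩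
  -- the maximal simplices form a compact space that surjects onto the Hausdorff product
  have hf : IsQuotientMap f := by
    refine IsQuotientMap.of_surjective_continuous ?_ f.continuous
    rintro ⟨t, s⟩
    obtain ⟨i, r, h1, h2⟩ := exists_prismChain t s
    exact ⟨⟨i, r⟩, Prod.ext h1 h2⟩
  have hg : Function.FactorsThrough g f := by
    rintro p q h
    exact hΦ.eq_of_marginals (Prod.ext_iff.1 h).1 (Prod.ext_iff.1 h).2
  refine ⟨hf.lift g hg, fun k γ r => ?_⟩
  obtain ⟨i, r', h1, h2⟩ := exists_prismChain (stdSimplex.map (fun j => (γ j).1) r)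
    (stdSimplex.map (fun j => (γ j).2) r)
  have h3 : hf.lift g hg (f ⟨i, r'⟩) = g ⟨i, r'⟩ :=
    DFunLike.congr_fun (hf.lift_comp g hg) _
  have h4 : f ⟨i, r'⟩ = (stdSimplex.map (fun j => (γ j).1) r,
    stdSimplex.map (fun j => (γ j).2) r) := Prod.ext h1 h2
  rw [← h4, h3]
  exact hΦ.eq_of_marginals h1 h2

end prism
end AInf

/-! ### Realization of simplicial homotopies -/

namespace AInf

open Simplicial SimplexCategory MonoidalCategory

section realization

variable {X Y : SSet.{u}}

/-- The characteristic map of a simplex in the geometric realization. -/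
noncomputable def charMap {n : SimplexCategory} (x : X.obj (op n)) :
    C(stdSimplex ℝ (Fin (n.len + 1)), SSet.toTop.obj X) :=
  TopCat.toSSetObjEquiv _ _ ((sSetTopAdj.unit.app X).app (op n) x)

lemma charMap_map {m n : SimplexCategory} (α : m ⟶ n) (x : X.obj (op n))
    (t : stdSimplex ℝ (Fin (m.len + 1))) :
    charMap (X.map α.op x) t = charMap x (stdSimplex.map α t) := by
  unfold charMap
  rw [← TopCat.toSSetObjEquiv_naturality_apply]
  refine congrArg (fun y => TopCat.toSSetObjEquiv _ _ y t) ?_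
  exact ConcreteCategory.congr_hom ((sSetTopAdj.unit.app X).naturality α.op) x

lemma toTop_map_charMap (f : X ⟶ Y) {n : SimplexCategory} (x : X.obj (op n))
    (t : stdSimplex ℝ (Fin (n.len + 1))) :
    (SSet.toTop.map f).hom (charMap x t) = charMap (f.app (op n) x) t := by
  have h := sSetTopAdj.unit.naturality f
  have h1 := ConcreteCategory.congr_hom (congr_app h (op n)) x
  exact (congrArg (fun y => TopCat.toSSetObjEquiv _ _ y t) h1).symm

lemma homEquiv_symm_charMap {Z : TopCat.{u}} (σ : X ⟶ TopCat.toSSet.obj Z) {n : SimplexCategory}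
    (x : X.obj (op n)) (t : stdSimplex ℝ (Fin (n.len + 1))) :
    ((sSetTopAdj.homEquiv X Z).symm σ).hom (charMap x t) =
      TopCat.toSSetObjEquiv _ _ (σ.app (op n) x) t := by
  have h : (sSetTopAdj.homEquiv X Z) ((sSetTopAdj.homEquiv X Z).symm σ) = σ :=
    Equiv.apply_symm_apply _ _
  rw [Adjunction.homEquiv_unit] at h
  have h1 := ConcreteCategory.congr_hom (congr_app h (op n)) x
  exact congrArg (fun y => TopCat.toSSetObjEquiv _ _ y t) h1

lemma realization_hom_ext {Z : TopCat.{u}} {f g : SSet.toTop.obj X ⟶ Z}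
    (h : ∀ (n : SimplexCategory) (x : X.obj (op n)) (t : stdSimplex ℝ (Fin (n.len + 1))),
      f.hom (charMap x t) = g.hom (charMap x t)) : f = g := by
  apply (sSetTopAdj.homEquiv X Z).injective
  rw [Adjunction.homEquiv_unit, Adjunction.homEquiv_unit]
  ext n x
  induction n using Opposite.rec with
  | op n =>
  refine (TopCat.toSSetObjEquiv Z (op n)).injective (ContinuousMap.ext fun t => ?_)
  exact h n x t

/-- Functions on the geometric realization from compatible functions on the simplices. -/
lemma exists_realization_desc {Z : TopCat.{u}}
    (φ : ∀ (n : SimplexCategory), X.obj (op n) → C(stdSimplex ℝ (Fin (n.len + 1)), Z))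
    (hφ : ∀ {m n : SimplexCategory} (α : m ⟶ n) (x : X.obj (op n))
      (t : stdSimplex ℝ (Fin (m.len + 1))), φ m (X.map α.op x) t = φ n x (stdSimplex.map α t)) :
    ∃ G : C(SSet.toTop.obj X, Z), ∀ n x t, G (charMap x t) = φ n x t := by
  let σ : X ⟶ TopCat.toSSet.obj Z :=
    { app n := TypeCat.ofHom fun x => (TopCat.toSSetObjEquiv Z n).symm (φ n.unop x)
      naturality n m α := by
        ext x
        refine (TopCat.toSSetObjEquiv Z m).injective (ContinuousMap.ext fun t => ?_)
        exact hφ α.unop x t }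
  refine ⟨((sSetTopAdj.homEquiv X Z).symm σ).hom, fun n x t => ?_⟩
  rw [homEquiv_symm_charMap]
  rfl

/-- A chain in `[n] × [1]` as a simplex of the cylinder on a simplex. -/
def cylinderSimplex {n : SimplexCategory} (x : X.obj (op n)) {k : ℕ}
    (γ : Fin (k + 1) →o Fin (n.len + 1) × Fin 2) : (X ⊗ Δ[1] : SSet.{u}).obj (op ⦋k⦌) :=
  (X.map (show ⦋k⦌ ⟶ n from SimplexCategory.Hom.mk (OrderHom.fst.comp γ)).op x,
    SSet.stdSimplex.objEquiv.symm (SimplexCategory.Hom.mk (OrderHom.snd.comp γ)))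

/-- The geometric realization of a simplicial homotopy. -/
lemma exists_realization_homotopy (H : X ⊗ Δ[1] ⟶ Y) :
    Nonempty (ContinuousMap.Homotopy (SSet.toTop.map (SSet.ι₀ ≫ H)).hom
      (SSet.toTop.map (SSet.ι₁ ≫ H)).hom) := by
  let Φ (n : SimplexCategory) (x : X.obj (op n)) (k : ℕ)
      (γ : Fin (k + 1) →o Fin (n.len + 1) × Fin 2) (r : stdSimplex ℝ (Fin (k + 1))) :
      SSet.toTop.obj Y := charMap (H.app (op ⦋k⦌) (cylinderSimplex x γ)) r
  have hΦ : ∀ n x, IsPrismFamily (Φ n x) := by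
    intro n x k k' π γ r
    dsimp only [Φ]
    have h1 := charMap_map (SimplexCategory.Hom.mk π : ⦋k⦌ ⟶ ⦋k'⦌)
      (H.app (op ⦋k'⦌) (cylinderSimplex x γ)) r
    refine Eq.trans ?_ h1
    refine congrArg (fun y => charMap y r) ?_
    refine Eq.trans ?_ (ConcreteCategory.congr_hom
      (H.naturality (show ⦋k⦌ ⟶ ⦋k'⦌ from SimplexCategory.Hom.mk π).op) (cylinderSimplex x γ))
    refine congrArg (H.app (op ⦋k⦌)) (Prod.ext ?_ ?_)
    · exact ConcreteCategory.congr_hom (X.map_comp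
        (show ⦋k'⦌ ⟶ n from SimplexCategory.Hom.mk (OrderHom.fst.comp γ)).op
        (show ⦋k⦌ ⟶ ⦋k'⦌ from SimplexCategory.Hom.mk π).op) x
    · rfl
  have hc : ∀ n x k γ, Continuous (Φ n x k γ) := fun n x k γ => ContinuousMap.continuous _
  choose Ψ hΨ using fun n x => IsPrismFamily.exists_desc (Φ := Φ n x) (hΦ n x) (hc n x)
  -- naturality can be tested on the maximal simplices of the prism
  have hnat : ∀ {m n : SimplexCategory} (α : m ⟶ n) (x : X.obj (op n))
      (t : stdSimplex ℝ (Fin (m.len + 1))) (s : stdSimplex ℝ (Fin 2)),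
      Ψ m (X.map α.op x) (t, s) = Ψ n x (stdSimplex.map α t, s) := by
    intro m n α x t s
    obtain ⟨i, r, rfl, rfl⟩ := exists_prismChain t s
    rw [hΨ, stdSimplex.map_comp_apply]
    let γ : Fin (m.len + 2) →o Fin (n.len + 1) × Fin 2 :=
      (OrderHom.prodMap α.toOrderHom OrderHom.id).comp (prismChain i)
    refine Eq.trans ?_ (hΨ n x _ γ r).symm
    refine congrArg (fun y => charMap (H.app (op ⦋m.len + 1⦌) y) r) (Prod.ext ?_ ?_)
    · exact (ConcreteCategory.congr_hom (X.map_comp α.op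
        (show ⦋m.len + 1⦌ ⟶ m from
          SimplexCategory.Hom.mk (OrderHom.fst.comp (prismChain i))).op) x).symm
    · rfl
  -- the homotopy is constructed in its adjoint form, as a map into the space of paths in the target;
  -- this avoids comparing the realization of the cylinder with the product
  let e := stdSimplexHomeomorphUnitInterval
  obtain ⟨G, hG⟩ := exists_realization_desc (X := X)
    (Z := TopCat.of C(unitInterval, SSet.toTop.obj Y))
    (fun n x => ContinuousMap.curry
      ((Ψ n x).comp ⟨fun p => (p.1, e.symm p.2), by fun_prop⟩))
    (fun α x t => ContinuousMap.ext fun s => hnat α x t (e.symm s))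
  have hend : ∀ (e₀ : Fin 2) (n : SimplexCategory) (x : X.obj (op n))
      (t : stdSimplex ℝ (Fin (n.len + 1))), Ψ n x (t, stdSimplex.vertex e₀) =
      charMap (H.app (op ⦋n.len⦌) (cylinderSimplex x
        (OrderHom.prod OrderHom.id (OrderHom.const _ e₀)))) t := by
    intro e₀ n x t
    refine Eq.trans ?_ (hΨ n x _ (OrderHom.prod OrderHom.id (OrderHom.const _ e₀)) t)
    refine congrArg (Ψ n x) (Prod.ext ?_ ?_)
    · exact (stdSimplex.map_id_apply t).symm
    · refine stdSimplex.ext (funext fun a => ?_)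
      rw [map_apply]
      have := t.2.2
      by_cases h : e₀ = a
      · subst h
        simp
      · simp [h, Ne.symm h]
  let A : C(unitInterval × SSet.toTop.obj X, SSet.toTop.obj Y) :=
    ⟨fun p => G p.2 p.1, by fun_prop⟩
  have hA : ∀ s n x t, A (s, charMap x t) = Ψ n x (t, e.symm s) := fun s n x t =>
    DFunLike.congr_fun (hG n x t) s
  refine ⟨⟨A, fun z => ?_, fun z => ?_⟩⟩
  · have : TopCat.ofHom (A.comp ⟨fun z => (0, z), by fun_prop⟩) =
        SSet.toTop.map (SSet.ι₀ ≫ H) := by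
      refine realization_hom_ext fun n x t => ?_
      rw [toTop_map_charMap]
      refine (hA 0 n x t).trans ?_
      have h0 : e.symm 0 = stdSimplex.vertex 0 := by
        rw [Homeomorph.symm_apply_eq]
        rfl
      rw [h0, hend]
      refine congrArg (fun y => charMap (H.app (op ⦋n.len⦌) y) t) (Prod.ext ?_ ?_)
      · exact ConcreteCategory.congr_hom (X.map_id (op n)) x
      · rfl
    exact ConcreteCategory.congr_hom this z
  · have : TopCat.ofHom (A.comp ⟨fun z => (1, z), by fun_prop⟩) =
        SSet.toTop.map (SSet.ι₁ ≫ H) := by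
      refine realization_hom_ext fun n x t => ?_
      rw [toTop_map_charMap]
      refine (hA 1 n x t).trans ?_
      have h0 : e.symm 1 = stdSimplex.vertex 1 := by
        rw [Homeomorph.symm_apply_eq]
        rfl
      rw [h0, hend]
      refine congrArg (fun y => charMap (H.app (op ⦋n.len⦌) y) t) (Prod.ext ?_ ?_)
      · exact ConcreteCategory.congr_hom (X.map_id (op n)) x
      · rfl
    exact ConcreteCategory.congr_hom this z

end realization
end AInf

/-! ### Trivial fibrations and mapping spaces -/

namespace AInf

open Simplicial SimplexCategory MonoidalCategory

section trivialFibration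

variable {X Y : SSet.{u}}

/-- The vertices of the second component of a simplex of the cylinder. -/
def cylinderCoord {n : SimplexCategoryᵒᵖ} (y : (X ⊗ Δ[1] : SSet.{u}).obj n)
    (a : Fin (n.unop.len + 1)) : Fin 2 :=
  (SSet.stdSimplex.objEquiv y.2).toOrderHom a

/-- The two ends of the cylinder. -/
def cylinderEnds (X : SSet.{u}) : (X ⊗ Δ[1] : SSet.{u}).Subcomplex where
  obj _ := {y | ∀ a b, cylinderCoord y a = cylinderCoord y b}
  map f _ hy a b := hy (f.unop.toOrderHom a) (f.unop.toOrderHom b)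

/-- The map on the two ends of the cylinder that is the identity on the first end and is given by
`g` on the other end. -/
noncomputable def cylinderEndsMap (g : X ⟶ X) : (cylinderEnds X : SSet.{u}) ⟶ X where
  app n := TypeCat.ofHom fun y => if cylinderCoord y.1 0 = 0 then y.1.1 else g.app n y.1.1
  naturality n m f := by
    ext ⟨y, hy⟩
    have h : cylinderCoord y (f.unop.toOrderHom 0) = cylinderCoord y 0 := hy _ _
    change (if cylinderCoord y (f.unop.toOrderHom 0) = 0 then X.map f y.1 else g.app m (X.map f y.1)) =
      X.map f (if cylinderCoord y 0 = 0 then y.1 else g.app n y.1)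
    rw [h]
    split_ifs
    · rfl
    · exact ConcreteCategory.congr_hom (g.naturality f) y.1

/-- Trivial fibrations are deformation retractions. -/
lemma exists_section_homotopy {p : X ⟶ Y} (hp : SSet.modelCategoryQuillen.I.rlp p) :
    ∃ (s : Y ⟶ X) (H : X ⊗ Δ[1] ⟶ X), s ≫ p = 𝟙 Y ∧ SSet.ι₀ ≫ H = 𝟙 X ∧ SSet.ι₁ ≫ H = p ≫ s := by
  rw [← SSet.rlp_monomorphisms] at hp
  have h1 : HasLiftingProperty (⊥ : Y.Subcomplex).ι p := hp _ (.infer_property _)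
  have sq1 : CommSq ((SSet.Subcomplex.isInitialBot (X := Y)).to X) (⊥ : Y.Subcomplex).ι p (𝟙 Y) :=
    ⟨(SSet.Subcomplex.isInitialBot (X := Y)).hom_ext _ _⟩
  have hs : sq1.lift ≫ p = 𝟙 Y := sq1.fac_right
  -- the homotopy lifts the constant homotopy of `p`, relative to the ends of the cylinder
  have h2 : HasLiftingProperty (cylinderEnds X).ι p := hp _ (.infer_property _)
  have sq2 : CommSq (cylinderEndsMap (p ≫ sq1.lift)) (cylinderEnds X).ι p
      (CartesianMonoidalCategory.fst X Δ[1] ≫ p) := by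
    constructor
    ext n ⟨y, hy⟩
    change p.app n (if cylinderCoord y 0 = 0 then y.1 else sq1.lift.app n (p.app n y.1)) = p.app n y.1
    split_ifs
    · rfl
    · exact ConcreteCategory.congr_hom (congr_app hs n) (p.app n y.1)
  have h3 := sq2.fac_left
  refine ⟨sq1.lift, sq2.lift, hs, ?_, ?_⟩
  · ext n x
    have h4 := ConcreteCategory.congr_hom (congr_app h3 n)
      ⟨SSet.ι₀.app n x, fun a b => rfl⟩
    refine Eq.trans h4 ?_
    change (if cylinderCoord (SSet.ι₀.app n x) 0 = 0 then x else (p ≫ sq1.lift).app n x) = x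
    exact if_pos rfl
  · ext n x
    have h4 := ConcreteCategory.congr_hom (congr_app h3 n)
      ⟨SSet.ι₁.app n x, fun a b => rfl⟩
    refine Eq.trans h4 ?_
    change (if cylinderCoord (SSet.ι₁.app n x) 0 = 0 then x else (p ≫ sq1.lift).app n x) =
      (p ≫ sq1.lift).app n x
    exact if_neg (one_ne_zero (α := Fin 2))

/-- The geometric realization of a trivial fibration is a weak homotopy equivalence. -/
lemma isWeakHomotopyEquiv_of_rlp {p : X ⟶ Y} (hp : SSet.modelCategoryQuillen.I.rlp p) :
    IsWeakHomotopyEquiv (SSet.toTop.map p).hom := by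
  obtain ⟨s, H, hs, h0, h1⟩ := exists_section_homotopy hp
  obtain ⟨K⟩ := exists_realization_homotopy H
  rw [h0, h1, CategoryTheory.Functor.map_id, Functor.map_comp] at K
  refine isWeakHomotopyEquiv_of_section (s := (SSet.toTop.map s).hom) ?_
    (isWeakHomotopyEquiv_of_homotopy K)
  have h2 := congrArg (fun f => (SSet.toTop.map f).hom) hs
  simp only [Functor.map_comp, CategoryTheory.Functor.map_id] at h2
  exact h2

/-- The geometric realization of an isomorphism is a weak homotopy equivalence. -/
lemma isWeakHomotopyEquiv_of_isIso (p : X ⟶ Y) [IsIso p] :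
    IsWeakHomotopyEquiv (SSet.toTop.map p).hom :=
  isWeakHomotopyEquiv_of_rlp fun _ _ _ _ => inferInstance

end trivialFibration

/-- Quasi-isomorphisms of complexes induce weak homotopy equivalences of the associated spaces. -/
lemma ComplexMap.IsQuasiIso.isWeakHomotopyEquiv {A : GradedComplex.{v}} {B : GradedComplex.{v}}
    {φ : ComplexMap A B} (hφ : φ.IsQuasiIso) :
    IsWeakHomotopyEquiv (SSet.toTop.map (spaceMap.{v, u} φ)).hom := by
  have h1 := isWeakHomotopyEquiv_of_rlp (spaceMap_rlp.{v, u} φ.pathFst_hasLifting)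
  have h2 := isWeakHomotopyEquiv_of_rlp (spaceMap_rlp.{v, u} (φ.pathSnd_hasLifting hφ))
  have h3 : IsWeakHomotopyEquiv (SSet.toTop.map (spaceMap.{v, u} φ.toPath)).hom := by
    refine h1.of_comp_left ?_
    rw [← TopCat.hom_comp, ← Functor.map_comp, toPath_pathFst]
    exact isWeakHomotopyEquiv_of_isIso (𝟙 _)
  -- `φ` is the section of the first projection, followed by the second projection
  rw [← toPath_pathSnd, Functor.map_comp, TopCat.hom_comp]
  exact h2.comp h3

/-- A quasi-equivalence induces weak homotopy equivalences of mapping spaces. -/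
lemma isWeakHomotopyEquiv_homRMap {K : Type w} [CommRing K] {C D : AInfCategory.{w, v, u} K}
    (F : AInfFunctor C D) (x y : (nerve C).obj (op (mk 0)))
    [QuasiIso (F.homComplexMap (x.obj (0 : Fin 1)) (y.obj (0 : Fin 1)))] :
    IsWeakHomotopyEquiv (SSet.toTop.map (homRMap (nerveMap F) x y)).hom := by
  have h1 := (isQuasiIso_homGradedMap F (x := x.obj (0 : Fin 1)) (y := y.obj (0 : Fin 1))).isWeakHomotopyEquiv.{v, max u w}
  have h2 := homRToSpace_naturality F x y
  have h3 := congrArg (fun f => (SSet.toTop.map f).hom) h2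
  have h4 := fun {X Y Z : SSet.{max u v w}} (f : X ⟶ Y) (g : Y ⟶ Z) =>
    congrArg TopCat.Hom.hom (SSet.toTop.map_comp f g)
  refine (isWeakHomotopyEquiv_of_isIso (homRToSpace _ _)).of_comp_left ?_
  refine (congrArg IsWeakHomotopyEquiv ((h4 _ _).symm.trans (h3.trans (h4 _ _)))).mpr ?_
  exact h1.comp (isWeakHomotopyEquiv_of_isIso (homRToSpace x y))

end AInf

/-! ### Homotopy categories of ∞-categories -/

namespace AInf

open Simplicial SSet.Truncated SimplexCategory.Truncated SimplicialObject.Truncated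

section homotopyCategory

variable {X : SSet.{u}} [SSet.Quasicategory X]

/-- In an ∞-category, edges can be composed, by filling a horn. -/
lemma exists_edge_compStruct {x₀ x₁ x₂ : X.obj (op ⦋0⦌)} (e₀₁ : SSet.Edge x₀ x₁)
    (e₁₂ : SSet.Edge x₁ x₂) :
    ∃ e₀₂ : SSet.Edge x₀ x₂, Nonempty (SSet.Edge.CompStruct e₀₁ e₁₂ e₀₂) := by
  have w : SSet.stdSimplex.δ (0 : Fin 2) ≫ SSet.yonedaEquiv.symm e₀₁.edge =
      SSet.stdSimplex.δ (1 : Fin 2) ≫ SSet.yonedaEquiv.symm e₁₂.edge := by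
    rw [SSet.stdSimplex.δ_comp_yonedaEquiv_symm, SSet.stdSimplex.δ_comp_yonedaEquiv_symm,
      e₀₁.tgt_eq, e₁₂.src_eq]
  obtain ⟨s, hs⟩ := SSet.Quasicategory.hornFilling (S := X) (i := (1 : Fin 3)) (by decide)
    (by decide) (SSet.horn₂₁.isPushout.desc _ _ w)
  have h2 : SSet.stdSimplex.δ (2 : Fin 3) ≫ s = SSet.yonedaEquiv.symm e₀₁.edge := by
    rw [← SSet.horn₂₁.isPushout.inl_desc _ _ w, hs, SSet.horn.ι_ι_assoc]
  have h0 : SSet.stdSimplex.δ (0 : Fin 3) ≫ s = SSet.yonedaEquiv.symm e₁₂.edge := by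
    rw [← SSet.horn₂₁.isPushout.inr_desc _ _ w, hs, SSet.horn.ι_ι_assoc]
  set t := SSet.yonedaEquiv s with ht
  have f2 : X.δ 2 t = e₀₁.edge :=
    (SSet.yonedaEquiv_naturality (SimplexCategory.δ 2) s).trans
      ((congrArg SSet.yonedaEquiv h2).trans (Equiv.apply_symm_apply _ _))
  have f0 : X.δ 0 t = e₁₂.edge :=
    (SSet.yonedaEquiv_naturality (SimplexCategory.δ 0) s).trans
      ((congrArg SSet.yonedaEquiv h0).trans (Equiv.apply_symm_apply _ _))
  have d1 := ConcreteCategory.congr_hom (X.δ_comp_δ (i := (1 : Fin 2)) (j := 1) le_rfl) t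
  have d0 := ConcreteCategory.congr_hom (X.δ_comp_δ (i := (0 : Fin 2)) (j := 0) le_rfl) t
  exact ⟨SSet.Edge.mk (X.δ 1 t)
    (d1.symm.trans ((congrArg (X.δ 1) f2).trans e₀₁.src_eq))
    (d0.trans ((congrArg (X.δ 0) f0).trans e₁₂.tgt_eq)),
    ⟨SSet.Edge.CompStruct.mk t f2 f0 rfl⟩⟩

/-- The morphisms of the homotopy category that are classes of edges. -/
def edgeProperty (X : SSet.{u}) : MorphismProperty ((SSet.truncation 2).obj X).HomotopyCategory :=
  fun p q f => ∃ e : SSet.Truncated.Edge p.as.as q.as.as, HomotopyCategory.homMk e = f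

instance : (edgeProperty X).IsMultiplicative where
  id_mem p := ⟨SSet.Truncated.Edge.id p.as.as, HomotopyCategory.homMk_id p.as.as⟩
  comp_mem := by
    rintro p q r _ _ ⟨e, rfl⟩ ⟨e', rfl⟩
    obtain ⟨e'', ⟨h⟩⟩ := exists_edge_compStruct (SSet.Edge.ofTruncated e)
      (SSet.Edge.ofTruncated e')
    exact ⟨e''.toTruncated, (HomotopyCategory.homMk_comp_homMk h.toTruncated).symm⟩

/-- In the homotopy category of an ∞-category, all morphisms are classes of edges. -/
lemma exists_homMk_eq {x y : ((SSet.truncation 2).obj X).obj (op ⦋0⦌₂)}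
    (f : HomotopyCategory.mk x ⟶ HomotopyCategory.mk y) :
    ∃ e : SSet.Truncated.Edge x y, HomotopyCategory.homMk e = f := by
  have h : edgeProperty X = ⊤ := HomotopyCategory.morphismProperty_eq_top fun e => ⟨e, rfl⟩
  have h1 : edgeProperty X f := by
    rw [h]
    trivial
  exact h1

end homotopyCategory
end AInf

/-! ### Classes of edges of the nerve -/

namespace AInf

open Simplicial SSet.Truncated SimplexCategory.Truncated SimplicialObject.Truncated
open Word DirectSum AInfFunctorData SimplexCategory

section edgeClass
variable {K : Type w} [CommRing K] {C D : AInfCategory.{w, v, u} K} {m n : ℕ}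

lemma hoFunctor_comp_map {E : AInfCategory.{w, v₁, u₁} K} {C : AInfCategory.{w, v₂, u₂} K}
    {D : AInfCategory.{w, v₃, u₃} K} (F : AInfFunctor E C) (G : AInfFunctor C D) {x y : Ho E} (f : x ⟶ y) :
    (F.comp G).hoFunctor.map f = G.hoFunctor.map (F.hoFunctor.map f) := by
  induction f using Quotient.inductionOn with
  | _ f =>
  refine congrArg Submodule.Quotient.mk (Subtype.ext ?_)
  apply AInfCategory.lof_inj
  refine ((F.comp G).lof_map₁ f.1).trans ?_
  refine (comp_mapT F.toAInfFunctorData G.toAInfFunctorData (single f.1)).trans ?_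
  refine Eq.trans ?_ (G.lof_map₁ (F.map₁ 0 f.1)).symm
  exact add_zero _

lemma d_gen (i k : Fin (n + 1)) : (minimalCategory K n).d 0 1 rfl (gen K i k) = 0 :=
  Subtype.ext (@if_neg ((single (gen K i k) : Word (minimalData K n).Hom i k).length = 2) _
    (by simp) K (coef (single (Hom := (minimalData K n).Hom) (gen K i k))) 0)

variable (K) in
/-- The class of a generator in the homotopy category of `[n]_K`. -/
noncomputable def genClass (i k : Fin (n + 1)) : (⟨i⟩ : Ho (minimalCategory K n)) ⟶ ⟨k⟩ :=
  Submodule.Quotient.mk ⟨gen K i k, d_gen i k⟩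

lemma genClass_self (i : Fin (n + 1)) : genClass K i i = 𝟙 _ :=
  congrArg Submodule.Quotient.mk (Subtype.ext (gen_self i))

lemma genClass_comp {i k l : Fin (n + 1)} (h : i ≤ k) (h' : k ≤ l) :
    genClass K i k ≫ genClass K k l = genClass K i l := by
  refine congrArg Submodule.Quotient.mk (Subtype.ext (Subtype.ext ?_))
  have h1 : ((minimalCategory K n).mul (gen K k l) (gen K i k) 0 rfl).1 =
    (gen K k l).1 * ((gen K i k).1 * 1) :=
    @if_pos ((cons (gen K k l) (single (gen K i k)) : Word (minimalData K n).Hom i l).length = 2)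
      _ rfl _ _ 0
  refine h1.trans ?_
  rw [gen_of_le h, gen_of_le h', gen_of_le (h.trans h')]
  simp

lemma minimalFunctor_map_genClass (α : Fin (m + 1) →o Fin (n + 1)) {i k : Fin (m + 1)}
    (h : i ≤ k) : (minimalFunctor K α).hoFunctor.map (genClass K i k) = genClass K (α i) (α k) := by
  refine congrArg Submodule.Quotient.mk (Subtype.ext (Subtype.ext ?_))
  have h1 : ((minimalFunctor K α).map₁ 0 (gen K i k)).1 = (gen K i k).1 * 1 :=
    @if_pos ((single (gen K i k) : Word (minimalData K m).Hom i k).length = 1) _ rfl _ _ 0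
  refine h1.trans ?_
  rw [gen_of_le h, gen_of_le (α.monotone h), mul_one]

/-- The morphism in the homotopy category given by an edge of a simplex of the nerve. -/
noncomputable def edgeClass (σ : AInfFunctor (minimalCategory K n) C) (i k : Fin (n + 1)) :
    (⟨σ.obj i⟩ : Ho C) ⟶ ⟨σ.obj k⟩ :=
  σ.hoFunctor.map (genClass K i k)

lemma edgeClass_self (σ : AInfFunctor (minimalCategory K n) C) (i : Fin (n + 1)) :
    edgeClass σ i i = 𝟙 _ := by
  rw [edgeClass, genClass_self]
  exact σ.hoFunctor.map_id _

lemma edgeClass_comp (σ : AInfFunctor (minimalCategory K n) C) {i k l : Fin (n + 1)} (h : i ≤ k)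
    (h' : k ≤ l) : edgeClass σ i k ≫ edgeClass σ k l = edgeClass σ i l := by
  have h1 := σ.hoFunctor.map_comp (genClass K i k) (genClass K k l)
  rw [genClass_comp h h'] at h1
  exact h1.symm

/-- The morphism between given objects of the homotopy category given by an edge of a simplex of the
nerve. -/
noncomputable def edgeHom (σ : AInfFunctor (minimalCategory K n) C) (i k : Fin (n + 1)) {x y : C.Obj}
    (hx : σ.obj i = x) (hy : σ.obj k = y) : (⟨x⟩ : Ho C) ⟶ ⟨y⟩ :=
  eqToHom (congrArg Ho.mk hx.symm) ≫ edgeClass σ i k ≫ eqToHom (congrArg Ho.mk hy)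

lemma edgeHom_comp (σ : AInfFunctor (minimalCategory K n) C) {i k l : Fin (n + 1)} (h : i ≤ k)
    (h' : k ≤ l) {x y z : C.Obj} (hx : σ.obj i = x) (hy : σ.obj k = y) (hz : σ.obj l = z) :
    edgeHom σ i k hx hy ≫ edgeHom σ k l hy hz = edgeHom σ i l hx hz := by
  subst hx hy hz
  simp only [edgeHom, eqToHom_refl, Category.comp_id, Category.id_comp]
  exact edgeClass_comp σ h h'

lemma edgeHom_self (σ : AInfFunctor (minimalCategory K n) C) {i : Fin (n + 1)} {x : C.Obj}
    (hx : σ.obj i = x) : edgeHom σ i i hx hx = 𝟙 _ := by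
  subst hx
  simp only [edgeHom, eqToHom_refl, Category.comp_id, Category.id_comp]
  exact edgeClass_self σ i

lemma edgeHom_restrict {σ : AInfFunctor (minimalCategory K n) C}
    {τ : AInfFunctor (minimalCategory K m) C} (α : Fin (m + 1) →o Fin (n + 1))
    (hτ : (minimalFunctor K α).comp σ = τ) {i k : Fin (m + 1)} (h : i ≤ k) {x y : C.Obj}
    (hx : τ.obj i = x) (hy : τ.obj k = y) :
    edgeHom τ i k hx hy = edgeHom σ (α i) (α k) (by subst hτ; exact hx) (by subst hτ; exact hy) := by
  subst hτ hx hy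
  have h1 : edgeClass ((minimalFunctor K α).comp σ) i k = edgeClass σ (α i) (α k) := by
    refine (hoFunctor_comp_map (minimalFunctor K α) σ (genClass K i k)).trans ?_
    rw [minimalFunctor_map_genClass α h]
    rfl
  exact congrArg (fun f => eqToHom rfl ≫ f ≫ eqToHom rfl) h1

lemma hoFunctor_map_edgeHom (F : AInfFunctor C D) (σ : AInfFunctor (minimalCategory K n) C)
    {i k : Fin (n + 1)} {x y : C.Obj} (hx : σ.obj i = x) (hy : σ.obj k = y) :
    F.hoFunctor.map (edgeHom σ i k hx hy) =
      edgeHom (σ.comp F) i k (congrArg F.obj hx) (congrArg F.obj hy) := by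
  subst hx hy
  simp only [edgeHom, eqToHom_refl, Category.comp_id, Category.id_comp]
  refine (hoFunctor_comp_map σ F (genClass K i k)).symm.trans ?_
  exact ((Category.id_comp _).trans (Category.comp_id _)).symm

/-- The values of edges on the generator are the representing cocycles of their classes. -/
lemma exists_edgeHom_eq {σ : AInfFunctor (minimalCategory K (0 + 1)) C} {x y : C.Obj}
    (hx : σ.obj 0 = x) (hy : σ.obj (Fin.last 1) = y) :
    ∃ f : C.Z0 x y, coneVal σ.toAInfFunctorData x y [0] = hlof C 0 f.1 ∧
      edgeHom σ 0 (Fin.last 1) hx hy = Submodule.Quotient.mk f := by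
  subst hx hy
  refine ⟨⟨σ.map₁ 0 (gen K 0 (Fin.last 1)), ?_⟩, ?_, ?_⟩
  · refine (σ.map₁_d rfl _).symm.trans ?_
    exact (congrArg (σ.map₁ 1) (d_gen 0 (Fin.last 1))).trans (map_zero _)
  · refine (prTo_mk _).trans ?_
    exact (σ.lof_map₁ (gen K 0 (Fin.last 1))).symm
  · simp only [edgeHom, eqToHom_refl, Category.comp_id, Category.id_comp]
    rfl

end edgeClass
end AInf

/-! ### The comparison of homotopy categories -/

namespace AInf

open Simplicial SSet.Truncated SimplexCategory.Truncated SimplicialObject.Truncated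
open Word DirectSum AInfFunctorData SimplexCategory

section comparison
variable {K : Type w} [CommRing K] {C D : AInfCategory.{w, v, u} K}

/-- The functor `[0]_K → C` given by a vertex of the nerve. -/
abbrev vertexFunctor (x : ((SSet.truncation 2).obj (nerve C)).obj (op ⦋0⦌₂)) :
    AInfFunctor (minimalCategory K 0) C := x

/-- The object of `C` given by a vertex of the nerve. -/
abbrev vertexObj (x : ((SSet.truncation 2).obj (nerve C)).obj (op ⦋0⦌₂)) : C.Obj :=
  (vertexFunctor x).obj (0 : Fin 1)

/-- The functor `[1]_K → C` given by an edge of the nerve. -/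
abbrev edgeFunctor {x y : ((SSet.truncation 2).obj (nerve C)).obj (op ⦋0⦌₂)}
    (e : SSet.Truncated.Edge x y) : AInfFunctor (minimalCategory K 1) C := e.edge

lemma edgeFunctor_obj_zero {x y : ((SSet.truncation 2).obj (nerve C)).obj (op ⦋0⦌₂)}
    (e : SSet.Truncated.Edge x y) : (edgeFunctor e).obj (0 : Fin 2) = vertexObj x :=
  have h : (minimalFunctor K (SimplexCategory.δ (1 : Fin 2)).toOrderHom).comp (edgeFunctor e) =
    vertexFunctor x := e.src_eq
  congrArg (fun F : AInfFunctor (minimalCategory K 0) C => F.obj (0 : Fin 1)) h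

lemma edgeFunctor_obj_one {x y : ((SSet.truncation 2).obj (nerve C)).obj (op ⦋0⦌₂)}
    (e : SSet.Truncated.Edge x y) : (edgeFunctor e).obj (1 : Fin 2) = vertexObj y :=
  have h : (minimalFunctor K (SimplexCategory.δ (0 : Fin 2)).toOrderHom).comp (edgeFunctor e) =
    vertexFunctor y := e.tgt_eq
  congrArg (fun F : AInfFunctor (minimalCategory K 0) C => F.obj (0 : Fin 1)) h

/-- The morphism in `Ho C` given by an edge of the nerve. -/
noncomputable def edgeMorphism {x y : ((SSet.truncation 2).obj (nerve C)).obj (op ⦋0⦌₂)}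
    (e : SSet.Truncated.Edge x y) : (⟨vertexObj x⟩ : Ho C) ⟶ ⟨vertexObj y⟩ :=
  edgeHom (edgeFunctor e) 0 1 (edgeFunctor_obj_zero e) (edgeFunctor_obj_one e)

lemma edgeMorphism_id (x : ((SSet.truncation 2).obj (nerve C)).obj (op ⦋0⦌₂)) :
    edgeMorphism (SSet.Truncated.Edge.id x) = 𝟙 _ :=
  (edgeHom_restrict (SimplexCategory.σ (0 : Fin 1)).toOrderHom rfl (Fin.zero_le 1) _ _).trans
    (edgeHom_self (vertexFunctor x) (i := (0 : Fin 1)) rfl)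

lemma edgeMorphism_comp {x y z : ((SSet.truncation 2).obj (nerve C)).obj (op ⦋0⦌₂)}
    {e : SSet.Truncated.Edge x y} {e' : SSet.Truncated.Edge y z} {e'' : SSet.Truncated.Edge x z}
    (h : SSet.Truncated.Edge.CompStruct e e' e'') :
    edgeMorphism e ≫ edgeMorphism e' = edgeMorphism e'' := by
  have h2 := edgeHom_restrict (σ := (h.simplex : AInfFunctor (minimalCategory K 2) C))
    (τ := edgeFunctor e) (SimplexCategory.δ (2 : Fin 3)).toOrderHom h.d₂ (Fin.zero_le 1)
    (edgeFunctor_obj_zero e) (edgeFunctor_obj_one e)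
  have h0 := edgeHom_restrict (σ := (h.simplex : AInfFunctor (minimalCategory K 2) C))
    (τ := edgeFunctor e') (SimplexCategory.δ (0 : Fin 3)).toOrderHom h.d₀ (Fin.zero_le 1)
    (edgeFunctor_obj_zero e') (edgeFunctor_obj_one e')
  have h1 := edgeHom_restrict (σ := (h.simplex : AInfFunctor (minimalCategory K 2) C))
    (τ := edgeFunctor e'') (SimplexCategory.δ (1 : Fin 3)).toOrderHom h.d₁ (Fin.zero_le 1)
    (edgeFunctor_obj_zero e'') (edgeFunctor_obj_one e'')
  refine (congrArg₂ (· ≫ ·) h2 h0).trans (Eq.trans ?_ h1.symm)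
  exact edgeHom_comp (K := K) (C := C) (n := 2) h.simplex (i := 0) (k := 1) (l := 2)
    (by decide) (by decide) _ _ _

variable (C) in
/-- The comparison functor from the homotopy category of the nerve of `C` to the homotopy category
of `C`. -/
noncomputable def hoNerveFunctor : ((SSet.truncation 2).obj (nerve C)).HomotopyCategory ⥤ Ho C :=
  HomotopyCategory.lift (fun x => ⟨vertexObj x⟩) edgeMorphism edgeMorphism_id edgeMorphism_comp

lemma hoNerveFunctor_map_homMk {x y : ((SSet.truncation 2).obj (nerve C)).obj (op ⦋0⦌₂)}
    (e : SSet.Truncated.Edge x y) :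
    (hoNerveFunctor C).map (HomotopyCategory.homMk e) = edgeMorphism e :=
  HomotopyCategory.lift_map_homMk _ _ _ _ e

/-- The comparison functors are natural. -/
noncomputable def hoNerveFunctorIso (F : AInfFunctor C D) :
    mapHomotopyCategory ((SSet.truncation 2).map (nerveMap F)) ⋙ hoNerveFunctor D ≅
      hoNerveFunctor C ⋙ F.hoFunctor :=
  HomotopyCategory.mkNatIso (fun x => Iso.refl (⟨F.obj (vertexObj x)⟩ : Ho D)) (fun x y e => by
    refine (Category.comp_id _).trans (Eq.trans ?_ (Category.id_comp _).symm)
    refine (hoNerveFunctor_map_homMk (e.map _)).trans ?_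
    refine Eq.trans ?_ (congrArg F.hoFunctor.map (hoNerveFunctor_map_homMk e)).symm
    exact (hoFunctor_map_edgeHom F (edgeFunctor e) (edgeFunctor_obj_zero e)
      (edgeFunctor_obj_one e)).symm)

end comparison
end AInf

/-! ### The comparison is an equivalence -/

namespace AInf

open Simplicial SSet.Truncated SimplexCategory.Truncated SimplicialObject.Truncated
open Word DirectSum AInfFunctorData SimplexCategory

section equivalence
variable {K : Type w} [CommRing K] {C D : AInfCategory.{w, v, u} K}

lemma eq_nil_or_eq_of_isChain {l : List (Fin 1)} (h : l.IsChain (· > ·)) : l = [] ∨ l = [0] := by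
  match l with
  | [] => exact Or.inl rfl
  | [a] => exact Or.inr (congrArg (fun a => [a]) (Subsingleton.elim a 0))
  | a :: b :: l =>
    exact absurd (List.isChain_cons_cons.1 h).1 (by simp [Subsingleton.elim a b])

/-- Every object is a vertex of the nerve: the relations for a functor from `[0]_K` hold trivially,
since all words of length at least one contain a multiple of the unit. -/
lemma exists_vertexFunctor (x : C.Obj) : ∃ σ : AInfFunctor (minimalCategory K 0) C, σ.obj 0 = x := by
  have hD : HasDegree (fun _ : Fin 1 => x) (fun _ _ _ => (0 : C.Tot x x)) := fun _ _ _ => zero_mem _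
  have hM := ofValues_isMulti hD
  have hU := ofValues_isUnital hD
  refine ⟨toFunctor _ hM hU fun i k t => curv_eq_zero hM hU (fun l _ hl => ?_) t, rfl⟩
  obtain h | h := eq_nil_or_eq_of_isChain hl
  · cases h
  · cases h
    exact curv_nil hM _

section simplices
variable {A : GradedComplex.{v}}

/-- A cocycle of degree `0` is a `0`-simplex of the space of a complex. -/
lemma exists_point {a : A.T} (ha : a ∈ A.gr 0) (hd : A.d a = 0) :
    ∃ f : Simplices A 0, f.1 [(0 : Fin 1)] = a := by
  refine ⟨⟨fun l => if l = [0] then a else 0, fun l => ?_, fun l hl => if_neg ?_, fun l hl => ?_⟩,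
    by simp⟩
  · dsimp only
    split_ifs with h
    · subst h
      exact ha
    · exact zero_mem _
  · rintro rfl
    exact hl ⟨by simp, List.isChain_singleton _⟩
  · obtain rfl | rfl := eq_nil_or_eq_of_isChain hl
    · simp
    · simpa [boundarySum] using hd

lemma eq_of_isChain_fin_two {l : List (Fin 2)} (hl : l.IsChain (· > ·)) :
    l = [] ∨ l = [0] ∨ l = [1] ∨ l = [1, 0] := by
  match l with
  | [] => simp
  | [a] => fin_cases a <;> simp
  | [a, b] => fin_cases a <;> fin_cases b <;> simp at hl ⊢
  | a :: b :: c :: l =>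
    have h1 := (List.isChain_cons_cons.1 hl).1
    have h2 := (List.isChain_cons_cons.1 (List.isChain_cons_cons.1 hl).2).1
    simp only [gt_iff_lt, Fin.lt_def] at h1 h2
    omega

/-- A homotopy between cocycles of degree `0` is a `1`-simplex of the space of a complex. -/
lemma exists_path {a b c : A.T} (ha : a ∈ A.gr 0) (hb : b ∈ A.gr 0) (hc : c ∈ A.gr (-1))
    (hda : A.d a = 0) (hdb : A.d b = 0) (hdc : A.d c = a - b) :
    ∃ f : Simplices A 1, f.1 [(0 : Fin 2)] = a ∧ f.1 [(1 : Fin 2)] = b := by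
  refine ⟨⟨fun l => if l = [0] then a else if l = [1] then b else if l = [1, 0] then c else 0,
    fun l => ?_, fun l hl => ?_, fun l hl => ?_⟩, by simp, by simp⟩
  · dsimp only
    split_ifs with h1 h2 h3
    · subst h1
      exact ha
    · subst h2
      exact hb
    · subst h3
      exact hc
    · exact zero_mem _
  · refine (if_neg ?_).trans ((if_neg ?_).trans (if_neg ?_)) <;> rintro rfl <;>
      exact hl ⟨by simp, by simp⟩
  · obtain rfl | rfl | rfl | rfl := eq_of_isChain_fin_two hl
    · simp
    · simpa [boundarySum] using hda
    · simpa [boundarySum] using hdb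
    · simp [boundarySum, Finset.sum_range_succ, hdc, Units.smul_def, sub_eq_add_neg, add_comm]

end simplices

lemma homGraded_d_cocycle {x y : C.Obj} (f : C.Z0 x y) :
    (homGraded C x y).d (hlof C 0 f.1) = 0 :=
  (C.dTot_lof' rfl f.1).trans ((congrArg (hlof C 1) f.2).trans (map_zero _))

variable {x y : ((SSet.truncation 2).obj (nerve C)).obj (op ⦋0⦌₂)}

lemma isCone_edge (e : SSet.Truncated.Edge x y) :
    IsCone (n := 0) (vertexFunctor x) (vertexFunctor y) (edgeFunctor e) :=
  ⟨ext_point (edgeFunctor_obj_zero e), ext_point (edgeFunctor_obj_one e)⟩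

lemma exists_edge {σ : AInfFunctor (minimalCategory K 1) C} (h0 : σ.obj (0 : Fin 2) = vertexObj x)
    (h1 : σ.obj (1 : Fin 2) = vertexObj y) : ∃ e : SSet.Truncated.Edge x y, edgeFunctor e = σ :=
  ⟨{ edge := σ
     src_eq := ext_point (K := K) (C := C) h0
     tgt_eq := ext_point (K := K) (C := C) h1 }, rfl⟩

/-- Edges with the same ends and the same value are equal. -/
lemma functor_ext_of_coneVal {z z' : AInfFunctor (minimalCategory K 0) C}
    {σ σ' : AInfFunctor (minimalCategory K (0 + 1)) C} (h : IsCone z z' σ) (h' : IsCone z z' σ')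
    (he : coneVal σ.toAInfFunctorData (z.obj 0) (z'.obj 0) [0] =
      coneVal σ'.toAInfFunctorData (z.obj 0) (z'.obj 0) [0]) : σ = σ' := by
  refine coneSimplex_injective h h' (Subtype.ext (funext fun l => ?_))
  by_cases hl : l.IsChain (· > ·)
  · obtain rfl | rfl := eq_nil_or_eq_of_isChain hl
    · exact ((coneSimplex h).2.2.1 [] fun h => h.1 rfl).trans
        ((coneSimplex h').2.2.1 [] fun h => h.1 rfl).symm
    · exact (coneSimplex_apply h (isChain_ge hl)).trans
        (he.trans (coneSimplex_apply h' (isChain_ge hl)).symm)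
  · exact ((coneSimplex h).2.2.1 l fun h => hl h.2).trans
      ((coneSimplex h').2.2.1 l fun h => hl h.2).symm

/-- An edge with the value of a cone over an edge on one of its vertices is a face of the cone. -/
lemma comp_coneMap_eq {τ : AInfFunctor (minimalCategory K (1 + 1)) C}
    (hτ : IsCone (vertexFunctor x) (vertexFunctor y) τ) (a : Fin 2) (e : SSet.Truncated.Edge x y)
    (he : coneVal (edgeFunctor e).toAInfFunctorData (vertexObj x) (vertexObj y) [(0 : Fin 1)] =
      coneVal τ.toAInfFunctorData (vertexObj x) (vertexObj y) [a]) :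
    (minimalFunctor K (coneMap (SimplexCategory.const (mk 0) (mk 1) a)).toOrderHom).comp τ =
      edgeFunctor e := by
  have h0 : ∀ b : Fin 2, τ.obj b.castSucc = vertexObj x := fun b =>
    (congrArg τ.obj (Fin.succAbove_last_apply b).symm).trans
      (congrArg (fun F : AInfFunctor (minimalCategory K 1) C => F.obj b) hτ.left)
  refine functor_ext_of_coneVal ⟨ext_point ?_, ext_point ?_⟩ (isCone_edge e) ?_
  · exact (congrArg τ.obj (coneMap_castSucc (SimplexCategory.const (mk 0) (mk 1) a) 0)).trans (h0 a)
  · exact (congrArg τ.obj (coneMap_last (SimplexCategory.const (mk 0) (mk 1) a))).trans hτ.obj_last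
  · exact (coneVal_comp_coneMap (SimplexCategory.const (mk 0) (mk 1) a) τ.isMulti _ _
      (List.isChain_singleton (0 : Fin 1))).trans he.symm

instance : (hoNerveFunctor C).EssSurj where
  mem_essImage x := by
    obtain ⟨σ, hσ⟩ := exists_vertexFunctor x.as
    refine ⟨HomotopyCategory.mk (V := (SSet.truncation 2).obj (nerve C)) σ, ⟨eqToIso ?_⟩⟩
    exact congrArg Ho.mk hσ

/-- Every cocycle of degree `0` is the value of an edge. -/
instance : (hoNerveFunctor C).Full where
  map_surjective {p q} f := by
    obtain ⟨x, rfl⟩ := p.mk_surjective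
    obtain ⟨y, rfl⟩ := q.mk_surjective
    obtain ⟨f, rfl⟩ := Submodule.Quotient.mk_surjective _ f
    obtain ⟨s, hs⟩ := exists_point (A := homGraded C (vertexObj x) (vertexObj y))
      ⟨f.1, rfl⟩ (homGraded_d_cocycle f)
    obtain ⟨σ, hσ, hf⟩ := exists_coneSimplex_eq (vertexFunctor x) (vertexFunctor y) s
    obtain ⟨e, rfl⟩ := exists_edge (x := x) (y := y) (σ := σ)
      (congrArg (fun F : AInfFunctor (minimalCategory K 0) C => F.obj 0) hσ.left) hσ.obj_last
    refine ⟨HomotopyCategory.homMk e, (hoNerveFunctor_map_homMk e).trans ?_⟩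
    obtain ⟨f', h1, h2⟩ := exists_edgeHom_eq (edgeFunctor_obj_zero e) (edgeFunctor_obj_one e)
    refine h2.trans (congrArg _ (Subtype.ext (AInfCategory.lof_inj ?_)))
    refine h1.symm.trans ?_
    refine (coneSimplex_apply hσ (List.isChain_singleton (0 : Fin 1))).symm.trans ?_
    exact (congrArg (fun s => s.1 [(0 : Fin 1)]) hf).trans (hs)

/-- Edges with cohomologous cocycles are homotopic. -/
instance : (hoNerveFunctor C).Faithful where
  map_injective {p q} f f' hff := by
    obtain ⟨x, rfl⟩ := p.mk_surjective
    obtain ⟨y, rfl⟩ := q.mk_surjective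
    have := quasicategory_nerve C
    obtain ⟨e, rfl⟩ := exists_homMk_eq f
    obtain ⟨e', rfl⟩ := exists_homMk_eq f'
    replace hff : edgeMorphism e = edgeMorphism e' :=
      (hoNerveFunctor_map_homMk e).symm.trans (hff.trans (hoNerveFunctor_map_homMk e'))
    obtain ⟨z, h1, h2⟩ := exists_edgeHom_eq (edgeFunctor_obj_zero e) (edgeFunctor_obj_one e)
    obtain ⟨z', h1', h2'⟩ := exists_edgeHom_eq (edgeFunctor_obj_zero e') (edgeFunctor_obj_one e')
    obtain ⟨h, hh⟩ := (Submodule.Quotient.eq _).1 (h2.symm.trans (hff.trans h2'))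
    -- a primitive of the difference of the cocycles of `e` and `e'` gives a `1`-simplex of the mapping
    -- space, that is, a `2`-simplex of the nerve with faces `e`, `e'` and a degenerate edge
    obtain ⟨s, hs, hs'⟩ := exists_path (A := homGraded C (vertexObj x) (vertexObj y))
      ⟨z.1, rfl⟩ ⟨z'.1, rfl⟩ ⟨h, rfl⟩ (homGraded_d_cocycle z) (homGraded_d_cocycle z')
      ((C.dTot_lof' rfl h).trans ((congrArg (hlof C 0) hh).trans (map_sub (hlof C 0) _ _)))
    obtain ⟨τ, hτ, hg⟩ := exists_coneSimplex_eq (vertexFunctor x) (vertexFunctor y) s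
    have ht : ∀ a : Fin 2, coneVal τ.toAInfFunctorData (vertexObj x) (vertexObj y) [a] =
        s.1 [a] := fun a =>
      (coneSimplex_apply hτ (List.isChain_singleton a)).symm.trans
        (congrArg (fun s => s.1 [a]) hg)
    have f0 := comp_coneMap_eq hτ 0 e (h1.trans ((ht 0).trans (hs)).symm)
    have f1 := comp_coneMap_eq hτ 1 e'
      (h1'.trans ((ht 1).trans (hs')).symm)
    have e0 : coneMap (SimplexCategory.const (mk 0) (mk 1) 0) = SimplexCategory.δ (1 : Fin 3) := by
      ext i : 3
      fin_cases i <;> rfl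
    have e1 : coneMap (SimplexCategory.const (mk 0) (mk 1) 1) = SimplexCategory.δ (0 : Fin 3) := by
      ext i : 3
      fin_cases i <;> rfl
    have e2 : OrderHom.const (Fin 2) 0 = (SimplexCategory.σ (0 : Fin 1)).toOrderHom :=
      OrderHom.ext _ _ (funext fun _ => Subsingleton.elim (α := Fin 1) _ _)
    have f2 := hτ.left.trans
      (congrArg (fun α => (minimalFunctor K α).comp (vertexFunctor x)) e2)
    rw [e0] at f0
    rw [e1] at f1
    have hc : SSet.Truncated.Edge.CompStruct (SSet.Truncated.Edge.id x) e' e :=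
      { simplex := τ
        d₂ := f2
        d₀ := f1
        d₁ := f0 }
    have h3 := HomotopyCategory.homMk_comp_homMk hc
    rw [HomotopyCategory.homMk_id, Category.id_comp] at h3
    exact h3.symm

instance : (hoNerveFunctor C).IsEquivalence where

/-- A functor that induces an equivalence on homotopy categories of A∞-categories induces one on
the homotopy categories of the nerves. -/
lemma isEquivalence_hoFunctor_nerveMap (F : AInfFunctor C D) [F.hoFunctor.IsEquivalence] :
    (SSet.hoFunctor.map (nerveMap F)).toFunctor.IsEquivalence := by
  have h : (mapHomotopyCategory ((SSet.truncation 2).map (nerveMap F)) ⋙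
      hoNerveFunctor D).IsEquivalence := Functor.isEquivalence_of_iso (hoNerveFunctorIso F).symm
  exact Functor.isEquivalence_of_comp_right
    (mapHomotopyCategory ((SSet.truncation 2).map (nerveMap F))) (hoNerveFunctor D)

end equivalence
end AInf

theorem theorem3p4 {K : Type w} [CommRing K] (C D : AInf.AInfCategory.{w, v, u} K)
    (F : AInf.AInfFunctor C D) (hF : F.IsQuasiEquivalence) :
    AInf.IsJoyalWeakEquivalence (AInf.nerveMap F) where
  quasicategory_source := AInf.quasicategory_nerve C
  quasicategory_target := AInf.quasicategory_nerve D
  isEquivalence_hoFunctor :=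
    haveI := hF.isEquivalence_hoFunctor
    AInf.isEquivalence_hoFunctor_nerveMap F
  isWeakHomotopyEquiv x y :=
    haveI := hF.quasiIso (AInf.vertexObj x) (AInf.vertexObj y)
    AInf.isWeakHomotopyEquiv_homRMap F x y
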